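/- Let $R$ be a commutative ring; all graded $R$-modules are $\mathbb{Z}$-graded, differentials have degree $-1$, and $|a|$ is the degree of $a$. Signs follow the Koszul rule; $\tau(a\otimes b)=(-1)^{|a||b|}b\otimes a$. $(s^{r}M)_n=M_{n-r}$. For an augmented DG-algebra or coaugmented DG-coalgebra $A$ put $\bar A=\ker\epsilon$; $A$ is connected if $A_n=0$ for $n<0$ and $A_0=R\cdot 1\cong R$, and $n$-reduced if moreover $A_k=0$ for $1\le k\le n$. The cobar construction of a DG-coalgebra $C$ is $\Omega C=T(s^{-1}\bar C)$ with the derivation $d_\Omega(s^{-1}c)=-s^{-1}dc+\sum(-1)^{|c'|}s^{-1}c'\otimes s^{-1}c''$, where $\bar\nabla c=\sum c'\otimes c''$ is the reduced coproduct. The bar construction of an augmented DG-algebra $\Lambda$ is the tensor coalgebra $B\Lambda=T^c(s\bar\Lambda)$ (deconcatenation) with the coderivation whose corestriction is $sa\mapsto -s\,da$, $sa\otimes sb\mapsto(-1)^{|a|+1}s(ab)$. A homotopy G-coalgebra is a $1$-reduced DG-coalgebra $C$ with a map $\nabla:\Omega C\to\Omega C\otimes\Omega C$ making $\Omega C$ (with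 its product, differential and augmentation) a coassociative counital DG-bialgebra, such that, writing $\tilde C=s^{-1}\bar C$ and $E^{i,j}:\tilde C\to\tilde C^{\otimes i}\otimes\tilde C^{\otimes j}$ for the components of $\nabla|_{\tilde C}$, one has $E^{i,j}=0$ for $j\ge 2$. Put $F^1=-\mathrm{Id}$ and, for $n\ge2$, $$F^n=\sum_{\substack{1\le s\le n-1,\ n_i\ge1\\ n_1+\dots+n_s=n-1}}(-1)^{s+1}(1^{\otimes n_1+\dots+n_{s-1}}\otimes E^{n_s,1})\cdots(1^{\otimes n_1}\otimes E^{n_2,1})E^{n_1,1}:\tilde C\to\tilde C^{\otimes n},$$ $$O_n=\sum_{s=1}^n\ \sum_{n_1+\dots+n_s=n,\ n_i\ge 1}\mu_{(12)}^{(s)}(F^{n_1}\otimes\dots\otimes F^{n_s})F^s:\tilde C\to\tilde C^{\otimes n},\qquad n\ge2,$$ where $\mu_{(12)}=\mu\tau$ is the opposite product of $\Omega C$ and $\mu^{(s)}_{(12)}$ its iterate on $s$ factors. An antipode of a DG-bialgebra $H$ is a degree $0$ chain map $S:H\to H$ which is the convolution inverse of $\mathrm{Id}_H$; $(H,S)$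 is an involutive DG-Hopf algebra if moreover $S^2=\mathrm{Id}$. A homotopy G-algebra is a connected DG-algebra $\Lambda$ with a product on $B\Lambda$ making it an associative unital DG-bialgebra, such that the operations $E_{i,j}(a_1,\dots,a_i;b_1,\dots,b_j)=s^{-1}\mathrm{pr}\,\bigl((sa_1\otimes\dots\otimes sa_i)\cdot(sb_1\otimes\dots\otimes sb_j)\bigr)$ (where $\mathrm{pr}:B\Lambda\to s\bar\Lambda$ is the projection) vanish for $i\ge2$. Let $\{a;b\}=E_{1,1}(a;b)-(-1)^{(|a|+1)(|b|+1)}E_{1,1}(b;a)$, where $E_{1,1}$ is extended by $0$ to the unit. A homotopy BV-algebra is a homotopy G-algebra with a linear map $\Delta:\Lambda\to\Lambda$ of degree $1$ such that $d\Delta=-\Delta d$, $\Delta^2=0$, and such that for some bilinear map $H:\Lambda\otimes\Lambda\to\Lambda$ of degree $2$ and all homogeneous $a,b\in\Lambda$ $$\{a;b\}=(-1)^{|a|}\bigl(\Delta(ab)-\Delta(a)b-(-1)^{|a|}a\Delta(b)\bigr)+dH(a;b)+H(da;b)-(-1)^{|a|}H(a;db).$$ For a DG-bialgebra $H$, Kadeishvili's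 operations on $\Omega H$ are given, writing $a\diamond(s^{-1}b_1\otimes\dots\otimes s^{-1}b_m)=\sum\pm s^{-1}(a^1b_1)\otimes\dots\otimes s^{-1}(a^mb_m)$ for the diagonal action of $a\in H$ on words in $s^{-1}H$ (Koszul sign, the elements $a^i$ passing the symbols $s^{-1}$), by $$E_{1,k}(s^{-1}a_1\otimes\dots\otimes s^{-1}a_n;\bar b_1,\dots,\bar b_k)=\sum_{i_1<\dots<i_k}\pm\, s^{-1}a_1\otimes\dots\otimes(-1)^{|a_{i_1}|}a_{i_1}\diamond\bar b_1\otimes\dots\otimes(-1)^{|a_{i_k}|}a_{i_k}\diamond\bar b_k\otimes\dots\otimes s^{-1}a_n,$$ where $\pm$ is the Koszul sign of moving each $s\bar b_r$ (of degree $|\bar b_r|+1$) leftwards past $s^{-1}a_{i_r+1},\dots,s^{-1}a_n$ (so that $E_{1,1}(s^{-1}a;s^{-1}b)=s^{-1}(ab)$). If $H$ has an antipode $S$, the Connes–Moscovici operator $\Delta_{CM}$ on $\Omega H$ is zero on words of length $\le1$ and equals $\sum_{i=0}^{n-1}\pi_n\tau_n^i$ on words of length $n\ge2$, where $$\tau_n(s^{-1}a_1\otimes\dots\otimes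 s^{-1}a_n)=(-1)^{(|a_1|-1)\sum_{i\ge2}(|a_i|-1)}s^{-1}a_2\otimes\dots\otimes s^{-1}a_n\otimes s^{-1}a_1,$$ $$\pi_n(s^{-1}a_1\otimes\dots\otimes s^{-1}a_n)=\sum\pm\, s^{-1}\bigl(S(a_1^{n-1})a_2\bigr)\otimes s^{-1}\bigl(S(a_1^{n-2})a_3\bigr)\otimes\dots\otimes s^{-1}\bigl(S(a_1^{1})a_n\bigr)$$ is the diagonal action of the opposite iterated coproduct of $a_1$, with $S$ applied to each factor, on $s^{-1}a_2\otimes\dots\otimes s^{-1}a_n$ (Koszul sign, the $S(a_1^{i})$ passing the symbols $s^{-1}$). **Proposition.** Let $C$ be a homotopy G-coalgebra. 1. $\Omega C$ has a unique antipode $S$, and for every $n\ge2$ the component $\tilde C\to\tilde C^{\otimes n}$ of $S^2-\mathrm{Id}$ is $O_n$. Moreover $\Omega C$ is an involutive DG-Hopf algebra if and only if $O_n=0$ for all $n\ge2$. 2. If $C$ is $2$-reduced and $O_n=0$ for all $n\ge2$, then the double cobar construction $\Omega^2C=\Omega(\Omega C)$, with Kadeishvili's operations $E_{1,k}$ and the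 Connes–Moscovici operator $\Delta_{CM}$ of the involutive DG-Hopf algebra $(\Omega C,\nabla,S)$, is a homotopy BV-algebra. -/

import Mathlib

open scoped TensorProduct DirectSum

universe u v w

namespace DoubleCobar

noncomputable section

/-! ## Graded modules and Koszul signs -/

/-- A `ℤ`-graded `R`-module, presented as a module which is the internal direct sum of its
homogeneous parts `deg n`. -/
structure GrMod (R : Type u) [CommRing R] where
  carrier : Type v
  [acg : AddCommGroup carrier]
  [mod : Module R carrier]
  deg : ℤ → Submodule R carrier
  [dec : DirectSum.Decomposition deg]

instance (R : Type u) [CommRing R] : CoeSort (GrMod.{u, v} R) (Type v) := ⟨GrMod.carrier⟩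

attribute [instance] GrMod.acg GrMod.mod GrMod.dec

/-- The sign operator `a ↦ (-1)^{|a|} a`. -/
def GrMod.sgn {R : Type u} [CommRing R] (V : GrMod.{u, v} R) : V →ₗ[R] V :=
  (DirectSum.toModule R ℤ V fun n => ((n.negOnePow : ℤˣ) : ℤ) • (V.deg n).subtype) ∘ₗ
    (DirectSum.decomposeLinearEquiv V.deg).toLinearMap

theorem GrMod.sgn_apply {R : Type u} [CommRing R] (V : GrMod.{u, v} R) {n : ℤ} {a : V}
    (ha : a ∈ V.deg n) : V.sgn a = ((n.negOnePow : ℤˣ) : ℤ) • a := by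
  lift a to V.deg n using ha
  simp only [GrMod.sgn, LinearMap.comp_apply, LinearEquiv.coe_coe,
    DirectSum.decomposeLinearEquiv_apply, DirectSum.decompose_coe]
  rw [← DirectSum.lof_eq_of R, DirectSum.toModule_lof]
  simp

/-- The Koszul symmetry `τ(a ⊗ b) = (-1)^{|a||b|} b ⊗ a`. -/
def koszul {R : Type u} [CommRing R] (V : GrMod.{u, v} R) (W : GrMod.{u, w} R) :
    V ⊗[R] W →ₗ[R] W ⊗[R] V :=
  (TensorProduct.congr (DirectSum.decomposeLinearEquiv W.deg)
      (DirectSum.decomposeLinearEquiv V.deg)).symm.toLinearMap ∘ₗ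
    (TensorProduct.gradedComm R (fun n => V.deg n) (fun n => W.deg n)).toLinearMap ∘ₗ
      (TensorProduct.congr (DirectSum.decomposeLinearEquiv V.deg)
        (DirectSum.decomposeLinearEquiv W.deg)).toLinearMap

theorem koszul_tmul {R : Type u} [CommRing R] (V : GrMod.{u, v} R) (W : GrMod.{u, w} R)
    {m n : ℤ} {a : V} {b : W} (ha : a ∈ V.deg m) (hb : b ∈ W.deg n) :
    koszul V W (a ⊗ₜ b) = (((m * n).negOnePow : ℤˣ) : ℤ) • (b ⊗ₜ[R] a) := by
  lift a to V.deg m using ha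
  lift b to W.deg n using hb
  simp only [koszul, LinearMap.comp_apply, LinearEquiv.coe_coe, TensorProduct.congr_tmul,
    DirectSum.decomposeLinearEquiv_apply, DirectSum.decompose_coe]
  rw [← DirectSum.lof_eq_of R, ← DirectSum.lof_eq_of R, TensorProduct.gradedComm_of_tmul_of]
  rw [mul_comm n m]
  simp [Units.smul_def, Int.negOnePow_def]

/-- The degree `n` part of `V ⊗ W`, that is `∑ p, V_p ⊗ W_{n-p}`. -/
def tensorDeg {R : Type u} [CommRing R] (V : GrMod.{u, v} R) (W : GrMod.{u, w} R) (n : ℤ) :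
    Submodule R (V ⊗[R] W) :=
  ⨆ p : ℤ, Submodule.map₂ (TensorProduct.mk R V W) (V.deg p) (W.deg (n - p))

/-- `(V ⊗ V) ⊗ (V ⊗ V) → (V ⊗ V) ⊗ (V ⊗ V)`, the Koszul symmetry of the two inner factors:
`(a ⊗ b) ⊗ (c ⊗ d) ↦ (-1)^{|b||c|} (a ⊗ c) ⊗ (b ⊗ d)`. -/
def middleSwap {R : Type u} [CommRing R] (V : GrMod.{u, v} R) :
    (V ⊗[R] V) ⊗[R] (V ⊗[R] V) →ₗ[R] (V ⊗[R] V) ⊗[R] (V ⊗[R] V) :=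
  (TensorProduct.assoc R V V (V ⊗[R] V)).symm.toLinearMap ∘ₗ
    LinearMap.lTensor V ((TensorProduct.assoc R V V V).toLinearMap ∘ₗ
      LinearMap.rTensor V (koszul V V) ∘ₗ (TensorProduct.assoc R V V V).symm.toLinearMap) ∘ₗ
    (TensorProduct.assoc R V V (V ⊗[R] V)).toLinearMap

/-! ## The tensor algebra of a graded module -/

/-- The degree `n` part of `T(V)` for the total degree: spanned by the words `v₁ ⋯ v_k` with
homogeneous letters and `|v₁| + ⋯ + |v_k| = n`. -/
def tensorAlgebraDeg {R : Type u} [CommRing R] (V : GrMod.{u, v} R) (n : ℤ) :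
    Submodule R (TensorAlgebra R V) :=
  Submodule.span R {x | ∃ l : List (Σ i : ℤ, V.deg i),
    (l.map fun a => TensorAlgebra.ι R (a.2 : V)).prod = x ∧ (l.map Sigma.fst).sum = n}

instance tensorAlgebraDeg.gradedMonoid {R : Type u} [CommRing R] (V : GrMod.{u, v} R) :
    SetLike.GradedMonoid (tensorAlgebraDeg V) where
  one_mem := Submodule.subset_span ⟨[], by simp, by simp⟩
  mul_mem i j a b ha hb := by
    have h := Submodule.mul_mem_mul ha hb
    rw [tensorAlgebraDeg, tensorAlgebraDeg, Submodule.span_mul_span] at h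
    refine Submodule.span_mono ?_ h
    rintro _ ⟨_, ⟨l, rfl, rfl⟩, _, ⟨l', rfl, rfl⟩, rfl⟩
    exact ⟨l ++ l', by simp, by simp⟩

theorem ι_mem_tensorAlgebraDeg {R : Type u} [CommRing R] (V : GrMod.{u, v} R) {n : ℤ} {a : V}
    (ha : a ∈ V.deg n) : TensorAlgebra.ι R a ∈ tensorAlgebraDeg V n :=
  Submodule.subset_span ⟨[⟨n, a, ha⟩], by simp, by simp⟩

/-- Auxiliary: the decomposition of the letters of `T(V)` by total degree. -/
def tensorAlgebraDeg.lift {R : Type u} [CommRing R] (V : GrMod.{u, v} R) :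
    TensorAlgebra R V →ₐ[R] ⨁ n, tensorAlgebraDeg V n :=
  TensorAlgebra.lift R ((DirectSum.toModule R ℤ _ fun n =>
    DirectSum.lof R ℤ (fun n => tensorAlgebraDeg V n) n ∘ₗ
      ((TensorAlgebra.ι R ∘ₗ (V.deg n).subtype).codRestrict (tensorAlgebraDeg V n)
        fun a => ι_mem_tensorAlgebraDeg V a.2)) ∘ₗ
    (DirectSum.decomposeLinearEquiv V.deg).toLinearMap)

theorem tensorAlgebraDeg.lift_ι {R : Type u} [CommRing R] (V : GrMod.{u, v} R) {n : ℤ}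
    (a : V.deg n) : tensorAlgebraDeg.lift V (TensorAlgebra.ι R (a : V)) =
      DirectSum.of (fun n => tensorAlgebraDeg V n) n
        ⟨TensorAlgebra.ι R (a : V), ι_mem_tensorAlgebraDeg V a.2⟩ := by
  simp only [tensorAlgebraDeg.lift, TensorAlgebra.lift_ι_apply, LinearMap.comp_apply,
    LinearEquiv.coe_coe, DirectSum.decomposeLinearEquiv_apply, DirectSum.decompose_coe]
  rw [← DirectSum.lof_eq_of R, DirectSum.toModule_lof]
  rfl

instance tensorAlgebraDeg.gradedAlgebra {R : Type u} [CommRing R] (V : GrMod.{u, v} R) :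
    GradedAlgebra (tensorAlgebraDeg V) :=
  GradedAlgebra.ofAlgHom _ (tensorAlgebraDeg.lift V)
    (by
      ext a
      simp only [LinearMap.comp_apply, AlgHom.toLinearMap_apply, AlgHom.comp_apply,
        AlgHom.id_apply]
      induction a using DirectSum.Decomposition.inductionOn V.deg with
      | zero => simp
      | homogeneous a => rw [tensorAlgebraDeg.lift_ι, DirectSum.coeAlgHom_of]
      | add a b ha hb => simp only [map_add, ha, hb])
    (by
      rintro n ⟨x, hx⟩
      change tensorAlgebraDeg.lift V x = _
      induction hx using Submodule.span_induction with
      | mem x hx =>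
        obtain ⟨l, rfl, rfl⟩ := hx
        induction l with
        | nil => simp only [List.map_nil, List.prod_nil, map_one]; rfl
        | cons a l ih =>
          simp only [List.map_cons, List.prod_cons, map_mul]
          rw [ih, tensorAlgebraDeg.lift_ι,
            DirectSum.of_mul_of]
          exact DirectSum.of_eq_of_gradedMonoid_eq (Sigma.subtype_ext rfl rfl)
      | zero => rw [map_zero]; exact (map_zero _).symm
      | add x y hx hy ihx ihy => rw [map_add, ihx, ihy, ← map_add]; rfl
      | smul r x hx ih => rw [map_smul, ih, ← DirectSum.lof_eq_of R, ← map_smul]; rfl)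

/-- `T(V)`, graded by the total degree. -/
abbrev GrMod.T {R : Type u} [CommRing R] (V : GrMod.{u, v} R) : GrMod.{u, max u v} R where
  carrier := TensorAlgebra R V
  deg := tensorAlgebraDeg V

/-- The multiplication (concatenation) `T(V) ⊗ T(V) → T(V)`. -/
def concat {R : Type u} [CommRing R] (V : GrMod.{u, v} R) : V.T ⊗[R] V.T →ₗ[R] V.T :=
  LinearMap.mul' R (TensorAlgebra R V)

/-- The inclusion of the letters `V → T(V)`. -/
def letter {R : Type u} [CommRing R] (V : GrMod.{u, v} R) : V →ₗ[R] V.T := TensorAlgebra.ι R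

/-- The projection `T(V) → V` on words of length one. -/
def unletter {R : Type u} [CommRing R] (V : GrMod.{u, v} R) : V.T →ₗ[R] V := TensorAlgebra.ιInv

/-- The augmentation of `T(V)`, the projection on words of length zero. -/
def augT {R : Type u} [CommRing R] (V : GrMod.{u, v} R) : V.T →ₗ[R] R :=
  (TensorAlgebra.algebraMapInv : TensorAlgebra R V →ₐ[R] R).toLinearMap

/-- The unit `R → T(V)`. -/
def unitT {R : Type u} [CommRing R] (V : GrMod.{u, v} R) : R →ₗ[R] V.T :=
  Algebra.linearMap R (TensorAlgebra R V)

/-- The projection of `T(V)` on words of length `k`. -/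
def lengthProj {R : Type u} [CommRing R] (V : GrMod.{u, v} R) (k : ℕ) : V.T →ₗ[R] V.T :=
  GradedAlgebra.proj
    ((LinearMap.range (TensorAlgebra.ι R : V →ₗ[R] TensorAlgebra R V) ^ ·) : ℕ → Submodule R _) k

/-- The operator on `T(V)` which acts by `f k` on words of length `k`. -/
def byLength {R : Type u} [CommRing R] (V : GrMod.{u, v} R) (f : ℕ → V.T →ₗ[R] V.T) :
    V.T →ₗ[R] V.T :=
  (DirectSum.toModule R ℕ (TensorAlgebra R V) fun k =>
    f k ∘ₗ (LinearMap.range (TensorAlgebra.ι R : V →ₗ[R] TensorAlgebra R V) ^ k).subtype) ∘ₗ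
  (DirectSum.decomposeLinearEquiv
    ((LinearMap.range (TensorAlgebra.ι R : V →ₗ[R] TensorAlgebra R V) ^ ·) :
      ℕ → Submodule R _)).toLinearMap

/-- Left recursion on words: `foldl step m` is the linear map `φ` with `φ(1) = m` and
`φ(v · x) = step v (φ x)`. -/
def foldLeft {R : Type u} [CommRing R] (V : GrMod.{u, v} R) {M : Type w} [AddCommGroup M]
    [Module R M] (step : V →ₗ[R] M →ₗ[R] M) (m : M) : V.T →ₗ[R] M :=
  LinearMap.applyₗ m ∘ₗ
    (TensorAlgebra.lift R (step : V →ₗ[R] Module.End R M)).toLinearMap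

theorem foldLeft_one {R : Type u} [CommRing R] (V : GrMod.{u, v} R) {M : Type w} [AddCommGroup M]
    [Module R M] (step : V →ₗ[R] M →ₗ[R] M) (m : M) :
    foldLeft V step m (1 : TensorAlgebra R V) = m := by
  simp [foldLeft]

theorem foldLeft_cons {R : Type u} [CommRing R] (V : GrMod.{u, v} R) {M : Type w}
    [AddCommGroup M] [Module R M] (step : V →ₗ[R] M →ₗ[R] M) (m : M) (a : V)
    (x : TensorAlgebra R V) :
    foldLeft V step m (TensorAlgebra.ι R a * x) = step a (foldLeft V step m x) := by
  simp [foldLeft]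

/-- Right recursion on words: the linear map `φ` with `φ(1) = m` and
`φ(x · v) = step v (φ x)`. -/
def foldRight {R : Type u} [CommRing R] (V : GrMod.{u, v} R) {M : Type w} [AddCommGroup M]
    [Module R M] (step : V →ₗ[R] M →ₗ[R] M) (m : M) : V.T →ₗ[R] M :=
  LinearMap.applyₗ m ∘ₗ (MulOpposite.opLinearEquiv R).symm.toLinearMap ∘ₗ
    (TensorAlgebra.lift R ((MulOpposite.opLinearEquiv R).toLinearMap ∘ₗ
      (step : V →ₗ[R] Module.End R M))).toLinearMap

theorem foldRight_one {R : Type u} [CommRing R] (V : GrMod.{u, v} R) {M : Type w}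
    [AddCommGroup M] [Module R M] (step : V →ₗ[R] M →ₗ[R] M) (m : M) :
    foldRight V step m (1 : TensorAlgebra R V) = m := by
  simp [foldRight]

theorem foldRight_snoc {R : Type u} [CommRing R] (V : GrMod.{u, v} R) {M : Type w}
    [AddCommGroup M] [Module R M] (step : V →ₗ[R] M →ₗ[R] M) (m : M) (a : V)
    (x : TensorAlgebra R V) :
    foldRight V step m (x * TensorAlgebra.ι R a) = step a (foldRight V step m x) := by
  simp [foldRight]

/-- The deconcatenation `v₁ ⋯ v_n ↦ ∑ i, v₁ ⋯ v_i ⊗ v_{i+1} ⋯ v_n`. It satisfies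
`δ(v · x) = 1 ⊗ v x + (v ⊗ 1) δ(x)`; the word itself is carried along as first component. -/
def deconcat {R : Type u} [CommRing R] (V : GrMod.{u, v} R) : V.T →ₗ[R] V.T ⊗[R] V.T :=
  LinearMap.snd R V.T (V.T ⊗[R] V.T) ∘ₗ
    foldLeft V (M := V.T × (V.T ⊗[R] V.T))
      (LinearMap.mk₂ R
        (fun a p => ((TensorAlgebra.ι R a * p.1 : TensorAlgebra R V),
          (1 : TensorAlgebra R V) ⊗ₜ[R] (TensorAlgebra.ι R a * p.1 : TensorAlgebra R V) +
            LinearMap.rTensor (TensorAlgebra R V)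
              (LinearMap.mul R (TensorAlgebra R V) (TensorAlgebra.ι R a)) p.2))
        (fun a b p => by
          ext
          · simp [add_mul]
          · simp [LinearMap.rTensor_add, add_mul, TensorProduct.tmul_add]
            abel)
        (fun r a p => by
          ext
          · simp
          · simp [LinearMap.rTensor_smul])
        (fun a p q => by
          ext
          · simp [mul_add]
          · simp [mul_add, TensorProduct.tmul_add]
            abel)
        (fun r a p => by
          ext <;> simp))
      ((1 : TensorAlgebra R V), (1 : TensorAlgebra R V) ⊗ₜ[R] (1 : TensorAlgebra R V))

/-- `v · x ↦ v ⊗ x` on words of positive length, and `1 ↦ 0`. -/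
def uncons {R : Type u} [CommRing R] (V : GrMod.{u, v} R) : V.T →ₗ[R] V ⊗[R] V.T :=
  LinearMap.rTensor V.T (unletter V) ∘ₗ deconcat V

/-- For `φ : T(V) → T(V)` of odd degree, the operator
`x ↦ ∑_{x = x₁ x₂ x₃} (-1)^{|x₁|} x₁ · φ(x₂) · x₃`. If `φ` vanishes on words of length `≠ 1`, this is
the derivation of `T(V)` extending `φ : V → T(V)`; if `φ` takes its values in `V`, this is the
coderivation of the deconcatenation coalgebra with corestriction `φ : T(V) → V`. -/
def insertOdd {R : Type u} [CommRing R] (V : GrMod.{u, v} R) (φ : V.T →ₗ[R] V.T) :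
    V.T →ₗ[R] V.T :=
  concat V ∘ₗ TensorProduct.map V.T.sgn (concat V ∘ₗ LinearMap.rTensor V.T φ ∘ₗ deconcat V) ∘ₗ
    deconcat V

/-! ## Augmented differential graded modules, algebras, coalgebras, bialgebras -/

/-- The data of a graded module `A` with an endomorphism `d`, an element `one` of degree zero (the
image of `1` under the (co)unit or coaugmentation `η : R → A`) and a map `counit : A → R` of degree
zero (the augmentation or counit) with `counit one = 1`. The differential axioms are stated
in `IsDGModule`. -/
structure AugMod (R : Type u) [CommRing R] extends GrMod.{u, v} R where
  d : carrier →ₗ[R] carrier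
  one : carrier
  counit : carrier →ₗ[R] R
  one_mem : one ∈ deg 0
  counit_one : counit one = 1
  counit_eq_zero : ∀ n : ℤ, n ≠ 0 → ∀ a ∈ deg n, counit a = 0

/-- The projection `A → Ā = ker ε`, `a ↦ a - ε(a) 1`. -/
def AugMod.proj {R : Type u} [CommRing R] (A : AugMod.{u, v} R) :
    A.toGrMod →ₗ[R] LinearMap.ker A.counit :=
  (LinearMap.id - (LinearMap.toSpanSingleton R A.carrier A.one) ∘ₗ A.counit).codRestrict _
    fun a => by simp [A.counit_one]

theorem AugMod.proj_coe {R : Type u} [CommRing R] (A : AugMod.{u, v} R)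
    (a : LinearMap.ker A.counit) : A.proj a = a := by
  ext
  have h : A.counit (a : A.carrier) = 0 := a.2
  simp [AugMod.proj, h]

theorem AugMod.proj_mem {R : Type u} [CommRing R] (A : AugMod.{u, v} R) {n : ℤ} {a : A.toGrMod}
    (ha : a ∈ A.deg n) : (A.proj a : A.carrier) ∈ A.deg n := by
  by_cases hn : n = 0
  · subst hn
    simpa [AugMod.proj] using Submodule.sub_mem _ ha (Submodule.smul_mem _ _ A.one_mem)
  · simpa [AugMod.proj, A.counit_eq_zero n hn a ha] using ha

/-- The degree `n` part `(s^r Ā)_n = Ā_{n-r}` of the `r`-fold suspension of `Ā = ker ε`. -/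
def AugMod.suspDeg {R : Type u} [CommRing R] (A : AugMod.{u, v} R) (r n : ℤ) :
    Submodule R (LinearMap.ker A.counit) :=
  (A.deg (n - r)).comap (LinearMap.ker A.counit).subtype

instance AugMod.suspDeg.decomposition {R : Type u} [CommRing R] (A : AugMod.{u, v} R) (r : ℤ) :
    DirectSum.Decomposition (A.suspDeg r) :=
  DirectSum.Decomposition.ofLinearMap _
    ((DirectSum.toModule R ℤ _ fun n =>
      DirectSum.lof R ℤ (fun n => A.suspDeg r n) (n + r) ∘ₗ
        ((A.proj ∘ₗ (A.deg n).subtype).codRestrict (A.suspDeg r (n + r)) fun a => by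
          have := A.proj_mem a.2
          simpa [AugMod.suspDeg] using this)) ∘ₗ
      (DirectSum.decomposeLinearEquiv A.deg).toLinearMap ∘ₗ (LinearMap.ker A.counit).subtype)
    (by
      ext a : 1
      obtain ⟨a, ha⟩ := a
      have key : ∀ b : A.toGrMod, DirectSum.coeLinearMap (A.suspDeg r)
          ((DirectSum.toModule R ℤ _ fun n =>
            DirectSum.lof R ℤ (fun n => A.suspDeg r n) (n + r) ∘ₗ
              ((A.proj ∘ₗ (A.deg n).subtype).codRestrict (A.suspDeg r (n + r)) fun a => by
                have := A.proj_mem a.2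
                simpa [AugMod.suspDeg] using this))
            (DirectSum.decomposeLinearEquiv A.deg b)) = A.proj b := by
        intro b
        induction b using DirectSum.Decomposition.inductionOn A.deg with
        | zero => simp only [map_zero]
        | homogeneous b =>
          rw [DirectSum.decomposeLinearEquiv_apply, DirectSum.decompose_coe,
            ← DirectSum.lof_eq_of R, DirectSum.toModule_lof]
          simp only [LinearMap.comp_apply, DirectSum.coeLinearMap_lof]
          rfl
        | add a b ha hb => simp only [map_add, ha, hb]
      exact (key a).trans (A.proj_coe ⟨a, ha⟩))
    (by
      have cast : ∀ {m n : ℤ} (_ : m = n) (x : A.suspDeg r m) (y : A.suspDeg r n),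
          (x : LinearMap.ker A.counit) = y →
          DirectSum.lof R ℤ (fun n => A.suspDeg r n) m x =
            DirectSum.lof R ℤ (fun n => A.suspDeg r n) n y := by
        rintro m _ rfl x y h
        rw [Subtype.ext h]
      ext n a : 2
      obtain ⟨a, ha⟩ := a
      have ha' : (a : A.carrier) ∈ A.deg (n - r) := ha
      simp only [LinearMap.comp_apply, DirectSum.coeLinearMap_lof, LinearEquiv.coe_coe,
        DirectSum.decomposeLinearEquiv_apply, Submodule.subtype_apply, LinearMap.id_apply]
      rw [DirectSum.decompose_of_mem _ ha', ← DirectSum.lof_eq_of R, DirectSum.toModule_lof]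
      exact cast (by ring) _ _ (A.proj_coe a))

/-- The `r`-fold suspension `s^r Ā` of `Ā = ker ε`. -/
abbrev AugMod.susp {R : Type u} [CommRing R] (A : AugMod.{u, v} R) (r : ℤ) : GrMod.{u, v} R where
  carrier := LinearMap.ker A.counit
  deg := A.suspDeg r

/-- `A → s^r Ā`, `a ↦ s^r (a - ε(a) 1)`. -/
def AugMod.inS {R : Type u} [CommRing R] (A : AugMod.{u, v} R) (r : ℤ) :
    A.toGrMod →ₗ[R] A.susp r := A.proj

/-- `s^r Ā → A`, `s^r a ↦ a`. -/
def AugMod.outS {R : Type u} [CommRing R] (A : AugMod.{u, v} R) (r : ℤ) :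
    A.susp r →ₗ[R] A.toGrMod := (LinearMap.ker A.counit).subtype

/-- The differential `d ⊗ 1 + 1 ⊗ d` of `A ⊗ A`, that is `a ⊗ b ↦ da ⊗ b + (-1)^{|a|} a ⊗ db`. -/
def AugMod.tensorD {R : Type u} [CommRing R] (A : AugMod.{u, v} R) :
    A.toGrMod ⊗[R] A.toGrMod →ₗ[R] A.toGrMod ⊗[R] A.toGrMod :=
  LinearMap.rTensor A.toGrMod A.d + TensorProduct.map A.toGrMod.sgn A.d

/-- `d` is a differential of degree `-1`, compatible with unit and augmentation. -/
structure IsDGModule {R : Type u} [CommRing R] (A : AugMod.{u, v} R) : Prop where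
  d_mem : ∀ n : ℤ, ∀ a ∈ A.deg n, A.d a ∈ A.deg (n - 1)
  d_d : A.d ∘ₗ A.d = 0
  d_one : A.d A.one = 0
  counit_d : A.counit ∘ₗ A.d = 0

/-- `A` with the product `mul` is an augmented associative DG-algebra. -/
structure IsDGAlgebra {R : Type u} [CommRing R] (A : AugMod.{u, v} R)
    (mul : A.toGrMod ⊗[R] A.toGrMod →ₗ[R] A.toGrMod) : Prop extends IsDGModule A where
  mul_mem : ∀ m n : ℤ, ∀ a ∈ A.deg m, ∀ b ∈ A.deg n, mul (a ⊗ₜ b) ∈ A.deg (m + n)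
  mul_assoc : ∀ a b c : A.toGrMod,
    mul (mul (a ⊗ₜ b) ⊗ₜ c) = mul (a ⊗ₜ mul (b ⊗ₜ c))
  one_mul : ∀ a : A.toGrMod, mul (A.one ⊗ₜ a) = a
  mul_one : ∀ a : A.toGrMod, mul (a ⊗ₜ A.one) = a
  d_mul : A.d ∘ₗ mul = mul ∘ₗ A.tensorD
  counit_mul : ∀ a b : A.toGrMod, A.counit (mul (a ⊗ₜ b)) = A.counit a * A.counit b

/-- `A` with the coproduct `comul` is a coaugmented coassociative counital DG-coalgebra. -/
structure IsDGCoalgebra {R : Type u} [CommRing R] (A : AugMod.{u, v} R)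
    (comul : A.toGrMod →ₗ[R] A.toGrMod ⊗[R] A.toGrMod) : Prop extends IsDGModule A where
  comul_mem : ∀ n : ℤ, ∀ a ∈ A.deg n, comul a ∈ tensorDeg A.toGrMod A.toGrMod n
  coassoc : (TensorProduct.assoc R A.toGrMod A.toGrMod A.toGrMod).toLinearMap ∘ₗ
    LinearMap.rTensor A.toGrMod comul ∘ₗ comul = LinearMap.lTensor A.toGrMod comul ∘ₗ comul
  counit_comul : (TensorProduct.lid R A.toGrMod).toLinearMap ∘ₗ
    LinearMap.rTensor A.toGrMod A.counit ∘ₗ comul = LinearMap.id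
  comul_counit : (TensorProduct.rid R A.toGrMod).toLinearMap ∘ₗ
    LinearMap.lTensor A.toGrMod A.counit ∘ₗ comul = LinearMap.id
  comul_d : comul ∘ₗ A.d = A.tensorD ∘ₗ comul
  comul_one : comul A.one = A.one ⊗ₜ A.one

/-- `(H, d, mul, one, comul, counit)` is a DG-bialgebra. -/
structure IsDGBialgebra {R : Type u} [CommRing R] (H : AugMod.{u, v} R)
    (mul : H.toGrMod ⊗[R] H.toGrMod →ₗ[R] H.toGrMod)
    (comul : H.toGrMod →ₗ[R] H.toGrMod ⊗[R] H.toGrMod) : Prop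
    extends IsDGAlgebra H mul, IsDGCoalgebra H comul where
  comul_mul : comul ∘ₗ mul =
    TensorProduct.map mul mul ∘ₗ middleSwap H.toGrMod ∘ₗ TensorProduct.map comul comul

/-- `S` is an antipode: a chain map of degree zero which is inverse to the identity for the
convolution product. -/
structure IsAntipode {R : Type u} [CommRing R] (H : AugMod.{u, v} R)
    (mul : H.toGrMod ⊗[R] H.toGrMod →ₗ[R] H.toGrMod)
    (comul : H.toGrMod →ₗ[R] H.toGrMod ⊗[R] H.toGrMod)
    (S : H.toGrMod →ₗ[R] H.toGrMod) : Prop where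
  mem : ∀ n : ℤ, ∀ a ∈ H.deg n, S a ∈ H.deg n
  comm_d : S ∘ₗ H.d = H.d ∘ₗ S
  left_inv : mul ∘ₗ LinearMap.rTensor H.toGrMod S ∘ₗ comul =
    LinearMap.toSpanSingleton R H.carrier H.one ∘ₗ H.counit
  right_inv : mul ∘ₗ LinearMap.lTensor H.toGrMod S ∘ₗ comul =
    LinearMap.toSpanSingleton R H.carrier H.one ∘ₗ H.counit

/-- `(H, S)` is an involutive DG-Hopf algebra. -/
structure IsInvolutiveDGHopf {R : Type u} [CommRing R] (H : AugMod.{u, v} R)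
    (mul : H.toGrMod ⊗[R] H.toGrMod →ₗ[R] H.toGrMod)
    (comul : H.toGrMod →ₗ[R] H.toGrMod ⊗[R] H.toGrMod)
    (S : H.toGrMod →ₗ[R] H.toGrMod) : Prop where
  bialgebra : IsDGBialgebra H mul comul
  antipode : IsAntipode H mul comul S
  involutive : S ∘ₗ S = LinearMap.id

/-- Connected: zero in negative degrees, and `A₀ = R · 1 ≅ R`. -/
structure AugMod.IsConnected {R : Type u} [CommRing R] (A : AugMod.{u, v} R) : Prop where
  deg_neg : ∀ n : ℤ, n < 0 → A.deg n = ⊥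
  deg_zero : A.deg 0 = Submodule.span R {A.one}

/-- `n`-reduced: connected, and zero in degrees `1, …, n`. -/
structure AugMod.IsReduced {R : Type u} [CommRing R] (A : AugMod.{u, v} R) (n : ℕ) : Prop
    extends A.IsConnected where
  deg_eq_bot : ∀ k : ℤ, 1 ≤ k → k ≤ n → A.deg k = ⊥

/-! ## The cobar and bar constructions -/

theorem augT_eq_zero {R : Type u} [CommRing R] (V : GrMod.{u, v} R) (n : ℤ) (hn : n ≠ 0)
    (x : V.T) (hx : x ∈ V.T.deg n) : augT V x = 0 := by
  change x ∈ tensorAlgebraDeg V n at hx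
  induction hx using Submodule.span_induction with
  | mem x hx =>
    obtain ⟨l, rfl, rfl⟩ := hx
    cases l with
    | nil => simp at hn
    | cons a l => simp [augT, TensorAlgebra.algebraMapInv]
  | zero => exact map_zero _
  | add x y hx hy ihx ihy => exact (map_add (augT V) x y).trans (by rw [ihx, ihy, add_zero])
  | smul r x hx ih => exact (map_smul (augT V) r x).trans (by rw [ih, smul_zero])

theorem augT_one {R : Type u} [CommRing R] (V : GrMod.{u, v} R) :
    augT V (1 : TensorAlgebra R V) = 1 := by
  simp [augT]

/-- `T(V)` with an endomorphism `d`, unit and augmentation. -/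
abbrev augTensor {R : Type u} [CommRing R] (V : GrMod.{u, v} R) (d : V.T →ₗ[R] V.T) :
    AugMod.{u, max u v} R where
  toGrMod := V.T
  d := d
  one := (1 : TensorAlgebra R V)
  counit := augT V
  one_mem := SetLike.GradedOne.one_mem (A := tensorAlgebraDeg V)
  counit_one := augT_one V
  counit_eq_zero := augT_eq_zero V

/-- `s⁻¹ c ↦ - s⁻¹ dc + (s⁻¹ ⊗ s⁻¹) ∇̄ c`, where `(s⁻¹ ⊗ s⁻¹)(a ⊗ b) = (-1)^{|a|} s⁻¹ a · s⁻¹ b`. The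
reduced coproduct is `∇` followed by the projections on `C̄ ⊗ C̄`. -/
def cobarGen {R : Type u} [CommRing R] (C : AugMod.{u, v} R)
    (comul : C.toGrMod →ₗ[R] C.toGrMod ⊗[R] C.toGrMod) : C.susp (-1) →ₗ[R] (C.susp (-1)).T :=
  -(letter (C.susp (-1)) ∘ₗ C.inS (-1) ∘ₗ C.d ∘ₗ C.outS (-1)) +
    concat (C.susp (-1)) ∘ₗ
      TensorProduct.map (letter (C.susp (-1)) ∘ₗ C.inS (-1) ∘ₗ C.toGrMod.sgn)
        (letter (C.susp (-1)) ∘ₗ C.inS (-1)) ∘ₗ comul ∘ₗ C.outS (-1)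

/-- The cobar construction `Ω C = (T(s⁻¹ C̄), d_Ω)`; `d_Ω` is the derivation extending `cobarGen`. -/
abbrev cobar {R : Type u} [CommRing R] (C : AugMod.{u, v} R)
    (comul : C.toGrMod →ₗ[R] C.toGrMod ⊗[R] C.toGrMod) : AugMod.{u, max u v} R :=
  augTensor (C.susp (-1))
    (insertOdd (C.susp (-1)) (cobarGen C comul ∘ₗ unletter (C.susp (-1))))

/-- The corestriction of the differential of the bar construction: `sa ↦ - s da`,
`sa · sb ↦ s μ (s⁻¹ ⊗ s⁻¹)(sa ⊗ sb) = (-1)^{|a|+1} s(ab)`, and zero on words of other lengths. -/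
def barCogen {R : Type u} [CommRing R] (A : AugMod.{u, v} R)
    (mul : A.toGrMod ⊗[R] A.toGrMod →ₗ[R] A.toGrMod) : (A.susp 1).T →ₗ[R] A.susp 1 :=
  -(A.inS 1 ∘ₗ A.d ∘ₗ A.outS 1 ∘ₗ unletter (A.susp 1)) +
    A.inS 1 ∘ₗ mul ∘ₗ TensorProduct.map (A.outS 1 ∘ₗ (A.susp 1).sgn ∘ₗ unletter (A.susp 1))
      (A.outS 1 ∘ₗ unletter (A.susp 1)) ∘ₗ deconcat (A.susp 1)

/-- The bar construction `B A = (T^c(s Ā), d_B)`; its coproduct is `deconcat (A.susp 1)`, and `d_B` is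
the coderivation with corestriction `barCogen`. -/
abbrev bar {R : Type u} [CommRing R] (A : AugMod.{u, v} R)
    (mul : A.toGrMod ⊗[R] A.toGrMod →ₗ[R] A.toGrMod) : AugMod.{u, max u v} R :=
  augTensor (A.susp 1) (insertOdd (A.susp 1) (letter (A.susp 1) ∘ₗ barCogen A mul))

/-! ## Homotopy G-coalgebras and the obstructions -/

/-- The operation `E^{i,j} : C̃ → C̃^{⊗ i} ⊗ C̃^{⊗ j}`, `C̃ = V = s⁻¹ C̄`, of a map
`∇ : ΩC → ΩC ⊗ ΩC`: a component of the restriction of `∇` to `C̃`. -/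
def coOp {R : Type u} [CommRing R] {V : GrMod.{u, v} R} (nabla : V.T →ₗ[R] V.T ⊗[R] V.T)
    (i j : ℕ) : V →ₗ[R] V.T ⊗[R] V.T :=
  TensorProduct.map (lengthProj V i) (lengthProj V j) ∘ₗ nabla ∘ₗ letter V

/-- The operation `E^{k,1}`, seen as a map `C̃ → C̃^{⊗ k} ⊗ C̃ ⊆ T(C̃) ⊗ C̃`. -/
def coOpOne {R : Type u} [CommRing R] {V : GrMod.{u, v} R} (nabla : V.T →ₗ[R] V.T ⊗[R] V.T)
    (k : ℕ) : V →ₗ[R] V.T ⊗[R] V :=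
  TensorProduct.map (lengthProj V k) (unletter V) ∘ₗ nabla ∘ₗ letter V

/-- The maps `1^{⊗ m} ⊗ E^{k,1} : C̃^{⊗ m} ⊗ C̃ → C̃^{⊗ m+k} ⊗ C̃`, for all `m` at once. -/
def coOpExt {R : Type u} [CommRing R] {V : GrMod.{u, v} R} (nabla : V.T →ₗ[R] V.T ⊗[R] V.T)
    (k : ℕ) : V.T ⊗[R] V →ₗ[R] V.T ⊗[R] V :=
  LinearMap.rTensor V (concat V) ∘ₗ (TensorProduct.assoc R V.T V.T V).symm.toLinearMap ∘ₗ
    LinearMap.lTensor V.T (coOpOne nabla k)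

/-- The map `F^n : C̃ → C̃^{⊗ n} ⊆ T(C̃)`, `n ≥ 1`:
`F^n = ∑_{n₁ + ⋯ + n_s = n - 1} (-1)^{s+1}
  (1^{⊗ n₁+⋯+n_{s-1}} ⊗ E^{n_s,1}) ⋯ (1^{⊗ n₁} ⊗ E^{n₂,1}) E^{n₁,1}`.
For `n = 1` only the empty composition of `0` contributes, and `F^1 = -1`. -/
def antipodeComp {R : Type u} [CommRing R] {V : GrMod.{u, v} R}
    (nabla : V.T →ₗ[R] V.T ⊗[R] V.T) (n : ℕ) : V →ₗ[R] V.T :=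
  ∑ c : Composition (n - 1), (-1 : ℤ) ^ (c.length + 1) •
    (concat V ∘ₗ LinearMap.lTensor V.T (letter V) ∘ₗ
      c.blocks.foldl (fun g k => coOpExt nabla k ∘ₗ g)
        (TensorProduct.mk R V.T V (1 : TensorAlgebra R V)))

/-- For a list `n₁, …, n_s`, the map `μ_{(12)}^{(s)} (F^{n₁} ⊗ ⋯ ⊗ F^{n_s}) : C̃^{⊗ s} → T(C̃)`, extended
by zero to words of length `≠ s`. Here `μ_{(12)} = μ τ` is the opposite product, so that
`v₁ ⋯ v_s ↦ ± F^{n_s}(v_s) ⋯ F^{n₁}(v₁)`. -/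
def opProd {R : Type u} [CommRing R] {V : GrMod.{u, v} R}
    (nabla : V.T →ₗ[R] V.T ⊗[R] V.T) : List ℕ → (V.T →ₗ[R] V.T)
  | [] => unitT V ∘ₗ augT V
  | n :: l => concat V ∘ₗ koszul V.T V.T ∘ₗ
      TensorProduct.map (antipodeComp nabla n) (opProd nabla l) ∘ₗ uncons V

/-- The obstruction `O_n = ∑_{s=1}^n ∑_{n₁ + ⋯ + n_s = n} μ_{(12)}^{(s)} (F^{n₁} ⊗ ⋯ ⊗ F^{n_s}) F^s`, a map
`C̃ → C̃^{⊗ n} ⊆ T(C̃)`. -/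
def obstruction {R : Type u} [CommRing R] {V : GrMod.{u, v} R}
    (nabla : V.T →ₗ[R] V.T ⊗[R] V.T) (n : ℕ) : V →ₗ[R] V.T :=
  ∑ c : Composition n, opProd nabla c.blocks ∘ₗ antipodeComp nabla c.length

/-- A homotopy G-coalgebra: a `1`-reduced DG-coalgebra `C` with a map `∇ : ΩC → ΩC ⊗ ΩC` which makes
`ΩC` into a DG-bialgebra, such that `E^{i,j} = 0` for `j ≥ 2`. -/
structure HomotopyGCoalgebra (R : Type u) [CommRing R] where
  C : AugMod.{u, v} R
  comul : C.toGrMod →ₗ[R] C.toGrMod ⊗[R] C.toGrMod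
  isDGCoalgebra : IsDGCoalgebra C comul
  isReduced : C.IsReduced 1
  nabla : (C.susp (-1)).T →ₗ[R] (C.susp (-1)).T ⊗[R] (C.susp (-1)).T
  isDGBialgebra : IsDGBialgebra (cobar C comul) (concat (C.susp (-1))) nabla
  coOp_eq_zero : ∀ i j : ℕ, 2 ≤ j → coOp nabla i j = 0

/-! ## Operations on the cobar construction of a bialgebra -/

/-- For a bialgebra `H`, a coproduct `cop` and `f : H → H` of degree zero, the map
`Ω H → Hom(H, Ω H)` sending `s⁻¹ b₁ ⋯ s⁻¹ b_n` to
`a ↦ ∑ ± s⁻¹(f(a¹) b₁) ⋯ s⁻¹(f(aⁿ) b_n)`, the sums being taken with respect to the iterated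
coproduct `cop`, with Koszul signs: `1 ↦ ε`, and
`(s⁻¹ b · x)(a) = ∑ (-1)^{|a¹| + |a²|(|b| - 1)} s⁻¹(f(a¹) b) · x(a²)`. -/
def diagonalAct {R : Type u} [CommRing R] (H : AugMod.{u, v} R)
    (mul : H.toGrMod ⊗[R] H.toGrMod →ₗ[R] H.toGrMod)
    (cop : H.toGrMod →ₗ[R] H.toGrMod ⊗[R] H.toGrMod) (f : H.toGrMod →ₗ[R] H.toGrMod) :
    (H.susp (-1)).T →ₗ[R] H.toGrMod →ₗ[R] (H.susp (-1)).T :=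
  let V := H.susp (-1)
  let m : H.toGrMod ⊗[R] V →ₗ[R] V.T :=
    letter V ∘ₗ H.inS (-1) ∘ₗ mul ∘ₗ TensorProduct.map (f ∘ₗ H.toGrMod.sgn) (H.outS (-1))
  let θ : H.toGrMod ⊗[R] V →ₗ[R] V.T ⊗[R] H.toGrMod :=
    LinearMap.rTensor H.toGrMod m ∘ₗ
      (TensorProduct.assoc R H.toGrMod V H.toGrMod).symm.toLinearMap ∘ₗ
      LinearMap.lTensor H.toGrMod (koszul H.toGrMod V) ∘ₗ
      (TensorProduct.assoc R H.toGrMod H.toGrMod V).toLinearMap ∘ₗ LinearMap.rTensor V cop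
  foldLeft V (M := H.toGrMod →ₗ[R] V.T)
    (LinearMap.mk₂ R
      (fun b ρ => concat V ∘ₗ LinearMap.lTensor V.T ρ ∘ₗ θ ∘ₗ
        (TensorProduct.mk R H.toGrMod V).flip b)
      (fun b b' ρ => by simp only [map_add, LinearMap.comp_add])
      (fun r b ρ => by simp only [map_smul, LinearMap.comp_smul])
      (fun b ρ ρ' => by
        simp only [LinearMap.lTensor_add, LinearMap.add_comp, LinearMap.comp_add])
      (fun r b ρ => by
        simp only [LinearMap.lTensor_smul, LinearMap.smul_comp, LinearMap.comp_smul]))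
    (unitT V ∘ₗ H.counit)

/-- The operations `E_{1,k} : Ω H ⊗ (Ω H)^{⊗ k} → Ω H`, for all `k` at once, as a pairing
`(x, w) ↦ E_{1,k}(x; b̄₁, …, b̄_k)` of `x` in `Ω H` with the word `w = s b̄₁ ⋯ s b̄_k` of `B Ω H`. On one
letter it is given by `E_{1,0}(s⁻¹ a) = s⁻¹ a`, by
`E_{1,1}(s⁻¹ a; b̄) = (-1)^{|a|} a ⋄ b̄ = ∑ ± s⁻¹(a¹ b₁) ⋯ s⁻¹(aⁿ b_n)` for `b̄ = s⁻¹ b₁ ⋯ s⁻¹ b_n`, and by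
zero for `k ≥ 2`; it is extended to words by `E(1; w) = ε(w)` and
`E(x · s⁻¹ a; w) = ∑_{w = w₁ w₂} (-1)^{(|a|-1)|w₁|} E(x; w₁) · E(s⁻¹ a; w₂)`, so that
`E_{1,k}(s⁻¹ a₁ ⋯ s⁻¹ a_n; b̄₁, …, b̄_k)` is the sum over `i₁ < ⋯ < i_k` of the words obtained by
replacing, for each `r`, the letter `s⁻¹ a_{i_r}` by `a_{i_r} ⋄ b̄_r`, with Koszul signs. -/
def braceOp {R : Type u} [CommRing R] (H : AugMod.{u, v} R)
    (mul : H.toGrMod ⊗[R] H.toGrMod →ₗ[R] H.toGrMod)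
    (comul : H.toGrMod →ₗ[R] H.toGrMod ⊗[R] H.toGrMod) :
    (H.susp (-1)).T →ₗ[R] ((cobar H comul).susp 1).T →ₗ[R] (H.susp (-1)).T :=
  let V := H.susp (-1)
  let W := (cobar H comul).susp 1
  let g : V ⊗[R] W.T →ₗ[R] V.T :=
    letter V ∘ₗ (TensorProduct.rid R V).toLinearMap ∘ₗ LinearMap.lTensor V (augT W) +
      TensorProduct.lift (diagonalAct H mul comul LinearMap.id).flip ∘ₗ
        TensorProduct.map (H.toGrMod.sgn ∘ₗ H.outS (-1))
          ((cobar H comul).outS 1 ∘ₗ unletter W)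
  let θ : V ⊗[R] W.T →ₗ[R] W.T ⊗[R] V.T :=
    LinearMap.lTensor W.T g ∘ₗ (TensorProduct.assoc R W.T V W.T).toLinearMap ∘ₗ
      LinearMap.rTensor W.T (koszul V W.T) ∘ₗ
      (TensorProduct.assoc R V W.T W.T).symm.toLinearMap ∘ₗ LinearMap.lTensor V (deconcat W)
  foldRight V (M := W.T →ₗ[R] V.T)
    (LinearMap.mk₂ R
      (fun a ρ => concat V ∘ₗ LinearMap.rTensor V.T ρ ∘ₗ θ ∘ₗ TensorProduct.mk R V W.T a)
      (fun a a' ρ => by simp only [map_add, LinearMap.comp_add])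
      (fun r a ρ => by simp only [map_smul, LinearMap.comp_smul])
      (fun a ρ ρ' => by
        simp only [LinearMap.rTensor_add, LinearMap.add_comp, LinearMap.comp_add])
      (fun r a ρ => by
        simp only [LinearMap.rTensor_smul, LinearMap.smul_comp, LinearMap.comp_smul]))
    (unitT V ∘ₗ augT W)

/-- The cyclic permutation `v · x ↦ (-1)^{|v||x|} x · v` of the words of `T(V)`. -/
def rotate {R : Type u} [CommRing R] (V : GrMod.{u, v} R) : V.T →ₗ[R] V.T :=
  concat V ∘ₗ LinearMap.lTensor V.T (letter V) ∘ₗ koszul V V.T ∘ₗ uncons V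

/-- The maps `π_n`:
`s⁻¹ a₁ ⋯ s⁻¹ a_n ↦ ∑ ± s⁻¹(S(a₁^{n-1}) a₂) · s⁻¹(S(a₁^{n-2}) a₃) ⋯ s⁻¹(S(a₁^1) a_n)`, defined from the
opposite coproduct `τ ∇` and the antipode. -/
def connesPi {R : Type u} [CommRing R] (H : AugMod.{u, v} R)
    (mul : H.toGrMod ⊗[R] H.toGrMod →ₗ[R] H.toGrMod)
    (comul : H.toGrMod →ₗ[R] H.toGrMod ⊗[R] H.toGrMod) (S : H.toGrMod →ₗ[R] H.toGrMod) :
    (H.susp (-1)).T →ₗ[R] (H.susp (-1)).T :=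
  TensorProduct.lift
      ((diagonalAct H mul (koszul H.toGrMod H.toGrMod ∘ₗ comul) S).flip ∘ₗ H.outS (-1)) ∘ₗ
    uncons (H.susp (-1))

/-- The Connes–Moscovici operator on `Ω H`: zero on words of length `0` and `1`, and
`∑_{i=0}^{n-1} π_n τ_n^i` on words of length `n ≥ 2`, where `τ_n` is the cyclic permutation of the
desuspended letters. -/
def connesMoscovici {R : Type u} [CommRing R] (H : AugMod.{u, v} R)
    (mul : H.toGrMod ⊗[R] H.toGrMod →ₗ[R] H.toGrMod)
    (comul : H.toGrMod →ₗ[R] H.toGrMod ⊗[R] H.toGrMod) (S : H.toGrMod →ₗ[R] H.toGrMod) :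
    (H.susp (-1)).T →ₗ[R] (H.susp (-1)).T :=
  byLength (H.susp (-1)) fun n =>
    if 2 ≤ n then
      ∑ i ∈ Finset.range n, connesPi H mul comul S ∘ₗ (rotate (H.susp (-1)) ^ i :
        Module.End R (H.susp (-1)).T)
    else 0

/-! ## Homotopy G-algebras and homotopy BV-algebras -/

/-- For a product `mulB : BΛ ⊗ BΛ → BΛ`, the operation `E_{i,j}`, as a map on `BΛ ⊗ BΛ` which vanishes
outside of `(sΛ̄)^{⊗ i} ⊗ (sΛ̄)^{⊗ j}`:
`E_{i,j}(a₁, …, a_i; b₁, …, b_j) = s⁻¹ pr mulB (s a₁ ⋯ s a_i ⊗ s b₁ ⋯ s b_j)`. -/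
def barOp {R : Type u} [CommRing R] (A : AugMod.{u, v} R)
    (mulB : (A.susp 1).T ⊗[R] (A.susp 1).T →ₗ[R] (A.susp 1).T) (i j : ℕ) :
    (A.susp 1).T ⊗[R] (A.susp 1).T →ₗ[R] A.toGrMod :=
  A.outS 1 ∘ₗ unletter (A.susp 1) ∘ₗ mulB ∘ₗ
    TensorProduct.map (lengthProj (A.susp 1) i) (lengthProj (A.susp 1) j)

/-- `(A, mul, mulB)` is a homotopy G-algebra: a connected DG-algebra with a product on `B A` making
it into a DG-bialgebra, such that `E_{i,j} = 0` for `i ≥ 2`. -/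
structure IsHomotopyGAlgebra {R : Type u} [CommRing R] (A : AugMod.{u, v} R)
    (mul : A.toGrMod ⊗[R] A.toGrMod →ₗ[R] A.toGrMod)
    (mulB : (A.susp 1).T ⊗[R] (A.susp 1).T →ₗ[R] (A.susp 1).T) : Prop where
  isConnected : A.IsConnected
  isDGAlgebra : IsDGAlgebra A mul
  isDGBialgebra : IsDGBialgebra (bar A mul) mulB (deconcat (A.susp 1))
  barOp_eq_zero : ∀ i j : ℕ, 2 ≤ i → barOp A mulB i j = 0

/-- `E_{1,1}(a; b)`, extended by zero when `a` or `b` is a multiple of the unit. -/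
def E11 {R : Type u} [CommRing R] (A : AugMod.{u, v} R)
    (mulB : (A.susp 1).T ⊗[R] (A.susp 1).T →ₗ[R] (A.susp 1).T) (a b : A.toGrMod) : A.toGrMod :=
  barOp A mulB 1 1 (letter (A.susp 1) (A.inS 1 a) ⊗ₜ letter (A.susp 1) (A.inS 1 b))

/-- `(A, mul, mulB, Δ)` is a homotopy BV-algebra: a homotopy G-algebra with a square zero operator `Δ`
of degree one anticommuting with `d`, and a map `h` of degree two with
`{a;b} = (-1)^{|a|} (Δ(ab) - Δ(a) b - (-1)^{|a|} a Δ(b)) + d h(a;b) + h(da;b) - (-1)^{|a|} h(a;db)`, where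
`{a;b} = E_{1,1}(a;b) - (-1)^{(|a|+1)(|b|+1)} E_{1,1}(b;a)`. The sign of the last term is the one for
which the boundary of `h` follows the same rule as the bracket,
`d{a;b} = {da;b} - (-1)^{|a|} {a;db}`. -/
structure IsHomotopyBVAlgebra {R : Type u} [CommRing R] (A : AugMod.{u, v} R)
    (mul : A.toGrMod ⊗[R] A.toGrMod →ₗ[R] A.toGrMod)
    (mulB : (A.susp 1).T ⊗[R] (A.susp 1).T →ₗ[R] (A.susp 1).T)
    (Δ : A.toGrMod →ₗ[R] A.toGrMod) : Prop where
  isHomotopyGAlgebra : IsHomotopyGAlgebra A mul mulB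
  mem : ∀ n : ℤ, ∀ a ∈ A.deg n, Δ a ∈ A.deg (n + 1)
  d_comm : A.d ∘ₗ Δ = -(Δ ∘ₗ A.d)
  sq_zero : Δ ∘ₗ Δ = 0
  exists_homotopy : ∃ h : A.toGrMod →ₗ[R] A.toGrMod →ₗ[R] A.toGrMod,
    (∀ p q : ℤ, ∀ a ∈ A.deg p, ∀ b ∈ A.deg q, h a b ∈ A.deg (p + q + 2)) ∧
    ∀ p q : ℤ, ∀ a ∈ A.deg p, ∀ b ∈ A.deg q,
      E11 A mulB a b - ((((p + 1) * (q + 1)).negOnePow : ℤˣ) : ℤ) • E11 A mulB b a =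
        ((p.negOnePow : ℤˣ) : ℤ) • (Δ (mul (a ⊗ₜ b)) - mul (Δ a ⊗ₜ b)
            - ((p.negOnePow : ℤˣ) : ℤ) • mul (a ⊗ₜ Δ b)) +
          (A.d (h a b) + h (A.d a) b - ((p.negOnePow : ℤˣ) : ℤ) • h a (A.d b))

/-- `mulB` is the product on `B Ω H` whose operations `E_{1,k}` are the `braceOp`s. -/
def HasBraceOps {R : Type u} [CommRing R] (H : AugMod.{u, v} R)
    (mul : H.toGrMod ⊗[R] H.toGrMod →ₗ[R] H.toGrMod)
    (comul : H.toGrMod →ₗ[R] H.toGrMod ⊗[R] H.toGrMod)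
    (mulB : ((cobar H comul).susp 1).T ⊗[R] ((cobar H comul).susp 1).T →ₗ[R]
      ((cobar H comul).susp 1).T) : Prop :=
  ∀ (k : ℕ) (x : (cobar H comul).susp 1) (w : ((cobar H comul).susp 1).T),
    barOp (cobar H comul) mulB 1 k (letter ((cobar H comul).susp 1) x ⊗ₜ w) =
      braceOp H mul comul ((cobar H comul).outS 1 x)
        (lengthProj ((cobar H comul).susp 1) k w)

end

end DoubleCobar

namespace DoubleCobar
noncomputable section

/-! ## Signs -/

variable (R : Type u) [CommRing R]

/-- The sign `(-1)^n`. -/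
def sg (n : ℤ) : R := (((n.negOnePow : ℤˣ) : ℤ) : R)

variable {R}

theorem sg_congr {m n : ℤ} (h : (m : ZMod 2) = n) : sg R m = sg R n := by
  unfold sg
  rw [Int.negOnePow_eq_iff m n |>.2]
  rw [← ZMod.intCast_eq_zero_iff_even]
  simp [h]

theorem sg_add (m n : ℤ) : sg R (m + n) = sg R m * sg R n := by simp [sg, Int.negOnePow_add]

@[simp] theorem sg_zero : sg R 0 = 1 := by simp [sg]

@[simp] theorem sg_one : sg R 1 = -1 := by simp [sg]

theorem sg_mul_self (m : ℤ) : sg R m * sg R m = 1 := by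
  rw [← sg_add]
  exact (sg_congr (by push_cast; generalize (m : ZMod 2) = x; revert x; decide)).trans sg_zero

theorem negOnePow_smul {M : Type*} [AddCommGroup M] [Module R M] (n : ℤ) (x : M) :
    ((n.negOnePow : ℤˣ) : ℤ) • x = sg R n • x := (Int.cast_smul_eq_zsmul R _ x).symm

theorem sg_smul_sg_smul {M : Type*} [AddCommGroup M] [Module R M] (m n : ℤ) (x : M) :
    sg R m • sg R n • x = sg R (m + n) • x := by rw [smul_smul, sg_add]

theorem sg_smul_congr {M : Type*} [AddCommGroup M] [Module R M] {m n : ℤ} {x y : M}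
    (h : (m : ZMod 2) = n) (hxy : x = y) : sg R m • x = sg R n • y := by rw [sg_congr h, hxy]

/-! ## Graded modules -/

namespace GrMod

variable (V : GrMod.{u, v} R) {W : GrMod.{u, w} R} {M : Type*} [AddCommGroup M] [Module R M]

/-- The sign operator `a ↦ (-1)^{n|a|} a`. -/
def sp (n : ℤ) : V →ₗ[R] V :=
  (DirectSum.toModule R ℤ V fun m => sg R (n * m) • (V.deg m).subtype) ∘ₗ
    (DirectSum.decomposeLinearEquiv V.deg).toLinearMap

variable {V}

theorem sp_apply (n : ℤ) {m : ℤ} {a : V} (ha : a ∈ V.deg m) : V.sp n a = sg R (n * m) • a := by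
  lift a to V.deg m using ha
  simp only [sp, LinearMap.comp_apply, LinearEquiv.coe_coe,
    DirectSum.decomposeLinearEquiv_apply, DirectSum.decompose_coe]
  rw [← DirectSum.lof_eq_of R, DirectSum.toModule_lof]
  simp

theorem hom_ext {f g : V →ₗ[R] M} (h : ∀ n, ∀ a ∈ V.deg n, f a = g a) : f = g := by
  ext a
  induction a using DirectSum.Decomposition.inductionOn V.deg with
  | zero => simp
  | homogeneous a => exact h _ _ a.2
  | add a b ha hb => simp only [map_add, ha, hb]

theorem tensor_ext {f g : V ⊗[R] W →ₗ[R] M}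
    (h : ∀ m n, ∀ a ∈ V.deg m, ∀ b ∈ W.deg n, f (a ⊗ₜ b) = g (a ⊗ₜ b)) : f = g := by
  apply TensorProduct.ext
  refine hom_ext fun m a ha => hom_ext fun n b hb => ?_
  exact h m n a ha b hb

theorem sgn_eq : V.sgn = V.sp 1 :=
  hom_ext fun n a ha => by rw [V.sgn_apply ha, sp_apply 1 ha, one_mul, negOnePow_smul (R := R)]

theorem sp_congr {m n : ℤ} (h : (m : ZMod 2) = n) : V.sp m = V.sp n :=
  hom_ext fun k a ha => by
    rw [sp_apply _ ha, sp_apply _ ha]; exact sg_smul_congr (by push_cast; rw [h]) rfl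

@[simp] theorem sp_zero : V.sp 0 = LinearMap.id :=
  hom_ext fun n a ha => by rw [sp_apply _ ha]; simp

theorem sp_mem (n : ℤ) {m : ℤ} {a : V} (ha : a ∈ V.deg m) : V.sp n a ∈ V.deg m := by
  rw [sp_apply n ha]; exact Submodule.smul_mem _ _ ha

theorem sp_sp (m n : ℤ) (a : V) : V.sp m (V.sp n a) = V.sp (m + n) a := by
  have : V.sp m ∘ₗ V.sp n = V.sp (m + n) := hom_ext fun k a ha => by
    simp only [LinearMap.comp_apply, sp_apply n ha, sp_apply (m + n) ha, map_smul, sp_apply m ha]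
    rw [sg_smul_sg_smul]; exact sg_smul_congr (by push_cast; ring) rfl
  exact LinearMap.congr_fun this a

theorem sp_comp (m n : ℤ) : V.sp m ∘ₗ V.sp n = V.sp (m + n) := LinearMap.ext (sp_sp m n)

theorem sp_self (n : ℤ) (a : V) : V.sp n (V.sp n a) = a := by
  rw [sp_sp, sp_congr (n := 0), sp_zero, LinearMap.id_apply]
  push_cast; generalize (n : ZMod 2) = x; revert x; decide

/-- `f` is homogeneous of degree `s`. -/
def IsDeg (f : V →ₗ[R] W) (s : ℤ) : Prop := ∀ n, ∀ a ∈ V.deg n, f a ∈ W.deg (n + s)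

theorem IsDeg.sp {f : V →ₗ[R] W} {s : ℤ} (hf : IsDeg f s) (n : ℤ) (a : V) :
    W.sp n (f a) = sg R (n * s) • f (V.sp n a) := by
  have : W.sp n ∘ₗ f = sg R (n * s) • (f ∘ₗ V.sp n) := hom_ext fun k a ha => by
    simp only [LinearMap.comp_apply, LinearMap.smul_apply, sp_apply n ha, map_smul,
      sp_apply n (hf k a ha)]
    rw [sg_smul_sg_smul]; exact sg_smul_congr (by push_cast; ring) rfl
  exact LinearMap.congr_fun this a

theorem IsDeg.sp_comp {f : V →ₗ[R] W} {s : ℤ} (hf : IsDeg f s) (n : ℤ) :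
    W.sp n ∘ₗ f = sg R (n * s) • (f ∘ₗ V.sp n) := LinearMap.ext (hf.sp n)

theorem IsDeg.sp_comp_zero {f : V →ₗ[R] W} (hf : IsDeg f 0) (n : ℤ) :
    W.sp n ∘ₗ f = f ∘ₗ V.sp n := by rw [hf.sp_comp]; simp

theorem mem_of_eq {m n : ℤ} {a : V} (ha : a ∈ V.deg m) (h : m = n) : a ∈ V.deg n := h ▸ ha

/-- Two elements which coincide after adding up homogeneous parts: a linear predicate holds as soon as
it holds on homogeneous elements. -/
theorem homogeneous_induction {P : V → Prop} (zero : P 0) (add : ∀ a b, P a → P b → P (a + b))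
    (hom : ∀ n, ∀ a ∈ V.deg n, P a) (a : V) : P a := by
  induction a using DirectSum.Decomposition.inductionOn V.deg with
  | zero => exact zero
  | homogeneous a => exact hom _ _ a.2
  | add a b ha hb => exact add _ _ ha hb

theorem koszul_tmul' {m n : ℤ} {a : V} {b : W} (ha : a ∈ V.deg m) (hb : b ∈ W.deg n) :
    koszul V W (a ⊗ₜ b) = sg R (m * n) • (b ⊗ₜ[R] a) := by
  rw [koszul_tmul V W ha hb, negOnePow_smul (R := R)]

theorem koszul_right {n : ℤ} (a : V) {b : W} (hb : b ∈ W.deg n) :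
    koszul V W (a ⊗ₜ b) = b ⊗ₜ[R] V.sp n a := by
  have : koszul V W ∘ₗ (TensorProduct.mk R V W).flip b = TensorProduct.mk R W V b ∘ₗ V.sp n :=
    hom_ext fun m a ha => by
      simp only [LinearMap.comp_apply, LinearMap.flip_apply, TensorProduct.mk_apply,
        koszul_tmul' ha hb, sp_apply n ha, TensorProduct.tmul_smul]
      exact sg_smul_congr (by push_cast; ring) rfl
  exact LinearMap.congr_fun this a

theorem koszul_left {m : ℤ} {a : V} (ha : a ∈ V.deg m) (b : W) :
    koszul V W (a ⊗ₜ b) = W.sp m b ⊗ₜ[R] a := by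
  have : koszul V W ∘ₗ TensorProduct.mk R V W a = (TensorProduct.mk R W V).flip a ∘ₗ W.sp m :=
    hom_ext fun n b hb => by
      simp only [LinearMap.comp_apply, LinearMap.flip_apply, TensorProduct.mk_apply,
        koszul_tmul' ha hb, sp_apply m hb, TensorProduct.smul_tmul']
  exact LinearMap.congr_fun this b

theorem tmul_mem {p q n : ℤ} {a : V} {b : W} (ha : a ∈ V.deg p) (hb : b ∈ W.deg q)
    (h : p + q = n) : a ⊗ₜ[R] b ∈ tensorDeg V W n := by
  have : q = n - p := by lia
  subst this
  exact (le_iSup (fun p => Submodule.map₂ (TensorProduct.mk R V W) (V.deg p) (W.deg (n - p))) p)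
    (Submodule.apply_mem_map₂ (TensorProduct.mk R V W) ha hb)

theorem tensorDeg_le {n : ℤ} {N : Submodule R (V ⊗[R] W)}
    (h : ∀ p q, p + q = n → ∀ a ∈ V.deg p, ∀ b ∈ W.deg q, a ⊗ₜ[R] b ∈ N) :
    tensorDeg V W n ≤ N := by
  refine iSup_le fun p => Submodule.map₂_le.2 fun a ha b hb => ?_
  exact h p (n - p) (by lia) a ha b hb

theorem tensorDeg_eq {n : ℤ} {f g : V ⊗[R] W →ₗ[R] M}
    (h : ∀ p q, p + q = n → ∀ a ∈ V.deg p, ∀ b ∈ W.deg q, f (a ⊗ₜ b) = g (a ⊗ₜ b))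
    {x : V ⊗[R] W} (hx : x ∈ tensorDeg V W n) : f x = g x :=
  tensorDeg_le (N := LinearMap.eqLocus f g) h hx

theorem tensorDeg_mem {n : ℤ} {f : V ⊗[R] W →ₗ[R] M} {N : Submodule R M}
    (h : ∀ p q, p + q = n → ∀ a ∈ V.deg p, ∀ b ∈ W.deg q, f (a ⊗ₜ b) ∈ N)
    {x : V ⊗[R] W} (hx : x ∈ tensorDeg V W n) : f x ∈ N :=
  tensorDeg_le (N := N.comap f) h hx

theorem tensor_induction {P : V ⊗[R] W → Prop} (zero : P 0) (add : ∀ a b, P a → P b → P (a + b))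
    (hom : ∀ m n, ∀ a ∈ V.deg m, ∀ b ∈ W.deg n, P (a ⊗ₜ b)) (x : V ⊗[R] W) : P x := by
  induction x using TensorProduct.induction_on with
  | zero => exact zero
  | add a b ha hb => exact add _ _ ha hb
  | tmul a b =>
    induction a using homogeneous_induction with
    | zero => simpa using zero
    | add a a' h h' => rw [TensorProduct.add_tmul]; exact add _ _ h h'
    | hom m a ha =>
      induction b using homogeneous_induction with
      | zero => simpa using zero
      | add a a' h h' => rw [TensorProduct.tmul_add]; exact add _ _ h h'
      | hom n b hb => exact hom m n a ha b hb

end GrMod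

theorem middleSwap_tmul (V : GrMod.{u, v} R) {n : ℤ} (a b : V) {c : V} (hc : c ∈ V.deg n) (d : V) :
    middleSwap V ((a ⊗ₜ b) ⊗ₜ (c ⊗ₜ d)) = (a ⊗ₜ c) ⊗ₜ (V.sp n b ⊗ₜ[R] d) := by
  simp [middleSwap, GrMod.koszul_right b hc]

theorem middleSwap_tmul' (V : GrMod.{u, v} R) {n : ℤ} (a : V) {b : V} (hb : b ∈ V.deg n) (c d : V) :
    middleSwap V ((a ⊗ₜ b) ⊗ₜ (c ⊗ₜ d)) = (a ⊗ₜ V.sp n c) ⊗ₜ (b ⊗ₜ[R] d) := by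
  simp [middleSwap, GrMod.koszul_left hb c]

/-! ## The graded tensor algebra -/

section TensorAlgebra

variable {V : GrMod.{u, v} R} {M : Type*} [AddCommGroup M] [Module R M]

theorem one_memT : (1 : TensorAlgebra R V) ∈ V.T.deg 0 :=
  SetLike.GradedOne.one_mem (A := tensorAlgebraDeg V)

theorem mul_memT {m n : ℤ} {x y : TensorAlgebra R V} (hx : x ∈ V.T.deg m) (hy : y ∈ V.T.deg n) :
    x * y ∈ V.T.deg (m + n) := SetLike.GradedMul.mul_mem (A := tensorAlgebraDeg V) hx hy

theorem letter_mem {n : ℤ} {a : V} (ha : a ∈ V.deg n) : letter V a ∈ V.T.deg n :=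
  ι_mem_tensorAlgebraDeg V ha

/-- Induction on homogeneous words, for predicates which are linear in each degree. -/
theorem word_induction {P : ℤ → TensorAlgebra R V → Prop} (one : P 0 1)
    (cons : ∀ m n (v : V) x, v ∈ V.deg m → x ∈ V.T.deg n → P n x → P (m + n) (letter V v * x))
    (zero : ∀ n, P n 0) (add : ∀ n x y, P n x → P n y → P n (x + y))
    (smul : ∀ n (r : R) x, P n x → P n (r • x))
    (n : ℤ) (x : TensorAlgebra R V) (hx : x ∈ V.T.deg n) : P n x := by
  change x ∈ tensorAlgebraDeg V n at hx
  induction hx using Submodule.span_induction with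
  | mem x hx =>
    obtain ⟨l, rfl, rfl⟩ := hx
    induction l with
    | nil => simpa using one
    | cons a l ih =>
      simp only [List.map_cons, List.prod_cons, List.sum_cons]
      exact cons _ _ _ _ a.2.2 (Submodule.subset_span ⟨l, rfl, rfl⟩) ih
  | zero => exact zero n
  | add x y hx hy ihx ihy => exact add _ _ _ ihx ihy
  | smul r x hx ih => exact smul _ _ _ ih

/-- Induction on homogeneous words, adding letters on the right. -/
theorem word_induction_right {P : ℤ → TensorAlgebra R V → Prop} (one : P 0 1)
    (snoc : ∀ m n (v : V) x, v ∈ V.deg m → x ∈ V.T.deg n → P n x → P (n + m) (x * letter V v))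
    (zero : ∀ n, P n 0) (add : ∀ n x y, P n x → P n y → P n (x + y))
    (smul : ∀ n (r : R) x, P n x → P n (r • x))
    (n : ℤ) (x : TensorAlgebra R V) (hx : x ∈ V.T.deg n) : P n x := by
  change x ∈ tensorAlgebraDeg V n at hx
  induction hx using Submodule.span_induction with
  | mem x hx =>
    obtain ⟨l, rfl, rfl⟩ := hx
    induction l using List.reverseRecOn with
    | nil => simpa using one
    | append_singleton l a ih =>
      simp only [List.map_append, List.prod_append, List.sum_append, List.map_cons, List.map_nil,
        List.prod_singleton, List.sum_singleton]
      exact snoc _ _ _ _ a.2.2 (Submodule.subset_span ⟨l, rfl, rfl⟩) ih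
  | zero => exact zero n
  | add x y hx hy ihx ihy => exact add _ _ _ ihx ihy
  | smul r x hx ih => exact smul _ _ _ ih

/-- Induction on words with homogeneous letters, for linear predicates. -/
theorem word_induction' {P : TensorAlgebra R V → Prop} (one : P 1)
    (cons : ∀ m n (v : V) x, v ∈ V.deg m → x ∈ V.T.deg n → P x → P (letter V v * x))
    (zero : P 0) (add : ∀ x y, P x → P y → P (x + y))
    (smul : ∀ (r : R) x, P x → P (r • x)) (x : TensorAlgebra R V) : P x :=
  GrMod.homogeneous_induction (V := V.T) zero add
    (fun n x hx => word_induction (P := fun _ x => P x) one cons (fun _ => zero)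
      (fun _ => add) (fun _ => smul) n x hx) x

theorem sp_mul (n : ℤ) (x y : TensorAlgebra R V) :
    V.T.sp n (x * y : TensorAlgebra R V) = (V.T.sp n x * V.T.sp n y : TensorAlgebra R V) := by
  have : V.T.sp n ∘ₗ concat V = concat V ∘ₗ TensorProduct.map (V.T.sp n) (V.T.sp n) :=
    GrMod.tensor_ext fun p q x hx y hy => by
      simp only [LinearMap.comp_apply, TensorProduct.map_tmul, concat, LinearMap.mul'_apply,
        GrMod.sp_apply n hx, GrMod.sp_apply n hy]
      rw [GrMod.sp_apply n (mul_memT hx hy), smul_mul_smul_comm, ← sg_add, mul_add]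
  exact LinearMap.congr_fun this (x ⊗ₜ y)

@[simp] theorem sp_oneT (n : ℤ) : V.T.sp n (1 : TensorAlgebra R V) = (1 : TensorAlgebra R V) := by
  rw [GrMod.sp_apply n one_memT]; simp

theorem sp_letter (n : ℤ) (v : V) : V.T.sp n (letter V v) = letter V (V.sp n v) := by
  have : GrMod.IsDeg (V := V) (W := V.T) (letter V) 0 := fun m a ha => by
    rw [add_zero]; exact letter_mem ha
  exact LinearMap.congr_fun (this.sp_comp_zero n) v

@[simp] theorem augT_mul (x y : TensorAlgebra R V) : augT V (x * y : TensorAlgebra R V) =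
    augT V x * augT V y := map_mul TensorAlgebra.algebraMapInv x y

@[simp] theorem augT_letter (v : V) : augT V (letter V v) = 0 := by
  simp [augT, letter, TensorAlgebra.algebraMapInv]

@[simp] theorem concat_tmul (x y : TensorAlgebra R V) :
    concat V (x ⊗ₜ y) = (x * y : TensorAlgebra R V) := rfl

theorem unitT_apply (r : R) : unitT V r = r • (1 : TensorAlgebra R V) :=
  Algebra.algebraMap_eq_smul_one r

theorem degT_neg (hV : ∀ n ≤ 0, V.deg n = ⊥) (n : ℤ) (hn : n < 0) : V.T.deg n = ⊥ := by
  rw [eq_bot_iff]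
  intro x hx
  have := word_induction (V := V) (P := fun n x => (n < 0 → x = 0) ∧ (n = 0 → ∃ r : R, x = r • 1))
    ⟨by simp, fun _ => ⟨1, by simp⟩⟩ ?_ ?_ ?_ ?_ n x hx
  · exact this.1 hn
  · intro m n v x hv hx ih
    by_cases hm : m ≤ 0
    · rw [hV m hm, Submodule.mem_bot] at hv
      subst hv
      simp only [map_zero, zero_mul, implies_true, true_and]
      exact fun _ => ⟨0, by simp⟩
    · by_cases hn : n < 0
      · rw [ih.1 hn]
        simp only [mul_zero, implies_true, true_and]
        exact fun _ => ⟨0, by simp⟩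
      · exact ⟨fun h => by lia, fun h => by lia⟩
  · exact fun n => ⟨fun _ => rfl, fun _ => ⟨0, by simp⟩⟩
  · rintro n x y ⟨h1, h2⟩ ⟨h3, h4⟩
    refine ⟨fun h => by rw [h1 h, h3 h, add_zero], fun h => ?_⟩
    obtain ⟨r, hr⟩ := h2 h
    obtain ⟨s, hs⟩ := h4 h
    exact ⟨r + s, by rw [hr, hs, add_smul]⟩
  · rintro n r x ⟨h1, h2⟩
    refine ⟨fun h => by rw [h1 h, smul_zero], fun h => ?_⟩
    obtain ⟨s, hs⟩ := h2 h
    exact ⟨r * s, by rw [hs, mul_smul]⟩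

theorem degT_zero (hV : ∀ n ≤ 0, V.deg n = ⊥) :
    V.T.deg 0 = Submodule.span R {(1 : TensorAlgebra R V)} := by
  refine le_antisymm (fun x hx => ?_) ?_
  · have := word_induction (V := V) (P := fun n x => n = 0 → ∃ r : R, r • 1 = x)
      (fun _ => ⟨1, by simp⟩) ?_ ?_ ?_ ?_ 0 x hx rfl
    · exact Submodule.mem_span_singleton.2 this
    · intro m n v x hv hx ih hmn
      by_cases hm : m ≤ 0
      · rw [hV m hm, Submodule.mem_bot] at hv
        subst hv
        exact ⟨0, by simp⟩
      · rw [degT_neg hV n (by lia), Submodule.mem_bot] at hx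
        exact ⟨0, by simp [hx]⟩
    · exact fun n _ => ⟨0, by simp⟩
    · intro n x y hx hy h
      obtain ⟨r, hr⟩ := hx h
      obtain ⟨s, hs⟩ := hy h
      exact ⟨r + s, by rw [← hr, ← hs, add_smul]⟩
    · intro n r x hx h
      obtain ⟨s, hs⟩ := hx h
      exact ⟨r * s, by rw [← hs, mul_smul]⟩
  · rw [Submodule.span_singleton_le_iff_mem]
    exact one_memT

end TensorAlgebra

/-! ## Tensor products of graded modules -/

section Tensor

variable (V : GrMod.{u, v} R) (W : GrMod.{u, w} R)

/-- The decomposition of `V ⊗ W` by total degree, on homogeneous tensors. -/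
def tensorDeg.pair (m n : ℤ) : V.deg m →ₗ[R] W.deg n →ₗ[R] ⨁ k, tensorDeg V W k :=
  LinearMap.mk₂ R (fun a b => DirectSum.lof R ℤ (fun k => tensorDeg V W k) (m + n)
      ⟨(a : V) ⊗ₜ (b : W), GrMod.tmul_mem a.2 b.2 rfl⟩)
    (fun a a' b => by rw [← map_add]; congr 1; ext; simp [TensorProduct.add_tmul])
    (fun r a b => by rw [← map_smul]; congr 1)
    (fun a b b' => by rw [← map_add]; congr 1; ext; simp [TensorProduct.tmul_add])
    (fun r a b => by rw [← map_smul]; congr 1; ext; simp)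

/-- The decomposition of `V ⊗ W` by total degree. -/
def tensorDeg.decomp : V ⊗[R] W →ₗ[R] ⨁ k, tensorDeg V W k :=
  TensorProduct.lift ((DirectSum.toModule R ℤ _ fun m =>
    (LinearMap.lcomp R _ (DirectSum.decomposeLinearEquiv W.deg).toLinearMap ∘ₗ
      (DirectSum.toModule R ℤ _ fun n => (tensorDeg.pair V W m n).flip).flip)) ∘ₗ
    (DirectSum.decomposeLinearEquiv V.deg).toLinearMap)

theorem tensorDeg.decomp_tmul {m n : ℤ} {a : V} (ha : a ∈ V.deg m) {b : W} (hb : b ∈ W.deg n) :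
    tensorDeg.decomp V W (a ⊗ₜ b) = DirectSum.lof R ℤ (fun k => tensorDeg V W k) (m + n)
      ⟨a ⊗ₜ b, GrMod.tmul_mem ha hb rfl⟩ := by
  lift a to V.deg m using ha
  lift b to W.deg n using hb
  simp only [tensorDeg.decomp, TensorProduct.lift.tmul, LinearMap.comp_apply, LinearEquiv.coe_coe,
    DirectSum.decomposeLinearEquiv_apply, DirectSum.decompose_coe]
  rw [← DirectSum.lof_eq_of R, DirectSum.toModule_lof]
  simp only [LinearMap.comp_apply, LinearMap.lcomp_apply, LinearEquiv.coe_coe,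
    DirectSum.decomposeLinearEquiv_apply, DirectSum.decompose_coe, LinearMap.flip_apply]
  rw [← DirectSum.lof_eq_of R, DirectSum.toModule_lof]
  rfl

instance tensorDeg.decomposition : DirectSum.Decomposition (tensorDeg V W) :=
  DirectSum.Decomposition.ofLinearMap _ (tensorDeg.decomp V W)
    (by
      refine GrMod.tensor_ext fun m n a ha b hb => ?_
      simp only [LinearMap.comp_apply, tensorDeg.decomp_tmul V W ha hb, DirectSum.coeLinearMap_lof,
        LinearMap.id_apply])
    (by
      ext n ⟨x, hx⟩ : 2
      simp only [LinearMap.comp_apply, DirectSum.coeLinearMap_lof, LinearMap.id_apply]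
      let ι := DirectSum.lof R ℤ (fun k => tensorDeg V W k) n
      have key : ∀ y (hy : y ∈ tensorDeg V W n), ∃ z : tensorDeg V W n,
          (z : V ⊗[R] W) = y ∧ tensorDeg.decomp V W y = ι z := by
        intro y hy
        have : tensorDeg V W n ≤ (LinearMap.range (((tensorDeg V W n).subtype).prod ι)).comap
            (LinearMap.id.prod (tensorDeg.decomp V W)) := by
          refine GrMod.tensorDeg_le ?_
          rintro p q rfl a ha b hb
          exact ⟨⟨a ⊗ₜ b, GrMod.tmul_mem ha hb rfl⟩, by
            simp [ι, tensorDeg.decomp_tmul V W ha hb]⟩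
        obtain ⟨z, hz⟩ := this hy
        exact ⟨z, congrArg Prod.fst hz, (congrArg Prod.snd hz).symm⟩
      obtain ⟨z, hz, h⟩ := key x hx
      refine h.trans ?_
      congr 1
      exact Subtype.ext hz)

/-- The tensor product of graded modules. -/
abbrev GrMod.tensor : GrMod.{u, max v w} R where
  carrier := V ⊗[R] W
  deg := tensorDeg V W

variable {V W}

theorem GrMod.sp_tmul (n : ℤ) (a : V) (b : W) :
    (V.tensor W).sp n (a ⊗ₜ b) = V.sp n a ⊗ₜ W.sp n b := by
  have : (V.tensor W).sp n = TensorProduct.map (V.sp n) (W.sp n) :=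
    GrMod.tensor_ext fun p q a ha b hb => by
      rw [GrMod.sp_apply (V := V.tensor W) n (GrMod.tmul_mem ha hb rfl), TensorProduct.map_tmul,
        GrMod.sp_apply n ha, GrMod.sp_apply n hb, mul_add, sg_add, mul_smul,
        TensorProduct.tmul_smul, ← TensorProduct.smul_tmul', smul_comm]
  exact LinearMap.congr_fun this _

theorem GrMod.sp_tensor (n : ℤ) :
    (V.tensor W).sp n = TensorProduct.map (V.sp n) (W.sp n) :=
  TensorProduct.ext' (GrMod.sp_tmul n)

theorem koszul_map {V' : GrMod.{u, v} R} {W' : GrMod.{u, w} R} {f : V →ₗ[R] V'} {g : W →ₗ[R] W'}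
    (hf : GrMod.IsDeg f 0) (hg : GrMod.IsDeg g 0) :
    koszul V' W' ∘ₗ TensorProduct.map f g = TensorProduct.map g f ∘ₗ koszul V W :=
  GrMod.tensor_ext fun m n a ha b hb => by
    have h1 := hf m a ha
    have h2 := hg n b hb
    rw [add_zero] at h1 h2
    simp only [LinearMap.comp_apply, TensorProduct.map_tmul, GrMod.koszul_tmul' ha hb,
      GrMod.koszul_tmul' h1 h2, map_smul]

end Tensor

end
end DoubleCobar

namespace DoubleCobar
noncomputable section
variable {R : Type u} [CommRing R]

/-! ## Convolution -/

section Conv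

variable {K K₁ K₂ K₃ L L₁ L₂ A B C A' B' C' D D' : Type*}
  [AddCommGroup K] [AddCommGroup K₁] [AddCommGroup K₂] [AddCommGroup K₃] [AddCommGroup L]
  [AddCommGroup L₁] [AddCommGroup L₂]
  [AddCommGroup A] [AddCommGroup B] [AddCommGroup C] [AddCommGroup D]
  [AddCommGroup A'] [AddCommGroup B'] [AddCommGroup C'] [AddCommGroup D']
  [Module R K] [Module R K₁] [Module R K₂] [Module R K₃] [Module R L] [Module R L₁] [Module R L₂]
  [Module R A] [Module R B] [Module R C] [Module R D]
  [Module R A'] [Module R B'] [Module R C'] [Module R D']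

/-- The convolution `k ↦ ∑ mu (f k' ⊗ g k'')` with respect to `cm k = ∑ k' ⊗ k''`. -/
def conv (cm : K →ₗ[R] K₁ ⊗[R] K₂) (mu : A ⊗[R] B →ₗ[R] C) (f : K₁ →ₗ[R] A) (g : K₂ →ₗ[R] B) :
    K →ₗ[R] C := mu ∘ₗ TensorProduct.map f g ∘ₗ cm

variable (cm : K →ₗ[R] K₁ ⊗[R] K₂) (mu : A ⊗[R] B →ₗ[R] C)
  (f f' : K₁ →ₗ[R] A) (g g' : K₂ →ₗ[R] B)

theorem conv_apply (k : K) : conv cm mu f g k = mu (TensorProduct.map f g (cm k)) := rfl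

theorem conv_add_left : conv cm mu (f + f') g = conv cm mu f g + conv cm mu f' g := by
  simp [conv, TensorProduct.map_add_left, LinearMap.add_comp, LinearMap.comp_add]

theorem conv_add_right : conv cm mu f (g + g') = conv cm mu f g + conv cm mu f g' := by
  simp [conv, TensorProduct.map_add_right, LinearMap.add_comp, LinearMap.comp_add]

theorem conv_smul_left (r : R) : conv cm mu (r • f) g = r • conv cm mu f g := by
  simp [conv, TensorProduct.map_smul_left, LinearMap.smul_comp, LinearMap.comp_smul]

theorem conv_smul_right (r : R) : conv cm mu f (r • g) = r • conv cm mu f g := by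
  simp [conv, TensorProduct.map_smul_right, LinearMap.smul_comp, LinearMap.comp_smul]

theorem conv_neg_left : conv cm mu (-f) g = -conv cm mu f g := by
  simpa using conv_smul_left cm mu f g (-1)

theorem conv_neg_right : conv cm mu f (-g) = -conv cm mu f g := by
  simpa using conv_smul_right cm mu f g (-1)

theorem conv_sub_left : conv cm mu (f - f') g = conv cm mu f g - conv cm mu f' g := by
  rw [sub_eq_add_neg, conv_add_left, conv_neg_left, sub_eq_add_neg]

theorem conv_sub_right : conv cm mu f (g - g') = conv cm mu f g - conv cm mu f g' := by
  rw [sub_eq_add_neg, conv_add_right, conv_neg_right, sub_eq_add_neg]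

theorem conv_zero_left : conv cm mu (0 : K₁ →ₗ[R] A) g = 0 := by
  simpa using conv_smul_left cm mu 0 g 0

theorem conv_zero_right : conv cm mu f (0 : K₂ →ₗ[R] B) = 0 := by
  simpa using conv_smul_right cm mu f 0 0

theorem conv_comp_left (α : L →ₗ[R] K₁) (cm : K →ₗ[R] L ⊗[R] K₂) :
    conv cm mu (f ∘ₗ α) g = conv (LinearMap.rTensor K₂ α ∘ₗ cm) mu f g := by
  simp only [conv, ← LinearMap.comp_assoc, LinearMap.map_comp_rTensor]

theorem conv_comp_comp (α : L₁ →ₗ[R] K₁) (β : L₂ →ₗ[R] K₂) (cm : K →ₗ[R] L₁ ⊗[R] L₂) :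
    conv cm mu (f ∘ₗ α) (g ∘ₗ β) = conv (TensorProduct.map α β ∘ₗ cm) mu f g := by
  simp only [conv, TensorProduct.map_comp, LinearMap.comp_assoc]

theorem comp_conv (φ : C →ₗ[R] D) : φ ∘ₗ conv cm mu f g = conv cm (φ ∘ₗ mu) f g := by
  simp only [conv, LinearMap.comp_assoc]

theorem conv_comp (γ : L →ₗ[R] K) : conv cm mu f g ∘ₗ γ = conv (cm ∘ₗ γ) mu f g := by
  simp only [conv, LinearMap.comp_assoc]

theorem conv_comp_out (α : A →ₗ[R] A') (β : B →ₗ[R] B') (mu : A' ⊗[R] B' →ₗ[R] C) :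
    conv cm mu (α ∘ₗ f) (β ∘ₗ g) = conv cm (mu ∘ₗ TensorProduct.map α β) f g := by
  simp only [conv, TensorProduct.map_comp, LinearMap.comp_assoc]

/-- Associativity of convolution. -/
theorem conv_assoc {cm : K →ₗ[R] K₁ ⊗[R] K₂} {cm' : K₁ →ₗ[R] L ⊗[R] L₁}
    {cm₂ : K →ₗ[R] L ⊗[R] K₃} {cm₂' : K₃ →ₗ[R] L₁ ⊗[R] K₂}
    (hcm : (TensorProduct.assoc R L L₁ K₂).toLinearMap ∘ₗ LinearMap.rTensor K₂ cm' ∘ₗ cm =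
      LinearMap.lTensor L cm₂' ∘ₗ cm₂)
    {mu : C ⊗[R] D →ₗ[R] C'} {mu' : A ⊗[R] B →ₗ[R] C} {mu₂ : A ⊗[R] D' →ₗ[R] C'}
    {mu₂' : B ⊗[R] D →ₗ[R] D'}
    (hmu : ∀ a b d, mu (mu' (a ⊗ₜ b) ⊗ₜ d) = mu₂ (a ⊗ₜ mu₂' (b ⊗ₜ d)))
    (f : L →ₗ[R] A) (g : L₁ →ₗ[R] B) (h : K₂ →ₗ[R] D) :
    conv cm mu (conv cm' mu' f g) h = conv cm₂ mu₂ f (conv cm₂' mu₂' g h) := by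
  have h1 : mu ∘ₗ TensorProduct.map (mu' ∘ₗ TensorProduct.map f g) h =
      mu₂ ∘ₗ TensorProduct.map f (mu₂' ∘ₗ TensorProduct.map g h) ∘ₗ
        (TensorProduct.assoc R L L₁ K₂).toLinearMap := by
    refine TensorProduct.ext_threefold fun a b c => ?_
    simp [hmu]
  ext k
  have h2 := LinearMap.congr_fun hcm k
  have h3 := LinearMap.congr_fun h1 (LinearMap.rTensor K₂ cm' (cm k))
  simp only [LinearMap.comp_apply, LinearEquiv.coe_coe] at h2 h3
  rw [h2] at h3
  rw [conv_apply, conv_apply, conv, conv, ← LinearMap.comp_assoc cm', ← LinearMap.comp_assoc cm₂',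
    ← LinearMap.map_rTensor, h3, LinearMap.map_lTensor]

/-- `mu (y ⊗ -)`. -/
abbrev mulL (mu : A ⊗[R] B →ₗ[R] C) (a : A) : B →ₗ[R] C := mu ∘ₗ TensorProduct.mk R A B a

/-- `mu (- ⊗ y)`. -/
abbrev mulR (mu : A ⊗[R] B →ₗ[R] C) (b : B) : A →ₗ[R] C := mu ∘ₗ (TensorProduct.mk R A B).flip b

/-- The constant map `k ↦ ε(k) y`. -/
def cst (eps : K →ₗ[R] R) (y : A) : K →ₗ[R] A := LinearMap.toSpanSingleton R A y ∘ₗ eps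

theorem cst_apply (eps : K →ₗ[R] R) (y : A) (k : K) : cst eps y k = eps k • y := rfl

theorem comp_cst (eps : K →ₗ[R] R) (y : A) (φ : A →ₗ[R] B) : φ ∘ₗ cst eps y = cst eps (φ y) := by
  ext k; simp [cst_apply]

theorem cst_comp (eps : K →ₗ[R] R) (y : A) (φ : L →ₗ[R] K) : cst eps y ∘ₗ φ = cst (eps ∘ₗ φ) y :=
  rfl

theorem cst_add (eps : K →ₗ[R] R) (y z : A) : cst eps (y + z) = cst eps y + cst eps z := by
  ext k; simp [cst_apply]

theorem cst_smul (eps : K →ₗ[R] R) (r : R) (z : A) : cst eps (r • z) = r • cst eps z := by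
  ext k; exact smul_comm _ _ _

theorem cst_zero (eps : K →ₗ[R] R) : cst eps (0 : A) = 0 := by
  ext k; simp [cst_apply]

/-- Coassociative counital coalgebras (without signs). -/
structure IsCoalg (cm : K →ₗ[R] K ⊗[R] K) (eps : K →ₗ[R] R) : Prop where
  coassoc : (TensorProduct.assoc R K K K).toLinearMap ∘ₗ LinearMap.rTensor K cm ∘ₗ cm =
    LinearMap.lTensor K cm ∘ₗ cm
  counit_left : (TensorProduct.lid R K).toLinearMap ∘ₗ LinearMap.rTensor K eps ∘ₗ cm = LinearMap.id
  counit_right : (TensorProduct.rid R K).toLinearMap ∘ₗ LinearMap.lTensor K eps ∘ₗ cm =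
    LinearMap.id

variable {cm : K →ₗ[R] K ⊗[R] K} {eps : K →ₗ[R] R}

theorem IsCoalg.cst_conv (h : IsCoalg cm eps) (y : A) (g : K →ₗ[R] B) :
    conv cm mu (cst eps y) g = mulL mu y ∘ₗ g := by
  have : TensorProduct.map (cst eps y) g = TensorProduct.mk R A B y ∘ₗ g ∘ₗ
      (TensorProduct.lid R K).toLinearMap ∘ₗ LinearMap.rTensor K eps :=
    TensorProduct.ext' fun a b => by simp [cst_apply, TensorProduct.smul_tmul']
  rw [conv, this]
  have h2 := h.counit_left
  simp only [LinearMap.comp_assoc] at h2 ⊢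
  rw [h2]; rfl

theorem IsCoalg.conv_cst (h : IsCoalg cm eps) (y : B) (f : K →ₗ[R] A) :
    conv cm mu f (cst eps y) = mulR mu y ∘ₗ f := by
  have : TensorProduct.map f (cst eps y) = (TensorProduct.mk R A B).flip y ∘ₗ f ∘ₗ
      (TensorProduct.rid R K).toLinearMap ∘ₗ LinearMap.lTensor K eps :=
    TensorProduct.ext' fun a b => by simp [cst_apply, TensorProduct.smul_tmul']
  rw [conv, this]
  have h2 := h.counit_right
  simp only [LinearMap.comp_assoc] at h2 ⊢
  rw [h2]; rfl

theorem IsCoalg.conv_assoc (hc : IsCoalg cm eps)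
    {mu : C ⊗[R] D →ₗ[R] C'} {mu' : A ⊗[R] B →ₗ[R] C} {mu₂ : A ⊗[R] D' →ₗ[R] C'}
    {mu₂' : B ⊗[R] D →ₗ[R] D'}
    (hmu : ∀ a b d, mu (mu' (a ⊗ₜ b) ⊗ₜ d) = mu₂ (a ⊗ₜ mu₂' (b ⊗ₜ d)))
    (f : K →ₗ[R] A) (g : K →ₗ[R] B) (h : K →ₗ[R] D) :
    conv cm mu (conv cm mu' f g) h = conv cm mu₂ f (conv cm mu₂' g h) :=
  DoubleCobar.conv_assoc hc.coassoc hmu f g h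

end Conv

theorem concat_assoc (V : GrMod.{u, v} R) (a b c : V.T) :
    concat V (concat V (a ⊗ₜ b) ⊗ₜ c) = concat V (a ⊗ₜ concat V (b ⊗ₜ c)) :=
  mul_assoc (G := TensorAlgebra R V) a b c

theorem IsDGCoalgebra.isCoalg {H : AugMod.{u, v} R}
    {comul : H.toGrMod →ₗ[R] H.toGrMod ⊗[R] H.toGrMod} (h : IsDGCoalgebra H comul) :
    IsCoalg comul H.counit := ⟨h.coassoc, h.counit_comul, h.comul_counit⟩

/-! ## Graded coalgebras -/

section Cop

variable {V : GrMod.{u, v} R} {cm : V →ₗ[R] V ⊗[R] V} {eps : V →ₗ[R] R}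

/-- The opposite coproduct. -/
abbrev cop (cm : V →ₗ[R] V ⊗[R] V) : V →ₗ[R] V ⊗[R] V := koszul V V ∘ₗ cm

theorem comul_sp (hdeg : GrMod.IsDeg (W := V.tensor V) cm 0) (n : ℤ) :
    cm ∘ₗ V.sp n = TensorProduct.map (V.sp n) (V.sp n) ∘ₗ cm := by
  rw [← hdeg.sp_comp_zero, GrMod.sp_tensor]

theorem isDeg_koszul : GrMod.IsDeg (V := V.tensor V) (W := V.tensor V) (koszul V V) 0 :=
  fun n x hx => by
    rw [add_zero]
    refine GrMod.tensorDeg_mem (f := koszul V V) (N := tensorDeg V V n) ?_ hx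
    intro p q h a ha b hb
    rw [GrMod.koszul_tmul' ha hb]
    exact Submodule.smul_mem _ _ (GrMod.tmul_mem hb ha (by lia))

theorem isDeg_cop (hdeg : GrMod.IsDeg (W := V.tensor V) cm 0) :
    GrMod.IsDeg (W := V.tensor V) (cop cm) 0 := fun n x hx => by
  have := isDeg_koszul (n + 0) (cm x) (hdeg n x hx)
  simpa using this

theorem isDeg_id : GrMod.IsDeg (LinearMap.id : V →ₗ[R] V) 0 := fun n a ha => by simpa using ha

theorem koszul_rTensor_cm (hdeg : GrMod.IsDeg (W := V.tensor V) cm 0) :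
    koszul (V.tensor V) V ∘ₗ LinearMap.rTensor V cm = LinearMap.lTensor V cm ∘ₗ koszul V V :=
  GrMod.tensor_ext fun m n a ha b hb => by
    have := hdeg m a ha
    rw [add_zero] at this
    simp only [LinearMap.comp_apply, LinearMap.rTensor_tmul, LinearMap.lTensor_tmul,
      GrMod.koszul_tmul' ha hb, GrMod.koszul_tmul' (V := V.tensor V) this hb, map_smul]

theorem koszul_lTensor_cm (hdeg : GrMod.IsDeg (W := V.tensor V) cm 0) :
    koszul V (V.tensor V) ∘ₗ LinearMap.lTensor V cm = LinearMap.rTensor V cm ∘ₗ koszul V V :=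
  GrMod.tensor_ext fun m n a ha b hb => by
    have := hdeg n b hb
    rw [add_zero] at this
    simp only [LinearMap.comp_apply, LinearMap.rTensor_tmul, LinearMap.lTensor_tmul,
      GrMod.koszul_tmul' ha hb, GrMod.koszul_tmul' (W := V.tensor V) ha this, map_smul]

theorem IsCoalg.cop (h : IsCoalg cm eps) (hdeg : GrMod.IsDeg (W := V.tensor V) cm 0)
    (heps : ∀ n : ℤ, n ≠ 0 → ∀ a ∈ V.deg n, eps a = 0) : IsCoalg (cop cm) eps where
  coassoc := by
    have e1 := koszul_lTensor_cm hdeg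
    have e2 := koszul_rTensor_cm hdeg
    have e3 : (TensorProduct.assoc R V V V).toLinearMap ∘ₗ LinearMap.rTensor V (koszul V V) ∘ₗ
        koszul V (V.tensor V) ∘ₗ (TensorProduct.assoc R V V V).toLinearMap =
        LinearMap.lTensor V (koszul V V) ∘ₗ koszul (V.tensor V) V := by
      refine TensorProduct.ext_threefold fun a b c => ?_
      induction a using GrMod.homogeneous_induction with
      | zero => simp
      | add a a' h h' => simp only [TensorProduct.add_tmul, map_add, h, h']
      | hom m a ha =>
      induction c using GrMod.homogeneous_induction with
      | zero => simp
      | add a a' h h' => simp only [TensorProduct.tmul_add, map_add, h, h']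
      | hom n c hc =>
        simp only [LinearMap.comp_apply, LinearEquiv.coe_coe, TensorProduct.assoc_tmul]
        rw [GrMod.koszul_left (W := V.tensor V) ha, GrMod.koszul_right (V := V.tensor V) _ hc,
          GrMod.sp_tmul, GrMod.sp_tmul, LinearMap.rTensor_tmul, LinearMap.lTensor_tmul,
          GrMod.koszul_left (GrMod.sp_mem n ha), GrMod.koszul_right _ (GrMod.sp_mem m hc)]
        simp only [GrMod.sp_apply _ hc, GrMod.sp_apply _ ha, TensorProduct.tmul_smul,
          ← TensorProduct.smul_tmul', map_smul, TensorProduct.assoc_tmul, GrMod.sp_sp]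
        rw [mul_comm m n, add_comm m n]
    ext k
    have h1 := LinearMap.congr_fun h.coassoc k
    have h2 := LinearMap.congr_fun e1 (cm k)
    have h3 := LinearMap.congr_fun e2 (cm k)
    have h4 := LinearMap.congr_fun e3 (LinearMap.rTensor V cm (cm k))
    simp only [LinearMap.comp_apply, LinearEquiv.coe_coe, DoubleCobar.cop, LinearMap.rTensor_comp,
      LinearMap.lTensor_comp] at h1 h2 h3 h4 ⊢
    rw [← h2, ← h1, ← h3, h4]
  counit_left := by
    have : (TensorProduct.lid R V).toLinearMap ∘ₗ LinearMap.rTensor V eps ∘ₗ koszul V V =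
        (TensorProduct.rid R V).toLinearMap ∘ₗ LinearMap.lTensor V eps :=
      GrMod.tensor_ext fun m n a ha b hb => by
        by_cases hn : n = 0
        · subst hn
          simp [GrMod.koszul_right a hb]
        · simp [GrMod.koszul_right a hb, heps n hn b hb]
    rw [← h.counit_right]
    exact LinearMap.ext fun k => LinearMap.congr_fun this (cm k)
  counit_right := by
    have : (TensorProduct.rid R V).toLinearMap ∘ₗ LinearMap.lTensor V eps ∘ₗ koszul V V =
        (TensorProduct.lid R V).toLinearMap ∘ₗ LinearMap.rTensor V eps :=
      GrMod.tensor_ext fun m n a ha b hb => by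
        by_cases hm : m = 0
        · subst hm
          simp [GrMod.koszul_left ha b]
        · simp [GrMod.koszul_left ha b, heps m hm a ha]
    rw [← h.counit_left]
    exact LinearMap.ext fun k => LinearMap.congr_fun this (cm k)

end Cop

/-! ## Differential graded bialgebras and antipodes -/

section Hopf

variable {H : AugMod.{u, v} R} {mul : H.toGrMod ⊗[R] H.toGrMod →ₗ[R] H.toGrMod}
  {comul : H.toGrMod →ₗ[R] H.toGrMod ⊗[R] H.toGrMod} {S : H.toGrMod →ₗ[R] H.toGrMod}

theorem IsDGModule.isDeg_d (h : IsDGModule H) : GrMod.IsDeg (V := H.toGrMod) H.d (-1) :=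
  fun n a ha => h.d_mem n a ha

theorem IsDGModule.sp_d (h : IsDGModule H) (n : ℤ) (a : H.toGrMod) :
    H.toGrMod.sp n (H.d a) = sg R n • H.d (H.toGrMod.sp n a) := by
  rw [h.isDeg_d.sp]
  exact sg_smul_congr (by push_cast; generalize (n : ZMod 2) = x; revert x; decide) rfl

theorem IsDGCoalgebra.isDeg (h : IsDGCoalgebra H comul) :
    GrMod.IsDeg (W := H.toGrMod.tensor H.toGrMod) comul 0 := fun n a ha => by
  rw [add_zero]; exact h.comul_mem n a ha

theorem IsDGAlgebra.isDeg (h : IsDGAlgebra H mul) :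
    GrMod.IsDeg (V := H.toGrMod.tensor H.toGrMod) mul 0 := fun n a ha => by
  rw [add_zero]
  refine GrMod.tensorDeg_mem (fun p q hpq a ha b hb => ?_) ha
  exact GrMod.mem_of_eq (h.mul_mem p q a ha b hb) hpq

theorem IsDGAlgebra.sp_mul (h : IsDGAlgebra H mul) (n : ℤ) (a b : H.toGrMod) :
    H.toGrMod.sp n (mul (a ⊗ₜ b)) = mul (H.toGrMod.sp n a ⊗ₜ H.toGrMod.sp n b) := by
  have := LinearMap.congr_fun (h.isDeg.sp_comp_zero n) (a ⊗ₜ b)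
  rw [← GrMod.sp_tmul]; exact this

theorem AugMod.sp_one (H : AugMod.{u, v} R) (n : ℤ) : H.toGrMod.sp n H.one = H.one := by
  rw [GrMod.sp_apply n H.one_mem]; simp

theorem AugMod.counit_sp (H : AugMod.{u, v} R) (n : ℤ) : H.counit ∘ₗ H.toGrMod.sp n = H.counit :=
  GrMod.hom_ext fun m a ha => by
    rw [LinearMap.comp_apply, GrMod.sp_apply n ha]
    by_cases hm : m = 0
    · subst hm; simp
    · simp [H.counit_eq_zero m hm a ha]

theorem IsDGCoalgebra.comul_sp (h : IsDGCoalgebra H comul) (n : ℤ) :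
    comul ∘ₗ H.toGrMod.sp n = TensorProduct.map (H.toGrMod.sp n) (H.toGrMod.sp n) ∘ₗ comul :=
  DoubleCobar.comul_sp h.isDeg n

theorem IsDGCoalgebra.isCoalg_cop (h : IsDGCoalgebra H comul) : IsCoalg (cop comul) H.counit :=
  h.isCoalg.cop h.isDeg H.counit_eq_zero

/-- A convolution precomposed with the sign operator. -/
theorem IsDGCoalgebra.conv_sp (h : IsDGCoalgebra H comul) {A B C : Type*} [AddCommGroup A]
    [AddCommGroup B] [AddCommGroup C] [Module R A] [Module R B] [Module R C]
    (mu : A ⊗[R] B →ₗ[R] C) (f : H.toGrMod →ₗ[R] A) (g : H.toGrMod →ₗ[R] B) (n : ℤ) :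
    conv comul mu f g ∘ₗ H.toGrMod.sp n =
      conv comul mu (f ∘ₗ H.toGrMod.sp n) (g ∘ₗ H.toGrMod.sp n) := by
  rw [conv_comp, h.comul_sp, conv_comp_comp]

/-- A convolution precomposed with the differential. -/
theorem IsDGCoalgebra.conv_d (h : IsDGCoalgebra H comul) {A B C : Type*} [AddCommGroup A]
    [AddCommGroup B] [AddCommGroup C] [Module R A] [Module R B] [Module R C]
    (mu : A ⊗[R] B →ₗ[R] C) (f : H.toGrMod →ₗ[R] A) (g : H.toGrMod →ₗ[R] B) :
    conv comul mu f g ∘ₗ H.d =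
      conv comul mu (f ∘ₗ H.d) g + conv comul mu (f ∘ₗ H.toGrMod.sp 1) (g ∘ₗ H.d) := by
  rw [conv_comp, h.comul_d, AugMod.tensorD, GrMod.sgn_eq, conv_comp_left, conv_comp_comp]
  simp only [conv, LinearMap.add_comp, LinearMap.comp_add]

theorem IsAntipode.conv_left (hS : IsAntipode H mul comul S) :
    conv comul mul S LinearMap.id = cst H.counit H.one := hS.left_inv

theorem IsAntipode.conv_right (hS : IsAntipode H mul comul S) :
    conv comul mul LinearMap.id S = cst H.counit H.one := hS.right_inv

theorem IsDGBialgebra.one_conv (hb : IsDGBialgebra H mul comul) (g : H.toGrMod →ₗ[R] H.toGrMod) :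
    conv comul mul (cst H.counit H.one) g = g := by
  rw [hb.isCoalg.cst_conv]
  ext a; exact hb.one_mul _

theorem IsDGBialgebra.conv_one (hb : IsDGBialgebra H mul comul) (g : H.toGrMod →ₗ[R] H.toGrMod) :
    conv comul mul g (cst H.counit H.one) = g := by
  rw [hb.isCoalg.conv_cst]
  ext a; exact hb.mul_one _

theorem IsAntipode.unique (hb : IsDGBialgebra H mul comul) (hS : IsAntipode H mul comul S)
    {S' : H.toGrMod →ₗ[R] H.toGrMod} (hS' : IsAntipode H mul comul S') : S = S' := by
  rw [← hb.conv_one S, ← hS'.conv_right, ← hb.isCoalg.conv_assoc hb.mul_assoc, hS.conv_left,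
    hb.one_conv]

theorem IsAntipode.isDeg (hS : IsAntipode H mul comul S) : GrMod.IsDeg S 0 := fun n a ha => by
  rw [add_zero]; exact hS.mem n a ha

theorem IsAntipode.sp (hS : IsAntipode H mul comul S) (n : ℤ) :
    H.toGrMod.sp n ∘ₗ S = S ∘ₗ H.toGrMod.sp n := hS.isDeg.sp_comp_zero n

theorem IsAntipode.one (hb : IsDGBialgebra H mul comul) (hS : IsAntipode H mul comul S) :
    S H.one = H.one := by
  have := LinearMap.congr_fun hS.conv_left H.one
  rw [conv_apply, hb.comul_one, TensorProduct.map_tmul, LinearMap.id_apply, hb.mul_one,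
    cst_apply, H.counit_one, one_smul] at this
  exact this

theorem IsAntipode.counit (hb : IsDGBialgebra H mul comul) (hS : IsAntipode H mul comul S) :
    H.counit ∘ₗ S = H.counit := by
  have h1 : H.counit ∘ₗ mul = LinearMap.mul' R R ∘ₗ TensorProduct.map H.counit H.counit :=
    TensorProduct.ext' fun a b => by simp [hb.counit_mul]
  have h2 := congrArg (fun f => H.counit ∘ₗ f) hS.conv_left
  simp only [comp_conv, comp_cst, H.counit_one] at h2
  rw [h1, ← conv_comp_out, LinearMap.comp_id,
    show H.counit = cst H.counit (1 : R) by ext; simp [cst_apply], hb.isCoalg.conv_cst] at h2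
  ext a
  have h3 := LinearMap.congr_fun h2 a
  simpa [cst_apply] using h3

/-- The antipode is an antihomomorphism of algebras. -/
theorem IsAntipode.antimul (hb : IsDGBialgebra H mul comul) (hS : IsAntipode H mul comul S) :
    S ∘ₗ mul = mul ∘ₗ koszul H.toGrMod H.toGrMod ∘ₗ TensorProduct.map S S := by
  let Θ : (H.toGrMod ⊗[R] H.toGrMod) ⊗[R] H.toGrMod →ₗ[R] H.toGrMod :=
    mul ∘ₗ LinearMap.rTensor _ (S ∘ₗ mul) ∘ₗ (TensorProduct.assoc R _ _ _).symm.toLinearMap ∘ₗ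
      LinearMap.lTensor _ (koszul H.toGrMod H.toGrMod) ∘ₗ (TensorProduct.assoc R _ _ _).toLinearMap
  have hΘ : ∀ a, conv comul mul (Θ ∘ₗ TensorProduct.mk R _ _ (comul a)) LinearMap.id =
      cst H.counit (H.counit a • H.one) := by
    intro a
    have key : ∀ A B : H.toGrMod ⊗[R] H.toGrMod,
        mul (TensorProduct.map (Θ ∘ₗ TensorProduct.mk R _ _ A) LinearMap.id B) =
        mul (LinearMap.rTensor _ S (TensorProduct.map mul mul (middleSwap _ (A ⊗ₜ B)))) := by
      intro A B
      induction A using GrMod.tensor_induction with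
      | zero => simp
      | add A A' h h' =>
        simp only [TensorProduct.add_tmul, map_add, LinearMap.comp_add, TensorProduct.map_add_left,
          LinearMap.add_apply, h, h']
      | hom m n a1 ha1 a2 ha2 =>
      induction B using TensorProduct.induction_on with
      | zero => simp
      | add A A' h h' => simp only [TensorProduct.tmul_add, map_add, h, h']
      | tmul b1 b2 =>
        rw [middleSwap_tmul' _ _ ha2]
        simp [Θ, GrMod.koszul_left ha2, hb.mul_assoc]
    ext b
    rw [conv_apply, key]
    have h1 := LinearMap.congr_fun hb.comul_mul (a ⊗ₜ b)
    have h2 := LinearMap.congr_fun hS.conv_left (mul (a ⊗ₜ b))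
    simp only [LinearMap.comp_apply, TensorProduct.map_tmul] at h1
    rw [← h1]
    refine h2.trans ?_
    rw [cst_apply, cst_apply, hb.counit_mul, smul_smul, mul_comm]
  have hZ : ∀ a b, Θ (comul a ⊗ₜ b) = H.counit a • S b := by
    intro a b
    have h1 : Θ ∘ₗ TensorProduct.mk R _ _ (comul a) = H.counit a • S := by
      rw [← hb.conv_one (Θ ∘ₗ _), ← hS.conv_right, ← hb.isCoalg.conv_assoc hb.mul_assoc, hΘ,
        cst_smul, conv_smul_left, hb.one_conv]
    exact LinearMap.congr_fun h1 b
  refine GrMod.tensor_ext fun m n a _ b hbn => ?_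
  let g : H.toGrMod →ₗ[R] H.toGrMod := S ∘ₗ mul ∘ₗ (TensorProduct.mk R _ _).flip b
  have h1 : conv comul mul g (H.toGrMod.sp n) = cst H.counit (S b) := by
    ext a
    rw [cst_apply, ← hZ, conv_apply]
    have : mul ∘ₗ TensorProduct.map g (H.toGrMod.sp n) = Θ ∘ₗ (TensorProduct.mk R _ _).flip b :=
      TensorProduct.ext' fun x y => by simp [Θ, g, GrMod.koszul_right _ hbn]
    exact LinearMap.congr_fun this _
  have h2 : conv comul mul (H.toGrMod.sp n) (S ∘ₗ H.toGrMod.sp n) = cst H.counit H.one := by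
    have := congrArg (fun f => f ∘ₗ H.toGrMod.sp n) hS.conv_right
    simpa only [hb.conv_sp, cst_comp, H.counit_sp, LinearMap.id_comp] using this
  have h3 : g = conv comul mul (cst H.counit (S b)) (S ∘ₗ H.toGrMod.sp n) := by
    rw [← h1, hb.isCoalg.conv_assoc hb.mul_assoc, h2, hb.conv_one]
  have h4 := LinearMap.congr_fun h3 a
  rw [hb.isCoalg.cst_conv] at h4
  simp only [LinearMap.comp_apply, LinearMap.flip_apply, TensorProduct.mk_apply, g,
    TensorProduct.map_tmul] at h4 ⊢
  rw [h4, GrMod.koszul_right _ (hS.mem n b hbn), ← LinearMap.comp_apply, ← LinearMap.comp_apply,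
    hS.sp]

/-- The product of `H ⊗ H`. -/
abbrev mulTwo (mul : H.toGrMod ⊗[R] H.toGrMod →ₗ[R] H.toGrMod) :
    (H.toGrMod ⊗[R] H.toGrMod) ⊗[R] (H.toGrMod ⊗[R] H.toGrMod) →ₗ[R]
      H.toGrMod ⊗[R] H.toGrMod := TensorProduct.map mul mul ∘ₗ middleSwap H.toGrMod

theorem IsDGAlgebra.mulTwo_assoc (h : IsDGAlgebra H mul) (x y z : H.toGrMod ⊗[R] H.toGrMod) :
    mulTwo mul (mulTwo mul (x ⊗ₜ y) ⊗ₜ z) = mulTwo mul (x ⊗ₜ mulTwo mul (y ⊗ₜ z)) := by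
  induction x using GrMod.tensor_induction with
  | zero => simp
  | add A A' h h' => simp only [TensorProduct.add_tmul, map_add, h, h']
  | hom m1 m2 a1 ha1 a2 ha2 =>
  induction y using GrMod.tensor_induction with
  | zero => simp
  | add A A' h h' => simp only [TensorProduct.tmul_add, TensorProduct.add_tmul, map_add, h, h']
  | hom n1 n2 b1 hb1 b2 hb2 =>
  induction z using TensorProduct.induction_on with
  | zero => simp
  | add A A' h h' => simp only [TensorProduct.tmul_add, map_add, h, h']
  | tmul c1 c2 =>
    simp only [LinearMap.comp_apply, middleSwap_tmul' _ _ ha2, middleSwap_tmul' _ _ hb2,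
      TensorProduct.map_tmul, GrMod.sp_apply _ hb1, TensorProduct.tmul_smul, map_smul,
      ← TensorProduct.smul_tmul']
    rw [middleSwap_tmul' _ _ (h.mul_mem _ _ _ ha2 _ hb2), TensorProduct.map_tmul, h.mul_assoc,
      h.mul_assoc, h.sp_mul, GrMod.sp_sp, GrMod.sp_apply _ hb1]
    simp only [TensorProduct.tmul_smul, map_smul, ← TensorProduct.smul_tmul']

/-- The antipode is an antihomomorphism of coalgebras. -/
theorem IsAntipode.anticomul (hb : IsDGBialgebra H mul comul) (hS : IsAntipode H mul comul S) :
    comul ∘ₗ S = TensorProduct.map S S ∘ₗ cop comul := by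
  let i₁ : H.toGrMod →ₗ[R] H.toGrMod ⊗[R] H.toGrMod := (TensorProduct.mk R _ _).flip H.one
  let i₂ : H.toGrMod →ₗ[R] H.toGrMod ⊗[R] H.toGrMod := TensorProduct.mk R _ _ H.one
  have as := hb.isCoalg.conv_assoc (mu := mulTwo mul) (mu' := mulTwo mul) (mu₂ := mulTwo mul)
    (mu₂' := mulTwo mul) hb.mulTwo_assoc
  have h1 : mulTwo mul ∘ₗ TensorProduct.map i₁ i₁ = i₁ ∘ₗ mul := TensorProduct.ext' fun a b => by
    simp [i₁, middleSwap_tmul' _ _ H.one_mem, hb.mul_one]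
  have h2 : mulTwo mul ∘ₗ TensorProduct.map i₂ i₂ = i₂ ∘ₗ mul := TensorProduct.ext' fun a b => by
    simp [i₂, middleSwap_tmul _ _ _ H.one_mem, hb.one_mul]
  have h3 : mulTwo mul ∘ₗ TensorProduct.map i₁ i₂ = LinearMap.id := TensorProduct.ext' fun a b => by
    simp [i₁, i₂, middleSwap_tmul _ _ _ H.one_mem, hb.one_mul, hb.mul_one]
  have h4 : mulTwo mul ∘ₗ TensorProduct.map i₂ i₁ = koszul _ _ :=
    GrMod.tensor_ext fun m n a ha b _ => by
    simp [i₁, i₂, middleSwap_tmul' _ _ ha, hb.one_mul, hb.mul_one, GrMod.koszul_left ha]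
  have e1 : conv comul (mulTwo mul) i₁ i₂ = comul := by
    rw [← i₁.comp_id, ← i₂.comp_id, conv_comp_out, h3]
    simp [conv]
  have e2 : conv comul (mulTwo mul) i₁ (i₁ ∘ₗ S) = cst H.counit (H.one ⊗ₜ H.one) := by
    rw [← i₁.comp_id, LinearMap.comp_assoc, conv_comp_out, h1, ← comp_conv, LinearMap.id_comp,
      hS.conv_right, comp_cst]; rfl
  have e3 : conv comul (mulTwo mul) i₂ (i₂ ∘ₗ S) = cst H.counit (H.one ⊗ₜ H.one) := by
    rw [← i₂.comp_id, LinearMap.comp_assoc, conv_comp_out, h2, ← comp_conv, LinearMap.id_comp,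
      hS.conv_right, comp_cst]; rfl
  have e4 : conv comul (mulTwo mul) (comul ∘ₗ S) comul = cst H.counit (H.one ⊗ₜ H.one) := by
    have : mulTwo mul ∘ₗ TensorProduct.map comul comul = comul ∘ₗ mul := hb.comul_mul.symm
    rw [← comul.comp_id, LinearMap.comp_assoc, conv_comp_out, LinearMap.comp_id, this, ← comp_conv,
      LinearMap.id_comp, hS.conv_left, comp_cst, hb.comul_one]
  have u1 : ∀ f : H.toGrMod →ₗ[R] H.toGrMod ⊗[R] H.toGrMod,
      conv comul (mulTwo mul) f (cst H.counit (H.one ⊗ₜ H.one)) = f := by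
    intro f
    rw [hb.isCoalg.conv_cst]
    have : mulR (mulTwo mul) (H.one ⊗ₜ H.one) = LinearMap.id := TensorProduct.ext' fun a b => by
      simp [middleSwap_tmul _ _ _ H.one_mem, hb.mul_one]
    rw [this, LinearMap.id_comp]
  have u2 : ∀ f : H.toGrMod →ₗ[R] H.toGrMod ⊗[R] H.toGrMod,
      conv comul (mulTwo mul) (cst H.counit (H.one ⊗ₜ H.one)) f = f := by
    intro f
    rw [hb.isCoalg.cst_conv]
    have : mulL (mulTwo mul) (H.one ⊗ₜ H.one) = LinearMap.id := TensorProduct.ext' fun a b => by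
      simp [middleSwap_tmul' _ _ H.one_mem, hb.one_mul]
    rw [this, LinearMap.id_comp]
  have e5 : conv comul (mulTwo mul) (conv comul (mulTwo mul) (comul ∘ₗ S) i₁) i₂ =
      cst H.counit (H.one ⊗ₜ H.one) := by rw [as, e1, e4]
  have e6 : conv comul (mulTwo mul) (comul ∘ₗ S) i₁ = i₂ ∘ₗ S := by
    rw [← u1 (conv _ _ _ _), ← e3, ← as, e5, u2]
  have e7 : comul ∘ₗ S = conv comul (mulTwo mul) (i₂ ∘ₗ S) (i₁ ∘ₗ S) := by
    rw [← e6, as, e2, u1]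
  rw [e7, conv_comp_out, h4]
  ext a
  exact LinearMap.congr_fun (koszul_map hS.isDeg hS.isDeg) (comul a)

/-- An involutive antipode is an antipode for the opposite coproduct. -/
theorem IsInvolutiveDGHopf.conv_cop_left (h : IsInvolutiveDGHopf H mul comul S) :
    conv (cop comul) mul S LinearMap.id = cst H.counit H.one := by
  have hS := h.antipode
  have h1 := congrArg (fun f => S ∘ₗ f) hS.conv_left
  simp only [comp_conv, comp_cst, hS.one h.bialgebra, hS.antimul h.bialgebra] at h1
  rw [← h1]
  have h2 : (mul ∘ₗ koszul H.toGrMod H.toGrMod ∘ₗ TensorProduct.map S S) ∘ₗ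
      TensorProduct.map S LinearMap.id = mul ∘ₗ TensorProduct.map S LinearMap.id ∘ₗ
        koszul H.toGrMod H.toGrMod := by
    rw [← koszul_map isDeg_id hS.isDeg, LinearMap.comp_assoc, LinearMap.comp_assoc,
      ← TensorProduct.map_comp, h.involutive, LinearMap.comp_id]
  ext a
  exact (LinearMap.congr_fun h2 (comul a)).symm

end Hopf

/-! ## Word length -/

section Length

variable {V : GrMod.{u, v} R}

theorem letter_cons_mem {k : ℕ} (v : V) {x : TensorAlgebra R V}
    (hx : x ∈ LinearMap.range (TensorAlgebra.ι R : V →ₗ[R] TensorAlgebra R V) ^ k) :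
    letter V v * x ∈ LinearMap.range (TensorAlgebra.ι R : V →ₗ[R] TensorAlgebra R V) ^ (k + 1) := by
  rw [pow_succ']
  exact Submodule.mul_mem_mul ⟨v, rfl⟩ hx

theorem lengthProj_of_mem {k n : ℕ} {x : TensorAlgebra R V}
    (hx : x ∈ LinearMap.range (TensorAlgebra.ι R : V →ₗ[R] TensorAlgebra R V) ^ k) :
    lengthProj V n x = if k = n then x else 0 := by
  rw [lengthProj, GradedAlgebra.proj_apply, DirectSum.decompose_of_mem _ hx]
  split_ifs with h
  · subst h
    rw [DirectSum.of_eq_same]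
  · rw [DirectSum.of_eq_of_ne _ _ _ (Ne.symm h)]; rfl

theorem lengthProj_one (n : ℕ) : lengthProj V n (1 : TensorAlgebra R V) =
    if n = 0 then (1 : TensorAlgebra R V) else 0 := by
  rw [lengthProj_of_mem (k := 0) (by rw [pow_zero]; exact Submodule.one_le.1 le_rfl)]
  simp only [eq_comm]

theorem length_induction {P : TensorAlgebra R V → Prop} (add : ∀ x y, P x → P y → P (x + y))
    (hom : ∀ (k : ℕ), ∀ x ∈ LinearMap.range (TensorAlgebra.ι R : V →ₗ[R] TensorAlgebra R V) ^ k,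
      P x) (x : TensorAlgebra R V) : P x := by
  induction x using DirectSum.Decomposition.inductionOn
    ((LinearMap.range (TensorAlgebra.ι R : V →ₗ[R] TensorAlgebra R V) ^ ·) :
      ℕ → Submodule R _) with
  | zero => exact hom 0 0 (zero_mem _)
  | homogeneous a => exact hom _ _ a.2
  | add a b ha hb => exact add _ _ ha hb

theorem lengthProj_cons (n : ℕ) (v : V) (x : TensorAlgebra R V) :
    lengthProj V (n + 1) (letter V v * x : TensorAlgebra R V) =
      (letter V v * lengthProj V n x : TensorAlgebra R V) := by
  induction x using length_induction with
  | add x y hx hy => simp only [mul_add, map_add, hx, hy]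
  | hom k x hx =>
    rw [lengthProj_of_mem hx, lengthProj_of_mem (letter_cons_mem v hx)]
    by_cases h : k = n <;> simp [h]

theorem lengthProj_zero_cons (v : V) (x : TensorAlgebra R V) :
    lengthProj V 0 (letter V v * x : TensorAlgebra R V) = 0 := by
  induction x using length_induction with
  | add x y hx hy => simp only [mul_add, map_add, hx, hy, add_zero]
  | hom k x hx => rw [lengthProj_of_mem (letter_cons_mem v hx)]; simp

theorem lengthProj_letter (n : ℕ) (v : V) :
    lengthProj V n (letter V v) = if n = 1 then letter V v else 0 := by
  have h : letter V v = (letter V v * 1 : TensorAlgebra R V) := (mul_one _).symm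
  rw [h]
  rcases n with _ | n
  · rw [lengthProj_zero_cons]; simp
  · rw [lengthProj_cons, lengthProj_one]
    by_cases hn : n = 0 <;> simp [hn]

theorem lengthProj_zero (x : TensorAlgebra R V) : lengthProj V 0 x = augT V x • 1 := by
  induction x using word_induction' with
  | one => rw [lengthProj_one, augT_one]; simp
  | cons m n v x hv hx ih => rw [lengthProj_zero_cons, augT_mul, augT_letter]; simp
  | zero => simp
  | add x y hx hy => simp only [map_add, hx, hy, add_smul]
  | smul r x hx => simp only [map_smul, hx, smul_eq_mul, mul_smul]

@[simp] theorem unletter_letter (v : V) : unletter V (letter V v) = v :=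
  TensorAlgebra.ι_leftInverse v

theorem unletter_one : unletter V (1 : TensorAlgebra R V) = 0 := by
  let _ : Module Rᵐᵒᵖ V := Module.compHom _ ((RingHom.id R).fromOpposite mul_comm)
  have : IsCentralScalar R V := ⟨fun r m => rfl⟩
  change TrivSqZeroExt.snd (TensorAlgebra.toTrivSqZeroExt (R := R) (M := V) 1) = 0
  rw [map_one, TrivSqZeroExt.snd_one]

theorem unletter_cons (v : V) (x : TensorAlgebra R V) :
    unletter V (letter V v * x : TensorAlgebra R V) = augT V x • v := by
  let _ : Module Rᵐᵒᵖ V := Module.compHom _ ((RingHom.id R).fromOpposite mul_comm)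
  have : IsCentralScalar R V := ⟨fun r m => rfl⟩
  have h : (TrivSqZeroExt.fstHom R R V).comp TensorAlgebra.toTrivSqZeroExt =
      TensorAlgebra.algebraMapInv := by
    ext v; simp [TensorAlgebra.algebraMapInv]
  have h' : TrivSqZeroExt.fst (TensorAlgebra.toTrivSqZeroExt (R := R) (M := V) x) = augT V x :=
    AlgHom.congr_fun h x
  change TrivSqZeroExt.snd (TensorAlgebra.toTrivSqZeroExt (R := R) (M := V)
    (TensorAlgebra.ι R v * x)) = _
  rw [map_mul, TrivSqZeroExt.snd_mul, TensorAlgebra.toTrivSqZeroExt_ι, TrivSqZeroExt.fst_inr,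
    TrivSqZeroExt.snd_inr, zero_smul, zero_add, h', op_smul_eq_smul]

theorem lengthProj_one_eq (x : TensorAlgebra R V) :
    lengthProj V 1 x = letter V (unletter V x) := by
  induction x using word_induction' with
  | one => rw [lengthProj_one, unletter_one]; simp
  | cons m n v x hv hx ih =>
    rw [lengthProj_cons, unletter_cons, lengthProj_zero, map_smul, mul_smul_comm, mul_one]
  | zero => simp
  | add x y hx hy => simp only [map_add, hx, hy]
  | smul r x hx => simp only [map_smul, hx]

/-- A word is the sum of its components of given lengths. -/
theorem exists_sum_lengthProj (x : TensorAlgebra R V) :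
    ∃ N : ℕ, ∀ M ≥ N, ∑ k ∈ Finset.range M, lengthProj V k x = x := by
  induction x using length_induction with
  | add x y hx hy =>
    obtain ⟨N, hN⟩ := hx
    obtain ⟨N', hN'⟩ := hy
    refine ⟨max N N', fun M hM => ?_⟩
    simp only [map_add, Finset.sum_add_distrib]
    rw [hN M (le_trans (le_max_left _ _) hM), hN' M (le_trans (le_max_right _ _) hM)]
  | hom k x hx =>
    refine ⟨k + 1, fun M hM => ?_⟩
    rw [Finset.sum_congr rfl fun n _ => lengthProj_of_mem hx]
    rw [Finset.sum_ite_eq]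
    simp; lia

theorem lengthProj_ext {x y : TensorAlgebra R V} (h : ∀ n, lengthProj V n x = lengthProj V n y) :
    x = y := by
  obtain ⟨N, hN⟩ := exists_sum_lengthProj x
  obtain ⟨N', hN'⟩ := exists_sum_lengthProj y
  rw [← hN _ (le_max_left N N'), ← hN' _ (le_max_right N N')]
  exact Finset.sum_congr rfl fun n _ => h n

theorem lengthProj_mul (n : ℕ) (x y : TensorAlgebra R V) :
    lengthProj V n (x * y : TensorAlgebra R V) = ∑ p ∈ Finset.HasAntidiagonal.antidiagonal n,
      (lengthProj V p.1 x * lengthProj V p.2 y : TensorAlgebra R V) := by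
  induction x using word_induction' generalizing n with
  | one =>
    rw [one_mul, Finset.sum_eq_single (0, n)]
    · rw [lengthProj_one, if_pos rfl, one_mul]
    · rintro ⟨i, j⟩ hij hne
      have : i ≠ 0 := by
        rintro rfl
        simp at hij
        exact hne (by simp [hij])
      rw [lengthProj_one, if_neg this, zero_mul]
    · simp
  | cons k l v x hv hx ih =>
    rw [mul_assoc]
    rcases n with _ | n
    · rw [lengthProj_zero_cons, Finset.Nat.antidiagonal_zero, Finset.sum_singleton,
        lengthProj_zero_cons, zero_mul]
    · rw [lengthProj_cons, ih, Finset.Nat.antidiagonal_succ, Finset.sum_cons, Finset.sum_map,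
        lengthProj_zero_cons, zero_mul, zero_add, Finset.mul_sum]
      refine Finset.sum_congr rfl fun p _ => ?_
      change _ = lengthProj V (p.1 + 1) (letter V v * x : TensorAlgebra R V) * lengthProj V p.2 y
      rw [lengthProj_cons, mul_assoc]
  | zero => simp
  | add x y hx hy => simp only [add_mul, map_add, hx, hy, Finset.sum_add_distrib]
  | smul r x hx => simp only [smul_mul_assoc, map_smul, hx, Finset.smul_sum]

theorem isDeg_lengthProj (n : ℕ) : GrMod.IsDeg (V := V.T) (W := V.T) (lengthProj V n) 0 := by
  intro m x hx
  rw [add_zero]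
  revert n
  refine word_induction (V := V) (P := fun m x => ∀ n, lengthProj V n x ∈ V.T.deg m)
    ?_ ?_ ?_ ?_ ?_ m x hx
  · intro n
    rw [lengthProj_one]
    split_ifs
    exacts [one_memT, zero_mem _]
  · intro p q v x hv hx ih n
    rcases n with _ | n
    · rw [lengthProj_zero_cons]; exact zero_mem _
    · rw [lengthProj_cons]; exact mul_memT (letter_mem hv) (ih n)
  · intro m n; rw [map_zero]; exact zero_mem _
  · intro m x y hx hy n; rw [map_add]; exact add_mem (hx n) (hy n)
  · intro m r x hx n; rw [map_smul]; exact Submodule.smul_mem _ _ (hx n)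

theorem isDeg_unletter : GrMod.IsDeg (V := V.T) (W := V) (unletter V) 0 := by
  intro m x hx
  rw [add_zero]
  refine word_induction (V := V) (P := fun m x => unletter V x ∈ V.deg m)
    ?_ ?_ ?_ ?_ ?_ m x hx
  · rw [unletter_one]; exact zero_mem _
  · intro p q v x hv hx ih
    rw [unletter_cons]
    by_cases hq : q = 0
    · subst hq; rw [add_zero]; exact Submodule.smul_mem _ _ hv
    · rw [augT_eq_zero V q hq x hx, zero_smul]; exact zero_mem _
  · intro m; rw [map_zero]; exact zero_mem _
  · intro m x y hx hy; rw [map_add]; exact add_mem hx hy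
  · intro m r x hx; rw [map_smul]; exact Submodule.smul_mem _ _ hx

end Length

/-! ## The antipode of a connected bialgebra -/

section Antipode

variable {V : GrMod.{u, v} R} {d : V.T →ₗ[R] V.T} {nabla : V.T →ₗ[R] V.T ⊗[R] V.T}

theorem isDeg_conv {U V W X Y : GrMod.{u, w} R} {cm : U →ₗ[R] V ⊗[R] V}
    {mu : X ⊗[R] Y →ₗ[R] W} {f : V →ₗ[R] X} {g : V →ₗ[R] Y} {s t : ℤ}
    (hcm : GrMod.IsDeg (W := V.tensor V) cm 0) (hmu : GrMod.IsDeg (V := X.tensor Y) mu 0)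
    (hf : GrMod.IsDeg f s) (hg : GrMod.IsDeg g t) : GrMod.IsDeg (conv cm mu f g) (s + t) := by
  intro n a ha
  refine GrMod.tensorDeg_mem (f := mu ∘ₗ TensorProduct.map f g) ?_ (hcm n a ha)
  intro p q hpq x hx y hy
  refine GrMod.mem_of_eq (hmu _ _ (GrMod.tmul_mem (hf p x hx) (hg q y hy) rfl)) (by lia)

theorem isDeg_cst {U : GrMod.{u, v} R} {X : GrMod.{u, w} R} {eps : U →ₗ[R] R} {y : X} {n : ℤ}
    (heps : ∀ n : ℤ, n ≠ 0 → ∀ a ∈ U.deg n, eps a = 0) (hy : y ∈ X.deg n) :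
    GrMod.IsDeg (cst eps y) n := by
  intro m a ha
  rw [cst_apply]
  by_cases hm : m = 0
  · subst hm; rw [zero_add]; exact Submodule.smul_mem _ _ hy
  · rw [heps m hm a ha, zero_smul]; exact zero_mem _

/-- The convolution powers of `ηε - 1`. -/
def antipodePow (V : GrMod.{u, v} R) (nabla : V.T →ₗ[R] V.T ⊗[R] V.T) : ℕ → (V.T →ₗ[R] V.T)
  | 0 => cst (augT V) (1 : TensorAlgebra R V)
  | n + 1 => conv nabla (concat V) (cst (augT V) (1 : TensorAlgebra R V) - LinearMap.id)
      (antipodePow V nabla n)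

theorem antipodePow_isDeg (hb : IsDGBialgebra (augTensor V d) (concat V) nabla) (n : ℕ) :
    GrMod.IsDeg (antipodePow V nabla n) 0 := by
  have h0 : GrMod.IsDeg (cst (augT V) (1 : TensorAlgebra R V) : V.T →ₗ[R] V.T) 0 :=
    isDeg_cst (X := V.T) (augT_eq_zero V) one_memT
  induction n with
  | zero => exact h0
  | succ n ih =>
    have h1 : GrMod.IsDeg (cst (augT V) (1 : TensorAlgebra R V) - LinearMap.id : V.T →ₗ[R] V.T) 0 :=
      fun m a ha => sub_mem (h0 m a ha) (isDeg_id m a ha)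
    have h2 : GrMod.IsDeg (W := V.T.tensor V.T) nabla 0 := hb.toIsDGCoalgebra.isDeg
    have h3 : GrMod.IsDeg (V := V.T.tensor V.T) (W := V.T) (concat V) 0 := hb.toIsDGAlgebra.isDeg
    have h4 := isDeg_conv h2 h3 h1 ih
    rw [add_zero] at h4
    exact h4

theorem antipodePow_eq_zero (hb : IsDGBialgebra (augTensor V d) (concat V) nabla)
    (hV : ∀ n ≤ 0, V.deg n = ⊥) (n : ℕ) : ∀ k : ℤ, k < n → ∀ x ∈ V.T.deg k,
      antipodePow V nabla n x = 0 := by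
  induction n with
  | zero =>
    intro k hk x hx
    rw [degT_neg hV k (by simpa using hk), Submodule.mem_bot] at hx
    rw [hx, map_zero]
  | succ n ih =>
    intro k hk x hx
    have := hb.comul_mem k x hx
    have key : ∀ f : V.T →ₗ[R] V.T, (∀ q < (n : ℤ), ∀ b ∈ V.T.deg q, f b = 0) →
        (concat V ∘ₗ TensorProduct.map (cst (augT V) (1 : TensorAlgebra R V) - LinearMap.id) f)
          (nabla x) = 0 := by
      intro f hf
      refine GrMod.tensorDeg_eq (V := V.T) (W := V.T) (g := 0) (n := k) ?_ this
      intro p q hpq a ha b hb'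
      simp only [LinearMap.comp_apply, TensorProduct.map_tmul, LinearMap.zero_apply]
      rcases lt_trichotomy p 0 with hp | hp | hp
      · rw [degT_neg hV p hp, Submodule.mem_bot] at ha
        rw [ha, map_zero, TensorProduct.zero_tmul, map_zero]
      · subst hp
        rw [degT_zero hV, Submodule.mem_span_singleton] at ha
        obtain ⟨r, rfl⟩ := ha
        rw [LinearMap.sub_apply, cst_apply, map_smul, augT_one]
        simp
      · rw [hf q (by push_cast at hk; lia) b hb', TensorProduct.tmul_zero, map_zero]
    exact key _ ih

/-- The antipode, the sum of the convolution powers of `ηε - 1`. -/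
def antipode (V : GrMod.{u, v} R) (nabla : V.T →ₗ[R] V.T ⊗[R] V.T) : V.T →ₗ[R] V.T :=
  (DirectSum.toModule R ℤ V.T fun k =>
    (∑ n ∈ Finset.range (k.toNat + 1), antipodePow V nabla n) ∘ₗ (V.T.deg k).subtype) ∘ₗ
    (DirectSum.decomposeLinearEquiv V.T.deg).toLinearMap

theorem antipode_apply (hb : IsDGBialgebra (augTensor V d) (concat V) nabla)
    (hV : ∀ n ≤ 0, V.deg n = ⊥) {k : ℤ} {x : V.T} (hx : x ∈ V.T.deg k) (N : ℕ) (hN : k < N) :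
    antipode V nabla x = ∑ n ∈ Finset.range N, antipodePow V nabla n x := by
  by_cases hk : k < 0
  · rw [degT_neg hV k hk, Submodule.mem_bot] at hx
    subst hx; simp
  have h1 : antipode V nabla x = ∑ n ∈ Finset.range (k.toNat + 1), antipodePow V nabla n x := by
    lift x to V.T.deg k using hx
    simp only [antipode, LinearMap.comp_apply, LinearEquiv.coe_coe,
      DirectSum.decomposeLinearEquiv_apply, DirectSum.decompose_coe]
    rw [← DirectSum.lof_eq_of R, DirectSum.toModule_lof]
    simp
  rw [h1]
  refine Finset.sum_subset (fun n hn => ?_) fun n _ hn => ?_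
  · simp only [Finset.mem_range] at hn ⊢; lia
  · simp only [Finset.mem_range, not_lt] at hn
    exact antipodePow_eq_zero hb hV n k (by lia) x hx

theorem isAntipode_antipode (hb : IsDGBialgebra (augTensor V d) (concat V) nabla)
    (hV : ∀ n ≤ 0, V.deg n = ⊥) : IsAntipode (augTensor V d) (concat V) nabla (antipode V nabla) := by
  have hdeg : GrMod.IsDeg (antipode V nabla) 0 := by
    intro k x hx
    rw [antipode_apply hb hV hx (k.toNat + 1) (by lia)]
    exact sum_mem fun n _ => antipodePow_isDeg hb n k x hx
  have hone : ∀ f : V.T →ₗ[R] V.T,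
      conv nabla (concat V) f (cst (augT V) (1 : TensorAlgebra R V)) = f := hb.conv_one
  have hone' : ∀ f : V.T →ₗ[R] V.T,
      conv nabla (concat V) (cst (augT V) (1 : TensorAlgebra R V)) f = f := hb.one_conv
  have hc : IsCoalg nabla (augT V) := hb.isCoalg
  let u : V.T →ₗ[R] V.T := cst (augT V) (1 : TensorAlgebra R V) - LinearMap.id
  have hid : (LinearMap.id : V.T →ₗ[R] V.T) = cst (augT V) (1 : TensorAlgebra R V) - u := by
    simp [u]
  have hcomm : ∀ n, conv nabla (concat V) (antipodePow V nabla n) u = antipodePow V nabla (n + 1) := by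
    intro n
    induction n with
    | zero => rw [antipodePow, hone', antipodePow, antipodePow, hone]
    | succ n ih => rw [antipodePow, hc.conv_assoc (concat_assoc V), ih]; rfl
  have hl : conv nabla (concat V) (antipode V nabla) LinearMap.id =
      cst (augT V) (1 : TensorAlgebra R V) := by
    refine GrMod.hom_ext (V := V.T) fun k x hx => ?_
    have e1 : conv nabla (concat V) (antipode V nabla) LinearMap.id x = conv nabla (concat V)
        (∑ n ∈ Finset.range (k.toNat + 1), antipodePow V nabla n) LinearMap.id x := by
      refine GrMod.tensorDeg_eq (V := V.T) (W := V.T) (f := concat V ∘ₗ TensorProduct.map _ _)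
        (g := concat V ∘ₗ TensorProduct.map _ _) ?_ (hb.comul_mem k x hx)
      intro p q hpq a ha b hb'
      by_cases hq : q < 0
      · rw [degT_neg hV q hq, Submodule.mem_bot] at hb'
        rw [hb', TensorProduct.tmul_zero, map_zero, map_zero]
      · simp only [LinearMap.comp_apply, TensorProduct.map_tmul, LinearMap.sum_apply]
        rw [antipode_apply hb hV ha (k.toNat + 1) (by lia)]
    rw [e1, hid, conv_sub_right, hone]
    have e2 : conv nabla (concat V) (∑ n ∈ Finset.range (k.toNat + 1), antipodePow V nabla n) u =
        ∑ n ∈ Finset.range (k.toNat + 1), antipodePow V nabla (n + 1) := by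
      rw [Finset.sum_congr rfl fun n _ => (hcomm n).symm]
      exact map_sum (⟨⟨fun f => conv nabla (concat V) f u, conv_zero_left _ _ _⟩,
        fun f g => conv_add_left _ _ f g u⟩ : (V.T →ₗ[R] V.T) →+ (V.T →ₗ[R] V.T)) _ _
    rw [e2, ← Finset.sum_sub_distrib, Finset.sum_range_sub', LinearMap.sub_apply,
      antipodePow_eq_zero hb hV (k.toNat + 1) k (by push_cast; have := Int.self_le_toNat k; lia) x hx,
      sub_zero]
    rfl
  have hr : conv nabla (concat V) LinearMap.id (antipode V nabla) =
      cst (augT V) (1 : TensorAlgebra R V) := by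
    refine GrMod.hom_ext (V := V.T) fun k x hx => ?_
    have e1 : conv nabla (concat V) LinearMap.id (antipode V nabla) x = conv nabla (concat V)
        LinearMap.id (∑ n ∈ Finset.range (k.toNat + 1), antipodePow V nabla n) x := by
      refine GrMod.tensorDeg_eq (V := V.T) (W := V.T) (f := concat V ∘ₗ TensorProduct.map _ _)
        (g := concat V ∘ₗ TensorProduct.map _ _) ?_ (hb.comul_mem k x hx)
      intro p q hpq a ha b hb'
      by_cases hq : p < 0
      · rw [degT_neg hV p hq, Submodule.mem_bot] at ha
        rw [ha, TensorProduct.zero_tmul, map_zero, map_zero]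
      · simp only [LinearMap.comp_apply, TensorProduct.map_tmul, LinearMap.sum_apply]
        rw [antipode_apply hb hV hb' (k.toNat + 1) (by lia)]
    rw [e1, hid, conv_sub_left, hone']
    have e2 : conv nabla (concat V) u (∑ n ∈ Finset.range (k.toNat + 1), antipodePow V nabla n) =
        ∑ n ∈ Finset.range (k.toNat + 1), antipodePow V nabla (n + 1) :=
      map_sum (⟨⟨fun f => conv nabla (concat V) u f, conv_zero_right _ _ _⟩,
        fun f g => conv_add_right _ _ u f g⟩ : (V.T →ₗ[R] V.T) →+ (V.T →ₗ[R] V.T)) _ _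
    rw [e2, ← Finset.sum_sub_distrib, Finset.sum_range_sub', LinearMap.sub_apply,
      antipodePow_eq_zero hb hV (k.toNat + 1) k (by push_cast; have := Int.self_le_toNat k; lia) x hx,
      sub_zero]
    rfl
  refine ⟨fun n a ha => by simpa using hdeg n a ha, ?_, hl, hr⟩
  have hd : ∀ f g : V.T →ₗ[R] V.T, d ∘ₗ conv nabla (concat V) f g =
      conv nabla (concat V) (d ∘ₗ f) g + conv nabla (concat V) (V.T.sp 1 ∘ₗ f) (d ∘ₗ g) := by
    intro f g
    have := hb.d_mul
    dsimp only at this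
    rw [comp_conv, this, AugMod.tensorD, GrMod.sgn_eq]
    refine LinearMap.ext fun x => ?_
    simp only [conv_apply, LinearMap.comp_apply, LinearMap.add_apply, map_add]
    generalize nabla x = z
    congr 2
    · exact LinearMap.congr_fun (LinearMap.rTensor_comp_map _ _ _ _) z
    · exact (LinearMap.congr_fun (TensorProduct.map_comp _ _ _ _) z).symm
  let P := antipode V nabla ∘ₗ d - d ∘ₗ antipode V nabla
  have hP : conv nabla (concat V) P LinearMap.id = 0 := by
    have h1 := congrArg (fun f => d ∘ₗ f) hl
    have h2 := congrArg (fun f => f ∘ₗ d) hl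
    simp only [hd, LinearMap.comp_id] at h1
    have h3 := hb.conv_d (concat V) (antipode V nabla) LinearMap.id
    dsimp only at h2 h3
    rw [h3, ← hdeg.sp_comp_zero, LinearMap.id_comp] at h2
    have h4 : d ∘ₗ cst (augT V) (1 : TensorAlgebra R V) = 0 := by
      rw [comp_cst]
      have : d (1 : TensorAlgebra R V) = 0 := hb.d_one
      rw [this, cst_zero]
    have h5 : cst (augT V) (1 : TensorAlgebra R V) ∘ₗ d = 0 := by
      rw [cst_comp]
      have : augT V ∘ₗ d = 0 := hb.counit_d
      rw [this]; ext; simp [cst_apply]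
    rw [conv_sub_left, sub_eq_zero]
    rw [h4] at h1; rw [h5] at h2
    rw [eq_neg_of_add_eq_zero_left h1, eq_neg_of_add_eq_zero_left h2]
  have hP0 : P = 0 := by
    rw [← hone P, ← hr, ← hc.conv_assoc (concat_assoc V), hP, conv_zero_left]
  exact sub_eq_zero.1 hP0

end Antipode

/-! ## Deconcatenation -/

section Deconcat

variable {V : GrMod.{u, v} R}

theorem deconcat_aux (x : TensorAlgebra R V) : ∃ step : V →ₗ[R] (V.T × (V.T ⊗[R] V.T)) →ₗ[R]
    (V.T × (V.T ⊗[R] V.T)), (∀ a p, step a p = ((TensorAlgebra.ι R a * p.1 : TensorAlgebra R V),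
          (1 : TensorAlgebra R V) ⊗ₜ[R] (TensorAlgebra.ι R a * p.1 : TensorAlgebra R V) +
            LinearMap.rTensor (TensorAlgebra R V)
              (LinearMap.mul R (TensorAlgebra R V) (TensorAlgebra.ι R a)) p.2)) ∧
    ∀ x, foldLeft V step ((1 : TensorAlgebra R V),
      (1 : TensorAlgebra R V) ⊗ₜ[R] (1 : TensorAlgebra R V)) x = (x, deconcat V x) := by
  refine ⟨_, ?_, fun x => Prod.ext ?_ (rfl : _ = deconcat V x)⟩
  · intro a p; rfl
  induction x using word_induction' with
  | one => rw [foldLeft_one]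
  | cons m n v x hv hx ih =>
    refine (congrArg Prod.fst (foldLeft_cons V _ _ v x)).trans ?_
    exact congrArg (fun z : TensorAlgebra R V => (TensorAlgebra.ι R v * z : TensorAlgebra R V)) ih
  | zero => rw [map_zero]; rfl
  | add x y hx hy => rw [map_add, Prod.fst_add, hx, hy]
  | smul r x hx => rw [map_smul, Prod.smul_fst, hx]

theorem deconcat_one : deconcat V (1 : TensorAlgebra R V) =
    (1 : TensorAlgebra R V) ⊗ₜ[R] (1 : TensorAlgebra R V) := by
  rw [deconcat, LinearMap.comp_apply, foldLeft_one]; rfl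

/-- Left multiplication of the first tensor factor. -/
def mulFst (x : TensorAlgebra R V) : V.T ⊗[R] V.T →ₗ[R] V.T ⊗[R] V.T :=
  LinearMap.rTensor (TensorAlgebra R V) (LinearMap.mul R (TensorAlgebra R V) x)

/-- Right multiplication of the second tensor factor. -/
def mulSnd (x : TensorAlgebra R V) : V.T ⊗[R] V.T →ₗ[R] V.T ⊗[R] V.T :=
  LinearMap.lTensor (TensorAlgebra R V) ((LinearMap.mul R (TensorAlgebra R V)).flip x)

@[simp] theorem mulFst_tmul (x a b : TensorAlgebra R V) :
    mulFst x (a ⊗ₜ[R] b) = (x * a : TensorAlgebra R V) ⊗ₜ[R] b := rfl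

@[simp] theorem mulSnd_tmul (x a b : TensorAlgebra R V) :
    mulSnd x (a ⊗ₜ[R] b) = a ⊗ₜ[R] (b * x : TensorAlgebra R V) := rfl

theorem deconcat_cons (v : V) (x : TensorAlgebra R V) :
    deconcat V (letter V v * x : TensorAlgebra R V) =
      (1 : TensorAlgebra R V) ⊗ₜ[R] (letter V v * x : TensorAlgebra R V) +
        mulFst (letter V v) (deconcat V x) := by
  obtain ⟨step, h1, h2⟩ := deconcat_aux (V := V) x
  have h := h2 (letter V v * x : TensorAlgebra R V)
  have h3 := foldLeft_cons V step ((1 : TensorAlgebra R V),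
      (1 : TensorAlgebra R V) ⊗ₜ[R] (1 : TensorAlgebra R V)) v x
  rw [h2 x, h1] at h3
  exact congrArg Prod.snd (h.symm.trans h3)

theorem deconcat_letter (v : V) : deconcat V (letter V v) =
    (1 : TensorAlgebra R V) ⊗ₜ[R] letter V v + letter V v ⊗ₜ[R] (1 : TensorAlgebra R V) := by
  have := deconcat_cons v (1 : TensorAlgebra R V)
  rwa [mul_one, deconcat_one, mulFst_tmul, mul_one] at this

theorem uncons_one : uncons V (1 : TensorAlgebra R V) = 0 := by
  rw [uncons, LinearMap.comp_apply, deconcat_one, LinearMap.rTensor_tmul, unletter_one,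
    TensorProduct.zero_tmul]

theorem unletter_mulFst (v : V) (z : V.T ⊗[R] V.T) :
    LinearMap.rTensor V.T (unletter V) (mulFst (letter V v) z) =
      v ⊗ₜ[R] TensorProduct.lid R V.T (LinearMap.rTensor V.T (augT V) z) := by
  induction z using TensorProduct.induction_on with
  | zero => simp
  | add a b ha hb => simp only [map_add, ha, hb, TensorProduct.tmul_add]
  | tmul a b =>
    rw [mulFst_tmul, LinearMap.rTensor_tmul, LinearMap.rTensor_tmul, unletter_cons,
      TensorProduct.lid_tmul, TensorProduct.smul_tmul]

theorem counit_deconcat (x : TensorAlgebra R V) :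
    TensorProduct.lid R V.T (LinearMap.rTensor V.T (augT V) (deconcat V x)) = x := by
  induction x using word_induction' with
  | one => rw [deconcat_one, LinearMap.rTensor_tmul, augT_one, TensorProduct.lid_tmul, one_smul]
  | cons m n v x hv hx ih =>
    have : ∀ z : V.T ⊗[R] V.T, LinearMap.rTensor V.T (augT V) (mulFst (letter V v) z) = 0 := by
      intro z
      induction z using TensorProduct.induction_on with
      | zero => simp
      | add a b ha hb => simp only [map_add, ha, hb, add_zero]
      | tmul a b =>
        rw [mulFst_tmul, LinearMap.rTensor_tmul, augT_mul, augT_letter, zero_mul,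
          TensorProduct.zero_tmul]
    rw [deconcat_cons, map_add, this, add_zero, LinearMap.rTensor_tmul, augT_one,
      TensorProduct.lid_tmul, one_smul]
  | zero => simp
  | add x y hx hy => simp only [map_add, hx, hy]
  | smul r x hx => simp only [map_smul, hx]

theorem uncons_cons (v : V) (x : TensorAlgebra R V) :
    uncons V (letter V v * x : TensorAlgebra R V) = v ⊗ₜ[R] x := by
  rw [uncons, LinearMap.comp_apply, deconcat_cons, map_add, LinearMap.rTensor_tmul, unletter_one,
    TensorProduct.zero_tmul, zero_add, unletter_mulFst, counit_deconcat]

end Deconcat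

/-! ## Sums over compositions -/

theorem sum_composition_succ {M : Type*} [AddCommMonoid M] (m : ℕ) (f : List ℕ → M) :
    ∑ c : Composition (m + 1), f c.blocks =
      ∑ k ∈ Finset.range (m + 1), ∑ c : Composition (m - k), f ((k + 1) :: c.blocks) := by
  let φ : (Σ k : Fin (m + 1), Composition (m - k)) → Composition (m + 1) := fun p =>
    ⟨((p.1 : ℕ) + 1) :: p.2.blocks, by
      intro i hi
      rcases List.mem_cons.1 hi with rfl | hi
      exacts [Nat.succ_pos _, p.2.blocks_pos hi], by
      have := p.1.2
      rw [List.sum_cons, p.2.blocks_sum]; lia⟩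
  have hφ : Function.Bijective φ := by
    constructor
    · rintro ⟨k, c⟩ ⟨k', c'⟩ h
      have h1 := congrArg Composition.blocks h
      simp only [φ, List.cons.injEq, add_left_inj] at h1
      obtain ⟨h1, h2⟩ := h1
      obtain rfl := Fin.ext h1
      rw [Composition.ext h2]
    · intro c
      rcases hc : c.blocks with _ | ⟨k, l⟩
      · have := c.blocks_sum; rw [hc] at this; simp at this
      · have h1 := c.blocks_sum
        rw [hc, List.sum_cons] at h1
        have h2 : 0 < k := c.blocks_pos (by rw [hc]; exact List.mem_cons_self)
        refine ⟨⟨⟨k - 1, by lia⟩, ⟨l, fun hi => c.blocks_pos (by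
          rw [hc]; exact List.mem_cons_of_mem _ hi), by
            change l.sum = m - (k - 1); lia⟩⟩, Composition.ext ?_⟩
        simp only [φ, hc, List.cons.injEq, and_true]
        lia
  rw [← hφ.sum_comp (fun c => f c.blocks), Fintype.sum_sigma, Finset.sum_range]

/-! ## The components of the antipode -/

section Components

variable {V : GrMod.{u, v} R} {d : V.T →ₗ[R] V.T} {nabla : V.T →ₗ[R] V.T ⊗[R] V.T}
  {S : V.T →ₗ[R] V.T}

theorem concat_lTensor_coOpExt (k : ℕ) (f : V →ₗ[R] V.T) :
    concat V ∘ₗ LinearMap.lTensor V.T f ∘ₗ coOpExt nabla k =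
      concat V ∘ₗ LinearMap.lTensor V.T (concat V ∘ₗ LinearMap.lTensor V.T f ∘ₗ coOpOne nabla k) := by
  refine TensorProduct.ext' fun x v => ?_
  simp only [coOpExt, LinearMap.comp_apply, LinearMap.lTensor_tmul, LinearEquiv.coe_coe]
  generalize coOpOne nabla k v = z
  induction z using TensorProduct.induction_on with
  | zero => simp
  | add a b ha hb => simp only [map_add, TensorProduct.tmul_add, ha, hb]
  | tmul a b =>
    rw [TensorProduct.assoc_symm_tmul, LinearMap.rTensor_tmul, LinearMap.lTensor_tmul,
      LinearMap.lTensor_tmul, concat_assoc]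

theorem coOpExt_one (k : ℕ) :
    coOpExt nabla k ∘ₗ TensorProduct.mk R V.T V (1 : TensorAlgebra R V) = coOpOne nabla k := by
  refine LinearMap.ext fun v => ?_
  simp only [coOpExt, LinearMap.comp_apply, LinearEquiv.coe_coe, TensorProduct.mk_apply,
    LinearMap.lTensor_tmul]
  generalize coOpOne nabla k v = z
  induction z using TensorProduct.induction_on with
  | zero => simp
  | add a b ha hb => simp only [map_add, TensorProduct.tmul_add, ha, hb]
  | tmul a b =>
    rw [TensorProduct.assoc_symm_tmul, LinearMap.rTensor_tmul, concat_tmul, one_mul]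

theorem concat_lTensor_foldl (l : List ℕ) (g : V →ₗ[R] V.T ⊗[R] V) :
    concat V ∘ₗ LinearMap.lTensor V.T (letter V) ∘ₗ
        l.foldl (fun g k => coOpExt nabla k ∘ₗ g) g =
      concat V ∘ₗ LinearMap.lTensor V.T (concat V ∘ₗ LinearMap.lTensor V.T (letter V) ∘ₗ
        l.foldl (fun g k => coOpExt nabla k ∘ₗ g)
          (TensorProduct.mk R V.T V (1 : TensorAlgebra R V))) ∘ₗ g := by
  induction l generalizing g with
  | nil =>
    have : concat V ∘ₗ LinearMap.lTensor V.T (letter V) ∘ₗ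
        TensorProduct.mk R V.T V (1 : TensorAlgebra R V) = letter V := LinearMap.ext fun v => by
      rw [LinearMap.comp_apply, LinearMap.comp_apply, TensorProduct.mk_apply, LinearMap.lTensor_tmul,
        concat_tmul, one_mul]
    rw [List.foldl_nil, List.foldl_nil, this]
  | cons k l ih =>
    rw [List.foldl_cons, List.foldl_cons, ih, ih (coOpExt nabla k ∘ₗ _)]
    generalize concat V ∘ₗ LinearMap.lTensor V.T (letter V) ∘ₗ
      l.foldl (fun g k => coOpExt nabla k ∘ₗ g)
        (TensorProduct.mk R V.T V (1 : TensorAlgebra R V)) = f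
    have h := concat_lTensor_coOpExt (nabla := nabla) k f
    rw [coOpExt_one]
    refine LinearMap.ext fun v => ?_
    exact LinearMap.congr_fun h (g v)

theorem antipodeComp_one : antipodeComp nabla 1 = -letter V := by
  refine LinearMap.ext fun v => ?_
  have : ∀ c : Composition 0, c.blocks = [] ∧ c.length = 0 := fun c => by
    have := c.length_le
    have h : c.length = 0 := by lia
    exact ⟨List.length_eq_zero_iff.1 h, h⟩
  rw [antipodeComp, LinearMap.sum_apply]
  rw [Finset.sum_congr rfl fun c _ => by rw [(this c).1, (this c).2]]
  rw [Finset.sum_const, Finset.card_univ, composition_card]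
  simp only [List.foldl_nil, LinearMap.smul_apply, LinearMap.comp_apply, TensorProduct.mk_apply,
    LinearMap.lTensor_tmul]
  rw [concat_tmul, one_mul]
  simp

theorem antipodeComp_succ_succ (n : ℕ) : antipodeComp nabla (n + 2) =
    -∑ k ∈ Finset.range (n + 1), concat V ∘ₗ
      LinearMap.lTensor V.T (antipodeComp nabla (n + 1 - k)) ∘ₗ coOpOne nabla (k + 1) := by
  have h := sum_composition_succ n fun l => (-1 : ℤ) ^ (l.length + 1) •
    (concat V ∘ₗ LinearMap.lTensor V.T (letter V) ∘ₗ
      l.foldl (fun g k => coOpExt nabla k ∘ₗ g)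
        (TensorProduct.mk R V.T V (1 : TensorAlgebra R V)))
  rw [antipodeComp]
  refine h.trans ?_
  rw [← Finset.sum_neg_distrib]
  refine Finset.sum_congr rfl fun k hk => ?_
  rw [antipodeComp]
  have hk' := Finset.mem_range.1 hk
  rw [show n + 1 - k - 1 = n - k by lia]
  refine LinearMap.ext fun v => ?_
  simp only [LinearMap.sum_apply, LinearMap.neg_apply, LinearMap.comp_apply]
  let Φ : (V →ₗ[R] V.T) →ₗ[R] V.T := concat V ∘ₗ LinearMap.applyₗ (coOpOne nabla (k + 1) v) ∘ₗ
    LinearMap.lTensorHom V.T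
  change _ = -Φ (∑ c : Composition (n - k), (-1 : ℤ) ^ (c.length + 1) •
    (concat V ∘ₗ LinearMap.lTensor V.T (letter V) ∘ₗ
      c.blocks.foldl (fun g k => coOpExt nabla k ∘ₗ g)
        (TensorProduct.mk R V.T V (1 : TensorAlgebra R V))))
  rw [map_sum, ← Finset.sum_neg_distrib]
  refine Finset.sum_congr rfl fun c _ => ?_
  rw [List.foldl_cons, coOpExt_one, concat_lTensor_foldl, List.length_cons, map_zsmul,
    pow_succ, mul_neg_one, neg_smul]
  rfl

/-- The components of the comultiplication of a letter. -/
theorem nabla_letter (hb : IsDGBialgebra (augTensor V d) (concat V) nabla)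
    (hop : ∀ i j : ℕ, 2 ≤ j → coOp nabla i j = 0) (v : V) :
    nabla (letter V v) = letter V v ⊗ₜ (1 : TensorAlgebra R V) +
      LinearMap.lTensor V.T (letter V) (LinearMap.lTensor V.T (unletter V) (nabla (letter V v))) := by
  have key : ∀ z : V.T ⊗[R] V.T, ∃ N : ℕ, ∀ M ≥ N,
      ∑ j ∈ Finset.range M, LinearMap.lTensor V.T (lengthProj V j) z = z := by
    intro z
    induction z using TensorProduct.induction_on with
    | zero => exact ⟨0, fun M _ => by simp⟩
    | add a b ha hb =>
      obtain ⟨N, hN⟩ := ha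
      obtain ⟨N', hN'⟩ := hb
      refine ⟨max N N', fun M hM => ?_⟩
      simp only [map_add, Finset.sum_add_distrib]
      rw [hN M (le_trans (le_max_left _ _) hM), hN' M (le_trans (le_max_right _ _) hM)]
    | tmul a b =>
      obtain ⟨N, hN⟩ := exists_sum_lengthProj b
      refine ⟨N, fun M hM => ?_⟩
      simp only [LinearMap.lTensor_tmul, ← TensorProduct.tmul_sum]
      rw [hN M hM]
  have key1 : ∀ z : V.T ⊗[R] V.T,
      (∀ i, LinearMap.rTensor V.T (lengthProj V i) z = 0) → z = 0 := by
    intro z hz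
    have : ∃ N : ℕ, ∀ M ≥ N, ∑ j ∈ Finset.range M, LinearMap.rTensor V.T (lengthProj V j) z = z := by
      clear hz
      induction z using TensorProduct.induction_on with
      | zero => exact ⟨0, fun M _ => by simp⟩
      | add a b ha hb =>
        obtain ⟨N, hN⟩ := ha
        obtain ⟨N', hN'⟩ := hb
        refine ⟨max N N', fun M hM => ?_⟩
        simp only [map_add, Finset.sum_add_distrib]
        rw [hN M (le_trans (le_max_left _ _) hM), hN' M (le_trans (le_max_right _ _) hM)]
      | tmul a b =>
        obtain ⟨N, hN⟩ := exists_sum_lengthProj a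
        refine ⟨N, fun M hM => ?_⟩
        simp only [LinearMap.rTensor_tmul, ← TensorProduct.sum_tmul]
        rw [hN M hM]
    obtain ⟨N, hN⟩ := this
    rw [← hN N le_rfl]
    exact Finset.sum_eq_zero fun i _ => hz i
  have key2 : ∀ z : V.T ⊗[R] V.T,
      (∀ i j, 2 ≤ j → TensorProduct.map (lengthProj V i) (lengthProj V j) z = 0) →
      z = LinearMap.lTensor V.T (lengthProj V 0) z + LinearMap.lTensor V.T (lengthProj V 1) z := by
    intro z hz
    obtain ⟨N, hN⟩ := key z
    have h := hN (N + 2) (by lia)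
    rw [add_comm N 2, Finset.sum_range_add] at h
    conv_lhs => rw [← h]
    rw [Finset.sum_range_succ, Finset.sum_range_one, add_eq_left]
    refine Finset.sum_eq_zero fun j _ => key1 _ fun i => ?_
    rw [← hz i (2 + j) (by lia), ← LinearMap.comp_apply, LinearMap.rTensor_comp_lTensor]
  have h := key2 (nabla (letter V v)) fun i j hj => LinearMap.congr_fun (hop i j hj) v
  conv_lhs => rw [h]
  congr 1
  · have h1 := LinearMap.congr_fun hb.comul_counit (letter V v)
    have h2 : lengthProj V 0 = unitT V ∘ₗ augT V := LinearMap.ext fun x =>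
      (lengthProj_zero x).trans (unitT_apply _).symm
    rw [h2, LinearMap.lTensor_comp, LinearMap.comp_apply]
    have h3 : LinearMap.lTensor V.T (unitT V) = (TensorProduct.mk R V.T V.T).flip
        (1 : TensorAlgebra R V) ∘ₗ (TensorProduct.rid R V.T).toLinearMap :=
      TensorProduct.ext' fun x r => by
        rw [LinearMap.lTensor_tmul, unitT_apply, TensorProduct.tmul_smul, LinearMap.comp_apply,
          LinearEquiv.coe_coe, TensorProduct.rid_tmul, map_smul]
        rfl
    rw [h3]
    exact congrArg (fun x => x ⊗ₜ[R] (1 : TensorAlgebra R V)) h1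
  · have h2 : lengthProj V 1 = letter V ∘ₗ unletter V := LinearMap.ext fun x => lengthProj_one_eq x
    rw [h2, LinearMap.lTensor_comp, LinearMap.comp_apply]

/-- The second part of the comultiplication of a letter, in `T(V) ⊗ V`. -/
theorem coOpOne_zero (hb : IsDGBialgebra (augTensor V d) (concat V) nabla) (v : V) :
    coOpOne nabla 0 v = (1 : TensorAlgebra R V) ⊗ₜ v := by
  have h1 := LinearMap.congr_fun hb.counit_comul (letter V v)
  have h2 : TensorProduct.map (lengthProj V 0) (unletter V) =
      (TensorProduct.mk R V.T V (1 : TensorAlgebra R V)) ∘ₗ unletter V ∘ₗ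
        (TensorProduct.lid R V.T).toLinearMap ∘ₗ LinearMap.rTensor V.T (augT V) :=
    TensorProduct.ext' fun x y => by
      rw [TensorProduct.map_tmul, lengthProj_zero]
      simp [TensorProduct.smul_tmul]
  rw [coOpOne, h2]
  have h3 := congrArg (fun y => (1 : TensorAlgebra R V) ⊗ₜ[R] unletter V y) h1
  refine Eq.trans ?_ (h3.trans ?_)
  · rfl
  · exact congrArg (fun y => (1 : TensorAlgebra R V) ⊗ₜ[R] y) (unletter_letter v)

theorem lengthProj_lengthProj (m n : ℕ) (x : TensorAlgebra R V) :
    lengthProj V m (lengthProj V n x) = if n = m then lengthProj V n x else 0 := by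
  induction x using length_induction with
  | add x y hx hy => simp only [map_add, hx, hy]; split_ifs <;> simp
  | hom k x hx =>
    rw [lengthProj_of_mem hx]
    split_ifs with h1 h2 h2
    · rw [lengthProj_of_mem hx, if_pos (h1.trans h2)]
    · rw [lengthProj_of_mem hx, if_neg (fun h => h2 (h1.symm.trans h))]
    · exact map_zero _
    · exact map_zero _

theorem lengthProj_concat (n : ℕ) : lengthProj V n ∘ₗ concat V =
    ∑ p ∈ Finset.HasAntidiagonal.antidiagonal n,
      concat V ∘ₗ TensorProduct.map (lengthProj V p.1) (lengthProj V p.2) :=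
  TensorProduct.ext' fun x y => by
    rw [LinearMap.comp_apply, concat_tmul, lengthProj_mul, LinearMap.sum_apply]
    rfl

/-- The components of the antipode on letters. -/
theorem lengthProj_antipode_letter (hb : IsDGBialgebra (augTensor V d) (concat V) nabla)
    (hop : ∀ i j : ℕ, 2 ≤ j → coOp nabla i j = 0)
    (hS : IsAntipode (augTensor V d) (concat V) nabla S) (n : ℕ) :
    lengthProj V (n + 1) ∘ₗ S ∘ₗ letter V = antipodeComp nabla (n + 1) := by
  have hS1 : S (1 : TensorAlgebra R V) = (1 : TensorAlgebra R V) := hS.one hb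
  have h0 : ∀ x, lengthProj V 0 (S x) = lengthProj V 0 x := fun x => by
    rw [lengthProj_zero, lengthProj_zero]
    exact congrArg (· • (1 : TensorAlgebra R V)) (LinearMap.congr_fun (hS.counit hb) x)
  have h1 : ∀ v : V, S (letter V v) = - letter V v - concat V (LinearMap.lTensor V.T (S ∘ₗ letter V)
      (LinearMap.lTensor V.T (unletter V) (nabla (letter V v)) -
        (1 : TensorAlgebra R V) ⊗ₜ v)) := by
    intro v
    have h := LinearMap.congr_fun hS.right_inv (letter V v)
    have e : concat V (LinearMap.lTensor V.T S (nabla (letter V v))) = 0 := by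
      refine h.trans ?_
      change augT V (letter V v) • (1 : TensorAlgebra R V) = 0
      rw [augT_letter, zero_smul]
    rw [nabla_letter hb hop, map_add, LinearMap.lTensor_tmul, hS1, map_add, concat_tmul, mul_one,
      ← LinearMap.comp_apply (LinearMap.lTensor V.T S), ← LinearMap.lTensor_comp] at e
    rw [map_sub, map_sub, LinearMap.lTensor_tmul, concat_tmul, one_mul, LinearMap.comp_apply,
      eq_neg_of_add_eq_zero_right e]
    abel
  induction n using Nat.strong_induction_on with
  | _ n ih =>
  refine LinearMap.ext fun v => ?_
  simp only [LinearMap.comp_apply]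
  let f : ℕ → V →ₗ[R] V.T := fun m => lengthProj V m ∘ₗ S ∘ₗ letter V
  have hf0 : f 0 = 0 := LinearMap.ext fun v => (h0 (letter V v)).trans (by
    rw [lengthProj_letter, if_neg zero_ne_one]; rfl)
  have hz : ∀ i, LinearMap.rTensor V (lengthProj V i) (LinearMap.lTensor V.T (unletter V)
      (nabla (letter V v)) - (1 : TensorAlgebra R V) ⊗ₜ v) = if i = 0 then 0 else coOpOne nabla i v := by
    intro i
    have e : LinearMap.rTensor V (lengthProj V i) (LinearMap.lTensor V.T (unletter V)
      (nabla (letter V v))) = coOpOne nabla i v := by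
      rw [← LinearMap.comp_apply, LinearMap.rTensor_comp_lTensor]; rfl
    rw [map_sub, e, LinearMap.rTensor_tmul, lengthProj_one]
    split_ifs with h
    · subst h; rw [coOpOne_zero hb, sub_self]
    · rw [TensorProduct.zero_tmul, sub_zero]
  have h2 : lengthProj V (n + 1) (S (letter V v)) = -lengthProj V (n + 1) (letter V v) -
      ∑ k ∈ Finset.range (n + 1), concat V (LinearMap.lTensor V.T (f (n - k))
        (coOpOne nabla (k + 1) v)) := by
    have e0 : ∀ z, lengthProj V (n + 1) (concat V z) = _ :=
      fun z => LinearMap.congr_fun (lengthProj_concat (n + 1)) z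
    rw [h1, map_sub, map_neg, e0, LinearMap.sum_apply, Finset.Nat.sum_antidiagonal_eq_sum_range_succ_mk,
      Nat.succ_eq_add_one, Finset.sum_range_succ']
    refine congrArg (fun y => -lengthProj V (n + 1) (letter V v) - y) ?_
    have e : ∀ i j, (concat V ∘ₗ TensorProduct.map (lengthProj V i) (lengthProj V j))
        (LinearMap.lTensor V.T (S ∘ₗ letter V) (LinearMap.lTensor V.T (unletter V)
          (nabla (letter V v)) - (1 : TensorAlgebra R V) ⊗ₜ v)) =
        concat V (LinearMap.lTensor V.T (f j) (if i = 0 then 0 else coOpOne nabla i v)) := by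
      intro i j
      rw [← hz]
      generalize LinearMap.lTensor V.T (unletter V) (nabla (letter V v)) - _ = z
      induction z using TensorProduct.induction_on with
      | zero => simp
      | add a b ha hb => simp only [map_add, ha, hb]
      | tmul a b => rfl
    rw [e, if_pos rfl, map_zero, map_zero, add_zero]
    refine Finset.sum_congr rfl fun k _ => ?_
    rw [e, if_neg (Nat.succ_ne_zero k), Nat.add_sub_add_right]
  rcases n with _ | n
  · rw [h2, antipodeComp_one, lengthProj_letter, if_pos rfl]
    simp [hf0]
  · rw [h2, antipodeComp_succ_succ, lengthProj_letter, if_neg (by lia), Finset.sum_range_succ,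
      Nat.sub_self, hf0, LinearMap.lTensor_zero, LinearMap.zero_apply, map_zero, add_zero, neg_zero,
      zero_sub, LinearMap.neg_apply, LinearMap.sum_apply]
    refine congrArg Neg.neg ?_
    refine Finset.sum_congr rfl fun k hk => ?_
    have hk' := Finset.mem_range.1 hk
    have := ih (n - k) (by lia)
    rw [show n - k + 1 = n + 1 - k by lia] at this
    simp only [f, this]
    rfl

theorem opProd_cons_one (k : ℕ) (l : List ℕ) :
    opProd nabla (k :: l) (1 : TensorAlgebra R V) = 0 := by
  simp only [opProd, LinearMap.comp_apply]
  rw [uncons_one, map_zero, map_zero, map_zero]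

theorem opProd_cons_cons (k : ℕ) (l : List ℕ) (v : V) (x : TensorAlgebra R V) :
    opProd nabla (k :: l) (letter V v * x : TensorAlgebra R V) =
      concat V (koszul V.T V.T (antipodeComp nabla k v ⊗ₜ opProd nabla l x)) := by
  simp only [opProd, LinearMap.comp_apply]
  rw [uncons_cons, TensorProduct.map_tmul]

theorem opProd_lengthProj (l : List ℕ) (x : TensorAlgebra R V) :
    opProd nabla l (lengthProj V l.length x) = opProd nabla l x := by
  induction l generalizing x with
  | nil =>
    rw [List.length_nil, lengthProj_zero, map_smul, opProd, LinearMap.comp_apply, augT_one,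
      LinearMap.comp_apply, ← map_smul, smul_eq_mul, mul_one]
  | cons k l ih =>
    rw [List.length_cons]
    induction x using word_induction' with
    | one => rw [lengthProj_one, if_neg (by lia), map_zero, opProd_cons_one]
    | cons m n v x hv hx _ => rw [lengthProj_cons, opProd_cons_cons, opProd_cons_cons, ih]
    | zero => simp
    | add x y hx hy => simp only [map_add, hx, hy]
    | smul r x hx => simp only [map_smul, hx]

theorem lengthProj_concat_koszul (n : ℕ) (x y : V.T) :
    lengthProj V n (concat V (koszul V.T V.T (x ⊗ₜ y))) = ∑ k ∈ Finset.range (n + 1),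
      concat V (koszul V.T V.T (lengthProj V k x ⊗ₜ lengthProj V (n - k) y)) := by
  have h : ∀ z : V.T ⊗[R] V.T, lengthProj V n (concat V (koszul V.T V.T z)) =
      ∑ k ∈ Finset.range (n + 1),
        concat V (koszul V.T V.T (TensorProduct.map (lengthProj V k) (lengthProj V (n - k)) z)) := by
    intro z
    induction z using GrMod.tensor_induction with
    | zero => simp
    | add a b ha hb => simp only [map_add, ha, hb, Finset.sum_add_distrib]
    | hom p q a ha b hb =>
      have hp : ∀ k, lengthProj V k a ∈ V.T.deg p := fun k => by
        simpa using isDeg_lengthProj k p a ha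
      have hq : ∀ k, lengthProj V k b ∈ V.T.deg q := fun k => by
        simpa using isDeg_lengthProj k q b hb
      rw [GrMod.koszul_tmul' ha hb, map_smul, map_smul, concat_tmul, lengthProj_mul,
        ← Finset.Nat.sum_antidiagonal_swap, Finset.Nat.sum_antidiagonal_eq_sum_range_succ_mk,
        Finset.smul_sum]
      refine Finset.sum_congr rfl fun k _ => ?_
      rw [TensorProduct.map_tmul, GrMod.koszul_tmul' (hp k) (hq (n - k)), map_smul, concat_tmul]
      rfl
  exact h _

/-- The components of the antipode on words. -/
theorem lengthProj_antipode (hb : IsDGBialgebra (augTensor V d) (concat V) nabla)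
    (hop : ∀ i j : ℕ, 2 ≤ j → coOp nabla i j = 0)
    (hS : IsAntipode (augTensor V d) (concat V) nabla S) (n : ℕ) (x : TensorAlgebra R V) :
    lengthProj V n (S x) = ∑ c : Composition n, opProd nabla c.blocks x := by
  have hS1 : S (1 : TensorAlgebra R V) = (1 : TensorAlgebra R V) := hS.one hb
  have h0 : ∀ x, lengthProj V 0 (S x) = lengthProj V 0 x := fun x => by
    rw [lengthProj_zero, lengthProj_zero]
    exact congrArg (· • (1 : TensorAlgebra R V)) (LinearMap.congr_fun (hS.counit hb) x)
  rcases n with _ | n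
  · have : ∀ c : Composition 0, c.blocks = [] := fun c => by
      have := c.length_le
      exact List.length_eq_zero_iff.1 (show c.length = 0 by lia)
    rw [h0, Finset.sum_congr rfl fun c _ => by rw [this c], Finset.sum_const, Finset.card_univ,
      composition_card, lengthProj_zero, opProd, LinearMap.comp_apply, unitT_apply]
    simp
  rw [sum_composition_succ n fun l => opProd nabla l x]
  induction x using word_induction' generalizing n with
  | one =>
    rw [hS1, lengthProj_one, if_neg (by lia)]
    exact (Finset.sum_eq_zero fun k _ => Finset.sum_eq_zero fun c _ => opProd_cons_one _ _).symm
  | cons p q v x hv hx ih =>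
    have hmul : S (letter V v * x : TensorAlgebra R V) =
        concat V (koszul V.T V.T (S (letter V v) ⊗ₜ S x)) :=
      LinearMap.congr_fun (hS.antimul hb) (letter V v ⊗ₜ x)
    have ih' : ∀ n, lengthProj V n (S x) = ∑ c : Composition n, opProd nabla c.blocks x := by
      intro m
      rcases m with _ | m
      · have : ∀ c : Composition 0, c.blocks = [] := fun c => by
          have := c.length_le
          exact List.length_eq_zero_iff.1 (show c.length = 0 by lia)
        rw [h0, Finset.sum_congr rfl fun c _ => by rw [this c], Finset.sum_const, Finset.card_univ,
          composition_card, lengthProj_zero, opProd, LinearMap.comp_apply, unitT_apply]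
        simp
      · rw [ih, sum_composition_succ m fun l => opProd nabla l x]
    rw [hmul, lengthProj_concat_koszul, Finset.sum_range_succ', h0, lengthProj_letter,
      if_neg zero_ne_one, TensorProduct.zero_tmul, map_zero, map_zero, add_zero]
    refine Finset.sum_congr rfl fun k hk => ?_
    have h3 := LinearMap.congr_fun (lengthProj_antipode_letter hb hop hS k) v
    simp only [LinearMap.comp_apply] at h3
    rw [h3, ih', TensorProduct.tmul_sum, map_sum, map_sum, Nat.add_sub_add_right]
    exact Finset.sum_congr rfl fun c _ => (opProd_cons_cons _ _ _ _).symm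
  | zero => simp
  | add x y hx hy => simp only [map_add, hx, hy, Finset.sum_add_distrib]
  | smul r x hx => simp only [map_smul, hx, Finset.smul_sum]

/-- The obstructions are the components of `S² - 1`. -/
theorem lengthProj_antipode_sq (hb : IsDGBialgebra (augTensor V d) (concat V) nabla)
    (hop : ∀ i j : ℕ, 2 ≤ j → coOp nabla i j = 0)
    (hS : IsAntipode (augTensor V d) (concat V) nabla S) (n : ℕ) (hn : 1 ≤ n) (v : V) :
    lengthProj V n (S (S (letter V v))) = obstruction nabla n v := by
  rw [lengthProj_antipode hb hop hS, obstruction, LinearMap.sum_apply]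
  refine Finset.sum_congr rfl fun c _ => ?_
  rw [← opProd_lengthProj, LinearMap.comp_apply]
  have h : c.blocks.length = c.length - 1 + 1 := by
    have := c.length_pos_of_pos hn
    change c.length = _; lia
  have h3 := LinearMap.congr_fun (lengthProj_antipode_letter hb hop hS (c.length - 1)) v
  rw [← h] at h3
  exact congrArg (opProd nabla c.blocks) h3

theorem concat_koszul_one (x : V.T) :
    concat V (koszul V.T V.T (x ⊗ₜ (1 : TensorAlgebra R V))) = x := by
  have h : koszul V.T V.T (x ⊗ₜ (1 : TensorAlgebra R V)) = (1 : TensorAlgebra R V) ⊗ₜ x := by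
    refine (GrMod.koszul_right (n := 0) x one_memT).trans ?_
    rw [GrMod.sp_zero, LinearMap.id_apply]
  exact (congrArg (concat V) h).trans (one_mul (M := TensorAlgebra R V) x)

theorem opProd_one_letter (v : V) : opProd nabla [1] (letter V v) = antipodeComp nabla 1 v := by
  have h : opProd nabla [] (1 : TensorAlgebra R V) = (1 : TensorAlgebra R V) := by
    rw [opProd, LinearMap.comp_apply, augT_one, unitT_apply, one_smul]
  have e : letter V v = (letter V v * 1 : TensorAlgebra R V) := (mul_one _).symm
  rw [e, opProd_cons_cons, h, concat_koszul_one]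

theorem obstruction_one : obstruction nabla 1 = letter V := by
  refine LinearMap.ext fun v => ?_
  have hsub : Subsingleton (Composition 1) := Fintype.card_le_one_iff_subsingleton.1 (by
    rw [composition_card, Nat.sub_self, pow_zero])
  have h1 : ∀ c : Composition 1, c.blocks = [1] := fun c => by
    rw [Subsingleton.elim c (Composition.ones 1)]; rfl
  have h : antipodeComp nabla 1 v = -letter V v := by rw [antipodeComp_one, LinearMap.neg_apply]
  have h2 : opProd nabla [1] (antipodeComp nabla 1 v) = letter V v := by
    rw [h, map_neg, opProd_one_letter, h]
    exact neg_neg (letter V v)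
  have h3 : ∀ c : Composition 1, (opProd nabla c.blocks ∘ₗ antipodeComp nabla c.length) v =
      letter V v := fun c => by
    rw [← h2, LinearMap.comp_apply, Composition.length, h1 c, List.length_singleton]
  rw [obstruction, LinearMap.sum_apply, Finset.sum_congr rfl fun c _ => h3 c, Finset.sum_const,
    Finset.card_univ, composition_card, Nat.sub_self, pow_zero, one_smul]

theorem antipode_sq_eq_id (hb : IsDGBialgebra (augTensor V d) (concat V) nabla)
    (hop : ∀ i j : ℕ, 2 ≤ j → coOp nabla i j = 0)
    (hS : IsAntipode (augTensor V d) (concat V) nabla S)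
    (hO : ∀ n, 2 ≤ n → obstruction nabla n = 0) : S ∘ₗ S = LinearMap.id := by
  have hS1 : S (1 : TensorAlgebra R V) = (1 : TensorAlgebra R V) := hS.one hb
  have hl : ∀ v, S (S (letter V v)) = letter V v := fun v => by
    refine lengthProj_ext fun n => ?_
    rcases n with _ | _ | n
    · rw [lengthProj_zero, lengthProj_zero]
      have h := LinearMap.congr_fun (hS.counit hb)
      exact congrArg (· • (1 : TensorAlgebra R V)) ((h (S (letter V v))).trans (h (letter V v)))
    · rw [lengthProj_antipode_sq hb hop hS _ le_rfl, obstruction_one, lengthProj_letter, if_pos rfl]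
    · rw [lengthProj_antipode_sq hb hop hS _ (by lia), hO _ (by lia), lengthProj_letter,
        if_neg (by lia), LinearMap.zero_apply]
  have hm : ∀ p q, ∀ a ∈ V.T.deg p, ∀ b ∈ V.T.deg q, S (a * b : TensorAlgebra R V) =
      sg R (p * q) • (S b * S a : TensorAlgebra R V) := by
    intro p q a ha b hb'
    have h := LinearMap.congr_fun (hS.antimul hb) (a ⊗ₜ b)
    refine h.trans ?_
    simp only [LinearMap.comp_apply, TensorProduct.map_tmul]
    rw [GrMod.koszul_tmul' (hS.mem p a ha) (hS.mem q b hb'), map_smul, concat_tmul]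
  refine LinearMap.ext fun x => ?_
  induction x using word_induction' with
  | one => rw [LinearMap.comp_apply, hS1, hS1]; rfl
  | cons m n v x hv hx ih =>
    have hx' : S x ∈ V.T.deg n := hS.mem n x hx
    have hv' : S (letter V v) ∈ V.T.deg m := hS.mem m _ (letter_mem hv)
    rw [LinearMap.comp_apply, hm m n _ (letter_mem hv) x hx, map_smul, hm n m _ hx' _ hv', hl,
      smul_smul, mul_comm n m, sg_mul_self, one_smul]
    exact congrArg (fun z : TensorAlgebra R V => (letter V v * z : TensorAlgebra R V)) ih
  | zero => simp
  | add x y hx hy => simp only [map_add, hx, hy]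
  | smul r x hx => simp only [map_smul, hx]

end Components

/-! ## The deconcatenation coalgebra -/

section DeconcatCoalgebra

variable {V : GrMod.{u, v} R}

theorem assoc_rTensor_mulFst (v : V) (z : V.T ⊗[R] V.T) :
    TensorProduct.assoc R V.T V.T V.T (LinearMap.rTensor V.T (deconcat V) (mulFst (letter V v) z)) =
      (1 : TensorAlgebra R V) ⊗ₜ mulFst (letter V v) z +
        LinearMap.rTensor (V.T ⊗[R] V.T) (LinearMap.mul R (TensorAlgebra R V) (letter V v))
          (TensorProduct.assoc R V.T V.T V.T (LinearMap.rTensor V.T (deconcat V) z)) := by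
  induction z using TensorProduct.induction_on with
  | zero => simp
  | add a b ha hb => simp only [map_add, TensorProduct.tmul_add, ha, hb]; abel
  | tmul a b =>
    rw [mulFst_tmul, LinearMap.rTensor_tmul, deconcat_cons, TensorProduct.add_tmul, map_add]
    congr 1
    rw [LinearMap.rTensor_tmul]
    generalize deconcat V a = y
    induction y using TensorProduct.induction_on with
    | zero => simp
    | add a b ha hb => simp only [map_add, TensorProduct.add_tmul, ha, hb]
    | tmul c e => rfl

theorem isCoalg_deconcat (V : GrMod.{u, v} R) : IsCoalg (deconcat V) (augT V) where
  coassoc := by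
    refine LinearMap.ext fun x => ?_
    simp only [LinearMap.comp_apply, LinearEquiv.coe_coe]
    induction x using word_induction' with
    | one => rw [deconcat_one, LinearMap.rTensor_tmul, LinearMap.lTensor_tmul, deconcat_one]; rfl
    | cons m n v x hv hx ih =>
      rw [deconcat_cons, map_add, map_add, assoc_rTensor_mulFst, ih, map_add, LinearMap.rTensor_tmul,
        LinearMap.lTensor_tmul, deconcat_one, deconcat_cons, TensorProduct.tmul_add,
        TensorProduct.assoc_tmul, ← add_assoc]
      congr 1
      generalize deconcat V x = z
      exact LinearMap.congr_fun ((LinearMap.rTensor_comp_lTensor (f := _) (g := _)).trans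
        (LinearMap.lTensor_comp_rTensor (f := _) (g := _)).symm) z
    | zero => simp
    | add x y hx hy => simp only [map_add, hx, hy]
    | smul r x hx => simp only [map_smul, hx]
  counit_left := LinearMap.ext counit_deconcat
  counit_right := by
    refine LinearMap.ext fun x => ?_
    simp only [LinearMap.comp_apply, LinearEquiv.coe_coe, LinearMap.id_apply]
    induction x using word_induction' with
    | one => rw [deconcat_one, LinearMap.lTensor_tmul, augT_one, TensorProduct.rid_tmul, one_smul]
    | cons m n v x hv hx ih =>
      have : ∀ z : V.T ⊗[R] V.T, TensorProduct.rid R V.T (LinearMap.lTensor V.T (augT V)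
          (mulFst (letter V v) z)) = (letter V v * TensorProduct.rid R V.T
            (LinearMap.lTensor V.T (augT V) z) : TensorAlgebra R V) := by
        intro z
        induction z using TensorProduct.induction_on with
        | zero => simp
        | add a b ha hb => simp only [map_add, ha, hb, mul_add]
        | tmul a b =>
          rw [mulFst_tmul, LinearMap.lTensor_tmul, LinearMap.lTensor_tmul, TensorProduct.rid_tmul,
            TensorProduct.rid_tmul, mul_smul_comm]
      rw [deconcat_cons, map_add, map_add, this, ih, LinearMap.lTensor_tmul, augT_mul, augT_letter,
        zero_mul, TensorProduct.tmul_zero, map_zero, zero_add]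
    | zero => simp
    | add x y hx hy => simp only [map_add, hx, hy]
    | smul r x hx => simp only [map_smul, hx]

theorem mulFst_mul (x y : TensorAlgebra R V) (z : V.T ⊗[R] V.T) :
    mulFst (x * y : TensorAlgebra R V) z = mulFst x (mulFst y z) := by
  induction z using TensorProduct.induction_on with
  | zero => simp
  | add a b ha hb => simp only [map_add, ha, hb]
  | tmul a b => rw [mulFst_tmul, mulFst_tmul, mulFst_tmul, mul_assoc]

theorem mulFst_mulSnd (x y : TensorAlgebra R V) (z : V.T ⊗[R] V.T) :
    mulFst x (mulSnd y z) = mulSnd y (mulFst x z) := by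
  induction z using TensorProduct.induction_on with
  | zero => simp
  | add a b ha hb => simp only [map_add, ha, hb]
  | tmul a b => rw [mulFst_tmul, mulSnd_tmul, mulFst_tmul, mulSnd_tmul]

theorem deconcat_mul_cons (x : TensorAlgebra R V) (v : V) (z : TensorAlgebra R V) :
    deconcat V (x * (letter V v * z) : TensorAlgebra R V) =
      mulSnd (letter V v * z : TensorAlgebra R V) (deconcat V x) +
        mulFst (x * letter V v : TensorAlgebra R V) (deconcat V z) := by
  induction x using word_induction' with
  | one =>
    rw [one_mul, one_mul, deconcat_cons, deconcat_one, mulSnd_tmul, one_mul]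
  | cons m n u x hv hx ih =>
    rw [mul_assoc, deconcat_cons, ih, map_add, deconcat_cons, map_add, mulSnd_tmul, mul_assoc,
      ← mulFst_mul, ← mulFst_mulSnd, mul_assoc, add_assoc]
  | zero => simp [mulFst]
  | add x y hx hy => simp only [add_mul, map_add, hx, hy, mulFst, LinearMap.rTensor_add,
      LinearMap.add_apply]; abel
  | smul r x hx => simp only [smul_mul_assoc, map_smul, hx, mulFst, LinearMap.rTensor_smul,
      LinearMap.smul_apply, smul_add]

theorem deconcat_mul_letter (x : TensorAlgebra R V) (v : V) :
    deconcat V (x * letter V v : TensorAlgebra R V) =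
      mulSnd (letter V v) (deconcat V x) +
        (x * letter V v : TensorAlgebra R V) ⊗ₜ (1 : TensorAlgebra R V) := by
  have h := deconcat_mul_cons x v (1 : TensorAlgebra R V)
  rwa [mul_one, deconcat_one, mulFst_tmul, mul_one] at h

theorem isDeg_deconcat (V : GrMod.{u, v} R) :
    GrMod.IsDeg (V := V.T) (W := V.T.tensor V.T) (deconcat V) 0 := by
  intro m x hx
  rw [add_zero]
  refine word_induction (V := V) (P := fun m x => deconcat V x ∈ tensorDeg V.T V.T m)
    ?_ ?_ ?_ ?_ ?_ m x hx
  · rw [deconcat_one]; exact GrMod.tmul_mem one_memT one_memT (add_zero 0)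
  · intro p q v x hv hx ih
    rw [deconcat_cons]
    refine add_mem (GrMod.tmul_mem one_memT (mul_memT (letter_mem hv) hx) (zero_add _)) ?_
    refine GrMod.tensorDeg_mem (f := mulFst (letter V v)) ?_ ih
    intro i j hij a ha b hb
    exact GrMod.tmul_mem (mul_memT (letter_mem hv) ha) hb (by lia)
  · intro m; rw [map_zero]; exact zero_mem _
  · intro m x y hx hy; rw [map_add]; exact add_mem hx hy
  · intro m r x hx; rw [map_smul]; exact Submodule.smul_mem _ _ hx

section Conv

variable {A B C : Type*} [AddCommGroup A] [AddCommGroup B] [AddCommGroup C] [Module R A]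
  [Module R B] [Module R C]

theorem conv_deconcat_one (mu : A ⊗[R] B →ₗ[R] C) (f : V.T →ₗ[R] A) (g : V.T →ₗ[R] B) :
    conv (deconcat V) mu f g (1 : TensorAlgebra R V) =
      mu (f (1 : TensorAlgebra R V) ⊗ₜ g (1 : TensorAlgebra R V)) := by
  rw [conv_apply, deconcat_one, TensorProduct.map_tmul]

/-- Convolution with a map supported on letters. -/
theorem conv_unletter_cons (mu : A ⊗[R] B →ₗ[R] C) (f : V →ₗ[R] A) (g : V.T →ₗ[R] B) (v : V)
    (x : TensorAlgebra R V) : conv (deconcat V) mu (f ∘ₗ unletter V) g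
      (letter V v * x : TensorAlgebra R V) = mu (f v ⊗ₜ g x) := by
  have h := uncons_cons v x
  have : conv (deconcat V) mu (f ∘ₗ unletter V) g = mu ∘ₗ TensorProduct.map f g ∘ₗ uncons V := by
    rw [uncons, conv]
    refine LinearMap.ext fun x => ?_
    simp only [LinearMap.comp_apply]
    rw [← LinearMap.comp_apply (TensorProduct.map f g), LinearMap.map_comp_rTensor]
  rw [this, LinearMap.comp_apply, LinearMap.comp_apply, h, TensorProduct.map_tmul]

theorem conv_unletter_one (mu : A ⊗[R] B →ₗ[R] C) (f : V →ₗ[R] A) (g : V.T →ₗ[R] B) :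
    conv (deconcat V) mu (f ∘ₗ unletter V) g (1 : TensorAlgebra R V) = 0 := by
  rw [conv_deconcat_one, LinearMap.comp_apply, unletter_one, map_zero, TensorProduct.zero_tmul,
    map_zero]

end Conv

theorem lengthProj_succ (n : ℕ) : lengthProj V (n + 1) =
    conv (deconcat V) (concat V) (letter V ∘ₗ unletter V) (lengthProj V n) := by
  refine LinearMap.ext fun x => ?_
  induction x using word_induction' with
  | one => rw [lengthProj_one, if_neg (by lia), conv_unletter_one]
  | cons m n v x hv hx ih => rw [lengthProj_cons, conv_unletter_cons, concat_tmul]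
  | zero => simp
  | add x y hx hy => simp only [map_add, hx, hy]
  | smul r x hx => simp only [map_smul, hx]

/-- A map `ψ : K → T^c(V)` with `δ ψ = (ψ ⊗ f + g ⊗ ψ) δ` vanishes as soon as its corestriction does. -/
theorem coderivation_ext {K : Type*} [AddCommGroup K] [Module R K] {cm : K →ₗ[R] K ⊗[R] K}
    {ψ f g : K →ₗ[R] V.T} (h : deconcat V ∘ₗ ψ = (TensorProduct.map ψ f + TensorProduct.map g ψ) ∘ₗ cm)
    (h1 : unletter V ∘ₗ ψ = 0) (h0 : augT V ∘ₗ ψ = 0) : ψ = 0 := by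
  refine LinearMap.ext fun x => lengthProj_ext fun n => ?_
  rw [LinearMap.zero_apply, map_zero]
  induction n generalizing x with
  | zero =>
    rw [lengthProj_zero]
    have := LinearMap.congr_fun h0 x
    rw [LinearMap.comp_apply, LinearMap.zero_apply] at this
    rw [this, zero_smul]
  | succ n ih =>
    have ih' : lengthProj V n ∘ₗ ψ = 0 := LinearMap.ext ih
    have h2 := LinearMap.congr_fun h x
    rw [LinearMap.comp_apply, LinearMap.comp_apply] at h2
    rw [lengthProj_succ, conv_apply, h2, LinearMap.add_apply, map_add, ← LinearMap.comp_apply,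
      ← TensorProduct.map_comp, LinearMap.comp_assoc, h1, LinearMap.comp_zero,
      TensorProduct.map_zero_left, ← LinearMap.comp_apply (TensorProduct.map _ _),
      ← TensorProduct.map_comp, ih', TensorProduct.map_zero_right]
    simp

end DeconcatCoalgebra

/-! ## Derivations of the tensor algebra -/

section Derivation

variable {V : GrMod.{u, v} R}

theorem insertOdd_eq (φ : V.T →ₗ[R] V.T) : insertOdd V φ =
    conv (deconcat V) (concat V) (V.T.sp 1) (conv (deconcat V) (concat V) φ LinearMap.id) := by
  rw [insertOdd, GrMod.sgn_eq]; rfl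

variable {g : V →ₗ[R] V.T}

theorem insertOdd_one : insertOdd V (g ∘ₗ unletter V) (1 : TensorAlgebra R V) = 0 := by
  rw [insertOdd_eq, conv_deconcat_one, conv_unletter_one, TensorProduct.tmul_zero, map_zero]

theorem insertOdd_cons (v : V) (x : TensorAlgebra R V) :
    insertOdd V (g ∘ₗ unletter V) (letter V v * x : TensorAlgebra R V) =
      (g v * x : TensorAlgebra R V) +
        (letter V (V.sp 1 v) * insertOdd V (g ∘ₗ unletter V) x : TensorAlgebra R V) := by
  rw [insertOdd_eq, conv_apply, deconcat_cons, map_add, map_add, TensorProduct.map_tmul, sp_oneT,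
    concat_tmul, one_mul, conv_unletter_cons, concat_tmul, LinearMap.id_apply]
  congr 1
  rw [conv_apply]
  generalize deconcat V x = z
  induction z using TensorProduct.induction_on with
  | zero => simp
  | add a b ha hb => simp only [map_add, mul_add, ha, hb]
  | tmul a b =>
    rw [mulFst_tmul, TensorProduct.map_tmul, TensorProduct.map_tmul, concat_tmul, concat_tmul, sp_mul,
      sp_letter, mul_assoc]

theorem insertOdd_letter (v : V) : insertOdd V (g ∘ₗ unletter V) (letter V v) = g v := by
  have h := insertOdd_cons (g := g) v (1 : TensorAlgebra R V)
  rwa [mul_one, mul_one, insertOdd_one, mul_zero, add_zero] at h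

theorem insertOdd_mul (x y : TensorAlgebra R V) :
    insertOdd V (g ∘ₗ unletter V) (x * y : TensorAlgebra R V) =
      (insertOdd V (g ∘ₗ unletter V) x * y : TensorAlgebra R V) +
        (V.T.sp 1 x * insertOdd V (g ∘ₗ unletter V) y : TensorAlgebra R V) := by
  induction x using word_induction' with
  | one => rw [one_mul, insertOdd_one, zero_mul, sp_oneT, one_mul, zero_add]
  | cons m n v x hv hx ih =>
    rw [mul_assoc, insertOdd_cons, ih, insertOdd_cons, sp_mul, sp_letter]
    noncomm_ring
  | zero => simp
  | add x y hx hy => simp only [map_add, add_mul, hx, hy]; abel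
  | smul r x hx => simp only [map_smul, smul_mul_assoc, hx, smul_add]

theorem isDeg_insertOdd (hg : GrMod.IsDeg (W := V.T) g (-1)) :
    GrMod.IsDeg (V := V.T) (W := V.T) (insertOdd V (g ∘ₗ unletter V)) (-1) := by
  intro m x hx
  refine word_induction (V := V) (P := fun m x => insertOdd V (g ∘ₗ unletter V) x ∈ V.T.deg (m + -1))
    ?_ ?_ ?_ ?_ ?_ m x hx
  · rw [insertOdd_one]; exact zero_mem _
  · intro p q v x hv hx ih
    rw [insertOdd_cons]
    refine add_mem (GrMod.mem_of_eq (mul_memT (hg p v hv) hx) (by lia)) ?_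
    exact GrMod.mem_of_eq (mul_memT (letter_mem (V.sp_mem 1 hv)) ih) (by lia)
  · intro m; rw [map_zero]; exact zero_mem _
  · intro m x y hx hy; rw [map_add]; exact add_mem hx hy
  · intro m r x hx; rw [map_smul]; exact Submodule.smul_mem _ _ hx

theorem insertOdd_sq (hg : GrMod.IsDeg (W := V.T) g (-1))
    (h : ∀ v, insertOdd V (g ∘ₗ unletter V) (g v) = 0) (x : TensorAlgebra R V) :
    insertOdd V (g ∘ₗ unletter V) (insertOdd V (g ∘ₗ unletter V) x) = 0 := by
  induction x using word_induction' with
  | one => rw [insertOdd_one, map_zero]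
  | cons m n v x hv hx ih =>
    have e : V.T.sp 1 (g v) = -g (V.sp 1 v) := by
      rw [hg.sp]; simp [sg]
    rw [insertOdd_cons, map_add, insertOdd_mul, h, insertOdd_cons, ih, e, V.sp_self]
    noncomm_ring
  | zero => simp
  | add x y hx hy => simp only [map_add, hx, hy, add_zero]
  | smul r x hx => simp only [map_smul, hx, smul_zero]

theorem augT_insertOdd (h : ∀ v, augT V (g v) = 0) (x : TensorAlgebra R V) :
    augT V (insertOdd V (g ∘ₗ unletter V) x) = 0 := by
  induction x using word_induction' with
  | one => rw [insertOdd_one, map_zero]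
  | cons m n v x hv hx ih =>
    rw [insertOdd_cons, map_add, augT_mul, augT_mul, h, augT_letter, zero_mul, zero_mul, add_zero]
  | zero => simp
  | add x y hx hy => simp only [map_add, hx, hy, add_zero]
  | smul r x hx => simp only [map_smul, hx, smul_zero]

end Derivation

/-! ## Suspensions -/

section Susp

variable (A : AugMod.{u, v} R) (r : ℤ)

@[simp] theorem AugMod.inS_outS (v : A.susp r) : A.inS r (A.outS r v) = v := A.proj_coe v

theorem AugMod.outS_inS (a : A.toGrMod) : A.outS r (A.inS r a) = a - A.counit a • A.one := rfl

theorem AugMod.outS_injective : Function.Injective (A.outS r) := Subtype.val_injective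

theorem AugMod.counit_outS (v : A.susp r) : A.counit (A.outS r v) = 0 := v.2

theorem AugMod.isDeg_inS : GrMod.IsDeg (V := A.toGrMod) (W := A.susp r) (A.inS r) r := fun n a ha => by
  change (A.proj a : A.carrier) ∈ A.deg (n + r - r)
  rw [add_sub_cancel_right]
  exact A.proj_mem ha

theorem AugMod.isDeg_outS : GrMod.IsDeg (V := A.susp r) (W := A.toGrMod) (A.outS r) (-r) :=
  fun n _ ha => GrMod.mem_of_eq (V := A.toGrMod) ha (sub_eq_add_neg n r)

@[simp] theorem AugMod.inS_one : A.inS r A.one = 0 := by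
  apply A.outS_injective r
  rw [A.outS_inS, A.counit_one, one_smul, sub_self, map_zero]

theorem AugMod.IsConnected.susp_neg_one {A : AugMod.{u, v} R} (h : A.IsReduced 1) (n : ℤ)
    (hn : n ≤ 0) : (A.susp (-1)).deg n = ⊥ := by
  rw [eq_bot_iff]
  intro a ha
  have ha' : A.outS (-1) a ∈ A.deg (n - -1) := ha
  have h0 : A.outS (-1) a = 0 := by
    rcases lt_trichotomy (n + 1) 0 with h1 | h1 | h1
    · rw [show n - -1 = n + 1 by ring, h.deg_neg _ h1] at ha'
      exact ha'
    · rw [show n - -1 = 0 by lia, h.deg_zero, Submodule.mem_span_singleton] at ha'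
      obtain ⟨c, hc⟩ := ha'
      have h2 := A.counit_outS (-1) a
      rw [← hc, map_smul, A.counit_one, smul_eq_mul, mul_one] at h2
      rw [← hc, h2, zero_smul]
    · rw [show n - -1 = 1 by lia, h.deg_eq_bot 1 le_rfl (by simp)] at ha'
      exact ha'
  exact A.outS_injective (-1) (h0.trans (map_zero _).symm)

/-- `a ↦ s⁻¹(a - ε(a))`, as a word of length one. -/
def AugMod.ell : A.toGrMod →ₗ[R] (A.susp (-1)).T := letter (A.susp (-1)) ∘ₗ A.inS (-1)

/-- `a ↦ (-1)^{|a|} s⁻¹(a - ε(a))`, as a word of length one. -/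
def AugMod.jay : A.toGrMod →ₗ[R] (A.susp (-1)).T := A.ell ∘ₗ A.toGrMod.sp 1

theorem AugMod.letter_eq (v : A.susp (-1)) : letter (A.susp (-1)) v = A.ell (A.outS (-1) v) := by
  rw [AugMod.ell, LinearMap.comp_apply, A.inS_outS]

theorem AugMod.isDeg_ell : GrMod.IsDeg (V := A.toGrMod) (W := (A.susp (-1)).T) A.ell (-1) :=
  fun n a ha => letter_mem (A.isDeg_inS (-1) n a ha)

theorem AugMod.isDeg_jay : GrMod.IsDeg (V := A.toGrMod) (W := (A.susp (-1)).T) A.jay (-1) :=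
  fun n a ha => A.isDeg_ell n _ (A.toGrMod.sp_mem 1 ha)

@[simp] theorem AugMod.ell_one : A.ell A.one = 0 := by
  rw [AugMod.ell, LinearMap.comp_apply, A.inS_one, map_zero]

@[simp] theorem AugMod.jay_one : A.jay A.one = 0 := by
  rw [AugMod.jay, LinearMap.comp_apply, A.sp_one, A.ell_one]

theorem AugMod.jay_sp : A.jay ∘ₗ A.toGrMod.sp 1 = A.ell := by
  rw [AugMod.jay, LinearMap.comp_assoc, GrMod.sp_comp, GrMod.sp_congr (n := 0) (by decide),
    GrMod.sp_zero, LinearMap.comp_id]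

theorem AugMod.sp_one_ell : (A.susp (-1)).T.sp 1 ∘ₗ A.ell = -A.jay := by
  rw [A.isDeg_ell.sp_comp]; simp [sg, AugMod.jay]

theorem AugMod.sp_one_jay : (A.susp (-1)).T.sp 1 ∘ₗ A.jay = -A.ell := by
  rw [AugMod.jay, ← LinearMap.comp_assoc, A.sp_one_ell, LinearMap.neg_comp, A.jay_sp]

theorem AugMod.augT_ell (a : A.toGrMod) : augT (A.susp (-1)) (A.ell a) = 0 := augT_letter _

end Susp

/-! ## The cobar construction is a DG-algebra -/

section Cobar

variable {C : AugMod.{u, v} R} {comul : C.toGrMod →ₗ[R] C.toGrMod ⊗[R] C.toGrMod}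

theorem cobar_d_one : (cobar C comul).d (1 : TensorAlgebra R (C.susp (-1))) = 0 := insertOdd_one

theorem cobar_d_mul (x y : TensorAlgebra R (C.susp (-1))) :
    (cobar C comul).d (x * y : TensorAlgebra R (C.susp (-1))) =
      ((cobar C comul).d x * y : TensorAlgebra R (C.susp (-1))) +
        ((C.susp (-1)).T.sp 1 x * (cobar C comul).d y : TensorAlgebra R (C.susp (-1))) :=
  insertOdd_mul x y

theorem cobar_d_concat {K K₁ K₂ : Type*} [AddCommGroup K] [AddCommGroup K₁] [AddCommGroup K₂]
    [Module R K] [Module R K₁] [Module R K₂] (cm : K →ₗ[R] K₁ ⊗[R] K₂)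
    (f : K₁ →ₗ[R] (C.susp (-1)).T) (g : K₂ →ₗ[R] (C.susp (-1)).T) :
    (cobar C comul).d ∘ₗ conv cm (concat _) f g =
      conv cm (concat _) ((cobar C comul).d ∘ₗ f) g +
        conv cm (concat _) ((C.susp (-1)).T.sp 1 ∘ₗ f) ((cobar C comul).d ∘ₗ g) := by
  refine LinearMap.ext fun x => ?_
  rw [LinearMap.comp_apply, LinearMap.add_apply, conv_apply, conv_apply, conv_apply]
  generalize cm x = z
  induction z using TensorProduct.induction_on with
  | zero => simp
  | add a b ha hb => simp only [map_add, ha, hb]; abel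
  | tmul a b => exact cobar_d_mul _ _

theorem cobar_d_ell (h : IsDGCoalgebra C comul) : (cobar C comul).d ∘ₗ C.ell =
    -(C.ell ∘ₗ C.d) + conv comul (concat _) C.jay C.ell := by
  refine LinearMap.ext fun a => ?_
  have h1 : (cobar C comul).d (C.ell a) = cobarGen C comul (C.inS (-1) a) := insertOdd_letter _
  rw [LinearMap.comp_apply, h1, cobarGen, LinearMap.add_apply, LinearMap.add_apply]
  simp only [LinearMap.neg_apply, LinearMap.comp_apply]
  rw [C.outS_inS, map_sub C.d, map_smul C.d, h.d_one, smul_zero, sub_zero, map_sub comul,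
    map_smul comul, h.comul_one, GrMod.sgn_eq, map_sub, map_smul, TensorProduct.map_tmul]
  congr 1
  have : C.jay C.one = 0 := C.jay_one
  change concat _ (TensorProduct.map C.jay C.ell (comul a) - C.counit a • (C.jay C.one ⊗ₜ _)) = _
  rw [this, TensorProduct.zero_tmul, smul_zero, sub_zero]
  rfl

theorem cobar_d_jay (h : IsDGCoalgebra C comul) : (cobar C comul).d ∘ₗ C.jay =
    C.jay ∘ₗ C.d + conv comul (concat _) C.ell C.jay := by
  rw [AugMod.jay, ← LinearMap.comp_assoc, cobar_d_ell h, LinearMap.add_comp, h.conv_sp, C.jay_sp]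
  congr 1
  refine LinearMap.ext fun a => ?_
  simp only [LinearMap.neg_apply, LinearMap.neg_comp, LinearMap.comp_apply]
  rw [h.sp_d]
  simp [sg]

theorem cobarGen_mem (h : IsDGCoalgebra C comul) :
    GrMod.IsDeg (V := C.susp (-1)) (W := (C.susp (-1)).T) (cobarGen C comul) (-1) := by
  intro n v hv
  have h1 : (cobar C comul).d (letter _ v) = cobarGen C comul v := insertOdd_letter _
  have hv' := C.isDeg_outS (-1) n v hv
  rw [← h1, C.letter_eq, ← LinearMap.comp_apply, cobar_d_ell h]
  refine add_mem (neg_mem ?_) ?_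
  · exact GrMod.mem_of_eq (C.isDeg_ell _ _ (h.d_mem _ _ hv')) (by ring)
  · refine GrMod.tensorDeg_mem (f := concat _ ∘ₗ TensorProduct.map C.jay C.ell) ?_
      (h.comul_mem _ _ hv')
    intro p q hpq a ha b hb
    exact GrMod.mem_of_eq (mul_memT (C.isDeg_jay _ _ ha) (C.isDeg_ell _ _ hb)) (by lia)

theorem cobar_d_sq (h : IsDGCoalgebra C comul) : (cobar C comul).d ∘ₗ (cobar C comul).d = 0 := by
  refine LinearMap.ext fun x => insertOdd_sq (cobarGen_mem h) (fun v => ?_) x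
  have h1 : (cobar C comul).d (letter _ v) = cobarGen C comul v := insertOdd_letter _
  rw [← h1, C.letter_eq]
  have key : (cobar C comul).d ∘ₗ (cobar C comul).d ∘ₗ C.ell = 0 := by
    rw [cobar_d_ell h, LinearMap.comp_add, LinearMap.comp_neg, ← LinearMap.comp_assoc,
      cobar_d_ell h, LinearMap.add_comp, h.conv_d, cobar_d_concat, cobar_d_jay h, cobar_d_ell h,
      C.jay_sp, C.sp_one_jay, conv_add_left, conv_add_right, conv_neg_left, conv_neg_left,
      conv_neg_right, h.isCoalg.conv_assoc (concat_assoc _), LinearMap.neg_comp, LinearMap.comp_assoc,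
      h.d_d, LinearMap.comp_zero]
    abel
  exact LinearMap.congr_fun key _

theorem isDGAlgebra_cobar (h : IsDGCoalgebra C comul) :
    IsDGAlgebra (cobar C comul) (concat (C.susp (-1))) where
  d_mem n a ha := isDeg_insertOdd (cobarGen_mem h) n a ha
  d_d := cobar_d_sq h
  d_one := cobar_d_one
  counit_d := LinearMap.ext fun x => augT_insertOdd (fun v => by
    have h1 : (cobar C comul).d (letter _ v) = cobarGen C comul v := insertOdd_letter _
    rw [← h1, C.letter_eq, ← LinearMap.comp_apply (cobar C comul).d, cobar_d_ell h,
      LinearMap.add_apply, map_add, LinearMap.neg_apply, map_neg, LinearMap.comp_apply, C.augT_ell, neg_zero, zero_add, conv_apply]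
    generalize comul _ = z
    induction z using TensorProduct.induction_on with
    | zero => simp
    | add a b ha hb => simp only [map_add, ha, hb, add_zero]
    | tmul a b =>
      rw [TensorProduct.map_tmul, concat_tmul, augT_mul, C.augT_ell, mul_zero]) x
  mul_mem m n a ha b hb := mul_memT ha hb
  mul_assoc := concat_assoc _
  one_mul a := one_mul (M := TensorAlgebra R (C.susp (-1))) a
  mul_one a := mul_one (M := TensorAlgebra R (C.susp (-1))) a
  d_mul := TensorProduct.ext' fun x y => by
    rw [LinearMap.comp_apply, concat_tmul, cobar_d_mul, AugMod.tensorD, GrMod.sgn_eq]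
    rfl
  counit_mul := augT_mul

end Cobar

/-! ## The bar construction is a DG-coalgebra -/

section Coderivation

variable {W : GrMod.{u, v} R} (φ : W.T →ₗ[R] W)

/-- The maps `letter ∘ φ` extend to coderivations. -/
theorem deconcat_insertOdd : deconcat W ∘ₗ insertOdd W (letter W ∘ₗ φ) =
    (LinearMap.rTensor W.T (insertOdd W (letter W ∘ₗ φ)) +
      TensorProduct.map (W.T.sp 1) (insertOdd W (letter W ∘ₗ φ))) ∘ₗ deconcat W := by
  have hδ := isCoalg_deconcat W
  let E : W.T →ₗ[R] W ⊗[R] W.T := conv (deconcat W) LinearMap.id φ LinearMap.id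
  let μ₃ : W.T ⊗[R] (W ⊗[R] W.T) →ₗ[R] W.T :=
    concat W ∘ₗ LinearMap.lTensor W.T (concat W ∘ₗ LinearMap.rTensor W.T (letter W))
  let μ₁ : W.T ⊗[R] (W ⊗[R] W.T) →ₗ[R] W.T ⊗[R] W.T :=
    LinearMap.lTensor W.T μ₃ ∘ₗ (TensorProduct.assoc R W.T W.T (W ⊗[R] W.T)).toLinearMap ∘ₗ
      LinearMap.rTensor (W ⊗[R] W.T) (deconcat W)
  let μ₄ : W.T ⊗[R] (W ⊗[R] (W.T ⊗[R] W.T)) →ₗ[R] W.T ⊗[R] W.T :=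
    LinearMap.rTensor W.T μ₃ ∘ₗ (TensorProduct.assoc R W.T (W ⊗[R] W.T) W.T).symm.toLinearMap ∘ₗ
      LinearMap.lTensor W.T (TensorProduct.assoc R W W.T W.T).symm.toLinearMap
  let μ₂ : W.T ⊗[R] (W ⊗[R] W.T) →ₗ[R] W.T ⊗[R] W.T :=
    μ₄ ∘ₗ LinearMap.lTensor W.T (LinearMap.lTensor W (deconcat W))
  have hD : insertOdd W (letter W ∘ₗ φ) = conv (deconcat W) μ₃ (W.T.sp 1) E := by
    rw [insertOdd_eq]
    have h1 : conv (deconcat W) (concat W) (letter W ∘ₗ φ) LinearMap.id =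
        (concat W ∘ₗ LinearMap.rTensor W.T (letter W)) ∘ₗ E := by
      rw [comp_conv]
      refine LinearMap.ext fun x => ?_
      simp only [conv_apply, LinearMap.comp_apply, LinearMap.id_apply]
      rw [← LinearMap.comp_apply (LinearMap.rTensor _ _), LinearMap.rTensor_comp_map]
    rw [h1]
    refine LinearMap.ext fun x => ?_
    simp only [conv_apply, μ₃, LinearMap.comp_apply]
    rw [← LinearMap.comp_apply (LinearMap.lTensor _ _), LinearMap.lTensor_comp_map]
  have hμ : deconcat W ∘ₗ μ₃ = μ₁ + μ₂ := by
    refine TensorProduct.ext_threefold' fun x v z => ?_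
    simp only [LinearMap.comp_apply, LinearMap.add_apply, μ₃, LinearMap.lTensor_tmul,
      LinearMap.rTensor_tmul]
    rw [concat_tmul, concat_tmul, deconcat_mul_cons]
    congr 1
    · simp only [μ₁, LinearMap.comp_apply, LinearMap.rTensor_tmul]
      generalize deconcat W x = y
      induction y using TensorProduct.induction_on with
      | zero => simp
      | add a b ha hb => simp only [map_add, TensorProduct.add_tmul, ha, hb]
      | tmul a b => rfl
    · simp only [μ₂, μ₄, LinearMap.comp_apply, LinearMap.lTensor_tmul]
      generalize deconcat W z = y
      induction y using TensorProduct.induction_on with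
      | zero => simp
      | add a b ha hb => simp only [map_add, TensorProduct.tmul_add, ha, hb]
      | tmul a b =>
        rw [mulFst_tmul, mul_assoc]
        rfl
  have h1 : conv (deconcat W) μ₁ (W.T.sp 1) E =
      TensorProduct.map (W.T.sp 1) (insertOdd W (letter W ∘ₗ φ)) ∘ₗ deconcat W := by
    have e : conv (deconcat W) μ₁ (W.T.sp 1) E = conv (deconcat W)
        (LinearMap.lTensor W.T μ₃ ∘ₗ (TensorProduct.assoc R W.T W.T (W ⊗[R] W.T)).toLinearMap)
        (conv (deconcat W) LinearMap.id (W.T.sp 1) (W.T.sp 1)) E := by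
      have e2 : conv (deconcat W) LinearMap.id (W.T.sp 1) (W.T.sp 1) = deconcat W ∘ₗ W.T.sp 1 := by
        rw [comul_sp (isDeg_deconcat W)]; rfl
      rw [e2, ← LinearMap.id_comp E, conv_comp_out, LinearMap.id_comp]
      rfl
    rw [e, hδ.conv_assoc (mu₂ := LinearMap.id) (mu₂' := μ₃) (fun a b c => rfl), ← hD]
    rfl
  have h2 : conv (deconcat W) μ₂ (W.T.sp 1) E =
      LinearMap.rTensor W.T (insertOdd W (letter W ∘ₗ φ)) ∘ₗ deconcat W := by
    have e1 : LinearMap.lTensor W (deconcat W) ∘ₗ E = conv (deconcat W)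
        (TensorProduct.assoc R W W.T W.T).toLinearMap E LinearMap.id := by
      rw [hδ.conv_assoc (mu₂ := LinearMap.id) (mu₂' := LinearMap.id) (fun a b c => rfl)]
      rw [comp_conv]
      refine LinearMap.ext fun x => ?_
      simp only [conv_apply, LinearMap.comp_apply, LinearMap.id_apply, TensorProduct.map_id]
      rw [← LinearMap.comp_apply (LinearMap.lTensor _ _), LinearMap.lTensor_comp_map]
      congr 2
      refine LinearMap.ext fun x => ?_
      simp only [conv_apply, LinearMap.comp_apply, LinearMap.id_apply, TensorProduct.map_id]
    have e2 : conv (deconcat W) μ₂ (W.T.sp 1) E =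
        conv (deconcat W) μ₄ (W.T.sp 1) (LinearMap.lTensor W (deconcat W) ∘ₗ E) := by
      conv_rhs => rw [← LinearMap.id_comp (W.T.sp 1), conv_comp_out]
      rfl
    rw [e2, e1, ← hδ.conv_assoc (mu := LinearMap.id) (mu' := μ₃), ← hD]
    · rfl
    · intro a b c
      induction b using TensorProduct.induction_on with
      | zero => simp
      | add x y hx hy => simp only [TensorProduct.tmul_add, TensorProduct.add_tmul, map_add, hx, hy]
      | tmul x y => rfl
  calc deconcat W ∘ₗ insertOdd W (letter W ∘ₗ φ) = conv (deconcat W) (deconcat W ∘ₗ μ₃) (W.T.sp 1) E := by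
        conv_lhs => rw [hD]
        rw [comp_conv]
    _ = conv (deconcat W) μ₁ (W.T.sp 1) E + conv (deconcat W) μ₂ (W.T.sp 1) E := by
        rw [hμ]; rfl
    _ = _ := by rw [h1, h2, LinearMap.add_comp, add_comm]

theorem unletter_mul (x y : TensorAlgebra R W) : unletter W (x * y : TensorAlgebra R W) =
    augT W y • unletter W x + augT W x • unletter W y := by
  induction x using word_induction' with
  | one => rw [one_mul, unletter_one, augT_one, smul_zero, zero_add, one_smul]
  | cons m n v x hv hx ih =>
    rw [mul_assoc, unletter_cons, unletter_cons, augT_mul, augT_mul, augT_letter, zero_mul, zero_smul,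
      add_zero, smul_smul, mul_comm]
  | zero => simp
  | add x y hx hy => simp only [add_mul, map_add, hx, hy, smul_add, add_smul]; abel
  | smul r x hx => simp only [smul_mul_assoc, map_smul, hx, smul_add, smul_smul, smul_eq_mul]; congr 2; ring

theorem conv_counit_left {K A B : Type*} [AddCommGroup K] [AddCommGroup A] [AddCommGroup B]
    [Module R K] [Module R A] [Module R B] {cm : K →ₗ[R] K ⊗[R] K} {eps : K →ₗ[R] R}
    (hc : IsCoalg cm eps) {mu : A ⊗[R] B →ₗ[R] B} {f : K →ₗ[R] A}
    (hf : ∀ x b, mu (f x ⊗ₜ b) = eps x • b) (g : K →ₗ[R] B) : conv cm mu f g = g := by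
  have h1 : mu ∘ₗ TensorProduct.map f g =
      g ∘ₗ (TensorProduct.lid R K).toLinearMap ∘ₗ LinearMap.rTensor K eps :=
    TensorProduct.ext' fun x y => by simp [hf]
  have h2 := hc.counit_left
  refine LinearMap.ext fun x => ?_
  exact (LinearMap.congr_fun h1 (cm x)).trans (congrArg g (LinearMap.congr_fun h2 x))

theorem conv_counit_right {K A B : Type*} [AddCommGroup K] [AddCommGroup A] [AddCommGroup B]
    [Module R K] [Module R A] [Module R B] {cm : K →ₗ[R] K ⊗[R] K} {eps : K →ₗ[R] R}
    (hc : IsCoalg cm eps) {mu : A ⊗[R] B →ₗ[R] A} {g : K →ₗ[R] B}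
    (hg : ∀ x a, mu (a ⊗ₜ g x) = eps x • a) (f : K →ₗ[R] A) : conv cm mu f g = f := by
  have h1 : mu ∘ₗ TensorProduct.map f g =
      f ∘ₗ (TensorProduct.rid R K).toLinearMap ∘ₗ LinearMap.lTensor K eps :=
    TensorProduct.ext' fun x y => by simp [hg]
  have h2 := hc.counit_right
  refine LinearMap.ext fun x => ?_
  exact (LinearMap.congr_fun h1 (cm x)).trans (congrArg f (LinearMap.congr_fun h2 x))

/-- The augmentation and the projection on letters of a convolution in `T(W)`. -/
theorem augT_conv {K K₁ K₂ : Type*} [AddCommGroup K] [AddCommGroup K₁] [AddCommGroup K₂]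
    [Module R K] [Module R K₁] [Module R K₂] (cm : K →ₗ[R] K₁ ⊗[R] K₂)
    (f : K₁ →ₗ[R] W.T) (g : K₂ →ₗ[R] W.T) :
    augT W ∘ₗ conv cm (concat W) f g = conv cm (LinearMap.mul' R R) (augT W ∘ₗ f) (augT W ∘ₗ g) := by
  rw [comp_conv, conv_comp_out]
  congr 1
  exact TensorProduct.ext' fun x y => augT_mul x y

theorem unletter_conv {K K₁ K₂ : Type*} [AddCommGroup K] [AddCommGroup K₁] [AddCommGroup K₂]
    [Module R K] [Module R K₁] [Module R K₂] (cm : K →ₗ[R] K₁ ⊗[R] K₂)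
    (f : K₁ →ₗ[R] W.T) (g : K₂ →ₗ[R] W.T) : unletter W ∘ₗ conv cm (concat W) f g =
      conv cm (TensorProduct.rid R W).toLinearMap (unletter W ∘ₗ f) (augT W ∘ₗ g) +
        conv cm (TensorProduct.lid R W).toLinearMap (augT W ∘ₗ f) (unletter W ∘ₗ g) := by
  rw [comp_conv, conv_comp_out, conv_comp_out]
  have : unletter W ∘ₗ concat W =
      (TensorProduct.rid R W).toLinearMap ∘ₗ TensorProduct.map (unletter W) (augT W) +
        (TensorProduct.lid R W).toLinearMap ∘ₗ TensorProduct.map (augT W) (unletter W) :=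
    TensorProduct.ext' fun x y => unletter_mul x y
  rw [this]; rfl

theorem augT_letter_comp : augT W ∘ₗ letter W ∘ₗ φ = 0 :=
  LinearMap.ext fun _ => augT_letter _

theorem augT_sp (n : ℤ) : augT W ∘ₗ W.T.sp n = augT W :=
  (augTensor W 0).counit_sp n

theorem augT_insertOdd_letter : augT W ∘ₗ insertOdd W (letter W ∘ₗ φ) = 0 := by
  rw [insertOdd_eq, augT_conv, augT_conv, augT_letter_comp, conv_zero_left, conv_zero_right]

theorem unletter_insertOdd : unletter W ∘ₗ insertOdd W (letter W ∘ₗ φ) = φ := by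
  have hδ := isCoalg_deconcat W
  rw [insertOdd_eq, unletter_conv, augT_conv, augT_letter_comp, conv_zero_left, conv_zero_right,
    zero_add, augT_sp, conv_counit_left hδ (by simp), unletter_conv, augT_letter_comp,
    conv_zero_left, add_zero, LinearMap.comp_id, conv_counit_right hδ (by simp)]
  exact LinearMap.ext fun x => unletter_letter _

theorem isDeg_insertOdd_letter (hφ : GrMod.IsDeg (V := W.T) φ (-1)) :
    GrMod.IsDeg (V := W.T) (W := W.T) (insertOdd W (letter W ∘ₗ φ)) (-1) := by
  have hμ : GrMod.IsDeg (V := W.T.tensor W.T) (W := W.T) (concat W) 0 := fun n x hx => by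
    rw [add_zero]
    refine GrMod.tensorDeg_mem (f := concat W) (fun p q hpq a ha b hb => ?_) hx
    exact GrMod.mem_of_eq (mul_memT ha hb) hpq
  have h1 : GrMod.IsDeg (V := W.T) (W := W.T) (letter W ∘ₗ φ) (-1) :=
    fun n x hx => letter_mem (hφ n x hx)
  have h2 := isDeg_conv (isDeg_deconcat W) hμ h1 (isDeg_id (V := W.T))
  have h3 := isDeg_conv (isDeg_deconcat W) hμ (f := W.T.sp 1) (s := 0)
    (fun n a ha => by rw [add_zero]; exact W.T.sp_mem 1 ha) h2
  rw [insertOdd_eq]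
  rw [add_zero, zero_add] at h3
  exact h3

end Coderivation

section Bar

variable (A : AugMod.{u, v} R) (mul : A.toGrMod ⊗[R] A.toGrMod →ₗ[R] A.toGrMod)

/-- The twisting map `B A → A`, `s a ↦ a`, zero on words of length `≠ 1`. -/
def AugMod.tw : (A.susp 1).T →ₗ[R] A.toGrMod := A.outS 1 ∘ₗ unletter (A.susp 1)

theorem AugMod.isDeg_tw : GrMod.IsDeg (V := (A.susp 1).T) (W := A.toGrMod) A.tw (-1) := fun n x hx => by
  have := A.isDeg_outS 1 _ _ (isDeg_unletter n x hx)
  rwa [add_zero] at this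

theorem AugMod.counit_tw : A.counit ∘ₗ A.tw = 0 := LinearMap.ext fun _ => A.counit_outS _ _

theorem AugMod.tw_one : A.tw (1 : TensorAlgebra R (A.susp 1)) = 0 := by
  rw [AugMod.tw, LinearMap.comp_apply, unletter_one, map_zero]

theorem AugMod.tw_letter (a : A.susp 1) : A.tw (letter (A.susp 1) a) = A.outS 1 a := by
  rw [AugMod.tw, LinearMap.comp_apply, unletter_letter]

theorem AugMod.sp_tw : A.toGrMod.sp 1 ∘ₗ A.tw = -(A.tw ∘ₗ (A.susp 1).T.sp 1) := by
  rw [A.isDeg_tw.sp_comp]; simp [sg]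

variable {A mul}

theorem counit_conv_tw (h : IsDGAlgebra A mul) {K K₁ K₂ : Type*} [AddCommGroup K] [AddCommGroup K₁]
    [AddCommGroup K₂] [Module R K] [Module R K₁] [Module R K₂] (cm : K →ₗ[R] K₁ ⊗[R] K₂)
    (f : K₁ →ₗ[R] A.toGrMod) (g : K₂ →ₗ[R] A.toGrMod) (hf : A.counit ∘ₗ f = 0) :
    A.counit ∘ₗ conv cm mul f g = 0 := by
  have h1 : A.counit ∘ₗ mul = LinearMap.mul' R R ∘ₗ TensorProduct.map A.counit A.counit :=
    TensorProduct.ext' fun x y => h.counit_mul x y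
  rw [comp_conv, h1, ← conv_comp_out, hf, conv_zero_left]

theorem outS_barCogen (h : IsDGAlgebra A mul) : A.outS 1 ∘ₗ barCogen A mul =
    -(A.d ∘ₗ A.tw) + conv (deconcat (A.susp 1)) mul (A.tw ∘ₗ (A.susp 1).T.sp 1) A.tw := by
  have h1 : A.outS 1 ∘ₗ (A.susp 1).sgn ∘ₗ unletter (A.susp 1) = A.tw ∘ₗ (A.susp 1).T.sp 1 := by
    rw [GrMod.sgn_eq, AugMod.tw, LinearMap.comp_assoc, isDeg_unletter.sp_comp_zero]
  refine LinearMap.ext fun x => ?_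
  simp only [barCogen, h1, LinearMap.comp_apply, LinearMap.add_apply, LinearMap.neg_apply, map_add,
    map_neg]
  rw [A.outS_inS, A.outS_inS]
  have h2 : A.counit (A.d (A.outS 1 (unletter (A.susp 1) x))) = 0 := LinearMap.congr_fun h.counit_d _
  have h3 := LinearMap.congr_fun (counit_conv_tw h (deconcat (A.susp 1))
    (A.tw ∘ₗ (A.susp 1).T.sp 1) A.tw
    (by rw [← LinearMap.comp_assoc, A.counit_tw, LinearMap.zero_comp])) x
  have h4 : A.counit (mul (TensorProduct.map (A.tw ∘ₗ (A.susp 1).T.sp 1) A.tw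
    (deconcat (A.susp 1) x))) = 0 := h3
  rw [h2, zero_smul, sub_zero]
  congr 1
  refine Eq.trans ?_ (sub_zero _)
  rw [← zero_smul R A.one, ← h4]
  rfl

theorem IsDGAlgebra.d_conv (h : IsDGAlgebra A mul) {K K₁ K₂ : Type*} [AddCommGroup K]
    [AddCommGroup K₁] [AddCommGroup K₂] [Module R K] [Module R K₁] [Module R K₂]
    (cm : K →ₗ[R] K₁ ⊗[R] K₂) (f : K₁ →ₗ[R] A.toGrMod) (g : K₂ →ₗ[R] A.toGrMod) :
    A.d ∘ₗ conv cm mul f g = conv cm mul (A.d ∘ₗ f) g +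
      conv cm mul (A.toGrMod.sp 1 ∘ₗ f) (A.d ∘ₗ g) := by
  rw [comp_conv, h.d_mul, AugMod.tensorD, GrMod.sgn_eq, conv_comp_out]
  conv_rhs => enter [1]; rw [← LinearMap.id_comp g, conv_comp_out]
  rw [LinearMap.comp_add]
  simp only [conv, LinearMap.add_comp]
  rfl

theorem bar_d_conv {K₁ K₂ K : Type*} [AddCommGroup K] [AddCommGroup K₁]
    [AddCommGroup K₂] [Module R K] [Module R K₁] [Module R K₂] (mu : K₁ ⊗[R] K₂ →ₗ[R] K)
    (f : (A.susp 1).T →ₗ[R] K₁) (g : (A.susp 1).T →ₗ[R] K₂) :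
    conv (deconcat (A.susp 1)) mu f g ∘ₗ (bar A mul).d =
      conv (deconcat (A.susp 1)) mu (f ∘ₗ (bar A mul).d) g +
      conv (deconcat (A.susp 1)) mu (f ∘ₗ (A.susp 1).T.sp 1) (g ∘ₗ (bar A mul).d) := by
  have h : deconcat (A.susp 1) ∘ₗ (bar A mul).d = _ := deconcat_insertOdd _
  rw [conv_comp, h, LinearMap.add_comp, conv_comp_left, conv_comp_comp]
  simp only [conv, LinearMap.comp_add]

theorem tw_bar_d (h : IsDGAlgebra A mul) : A.tw ∘ₗ (bar A mul).d =
    -(A.d ∘ₗ A.tw) + conv (deconcat (A.susp 1)) mul (A.tw ∘ₗ (A.susp 1).T.sp 1) A.tw := by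
  have h1 : unletter (A.susp 1) ∘ₗ (bar A mul).d = barCogen A mul := unletter_insertOdd _
  rw [AugMod.tw, LinearMap.comp_assoc, h1, outS_barCogen h]
  rfl

theorem isDeg_barCogen (h : IsDGAlgebra A mul) :
    GrMod.IsDeg (V := (A.susp 1).T) (W := A.susp 1) (barCogen A mul) (-1) := by
  intro n x hx
  have h1 : A.outS 1 (barCogen A mul x) ∈ A.deg (n + -1 - 1) := by
    rw [← LinearMap.comp_apply, outS_barCogen h]
    have ht := A.isDeg_tw
    refine add_mem (neg_mem (h.d_mem _ _ (ht n x hx))) ?_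
    refine GrMod.tensorDeg_mem (f := mul ∘ₗ TensorProduct.map (A.tw ∘ₗ (A.susp 1).T.sp 1) A.tw) ?_
      (by simpa using isDeg_deconcat (A.susp 1) n x hx)
    intro p q hpq a ha b hb
    refine GrMod.mem_of_eq (h.mul_mem _ _ _ (ht p _ ((A.susp 1).T.sp_mem 1 ha)) _ (ht q b hb)) (by lia)
  exact h1

theorem bar_d_sq (h : IsDGAlgebra A mul) : (bar A mul).d ∘ₗ (bar A mul).d = 0 := by
  have hδ := isCoalg_deconcat (A.susp 1)
  have hdeg : GrMod.IsDeg (V := (A.susp 1).T) (W := (A.susp 1).T) (bar A mul).d (-1) :=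
    isDeg_insertOdd_letter _ (isDeg_barCogen h)
  have hD : deconcat (A.susp 1) ∘ₗ (bar A mul).d = _ := deconcat_insertOdd _
  have hsp : (A.susp 1).T.sp 1 ∘ₗ (bar A mul).d = -((bar A mul).d ∘ₗ (A.susp 1).T.sp 1) := by
    rw [hdeg.sp_comp]; simp [sg]
  refine coderivation_ext (cm := deconcat (A.susp 1)) (f := LinearMap.id) (g := LinearMap.id) ?_ ?_ ?_
  · rw [← LinearMap.comp_assoc, hD, LinearMap.comp_assoc, hD, ← LinearMap.comp_assoc]
    congr 1
    change (LinearMap.rTensor _ (bar A mul).d + TensorProduct.map _ (bar A mul).d) ∘ₗ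
      (LinearMap.rTensor _ (bar A mul).d + TensorProduct.map _ (bar A mul).d) = _
    refine TensorProduct.ext' fun x y => ?_
    have e := LinearMap.congr_fun hsp x
    simp only [LinearMap.comp_apply, LinearMap.neg_apply] at e
    simp only [LinearMap.comp_apply, LinearMap.add_apply, LinearMap.rTensor_tmul, map_add,
      TensorProduct.map_tmul, LinearMap.id_apply, e, TensorProduct.neg_tmul]
    rw [GrMod.sp_self]
    abel
  · have key : A.tw ∘ₗ (bar A mul).d ∘ₗ (bar A mul).d = 0 := by
      have e1 : A.toGrMod.sp 1 ∘ₗ A.tw ∘ₗ (A.susp 1).T.sp 1 = - A.tw := by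
        rw [← LinearMap.comp_assoc, A.sp_tw, LinearMap.neg_comp, LinearMap.comp_assoc, GrMod.sp_comp,
          GrMod.sp_congr (n := 0) (by decide), GrMod.sp_zero, LinearMap.comp_id]
      have e2 : (A.tw ∘ₗ (A.susp 1).T.sp 1) ∘ₗ (A.susp 1).T.sp 1 = A.tw := by
        rw [LinearMap.comp_assoc, GrMod.sp_comp,
          GrMod.sp_congr (n := 0) (by decide), GrMod.sp_zero, LinearMap.comp_id]
      have e3 : (A.tw ∘ₗ (A.susp 1).T.sp 1) ∘ₗ (bar A mul).d = A.d ∘ₗ A.tw ∘ₗ (A.susp 1).T.sp 1 -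
          conv (deconcat (A.susp 1)) mul A.tw (A.tw ∘ₗ (A.susp 1).T.sp 1) := by
        rw [LinearMap.comp_assoc, hsp, LinearMap.comp_neg, ← LinearMap.comp_assoc, tw_bar_d h,
          LinearMap.add_comp, conv_comp, comul_sp (isDeg_deconcat _), ← conv_comp_comp, e2]
        simp only [LinearMap.neg_comp, LinearMap.comp_assoc]
        abel
      rw [← LinearMap.comp_assoc, tw_bar_d h, LinearMap.add_comp, LinearMap.neg_comp,
        LinearMap.comp_assoc, tw_bar_d h, bar_d_conv, e2, e3, tw_bar_d h, LinearMap.comp_add,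
        LinearMap.comp_neg, ← LinearMap.comp_assoc A.tw, h.d_d, LinearMap.zero_comp, h.d_conv, e1,
        conv_sub_left, conv_add_right, hδ.conv_assoc h.mul_assoc, conv_neg_left, conv_neg_right]
      abel
    refine LinearMap.ext fun x => A.outS_injective 1 ?_
    exact (LinearMap.congr_fun key x).trans (map_zero _).symm
  · rw [← LinearMap.comp_assoc, augT_insertOdd_letter, LinearMap.zero_comp]

theorem isDGCoalgebra_bar (h : IsDGAlgebra A mul) :
    IsDGCoalgebra (bar A mul) (deconcat (A.susp 1)) where
  d_mem n a ha := isDeg_insertOdd_letter _ (isDeg_barCogen h) n a ha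
  d_d := bar_d_sq h
  d_one := by
    change insertOdd _ _ (1 : TensorAlgebra R (A.susp 1)) = 0
    have h1 : A.outS 1 (barCogen A mul (1 : TensorAlgebra R (A.susp 1))) = 0 := by
      rw [← LinearMap.comp_apply, outS_barCogen h, LinearMap.add_apply, LinearMap.neg_apply,
        LinearMap.comp_apply, A.tw_one, conv_deconcat_one, A.tw_one, TensorProduct.tmul_zero]
      simp
    rw [insertOdd_eq, conv_deconcat_one, conv_deconcat_one, LinearMap.comp_apply,
      A.outS_injective 1 (h1.trans (map_zero _).symm)]
    simp
  counit_d := augT_insertOdd_letter _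
  comul_mem n a ha := by simpa using isDeg_deconcat (A.susp 1) n a ha
  coassoc := (isCoalg_deconcat _).coassoc
  counit_comul := (isCoalg_deconcat _).counit_left
  comul_counit := (isCoalg_deconcat _).counit_right
  comul_d := by
    rw [AugMod.tensorD, GrMod.sgn_eq]
    exact deconcat_insertOdd _
  comul_one := deconcat_one

end Bar

/-! ## The diagonal action -/

section DiagonalAct

variable {H : AugMod.{u, v} R} {mul : H.toGrMod ⊗[R] H.toGrMod →ₗ[R] H.toGrMod}
  {comul : H.toGrMod →ₗ[R] H.toGrMod ⊗[R] H.toGrMod}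

local notation "ΩH" => TensorAlgebra R (H.susp (-1))

section General

variable {cm : H.toGrMod →ₗ[R] H.toGrMod ⊗[R] H.toGrMod} {f : H.toGrMod →ₗ[R] H.toGrMod}

variable (mul cm f)

theorem diagonalAct_one : diagonalAct H mul cm f (1 : ΩH) =
    cst H.counit (1 : ΩH) := by
  rw [diagonalAct, foldLeft_one]
  exact LinearMap.ext fun a => unitT_apply _

/-- The action on a word of length one. -/
def letterAct (b : H.susp (-1)) : H.toGrMod →ₗ[R] (H.susp (-1)).T :=
  H.ell ∘ₗ mulR mul (H.outS (-1) b) ∘ₗ f ∘ₗ H.toGrMod.sp 1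

theorem diagonalAct_cons {n : ℤ} {b : H.susp (-1)} (hb : b ∈ (H.susp (-1)).deg n)
    (x : ΩH) :
    diagonalAct H mul cm f (letter (H.susp (-1)) b * x : ΩH) =
      conv cm (concat _) (letterAct mul f b) (diagonalAct H mul cm f x ∘ₗ H.toGrMod.sp n) := by
  have h : diagonalAct H mul cm f (letter (H.susp (-1)) b * x : ΩH) = _ :=
    foldLeft_cons _ _ _ b x
  rw [h]
  change concat _ ∘ₗ LinearMap.lTensor _ (diagonalAct H mul cm f x) ∘ₗ _ = _
  refine LinearMap.ext fun a => ?_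
  simp only [LinearMap.comp_apply, LinearMap.flip_apply, TensorProduct.mk_apply,
    LinearMap.rTensor_tmul, conv_apply]
  generalize cm a = z
  induction z using TensorProduct.induction_on with
  | zero => simp
  | add a b ha hb => simp only [map_add, TensorProduct.add_tmul, ha, hb]
  | tmul c e =>
    simp only [LinearEquiv.coe_coe, TensorProduct.assoc_tmul, LinearMap.lTensor_tmul]
    rw [GrMod.koszul_right _ hb]
    simp only [TensorProduct.assoc_symm_tmul, LinearMap.rTensor_tmul, LinearMap.lTensor_tmul]
    rw [GrMod.sgn_eq]
    rfl

variable {mul cm f}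

theorem letterAct_inS (h : IsDGAlgebra H mul) (a b : H.toGrMod) : letterAct mul f (H.inS (-1) b) a =
    H.ell (mul (f (H.toGrMod.sp 1 a) ⊗ₜ b)) - H.counit b • H.ell (f (H.toGrMod.sp 1 a)) := by
  rw [letterAct]
  simp only [LinearMap.comp_apply, LinearMap.flip_apply, TensorProduct.mk_apply, H.outS_inS]
  rw [TensorProduct.tmul_sub, map_sub, map_sub, TensorProduct.tmul_smul, map_smul, map_smul, h.mul_one]

theorem letterAct_mem (h : IsDGAlgebra H mul) (hf : GrMod.IsDeg (V := H.toGrMod) f 0) {m n : ℤ}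
    {b : H.susp (-1)} (hb : b ∈ (H.susp (-1)).deg n) {a : H.toGrMod} (ha : a ∈ H.deg m) :
    letterAct mul f b a ∈ (H.susp (-1)).T.deg (m + n) := by
  have := h.mul_mem _ _ _ (hf _ _ (H.toGrMod.sp_mem 1 ha)) _ (H.isDeg_outS (-1) n b hb)
  exact GrMod.mem_of_eq (H.isDeg_ell _ _ this) (by ring)

theorem diagonalAct_letter (hc : IsCoalg cm H.counit) (b : H.susp (-1)) :
    diagonalAct H mul cm f (letter (H.susp (-1)) b) = letterAct mul f b := by
  induction b using GrMod.homogeneous_induction with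
  | zero =>
    rw [map_zero, map_zero]
    simp [letterAct, mulR]
  | add b b' h h' =>
    rw [map_add, map_add, h, h']
    simp [letterAct, mulR, LinearMap.comp_add, LinearMap.add_comp]
  | hom n b hb =>
    have h := diagonalAct_cons mul cm f hb (1 : ΩH)
    rw [mul_one, diagonalAct_one, cst_comp, H.counit_sp, hc.conv_cst] at h
    rw [h]
    exact LinearMap.ext fun a => mul_one (M := ΩH) _

theorem diagonalAct_mul (hc : IsCoalg cm H.counit)
    (hcm : GrMod.IsDeg (V := H.toGrMod) (W := H.toGrMod.tensor H.toGrMod) cm 0) {n : ℤ}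
    {x : ΩH} (hx : x ∈ (H.susp (-1)).T.deg n)
    (y : ΩH) :
    diagonalAct H mul cm f (x * y : ΩH) =
      conv cm (concat _) (diagonalAct H mul cm f x) (diagonalAct H mul cm f y ∘ₗ H.toGrMod.sp n) := by
  refine word_induction (V := H.susp (-1)) (P := fun n x =>
    diagonalAct H mul cm f (x * y : ΩH) =
      conv cm (concat _) (diagonalAct H mul cm f x) (diagonalAct H mul cm f y ∘ₗ H.toGrMod.sp n))
    ?_ ?_ ?_ ?_ ?_ n x hx
  · rw [one_mul, diagonalAct_one, hc.cst_conv, GrMod.sp_zero, LinearMap.comp_id]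
    exact LinearMap.ext fun a => (one_mul (M := ΩH) _).symm
  · intro p q b x hb hx ih
    rw [mul_assoc, diagonalAct_cons mul cm f hb, ih, diagonalAct_cons mul cm f hb, conv_comp,
      comul_sp hcm, ← conv_comp_comp, hc.conv_assoc (concat_assoc _), LinearMap.comp_assoc,
      GrMod.sp_comp, add_comm q p]
  · intro m
    rw [zero_mul, map_zero, conv_zero_left]
  · intro m x x' h h'
    rw [add_mul, map_add, map_add, h, h', conv_add_left]
  · intro m r x h
    rw [smul_mul_assoc, map_smul, map_smul, h, conv_smul_left]

theorem diagonalAct_mem (h : IsDGAlgebra H mul) (hf : GrMod.IsDeg (V := H.toGrMod) f 0)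
    (hcm : GrMod.IsDeg (V := H.toGrMod) (W := H.toGrMod.tensor H.toGrMod) cm 0) {n : ℤ}
    {x : ΩH} (hx : x ∈ (H.susp (-1)).T.deg n) :
    GrMod.IsDeg (V := H.toGrMod) (W := (H.susp (-1)).T) (diagonalAct H mul cm f x) n := by
  refine word_induction (V := H.susp (-1)) (P := fun n x =>
    GrMod.IsDeg (V := H.toGrMod) (W := (H.susp (-1)).T) (diagonalAct H mul cm f x) n)
    ?_ ?_ ?_ ?_ ?_ n x hx
  · rw [diagonalAct_one]
    exact isDeg_cst (X := (H.susp (-1)).T) H.counit_eq_zero one_memT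
  · intro p q b x hb hx ih m a ha
    rw [diagonalAct_cons mul cm f hb]
    refine GrMod.tensorDeg_mem (f := concat _ ∘ₗ TensorProduct.map (letterAct mul f b)
      (diagonalAct H mul cm f x ∘ₗ H.toGrMod.sp p)) ?_ (by simpa using hcm m a ha)
    intro i j hij c hc e he
    exact GrMod.mem_of_eq (mul_memT (letterAct_mem h hf hb hc) (ih _ _ (H.toGrMod.sp_mem p he)))
      (by lia)
  · intro m k a ha
    rw [map_zero]; exact zero_mem _
  · intro m x y hx hy k a ha
    rw [map_add]; exact add_mem (hx k a ha) (hy k a ha)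
  · intro m r x hx k a ha
    rw [map_smul]; exact Submodule.smul_mem _ _ (hx k a ha)

end General

variable (mul comul) in
/-- The diagonal action `a ⋄ x`. -/
abbrev dact : (H.susp (-1)).T →ₗ[R] H.toGrMod →ₗ[R] (H.susp (-1)).T :=
  diagonalAct H mul comul LinearMap.id

section Bialgebra

variable (hb : IsDGBialgebra H mul comul)
include hb

theorem dact_mul {n : ℤ} {x : ΩH} (hx : x ∈ (H.susp (-1)).T.deg n)
    (y : ΩH) :
    dact mul comul (x * y : ΩH) =
      conv comul (concat _) (dact mul comul x) (dact mul comul y ∘ₗ H.toGrMod.sp n) :=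
  diagonalAct_mul hb.isCoalg hb.toIsDGCoalgebra.isDeg hx y

theorem dact_isDeg {n : ℤ} {x : ΩH} (hx : x ∈ (H.susp (-1)).T.deg n) :
    GrMod.IsDeg (V := H.toGrMod) (W := (H.susp (-1)).T) (dact mul comul x) n :=
  diagonalAct_mem hb.toIsDGAlgebra isDeg_id hb.toIsDGCoalgebra.isDeg hx

theorem dact_ell (a b : H.toGrMod) : dact mul comul (H.ell b) a =
    H.ell (mul (H.toGrMod.sp 1 a ⊗ₜ b)) - H.counit b • H.ell (H.toGrMod.sp 1 a) := by
  rw [AugMod.ell, LinearMap.comp_apply, dact, diagonalAct_letter hb.isCoalg,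
    letterAct_inS hb.toIsDGAlgebra]
  rfl

theorem dact_jay (a b : H.toGrMod) : dact mul comul (H.jay b) a =
    H.jay (mul (a ⊗ₜ b)) - H.counit b • H.jay a := by
  rw [AugMod.jay, LinearMap.comp_apply, dact_ell hb, LinearMap.comp_apply, LinearMap.comp_apply,
    hb.sp_mul]
  have := LinearMap.congr_fun (H.counit_sp 1) b
  rw [LinearMap.comp_apply] at this
  rw [this]

theorem dact_unit (x : ΩH) : dact mul comul x H.one = x := by
  induction x using word_induction' with
  | one => rw [dact, diagonalAct_one, cst_apply, H.counit_one, one_smul]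
  | cons m n b x hv hx ih =>
    rw [dact_mul hb (letter_mem hv), conv_apply, hb.comul_one, TensorProduct.map_tmul,
      LinearMap.comp_apply, H.sp_one, ih, concat_tmul, H.letter_eq, dact_ell hb, H.sp_one, hb.one_mul,
      H.ell_one, smul_zero, sub_zero]
  | zero => simp
  | add x y hx hy => simp only [map_add, LinearMap.add_apply, hx, hy]
  | smul r x hx => simp only [map_smul, LinearMap.smul_apply, hx]

theorem comul_mul_apply (a b : H.toGrMod) :
    comul (mul (a ⊗ₜ b)) = mulTwo mul (comul a ⊗ₜ comul b) :=
  LinearMap.congr_fun hb.comul_mul (a ⊗ₜ b)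

theorem dact_dact (x : ΩH) (a b : H.toGrMod) :
    dact mul comul x (mul (a ⊗ₜ b)) = dact mul comul (dact mul comul x b) a := by
  induction x using word_induction' generalizing a b with
  | one =>
    rw [dact, diagonalAct_one, cst_apply, cst_apply, map_smul, LinearMap.smul_apply,
      diagonalAct_one, cst_apply, hb.counit_mul, mul_smul, smul_comm]
  | cons n m u x hu hx ih =>
    have h1 : ∀ a b, dact mul comul (letter _ u) (mul (a ⊗ₜ b)) =
        dact mul comul (dact mul comul (letter _ u) b) a := by
      intro a b
      rw [H.letter_eq, dact_ell hb, dact_ell hb, H.counit_outS, zero_smul, zero_smul, sub_zero,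
        sub_zero, dact_ell hb, hb.counit_mul, H.counit_outS, mul_zero, zero_smul, sub_zero, hb.sp_mul,
        hb.mul_assoc]
    rw [dact_mul hb (letter_mem hu), conv_apply, conv_apply, comul_mul_apply hb]
    generalize comul b = z
    induction z using GrMod.tensor_induction with
    | zero => simp
    | add z z' h h' => simp only [map_add, TensorProduct.tmul_add, LinearMap.add_apply, h, h']
    | hom k l b₁ hb₁ b₂ hb₂ =>
      rw [TensorProduct.map_tmul, concat_tmul, dact_mul hb (dact_isDeg hb (letter_mem hu) k b₁ hb₁),
        conv_apply]
      generalize comul a = y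
      induction y using TensorProduct.induction_on with
      | zero => simp
      | add z z' h h' => simp only [map_add, TensorProduct.add_tmul, h, h']
      | tmul a₁ a₂ =>
        rw [mulTwo, LinearMap.comp_apply, middleSwap_tmul _ _ _ hb₁, TensorProduct.map_tmul,
          TensorProduct.map_tmul, TensorProduct.map_tmul, concat_tmul, concat_tmul, h1,
          LinearMap.comp_apply, LinearMap.comp_apply, LinearMap.comp_apply, hb.sp_mul, ih,
          GrMod.sp_sp, add_comm k n]
  | zero => simp
  | add x y hx hy => simp only [map_add, LinearMap.add_apply, hx, hy]
  | smul r x hx => simp only [map_smul, LinearMap.smul_apply, hx]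

/-- The action through the antipode. -/
theorem diagonalAct_cop_antipode {S : H.toGrMod →ₗ[R] H.toGrMod} (hS : IsAntipode H mul comul S)
    (x : ΩH) :
    diagonalAct H mul (koszul H.toGrMod H.toGrMod ∘ₗ comul) S x = dact mul comul x ∘ₗ S := by
  induction x using word_induction' with
  | one => rw [diagonalAct_one, dact, diagonalAct_one, cst_comp, hS.counit hb]
  | cons n m u x hu hx ih =>
    have h1 : letterAct mul S u = letterAct mul LinearMap.id u ∘ₗ S := by
      rw [letterAct, ← hS.sp]; rfl
    rw [diagonalAct_cons _ _ _ hu, ih, h1, dact, diagonalAct_cons _ _ _ hu, conv_comp,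
      hS.anticomul hb, LinearMap.comp_assoc, ← hS.sp, ← LinearMap.comp_assoc, conv_comp_comp]
  | zero => simp
  | add x y hx hy => simp only [map_add, LinearMap.add_comp, hx, hy]
  | smul r x hx => simp only [map_smul, LinearMap.smul_comp, hx]

end Bialgebra

end DiagonalAct

/-! ## The differential of the diagonal action -/

section DAct

variable {H : AugMod.{u, v} R} {mul : H.toGrMod ⊗[R] H.toGrMod →ₗ[R] H.toGrMod}
  {comul : H.toGrMod →ₗ[R] H.toGrMod ⊗[R] H.toGrMod}

theorem AugMod.outS_comp_inS (A : AugMod.{u, v} R) (r : ℤ) :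
    A.outS r ∘ₗ A.inS r = LinearMap.id - cst A.counit A.one := rfl

theorem IsDGCoalgebra.reduced_comul (h : IsDGCoalgebra H comul) {b : H.toGrMod}
    (hb : H.counit b = 0) :
    TensorProduct.map (H.outS (-1) ∘ₗ H.inS (-1)) (H.outS (-1) ∘ₗ H.inS (-1)) (comul b) =
      comul b - H.one ⊗ₜ b - b ⊗ₜ H.one := by
  have h1 : conv comul LinearMap.id (H.outS (-1) ∘ₗ H.inS (-1)) (H.outS (-1) ∘ₗ H.inS (-1)) b =
      comul b - H.one ⊗ₜ b - b ⊗ₜ H.one := by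
    rw [H.outS_comp_inS, conv_sub_left, conv_sub_right, h.isCoalg.conv_cst, h.isCoalg.cst_conv,
      LinearMap.sub_apply, LinearMap.sub_apply]
    have e : ∀ a, conv comul LinearMap.id LinearMap.id LinearMap.id a = comul a := fun a => by
      rw [conv_apply, TensorProduct.map_id]; rfl
    simp only [LinearMap.comp_apply, LinearMap.sub_apply, LinearMap.id_apply, LinearMap.flip_apply,
      TensorProduct.mk_apply, cst_apply, hb, zero_smul, sub_zero, e]
    abel
  exact h1

theorem sg_self (n : ℤ) {M : Type*} [AddCommGroup M] [Module R M] (x : M) :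
    sg R n • sg R n • x = x := by rw [smul_smul, sg_mul_self, one_smul]

variable (hb : IsDGBialgebra H mul comul)
include hb

theorem dact_ell_mul_jay (z : H.toGrMod ⊗[R] H.toGrMod) (a : H.toGrMod) :
    dact mul comul (concat _ (TensorProduct.map H.ell H.jay z)) (H.toGrMod.sp 1 a) =
      concat _ (TensorProduct.map H.ell H.jay (mulTwo mul (comul a ⊗ₜ TensorProduct.map
        (H.outS (-1) ∘ₗ H.inS (-1)) (H.outS (-1) ∘ₗ H.inS (-1)) z))) := by
  have hc : comul (H.toGrMod.sp 1 a) =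
      TensorProduct.map (H.toGrMod.sp 1) (H.toGrMod.sp 1) (comul a) :=
    LinearMap.congr_fun (hb.toIsDGCoalgebra.comul_sp 1) a
  induction z using GrMod.tensor_induction with
  | zero => simp
  | add z z' h h' => simp only [map_add, TensorProduct.tmul_add, LinearMap.add_apply, h, h']
  | hom k l b₁ hb₁ b₂ hb₂ =>
    have hπ : (H.outS (-1) ∘ₗ H.inS (-1)) b₁ ∈ H.deg k :=
      GrMod.mem_of_eq (V := H.toGrMod) (H.isDeg_outS (-1) _ _ (H.isDeg_inS (-1) k b₁ hb₁)) (by ring)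
    have e1 : ∀ b a, dact mul comul (H.ell b) (H.toGrMod.sp 1 a) =
        H.ell (mul (a ⊗ₜ (H.outS (-1) ∘ₗ H.inS (-1)) b)) := fun b a => by
      rw [dact_ell hb, LinearMap.comp_apply, H.outS_inS, GrMod.sp_self, TensorProduct.tmul_sub,
        TensorProduct.tmul_smul, map_sub, map_sub, map_smul, map_smul, hb.mul_one]
    have e2 : ∀ b a, dact mul comul (H.jay b) a =
        H.jay (mul (a ⊗ₜ (H.outS (-1) ∘ₗ H.inS (-1)) b)) := fun b a => by
      rw [dact_jay hb, LinearMap.comp_apply, H.outS_inS, TensorProduct.tmul_sub,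
        TensorProduct.tmul_smul, map_sub, map_sub, map_smul, map_smul, hb.mul_one]
    rw [TensorProduct.map_tmul, concat_tmul, TensorProduct.map_tmul,
      dact_mul hb (H.isDeg_ell k b₁ hb₁), conv_apply, hc]
    generalize comul a = y
    induction y using TensorProduct.induction_on with
    | zero => simp
    | add z z' h h' => simp only [map_add, TensorProduct.add_tmul, h, h']
    | tmul a₁ a₂ =>
      rw [mulTwo, LinearMap.comp_apply, middleSwap_tmul _ _ _ hπ, TensorProduct.map_tmul,
        TensorProduct.map_tmul, TensorProduct.map_tmul, TensorProduct.map_tmul, concat_tmul,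
        concat_tmul, LinearMap.comp_apply, e1, e2, GrMod.sp_sp,
        show k + -1 + 1 = k by ring]

theorem d_dact_jay {q : ℤ} {b : H.toGrMod} (hbq : b ∈ H.deg (q + 1)) (h0 : H.counit b = 0) :
    (cobar H comul).d ∘ₗ dact mul comul (H.jay b) =
      dact mul comul (H.jay b) ∘ₗ H.d + dact mul comul ((cobar H comul).d (H.jay b)) ∘ₗ
          H.toGrMod.sp 1 +
        conv comul (concat _) H.ell (dact mul comul (H.jay b)) -
        sg R q • conv comul (concat _) (dact mul comul (H.jay b) ∘ₗ H.toGrMod.sp 1)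
          (H.ell ∘ₗ H.toGrMod.sp q) := by
  have hj : ∀ a, (cobar H comul).d (H.jay a) = H.jay (H.d a) +
      concat _ (TensorProduct.map H.ell H.jay (comul a)) :=
    fun a => LinearMap.congr_fun (cobar_d_jay hb.toIsDGCoalgebra) a
  have hd0 : H.counit (H.d b) = 0 := LinearMap.congr_fun hb.counit_d b
  refine LinearMap.ext fun a => ?_
  have hdm : H.d (mul (a ⊗ₜ b)) = mul (H.d a ⊗ₜ b) + mul (H.toGrMod.sp 1 a ⊗ₜ H.d b) := by
    have := LinearMap.congr_fun hb.d_mul (a ⊗ₜ b)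
    rw [AugMod.tensorD, GrMod.sgn_eq] at this
    simpa using this
  have hj0 : ∀ a, dact mul comul (H.jay b) a = H.jay (mul (a ⊗ₜ b)) := fun a => by
    rw [dact_jay hb, h0, zero_smul, sub_zero]
  have key : concat _ (TensorProduct.map H.ell H.jay (mulTwo mul (comul a ⊗ₜ (H.one ⊗ₜ b)))) +
      concat _ (TensorProduct.map H.ell H.jay (mulTwo mul (comul a ⊗ₜ (b ⊗ₜ H.one)))) =
      conv comul (concat _) H.ell (dact mul comul (H.jay b)) a -
        (sg R q • conv comul (concat _) (dact mul comul (H.jay b) ∘ₗ H.toGrMod.sp 1)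
          (H.ell ∘ₗ H.toGrMod.sp q)) a := by
    rw [LinearMap.smul_apply, conv_apply, conv_apply]
    generalize comul a = y
    induction y using TensorProduct.induction_on with
    | zero => simp
    | add z z' h h' =>
      simp only [map_add, TensorProduct.add_tmul, smul_add]
      rw [add_sub_add_comm, ← h, ← h']; abel
    | tmul a₁ a₂ =>
      have e1 : H.jay (mul (H.toGrMod.sp 1 a₁ ⊗ₜ b)) = sg R (q + 1) • H.ell (mul (a₁ ⊗ₜ b)) := by
        rw [AugMod.jay, LinearMap.comp_apply, hb.sp_mul, GrMod.sp_self, GrMod.sp_apply 1 hbq,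
          one_mul, TensorProduct.tmul_smul, map_smul, map_smul]
      have e2 : H.jay (H.toGrMod.sp (q + 1) a₂) = H.ell (H.toGrMod.sp q a₂) := by
        rw [AugMod.jay, LinearMap.comp_apply, GrMod.sp_sp, GrMod.sp_congr (n := q)]
        push_cast; generalize (q : ZMod 2) = x; revert x; decide
      rw [mulTwo, LinearMap.comp_apply, LinearMap.comp_apply, middleSwap_tmul _ _ _ H.one_mem,
        middleSwap_tmul _ _ _ hbq]
      simp only [TensorProduct.map_tmul, concat_tmul, hb.mul_one, GrMod.sp_zero, LinearMap.id_apply,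
        LinearMap.comp_apply, hj0, e1, e2]
      rw [← TensorProduct.smul_tmul', map_smul, smul_smul, sg_add, ← mul_assoc, sg_mul_self]
      simp
  have h3 := dact_ell_mul_jay hb (comul b) a
  rw [hb.toIsDGCoalgebra.reduced_comul h0, TensorProduct.tmul_sub, TensorProduct.tmul_sub, map_sub,
    map_sub, map_sub, map_sub, map_sub, map_sub] at h3
  rw [LinearMap.comp_apply, hj0, hj, hj b, comul_mul_apply hb, hdm, map_add, map_add]
  simp only [LinearMap.sub_apply, LinearMap.add_apply, LinearMap.comp_apply]
  rw [add_sub_assoc, ← key, h3, hj0, dact_jay hb, hd0, zero_smul, sub_zero]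
  abel

/-- The boundary of the diagonal action. -/
theorem d_dact {q : ℤ} {x : TensorAlgebra R (H.susp (-1))} (hx : x ∈ (H.susp (-1)).T.deg q) :
    (cobar H comul).d ∘ₗ dact mul comul x =
      dact mul comul x ∘ₗ H.d + dact mul comul ((cobar H comul).d x) ∘ₗ H.toGrMod.sp 1 +
        conv comul (concat _) H.ell (dact mul comul x) -
        sg R q • conv comul (concat _) (dact mul comul x ∘ₗ H.toGrMod.sp 1)
          (H.ell ∘ₗ H.toGrMod.sp q) := by
  have hcb := isDGAlgebra_cobar hb.toIsDGCoalgebra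
  have hC := hb.isCoalg
  refine word_induction (V := H.susp (-1)) (P := fun q x =>
    (cobar H comul).d ∘ₗ dact mul comul x =
      dact mul comul x ∘ₗ H.d + dact mul comul ((cobar H comul).d x) ∘ₗ H.toGrMod.sp 1 +
        conv comul (concat _) H.ell (dact mul comul x) -
        sg R q • conv comul (concat _) (dact mul comul x ∘ₗ H.toGrMod.sp 1)
          (H.ell ∘ₗ H.toGrMod.sp q)) ?_ ?_ ?_ ?_ ?_ q x hx
  · rw [cobar_d_one, map_zero, LinearMap.zero_comp, dact, diagonalAct_one, comp_cst, cobar_d_one,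
      cst_zero, hC.conv_cst, cst_comp, cst_comp, H.counit_sp, hC.cst_conv, hb.counit_d, sg_zero,
      one_smul, GrMod.sp_zero, LinearMap.comp_id]
    have e1 : mulL (concat (H.susp (-1))) (1 : TensorAlgebra R (H.susp (-1))) ∘ₗ H.ell = H.ell :=
      LinearMap.ext fun a => one_mul (M := TensorAlgebra R (H.susp (-1))) _
    have e2 : mulR (concat (H.susp (-1))) (1 : TensorAlgebra R (H.susp (-1))) ∘ₗ H.ell = H.ell :=
      LinearMap.ext fun a => mul_one (M := TensorAlgebra R (H.susp (-1))) _
    rw [e1, e2]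
    refine LinearMap.ext fun a => ?_
    simp [cst_apply]
  · intro p q v x hv hx ih
    have hbv : H.toGrMod.sp 1 (H.outS (-1) v) ∈ H.deg (p + 1) :=
      H.toGrMod.sp_mem 1 (GrMod.mem_of_eq (V := H.toGrMod) (H.isDeg_outS (-1) p v hv) (by ring))
    have hl : letter _ v = H.jay (H.toGrMod.sp 1 (H.outS (-1) v)) := by
      rw [H.letter_eq, AugMod.jay, LinearMap.comp_apply, GrMod.sp_self]
    have h0 : H.counit (H.toGrMod.sp 1 (H.outS (-1) v)) = 0 :=
      (LinearMap.congr_fun (H.counit_sp 1) _).trans (H.counit_outS _ _)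
    have h1 := d_dact_jay hb hbv h0
    rw [← hl] at h1
    have hv' : letter (H.susp (-1)) v ∈ (H.susp (-1)).T.deg p := letter_mem hv
    have hDv : (cobar H comul).d (letter (H.susp (-1)) v) ∈ (H.susp (-1)).T.deg (p - 1) :=
      hcb.d_mem p _ hv'
    generalize letter (H.susp (-1)) v = y at h1 hv' hDv ⊢
    have hσ := (dact_isDeg hb hv').sp_comp 1
    have hdsp : H.d ∘ₗ H.toGrMod.sp p = sg R p • (H.toGrMod.sp p ∘ₗ H.d) :=
      LinearMap.ext fun a => by
        simp only [LinearMap.comp_apply, LinearMap.smul_apply]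
        rw [hb.toIsDGModule.sp_d, sg_self]
    have hss : H.toGrMod.sp 1 ∘ₗ H.toGrMod.sp p = H.toGrMod.sp (p - 1) := by
      rw [GrMod.sp_comp]
      exact GrMod.sp_congr (by push_cast; generalize (p : ZMod 2) = x; revert x; decide)
    have hsc : H.toGrMod.sp 1 ∘ₗ H.toGrMod.sp p = H.toGrMod.sp p ∘ₗ H.toGrMod.sp 1 := by
      rw [GrMod.sp_comp, GrMod.sp_comp, add_comm]
    rw [one_mul] at hσ
    have hy1 : (H.susp (-1)).T.sp 1 y = sg R p • y := by
      rw [GrMod.sp_apply 1 hv', one_mul]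
    have e1 : (dact mul comul x ∘ₗ H.d) ∘ₗ H.toGrMod.sp p =
        sg R p • ((dact mul comul x ∘ₗ H.toGrMod.sp p) ∘ₗ H.d) := by
      rw [LinearMap.comp_assoc, hdsp, LinearMap.comp_smul]; rfl
    have e2 : (conv comul (concat _) H.ell (dact mul comul x)) ∘ₗ H.toGrMod.sp p =
        conv comul (concat _) (H.ell ∘ₗ H.toGrMod.sp p) (dact mul comul x ∘ₗ H.toGrMod.sp p) :=
      hb.toIsDGCoalgebra.conv_sp _ _ _ _
    have e4 : ∀ f : H.toGrMod →ₗ[R] (H.susp (-1)).T, (f ∘ₗ H.toGrMod.sp 1) ∘ₗ H.toGrMod.sp p =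
        (f ∘ₗ H.toGrMod.sp p) ∘ₗ H.toGrMod.sp 1 := fun f => by
      rw [LinearMap.comp_assoc, hsc, LinearMap.comp_assoc]
    have e3 : (conv comul (concat _) (dact mul comul x ∘ₗ H.toGrMod.sp 1)
          (H.ell ∘ₗ H.toGrMod.sp q)) ∘ₗ H.toGrMod.sp p =
        conv comul (concat _) ((dact mul comul x ∘ₗ H.toGrMod.sp p) ∘ₗ H.toGrMod.sp 1)
          (H.ell ∘ₗ H.toGrMod.sp (p + q)) := by
      rw [hb.toIsDGCoalgebra.conv_sp, e4, add_comm p q, ← GrMod.sp_comp]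
      rfl
    have e5 : (dact mul comul x ∘ₗ H.toGrMod.sp (p - 1)) ∘ₗ H.toGrMod.sp 1 =
        dact mul comul x ∘ₗ H.toGrMod.sp p := by
      rw [LinearMap.comp_assoc, GrMod.sp_comp, sub_add_cancel]
    rw [dact_mul hb hv', cobar_d_concat, h1, ← LinearMap.comp_assoc (H.toGrMod.sp p), ih, hσ,
      hb.toIsDGCoalgebra.conv_d, cobar_d_mul, hy1, map_add, smul_mul_assoc, map_smul,
      dact_mul hb hDv, dact_mul hb hv', LinearMap.add_comp, LinearMap.smul_comp,
      hb.toIsDGCoalgebra.conv_sp, hb.toIsDGCoalgebra.conv_sp, hb.toIsDGCoalgebra.conv_sp, e5]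
    simp only [LinearMap.add_comp, LinearMap.sub_comp, LinearMap.smul_comp, e1, e2, e3, e4]
    simp only [conv_add_left, conv_add_right, conv_sub_left, conv_sub_right, conv_smul_left,
      conv_smul_right, hC.conv_assoc (concat_assoc _), smul_add, smul_sub, sg_add,
      smul_smul, ← mul_assoc, sg_mul_self, one_mul, one_smul]
    rw [mul_comm (sg R q) (sg R p)]
    abel
  · intro m
    simp only [map_zero, LinearMap.comp_zero, LinearMap.zero_comp, conv_zero_left, conv_zero_right,
      smul_zero, add_zero, sub_zero]
  · intro m x y hx hy
    simp only [map_add, LinearMap.comp_add, LinearMap.add_comp, conv_add_left, conv_add_right,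
      smul_add, hx, hy]
    abel
  · intro m r x hx
    simp only [map_smul, LinearMap.comp_smul, LinearMap.smul_comp, conv_smul_left, conv_smul_right,
      hx, smul_add, smul_sub]
    rw [smul_comm r (sg R m)]

end DAct

/-! ## The brace operations -/

section Brace

variable {H : AugMod.{u, v} R} {mul : H.toGrMod ⊗[R] H.toGrMod →ₗ[R] H.toGrMod}
  {comul : H.toGrMod →ₗ[R] H.toGrMod ⊗[R] H.toGrMod}

local notation "ΩH" => TensorAlgebra R (H.susp (-1))

variable (H comul) in
/-- The letters `s a` of the bar construction of `Ω H`. -/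
abbrev barLetters : GrMod.{u, max u v} R := (cobar H comul).susp 1

/-- `(a ⊗ b) ⊗ (c ⊗ d) ↦ (-1)^{|b||c|} (a ⊗ c) ⊗ (b ⊗ d)`. -/
def midSwap (V : GrMod.{u, v} R) (W : GrMod.{u, w} R) :
    (V ⊗[R] V) ⊗[R] (W ⊗[R] W) →ₗ[R] (V ⊗[R] W) ⊗[R] (V ⊗[R] W) :=
  (TensorProduct.assoc R V W (V ⊗[R] W)).symm.toLinearMap ∘ₗ
    LinearMap.lTensor V ((TensorProduct.assoc R W V W).toLinearMap ∘ₗ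
      LinearMap.rTensor W (koszul V W) ∘ₗ (TensorProduct.assoc R V W W).symm.toLinearMap) ∘ₗ
    (TensorProduct.assoc R V V (W ⊗[R] W)).toLinearMap

theorem midSwap_tmul {V : GrMod.{u, v} R} {W : GrMod.{u, w} R} {n : ℤ} (a b : V) {c : W}
    (hc : c ∈ W.deg n) (d : W) :
    midSwap V W ((a ⊗ₜ b) ⊗ₜ (c ⊗ₜ d)) = (a ⊗ₜ c) ⊗ₜ (V.sp n b ⊗ₜ[R] d) := by
  simp only [midSwap, LinearMap.comp_apply, LinearEquiv.coe_coe, TensorProduct.assoc_tmul,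
    LinearMap.lTensor_tmul, TensorProduct.assoc_symm_tmul, LinearMap.rTensor_tmul]
  rw [GrMod.koszul_right _ hc]
  simp only [TensorProduct.assoc_tmul, TensorProduct.assoc_symm_tmul]

variable (mul comul) in
/-- The operator `x ↦ a ⋄ x`. -/
abbrev actOn (a : H.toGrMod) : (H.susp (-1)).T →ₗ[R] (H.susp (-1)).T :=
  (dact mul comul).flip a

theorem isDeg_actOn (hb : IsDGBialgebra H mul comul) {n : ℤ} {a : H.toGrMod} (ha : a ∈ H.deg n) :
    GrMod.IsDeg (V := (H.susp (-1)).T) (W := (H.susp (-1)).T) (actOn mul comul a) n := by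
  intro m x hx
  exact GrMod.mem_of_eq (dact_isDeg hb hx n a ha) (add_comm _ _)

variable (mul comul) in
theorem braceOp_one : braceOp H mul comul (1 : ΩH) =
    cst (augT (barLetters H comul)) (1 : ΩH) := by
  rw [braceOp, foldRight_one]
  exact LinearMap.ext fun a => unitT_apply _

variable (mul comul) in
/-- The operations `E_{1,k}` on one letter. -/
def braceLetter (v : H.susp (-1)) : (barLetters H comul).T →ₗ[R] (H.susp (-1)).T :=
  cst (augT (barLetters H comul)) (letter (H.susp (-1)) v) +
    actOn mul comul (H.toGrMod.sp 1 (H.outS (-1) v)) ∘ₗ (cobar H comul).tw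

variable (mul comul) in
theorem braceOp_snoc {n : ℤ} {v : H.susp (-1)} (hv : v ∈ (H.susp (-1)).deg n)
    (x : ΩH) :
    braceOp H mul comul (x * letter (H.susp (-1)) v : ΩH) =
      conv (deconcat (barLetters H comul)) (concat _)
        (braceOp H mul comul x ∘ₗ (barLetters H comul).T.sp n) (braceLetter mul comul v) := by
  have h : braceOp H mul comul (x * letter (H.susp (-1)) v : ΩH) = _ :=
    foldRight_snoc _ _ _ v x
  rw [h]
  change concat _ ∘ₗ LinearMap.rTensor _ (braceOp H mul comul x) ∘ₗ _ = _
  refine LinearMap.ext fun a => ?_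
  simp only [LinearMap.comp_apply, TensorProduct.mk_apply, LinearMap.lTensor_tmul, conv_apply]
  generalize deconcat _ a = z
  induction z using TensorProduct.induction_on with
  | zero => simp
  | add a b ha hb => simp only [map_add, TensorProduct.tmul_add, ha, hb]
  | tmul c e =>
    simp only [LinearEquiv.coe_coe, TensorProduct.assoc_symm_tmul, LinearMap.rTensor_tmul]
    rw [GrMod.koszul_left hv]
    simp only [TensorProduct.assoc_tmul, LinearMap.rTensor_tmul, LinearMap.lTensor_tmul]
    rw [GrMod.sgn_eq]
    refine congrArg (concat _) (congrArg (fun y => _ ⊗ₜ[R] y) ?_)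
    simp only [LinearMap.add_apply, LinearMap.comp_apply, LinearMap.lTensor_tmul,
      TensorProduct.map_tmul, LinearEquiv.coe_coe, TensorProduct.rid_tmul, TensorProduct.lift.tmul,
      LinearMap.flip_apply, map_smul, braceLetter, cst_apply]
    rfl

theorem cst_comp_sp {W : GrMod.{u, w} R} {M : Type*} [AddCommGroup M] [Module R M] (y : M) (n : ℤ) :
    cst (augT W) y ∘ₗ W.T.sp n = cst (augT W) y := by
  rw [cst_comp, augT_sp]

theorem conv_deconcat_sp {W : GrMod.{u, w} R} {A B C : Type*} [AddCommGroup A] [AddCommGroup B]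
    [AddCommGroup C] [Module R A] [Module R B] [Module R C] (mu : A ⊗[R] B →ₗ[R] C)
    (f : W.T →ₗ[R] A) (g : W.T →ₗ[R] B) (n : ℤ) :
    conv (deconcat W) mu f g ∘ₗ W.T.sp n =
      conv (deconcat W) mu (f ∘ₗ W.T.sp n) (g ∘ₗ W.T.sp n) := by
  rw [conv_comp, comul_sp (isDeg_deconcat W), conv_comp_comp]

theorem mulL_concat_one {V : GrMod.{u, v} R} :
    mulL (concat V) (1 : TensorAlgebra R V) = LinearMap.id :=
  LinearMap.ext fun a => one_mul (M := TensorAlgebra R V) _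

theorem mulR_concat_one {V : GrMod.{u, v} R} :
    mulR (concat V) (1 : TensorAlgebra R V) = LinearMap.id :=
  LinearMap.ext fun a => mul_one (M := TensorAlgebra R V) _

theorem braceOp_letter (v : H.susp (-1)) :
    braceOp H mul comul (letter (H.susp (-1)) v) = braceLetter mul comul v := by
  induction v using GrMod.homogeneous_induction with
  | zero =>
    rw [map_zero, map_zero, braceLetter]
    simp [cst_zero]
  | add b b' h h' =>
    rw [map_add, map_add, h, h']
    simp only [braceLetter, map_add, cst_add, LinearMap.add_comp]
    abel
  | hom n b hb =>
    have h := braceOp_snoc mul comul hb (1 : ΩH)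
    rw [one_mul, braceOp_one, cst_comp_sp, (isCoalg_deconcat _).cst_conv, mulL_concat_one] at h
    exact h

theorem braceOp_jay (b : H.toGrMod) : braceOp H mul comul (H.jay b) =
    cst (augT (barLetters H comul)) (H.jay b) +
      actOn mul comul (b - H.counit b • H.one) ∘ₗ (cobar H comul).tw := by
  have h1 : H.jay b = letter (H.susp (-1)) (H.inS (-1) (H.toGrMod.sp 1 b)) := rfl
  have h2 : H.toGrMod.sp 1 (H.outS (-1) (H.inS (-1) (H.toGrMod.sp 1 b))) =
      b - H.counit b • H.one := by
    have h3 : H.counit (H.toGrMod.sp 1 b) = H.counit b := LinearMap.congr_fun (H.counit_sp 1) b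
    rw [H.outS_inS, map_sub, GrMod.sp_self, map_smul, H.sp_one, h3]
  rw [h1, braceOp_letter, braceLetter, h2]

theorem braceOp_mul {n : ℤ} {z : ΩH} (hz : z ∈ (H.susp (-1)).T.deg n)
    (x : ΩH) :
    braceOp H mul comul (x * z : ΩH) =
      conv (deconcat (barLetters H comul)) (concat _)
        (braceOp H mul comul x ∘ₗ (barLetters H comul).T.sp n) (braceOp H mul comul z) := by
  have hC := isCoalg_deconcat (barLetters H comul)
  refine word_induction_right (V := H.susp (-1)) (P := fun n z =>
    braceOp H mul comul (x * z : ΩH) =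
      conv (deconcat (barLetters H comul)) (concat _)
        (braceOp H mul comul x ∘ₗ (barLetters H comul).T.sp n) (braceOp H mul comul z))
    ?_ ?_ ?_ ?_ ?_ n z hz
  · rw [mul_one, braceOp_one, hC.conv_cst, GrMod.sp_zero, LinearMap.comp_id, mulR_concat_one]
    rfl
  · intro p q v z hv hz ih
    rw [← mul_assoc, braceOp_snoc mul comul hv, ih, braceOp_snoc mul comul hv, conv_deconcat_sp,
      hC.conv_assoc (concat_assoc _), LinearMap.comp_assoc, GrMod.sp_comp]
  · intro m
    rw [mul_zero, map_zero, conv_zero_right]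
  · intro m x x' h h'
    rw [mul_add, map_add, map_add, h, h', conv_add_right]
  · intro m r x h
    rw [mul_smul_comm, map_smul, map_smul, h, conv_smul_right]

theorem isDeg_braceOp (hb : IsDGBialgebra H mul comul) {n : ℤ} {x : ΩH}
    (hx : x ∈ (H.susp (-1)).T.deg n) :
    GrMod.IsDeg (V := (barLetters H comul).T) (W := (H.susp (-1)).T) (braceOp H mul comul x) n := by
  refine word_induction_right (V := H.susp (-1)) (P := fun n x =>
    GrMod.IsDeg (V := (barLetters H comul).T) (W := (H.susp (-1)).T) (braceOp H mul comul x) n)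
    ?_ ?_ ?_ ?_ ?_ n x hx
  · rw [braceOp_one]
    exact isDeg_cst (augT_eq_zero _) one_memT
  · intro p q v x hv hx ih m a ha
    rw [braceOp_snoc mul comul hv]
    refine GrMod.tensorDeg_mem (f := concat _ ∘ₗ TensorProduct.map
      (braceOp H mul comul x ∘ₗ (barLetters H comul).T.sp p) (braceLetter mul comul v)) ?_
      (by simpa using isDeg_deconcat (barLetters H comul) m a ha)
    intro i j hij c hc e he
    have h1 : braceLetter mul comul v e ∈ (H.susp (-1)).T.deg (j + p) := by
      refine add_mem ?_ ?_
      · exact isDeg_cst (augT_eq_zero _) (letter_mem hv) j e he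
      · have hv' : H.toGrMod.sp 1 (H.outS (-1) v) ∈ H.deg (p - -1) :=
          H.toGrMod.sp_mem 1 (H.isDeg_outS (-1) p v hv)
        have := isDeg_actOn hb hv' _ _ ((cobar H comul).isDeg_tw j e he)
        exact GrMod.mem_of_eq (V := (H.susp (-1)).T) this (by ring)
    exact GrMod.mem_of_eq (mul_memT (ih _ _ (GrMod.sp_mem p hc)) h1) (by lia)
  · intro m k a ha
    rw [map_zero]; exact zero_mem _
  · intro m x y hx hy k a ha
    rw [map_add]; exact add_mem (hx k a ha) (hy k a ha)
  · intro m r x hx k a ha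
    rw [map_smul]; exact Submodule.smul_mem _ _ (hx k a ha)

variable (hb : IsDGBialgebra H mul comul)
include hb

theorem actOn_concat (a : H.toGrMod) (z : (H.susp (-1)).T ⊗[R] (H.susp (-1)).T) :
    actOn mul comul a (concat _ z) =
      concat _ (TensorProduct.map (TensorProduct.lift (dact mul comul).flip)
        (TensorProduct.lift (dact mul comul).flip)
          (midSwap H.toGrMod (H.susp (-1)).T (comul a ⊗ₜ z))) := by
  induction z using GrMod.tensor_induction with
  | zero => simp
  | add z z' h h' => simp only [map_add, TensorProduct.tmul_add, h, h']
  | hom i j x₁ h₁ x₂ h₂ =>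
    rw [concat_tmul, LinearMap.flip_apply, dact_mul hb h₁, conv_apply]
    generalize comul a = c
    induction c using TensorProduct.induction_on with
    | zero => simp
    | add z z' h h' => simp only [map_add, TensorProduct.add_tmul, h, h']
    | tmul a₁ a₂ =>
      rw [midSwap_tmul _ _ h₁]
      rfl

/-- The operations `E_{1,k}` are equivariant for the diagonal action. -/
theorem braceOp_dact (x : ΩH) (a : H.toGrMod) :
    braceOp H mul comul (dact mul comul x a) = actOn mul comul a ∘ₗ braceOp H mul comul x := by
  induction x using word_induction' generalizing a with
  | one =>
    rw [dact, diagonalAct_one, cst_apply, map_smul, braceOp_one, comp_cst, LinearMap.flip_apply,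
      diagonalAct_one, cst_apply, cst_smul]
  | cons n q v x hv hx ih =>
    have h1 : ∀ a, braceOp H mul comul (dact mul comul (letter _ v) a) =
        actOn mul comul a ∘ₗ braceOp H mul comul (letter _ v) := fun a => by
      have hl : letter _ v = H.jay (H.toGrMod.sp 1 (H.outS (-1) v)) := by
        rw [H.letter_eq, AugMod.jay, LinearMap.comp_apply, GrMod.sp_self]
      have h0 : H.counit (H.toGrMod.sp 1 (H.outS (-1) v)) = 0 :=
        (LinearMap.congr_fun (H.counit_sp 1) _).trans (H.counit_outS _ _)
      rw [hl]
      generalize H.toGrMod.sp 1 (H.outS (-1) v) = b at h0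
      rw [dact_jay hb, h0, zero_smul, sub_zero, braceOp_jay, braceOp_jay, h0, hb.counit_mul, h0,
        mul_zero, zero_smul, sub_zero, sub_zero, LinearMap.comp_add, comp_cst,
        LinearMap.flip_apply, dact_jay hb, h0, zero_smul, sub_zero]
      congr 1
      refine LinearMap.ext fun w => ?_
      simp only [LinearMap.comp_apply, LinearMap.flip_apply]
      exact dact_dact hb _ _ _
    have hv' : letter (H.susp (-1)) v ∈ (H.susp (-1)).T.deg n := letter_mem hv
    generalize letter (H.susp (-1)) v = y at h1 hv' ⊢
    rw [dact_mul hb hv', conv_apply, braceOp_mul hx]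
    refine LinearMap.ext fun w => ?_
    rw [LinearMap.comp_apply, conv_apply]
    rw [actOn_concat hb]
    generalize comul a = c
    induction c using GrMod.tensor_induction with
    | zero => simp
    | add z z' h h' =>
      simp only [map_add, TensorProduct.add_tmul, LinearMap.add_apply, h, h']
    | hom k l a₁ h₁ a₂ h₂ =>
      rw [TensorProduct.map_tmul, concat_tmul, LinearMap.comp_apply,
        braceOp_mul (dact_isDeg hb hx l _ (H.toGrMod.sp_mem n h₂)), h1, ih, conv_apply]
      generalize deconcat _ w = d
      induction d using GrMod.tensor_induction with
      | zero => simp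
      | add z z' h h' =>
        simp only [map_add, TensorProduct.tmul_add, h, h']
      | hom i j w₁ hw₁ w₂ hw₂ =>
        rw [TensorProduct.map_tmul, TensorProduct.map_tmul, LinearMap.comp_apply (braceOp H mul comul y),
          midSwap_tmul _ _ (isDeg_braceOp hb hv' i _ (GrMod.sp_mem q hw₁)), TensorProduct.map_tmul,
          LinearMap.comp_apply, LinearMap.comp_apply, LinearMap.comp_apply, TensorProduct.lift.tmul,
          TensorProduct.lift.tmul, GrMod.sp_apply _ hw₁, GrMod.sp_apply _ hw₁, GrMod.sp_apply _ h₂,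
          GrMod.sp_apply _ h₂]
        simp only [map_smul, LinearMap.smul_apply, ← TensorProduct.smul_tmul', TensorProduct.tmul_smul,
          smul_smul]
        rw [← sg_add, ← sg_add]
        refine sg_smul_congr ?_ rfl
        push_cast; ring
  | zero => simp
  | add x y hx hy => simp only [map_add, LinearMap.add_apply, hx, hy, LinearMap.comp_add]
  | smul r x hx => simp only [map_smul, LinearMap.smul_apply, hx, LinearMap.comp_smul]

end Brace

/-! ## The boundary of the brace operations -/

theorem sg_eq_neg {m n : ℤ} (h : (m : ZMod 2) = n + 1) : sg R m = -sg R n := by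
  have h1 : sg R m = sg R (n + 1) := sg_congr (by rw [h]; push_cast; rfl)
  rw [h1, sg_add, sg_one, mul_neg_one]

section BraceBoundary

variable {H : AugMod.{u, v} R} {mul : H.toGrMod ⊗[R] H.toGrMod →ₗ[R] H.toGrMod}
  {comul : H.toGrMod →ₗ[R] H.toGrMod ⊗[R] H.toGrMod}

variable (hb : IsDGBialgebra H mul comul)

theorem braceOp_ell_mul_jay {m : ℤ} {w : (barLetters H comul).T}
    (hw : w ∈ (barLetters H comul).T.deg m) (z : H.toGrMod ⊗[R] H.toGrMod) :
    braceOp H mul comul (concat _ (TensorProduct.map H.ell H.jay z)) w =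
      augT _ w • concat _ (TensorProduct.map H.ell H.jay z) +
      concat _ (TensorProduct.map H.ell (dact mul comul ((cobar H comul).tw w))
        (TensorProduct.map (H.outS (-1) ∘ₗ H.inS (-1)) (H.outS (-1) ∘ₗ H.inS (-1)) z)) -
      sg R (m - 1) • concat _ (TensorProduct.map
        (dact mul comul ((cobar H comul).tw w) ∘ₗ H.toGrMod.sp 1) (H.ell ∘ₗ H.toGrMod.sp (m - 1))
        (TensorProduct.map (H.outS (-1) ∘ₗ H.inS (-1)) (H.outS (-1) ∘ₗ H.inS (-1)) z)) +
      concat _ (TensorProduct.map (TensorProduct.lift (dact mul comul).flip)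
        (TensorProduct.lift (dact mul comul).flip)
          (midSwap H.toGrMod (H.susp (-1)).T (TensorProduct.map (H.toGrMod.sp 1) (H.toGrMod.sp 1)
            (TensorProduct.map (H.outS (-1) ∘ₗ H.inS (-1)) (H.outS (-1) ∘ₗ H.inS (-1)) z) ⊗ₜ
            TensorProduct.map ((cobar H comul).tw ∘ₗ (barLetters H comul).T.sp 1)
              (cobar H comul).tw (deconcat _ w)))) := by
  have hC := isCoalg_deconcat (barLetters H comul)
  induction z using GrMod.tensor_induction with
  | zero => simp
  | add z z' h h' =>
    simp only [map_add, TensorProduct.add_tmul, LinearMap.add_apply, h, h', smul_add]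
    abel
  | hom k l b₁ h₁ b₂ h₂ =>
    have hell : ∀ b, H.ell ((H.outS (-1) ∘ₗ H.inS (-1)) b) = H.ell b := fun b => by
      rw [LinearMap.comp_apply, H.outS_inS, map_sub, map_smul, H.ell_one, smul_zero, sub_zero]
    have hjay : ∀ b, H.jay ((H.outS (-1) ∘ₗ H.inS (-1)) b) = H.jay b := fun b => by
      rw [LinearMap.comp_apply, H.outS_inS, map_sub, map_smul, H.jay_one, smul_zero, sub_zero]
    have hπ : ∀ {k} {b}, b ∈ H.deg k → (H.outS (-1) ∘ₗ H.inS (-1)) b ∈ H.deg k := fun hb =>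
      GrMod.mem_of_eq (V := H.toGrMod) (H.isDeg_outS (-1) _ _ (H.isDeg_inS (-1) _ _ hb)) (by ring)
    have hε : ∀ b, H.counit ((H.outS (-1) ∘ₗ H.inS (-1)) b) = 0 := fun b => H.counit_outS _ _
    rw [TensorProduct.map_tmul, TensorProduct.map_tmul, ← hell b₁, ← hjay b₂]
    replace h₁ := hπ h₁
    replace h₂ := hπ h₂
    have hε₁ := hε b₁
    have hε₂ := hε b₂
    generalize (H.outS (-1) ∘ₗ H.inS (-1)) b₁ = b₁ at *
    generalize (H.outS (-1) ∘ₗ H.inS (-1)) b₂ = b₂ at *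
    have hE₁ : braceOp H mul comul (H.ell b₁) =
        cst (augT (barLetters H comul)) (H.ell b₁) +
          actOn mul comul (H.toGrMod.sp 1 b₁) ∘ₗ (cobar H comul).tw := by
      have h3 : H.counit (H.toGrMod.sp 1 b₁) = 0 :=
        (LinearMap.congr_fun (H.counit_sp 1) b₁).trans hε₁
      rw [← H.jay_sp, LinearMap.comp_apply, braceOp_jay, h3, zero_smul, sub_zero]
    have hE₂ : braceOp H mul comul (H.jay b₂) = cst (augT (barLetters H comul)) (H.jay b₂) +
          actOn mul comul b₂ ∘ₗ (cobar H comul).tw := by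
      rw [braceOp_jay, hε₂, zero_smul, sub_zero]
    have e3 : concat _ (dact mul comul ((cobar H comul).tw ((barLetters H comul).T.sp (l + -1) w))
          (H.toGrMod.sp 1 b₁) ⊗ₜ H.jay b₂) =
        -(sg R (m - 1) • concat _ (dact mul comul ((cobar H comul).tw w) (H.toGrMod.sp 1 b₁) ⊗ₜ
          H.ell (H.toGrMod.sp (m - 1) b₂))) := by
      rw [concat_tmul, concat_tmul]
      rw [← H.jay_sp, LinearMap.comp_apply, GrMod.sp_sp, GrMod.sp_apply _ h₂, GrMod.sp_apply _ hw]
      simp only [map_smul, LinearMap.smul_apply, smul_mul_assoc, mul_smul_comm]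
      rw [smul_smul, ← sg_add, ← neg_smul, ← sg_eq_neg]
      push_cast
      generalize (m : ZMod 2) = x; generalize (l : ZMod 2) = y
      revert x y; decide
    have e4 : conv (deconcat _) (concat _) (actOn mul comul (H.toGrMod.sp 1 b₁) ∘ₗ
          (cobar H comul).tw ∘ₗ (barLetters H comul).T.sp (l + -1))
          (actOn mul comul b₂ ∘ₗ (cobar H comul).tw) w =
        concat _ (TensorProduct.map (TensorProduct.lift (dact mul comul).flip)
        (TensorProduct.lift (dact mul comul).flip)
          (midSwap H.toGrMod (H.susp (-1)).T (TensorProduct.map (H.toGrMod.sp 1) (H.toGrMod.sp 1)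
            (b₁ ⊗ₜ b₂) ⊗ₜ TensorProduct.map ((cobar H comul).tw ∘ₗ (barLetters H comul).T.sp 1)
              (cobar H comul).tw (deconcat _ w)))) := by
      rw [conv_apply]
      generalize deconcat _ w = d
      induction d using GrMod.tensor_induction with
      | zero => simp
      | add z z' h h' =>
        simp only [map_add, TensorProduct.tmul_add, h, h']
      | hom i j w₁ hw₁ w₂ hw₂ =>
        have ht : (cobar H comul).tw ((barLetters H comul).T.sp 1 w₁) ∈ (H.susp (-1)).T.deg (i + -1) :=
          (cobar H comul).isDeg_tw _ _ (GrMod.sp_mem 1 hw₁)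
        rw [TensorProduct.map_tmul, TensorProduct.map_tmul, TensorProduct.map_tmul,
          LinearMap.comp_apply (cobar H comul).tw ((barLetters H comul).T.sp 1),
          midSwap_tmul _ _ ht, TensorProduct.map_tmul, LinearMap.comp_apply, LinearMap.comp_apply,
          LinearMap.comp_apply, TensorProduct.lift.tmul,
          TensorProduct.lift.tmul, GrMod.sp_apply _ hw₁, GrMod.sp_apply _ hw₁, GrMod.sp_sp,
          GrMod.sp_apply _ h₂]
        simp only [map_smul, LinearMap.smul_apply, ← TensorProduct.smul_tmul',
          TensorProduct.tmul_smul, smul_smul]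
        rw [← sg_add]
        refine sg_smul_congr ?_ rfl
        push_cast
        generalize (i : ZMod 2) = x; generalize (l : ZMod 2) = y
        revert x y; decide
    rw [← e4, concat_tmul, braceOp_mul (H.isDeg_jay l b₂ h₂), hE₁, hE₂, LinearMap.add_comp,
      cst_comp_sp, conv_add_left, conv_add_right, conv_add_right, hC.cst_conv, hC.cst_conv,
      hC.conv_cst]
    simp only [LinearMap.add_apply, LinearMap.comp_apply, TensorProduct.map_tmul]
    simp only [LinearMap.flip_apply, TensorProduct.mk_apply, cst_apply]
    rw [e3, TensorProduct.tmul_smul, map_smul, concat_tmul, LinearMap.comp_assoc]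
    abel

theorem actOn_neg_smul (r : R) (b : H.toGrMod) :
    actOn mul comul (-(r • b)) = -(r • actOn mul comul b) := by
  rw [actOn, map_neg, map_smul]

include hb

theorem concat_midSwap_one_left {n : ℤ} {c : H.toGrMod} (hc : c ∈ H.deg n)
    (z : (H.susp (-1)).T ⊗[R] (H.susp (-1)).T) :
    concat _ (TensorProduct.map (TensorProduct.lift (dact mul comul).flip)
      (TensorProduct.lift (dact mul comul).flip)
        (midSwap H.toGrMod (H.susp (-1)).T ((H.one ⊗ₜ c) ⊗ₜ z))) =
      concat _ (TensorProduct.map ((H.susp (-1)).T.sp n) (actOn mul comul c) z) := by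
  induction z using GrMod.tensor_induction with
  | zero => simp
  | add z z' h h' => simp only [map_add, TensorProduct.tmul_add, h, h']
  | hom i j x₁ h₁ x₂ h₂ =>
    rw [midSwap_tmul _ _ h₁, TensorProduct.map_tmul, TensorProduct.map_tmul,
      TensorProduct.lift.tmul, TensorProduct.lift.tmul, GrMod.sp_apply _ hc, GrMod.sp_apply _ h₁,
      map_smul, LinearMap.smul_apply, ← TensorProduct.smul_tmul', TensorProduct.tmul_smul,
      mul_comm n i]
    have e : (dact mul comul).flip H.one x₁ = x₁ := dact_unit hb x₁
    rw [e]

theorem concat_midSwap_one_right (c : H.toGrMod) (z : (H.susp (-1)).T ⊗[R] (H.susp (-1)).T) :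
    concat _ (TensorProduct.map (TensorProduct.lift (dact mul comul).flip)
      (TensorProduct.lift (dact mul comul).flip)
        (midSwap H.toGrMod (H.susp (-1)).T ((c ⊗ₜ H.one) ⊗ₜ z))) =
      concat _ (TensorProduct.map (actOn mul comul c) LinearMap.id z) := by
  induction z using GrMod.tensor_induction with
  | zero => simp
  | add z z' h h' => simp only [map_add, TensorProduct.tmul_add, h, h']
  | hom i j x₁ h₁ x₂ h₂ =>
    have e : (dact mul comul).flip H.one x₂ = x₂ := dact_unit hb x₂
    rw [midSwap_tmul _ _ h₁, TensorProduct.map_tmul, TensorProduct.map_tmul,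
      TensorProduct.lift.tmul, TensorProduct.lift.tmul, H.sp_one, e]
    rfl

theorem braceOp_cobar_d_jay {r : ℤ} {b : H.toGrMod} (hbr : b ∈ H.deg (r + 1)) (h0 : H.counit b = 0)
    {m : ℤ} {w : (barLetters H comul).T} (hw : w ∈ (barLetters H comul).T.deg m) :
    braceOp H mul comul ((cobar H comul).d (H.jay b)) w =
      augT _ w • (cobar H comul).d (H.jay b) + actOn mul comul (H.d b) ((cobar H comul).tw w) +
      conv comul (concat _) H.ell (dact mul comul ((cobar H comul).tw w)) b -
      sg R (m - 1) • conv comul (concat _) (dact mul comul ((cobar H comul).tw w) ∘ₗ H.toGrMod.sp 1)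
        (H.ell ∘ₗ H.toGrMod.sp (m - 1)) b +
      sg R r • concat _ (H.jay b ⊗ₜ (cobar H comul).tw w) -
      sg R (r * m) • concat _ ((cobar H comul).tw w ⊗ₜ H.jay b) -
      sg R r • actOn mul comul b (conv (deconcat _) (concat _)
        ((cobar H comul).tw ∘ₗ (barLetters H comul).T.sp 1) (cobar H comul).tw w) -
      conv (deconcat _) (concat _) ((cobar H comul).tw ∘ₗ (barLetters H comul).T.sp r)
        (actOn mul comul b ∘ₗ (cobar H comul).tw) w +
      sg R r • conv (deconcat _) (concat _) (actOn mul comul b ∘ₗ (cobar H comul).tw ∘ₗ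
        (barLetters H comul).T.sp 1) (cobar H comul).tw w := by
  have hj : (cobar H comul).d (H.jay b) = H.jay (H.d b) +
      concat _ (TensorProduct.map H.ell H.jay (comul b)) :=
    LinearMap.congr_fun (cobar_d_jay hb.toIsDGCoalgebra) b
  have hd0 : H.counit (H.d b) = 0 := LinearMap.congr_fun hb.counit_d b
  have hσb : H.toGrMod.sp 1 b = -(sg R r • b) := by
    rw [GrMod.sp_apply 1 hbr, one_mul, sg_add, sg_one, mul_neg_one, neg_smul]
  have hell : H.ell b = -(sg R r • H.jay b) := by
    rw [← H.jay_sp, LinearMap.comp_apply, hσb, map_neg, map_smul]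
  have hσb' : H.toGrMod.sp 1 b ∈ H.deg (r + 1) := H.toGrMod.sp_mem 1 hbr
  have t0 := LinearMap.congr_fun (hb.toIsDGCoalgebra.comul_sp 1) b
  rw [LinearMap.comp_apply, LinearMap.comp_apply] at t0
  have t2 : (H.susp (-1)).T.sp (r + 1) ∘ₗ (cobar H comul).tw ∘ₗ (barLetters H comul).T.sp 1 =
      -(sg R r • ((cobar H comul).tw ∘ₗ (barLetters H comul).T.sp r)) := by
    have h := (cobar H comul).isDeg_tw.sp_comp (r + 1)
    have h' : (barLetters H comul).T.sp (r + 1 + 1) = (barLetters H comul).T.sp r :=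
      GrMod.sp_congr (by push_cast; generalize (r : ZMod 2) = y; revert y; decide)
    have h'' : sg R ((r + 1) * -1) = -sg R r := sg_eq_neg (by
      push_cast; generalize (r : ZMod 2) = y; revert y; decide)
    rw [← LinearMap.comp_assoc, h, LinearMap.smul_comp, LinearMap.comp_assoc, GrMod.sp_comp, h', h'',
      neg_smul]
  have h3 := braceOp_ell_mul_jay (mul := mul) hw (comul b)
  rw [hb.toIsDGCoalgebra.reduced_comul h0] at h3
  simp only [map_sub, TensorProduct.sub_tmul, TensorProduct.map_tmul, LinearMap.comp_apply, H.ell_one,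
    H.sp_one, TensorProduct.zero_tmul, TensorProduct.tmul_zero, map_zero, dact_unit hb, sub_zero] at h3
  rw [← t0, ← actOn_concat hb, concat_midSwap_one_left hb hσb', concat_midSwap_one_right hb,
    ← LinearMap.comp_apply (TensorProduct.map _ _) (TensorProduct.map _ _),
    ← LinearMap.comp_apply (TensorProduct.map _ _) (TensorProduct.map _ _), ← TensorProduct.map_comp,
    ← TensorProduct.map_comp, t2, hσb, actOn_neg_smul] at h3
  have e9 : sg R (m - 1) • concat _ ((cobar H comul).tw w ⊗ₜ H.ell (H.toGrMod.sp (m - 1) b)) =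
      -(sg R (r * m) • concat _ ((cobar H comul).tw w ⊗ₜ[R] H.jay b)) := by
    rw [GrMod.sp_apply _ hbr, map_smul, hell, smul_neg, TensorProduct.tmul_neg, map_neg, smul_neg,
      smul_smul, TensorProduct.tmul_smul, map_smul, smul_smul, ← sg_add, ← sg_add]
    refine congrArg Neg.neg (sg_smul_congr ?_ rfl)
    push_cast
    generalize (m : ZMod 2) = x; generalize (r : ZMod 2) = y
    revert x y; decide
  rw [hj, map_add, LinearMap.add_apply, h3, braceOp_jay, hd0, zero_smul, sub_zero]
  rw [smul_sub, e9, hell]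
  simp only [← conv_apply, LinearMap.add_apply, cst_apply, smul_add, TensorProduct.neg_tmul,
    ← TensorProduct.smul_tmul', map_neg, map_smul, LinearMap.neg_comp, LinearMap.smul_comp,
    conv_neg_left, conv_neg_right, conv_smul_left, conv_smul_right, LinearMap.neg_apply,
    LinearMap.smul_apply, LinearMap.id_comp, smul_neg, neg_neg, sg_self]
  rw [LinearMap.comp_apply]
  abel

theorem d_braceOp_jay {r : ℤ} {b : H.toGrMod} (hbr : b ∈ H.deg (r + 1)) (h0 : H.counit b = 0) :
    (cobar H comul).d ∘ₗ braceOp H mul comul (H.jay b) =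
      braceOp H mul comul ((cobar H comul).d (H.jay b)) +
        sg R r • (braceOp H mul comul (H.jay b) ∘ₗ (bar (cobar H comul) (concat _)).d) -
        sg R r • conv (deconcat _) (concat _)
          (braceOp H mul comul (H.jay b) ∘ₗ (barLetters H comul).T.sp 1) (cobar H comul).tw +
        conv (deconcat _) (concat _)
          ((cobar H comul).tw ∘ₗ (barLetters H comul).T.sp r) (braceOp H mul comul (H.jay b)) := by
  have hC := isCoalg_deconcat (barLetters H comul)
  have hj : (cobar H comul).d (H.jay b) = H.jay (H.d b) +
      concat _ (TensorProduct.map H.ell H.jay (comul b)) :=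
    LinearMap.congr_fun (cobar_d_jay hb.toIsDGCoalgebra) b
  have hd0 : H.counit (H.d b) = 0 := LinearMap.congr_fun hb.counit_d b
  refine GrMod.hom_ext fun m w hw => ?_
  have hx : (cobar H comul).tw w ∈ (H.susp (-1)).T.deg (m - 1) :=
    (cobar H comul).isDeg_tw m w hw
  have h1 := LinearMap.congr_fun (d_dact hb hx) b
  have hσb : H.toGrMod.sp 1 b = -(sg R r • b) := by
    rw [GrMod.sp_apply 1 hbr, one_mul, sg_add, sg_one, mul_neg_one, neg_smul]
  have hE : braceOp H mul comul (H.jay b) = cst (augT (barLetters H comul)) (H.jay b) +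
      actOn mul comul b ∘ₗ (cobar H comul).tw := by
    rw [braceOp_jay, h0, zero_smul, sub_zero]
  have hx1 : (cobar H comul).tw ((barLetters H comul).T.sp r w) =
      sg R (r * m) • (cobar H comul).tw w := by
    rw [GrMod.sp_apply r hw, map_smul]
  have ht := LinearMap.congr_fun (tw_bar_d (isDGAlgebra_cobar hb.toIsDGCoalgebra)) w
  have hε : augT (barLetters H comul) ((bar (cobar H comul) (concat _)).d w) = 0 :=
    LinearMap.congr_fun (isDGCoalgebra_bar (isDGAlgebra_cobar hb.toIsDGCoalgebra)).counit_d w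
  have hE0 := braceOp_cobar_d_jay hb hbr h0 hw
  rw [hE, LinearMap.add_comp, LinearMap.add_comp, cst_comp_sp, conv_add_left,
    conv_add_right, hC.cst_conv, hC.conv_cst]
  simp only [LinearMap.add_apply, LinearMap.sub_apply, LinearMap.smul_apply, LinearMap.comp_apply,
    LinearMap.flip_apply, TensorProduct.mk_apply, cst_apply, map_add, map_smul, LinearMap.neg_apply] at h1 ht hE0 ⊢
  rw [hE0, h1, ht, hε, hx1, hσb]
  simp only [map_add, map_neg, map_smul, zero_smul, zero_add,
    ← TensorProduct.smul_tmul', LinearMap.add_apply, LinearMap.neg_apply, smul_add, smul_neg]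
  rw [LinearMap.comp_assoc]
  abel

end BraceBoundary

section BraceBoundaryWord

/-- An identity for the boundary of a family of multiplicative operations holds on all words if it
holds on letters. -/
theorem boundary_of_letter {V : GrMod.{u, v} R} {W : GrMod.{u, w} R} (E : V.T →ₗ[R] W.T →ₗ[R] V.T)
    (d : V.T →ₗ[R] V.T) (dB : W.T →ₗ[R] W.T) (t : W.T →ₗ[R] V.T)
    (E_one : E (1 : TensorAlgebra R V) = cst (augT W) (1 : TensorAlgebra R V))
    (E_mul : ∀ n, ∀ z ∈ V.T.deg n, ∀ x : TensorAlgebra R V, E (x * z : TensorAlgebra R V) =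
      conv (deconcat W) (concat V) (E x ∘ₗ W.T.sp n) (E z))
    (E_deg : ∀ n, ∀ x ∈ V.T.deg n, GrMod.IsDeg (V := W.T) (W := V.T) (E x) n)
    (d_one : d (1 : TensorAlgebra R V) = 0)
    (d_mul : ∀ x y : TensorAlgebra R V, d (x * y : TensorAlgebra R V) =
      (d x * y : TensorAlgebra R V) + (V.T.sp 1 x * d y : TensorAlgebra R V))
    (d_deg : GrMod.IsDeg (V := V.T) (W := V.T) d (-1))
    (aug_dB : augT W ∘ₗ dB = 0) (dB_deg : GrMod.IsDeg (V := W.T) (W := W.T) dB (-1))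
    (conv_dB : ∀ f g : W.T →ₗ[R] V.T, conv (deconcat W) (concat V) f g ∘ₗ dB =
      conv (deconcat W) (concat V) (f ∘ₗ dB) g +
        conv (deconcat W) (concat V) (f ∘ₗ W.T.sp 1) (g ∘ₗ dB))
    (letter_case : ∀ r, ∀ v ∈ V.deg r, d ∘ₗ E (letter V v) =
      E (d (letter V v)) + sg R r • (E (letter V v) ∘ₗ dB) -
        sg R r • conv (deconcat W) (concat V) (E (letter V v) ∘ₗ W.T.sp 1) t +
        conv (deconcat W) (concat V) (t ∘ₗ W.T.sp r) (E (letter V v)))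
    {r : ℤ} {x : TensorAlgebra R V} (hx : x ∈ V.T.deg r) :
    d ∘ₗ E x = E (d x) + sg R r • (E x ∘ₗ dB) -
        sg R r • conv (deconcat W) (concat V) (E x ∘ₗ W.T.sp 1) t +
        conv (deconcat W) (concat V) (t ∘ₗ W.T.sp r) (E x) := by
  have hC := isCoalg_deconcat W
  refine word_induction (V := V) (P := fun r x =>
    d ∘ₗ E x = E (d x) + sg R r • (E x ∘ₗ dB) -
        sg R r • conv (deconcat W) (concat V) (E x ∘ₗ W.T.sp 1) t +
        conv (deconcat W) (concat V) (t ∘ₗ W.T.sp r) (E x))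
    ?_ ?_ ?_ ?_ ?_ r x hx
  · rw [d_one, map_zero, E_one, comp_cst, d_one, cst_zero, cst_comp, aug_dB,
      cst_comp_sp, hC.cst_conv, hC.conv_cst, mulL_concat_one, mulR_concat_one]
    refine LinearMap.ext fun a => ?_
    simp [cst_apply]
  · intro p q v y hv hy ih
    have h1 := letter_case p v hv
    have hv' : letter V v ∈ V.T.deg p := letter_mem hv
    generalize letter V v = x at h1 hv' ⊢
    have hDy : d y ∈ V.T.deg (q - 1) := d_deg q _ hy
    have hσ := (E_deg p x hv').sp_comp 1
    rw [one_mul] at hσ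
    have hx1 : V.T.sp 1 x = sg R p • x := by
      rw [GrMod.sp_apply 1 hv', one_mul]
    have hsq : sg R (q * -1) = sg R q := sg_congr (by push_cast; generalize (q : ZMod 2) = x; revert x; decide)
    have hdsp : dB ∘ₗ W.T.sp q = sg R q • (W.T.sp q ∘ₗ dB) := by
      rw [dB_deg.sp_comp q, hsq, sg_self]
    have hcomm : W.T.sp 1 ∘ₗ W.T.sp q = W.T.sp q ∘ₗ W.T.sp 1 := by
      rw [GrMod.sp_comp, GrMod.sp_comp, add_comm]
    have hq1 : W.T.sp q ∘ₗ W.T.sp 1 = W.T.sp (q - 1) := by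
      rw [GrMod.sp_comp]
      exact GrMod.sp_congr (by push_cast; generalize (q : ZMod 2) = x; revert x; decide)
    have e1 : (E x ∘ₗ dB) ∘ₗ W.T.sp q = sg R q • ((E x ∘ₗ W.T.sp q) ∘ₗ dB) := by
      rw [LinearMap.comp_assoc, hdsp, LinearMap.comp_smul]; rfl
    have e4 : ∀ f : W.T →ₗ[R] V.T, (f ∘ₗ W.T.sp 1) ∘ₗ W.T.sp q = (f ∘ₗ W.T.sp q) ∘ₗ W.T.sp 1 :=
      fun f => by rw [LinearMap.comp_assoc, hcomm, LinearMap.comp_assoc]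
    have e5 : (t ∘ₗ W.T.sp p) ∘ₗ W.T.sp q = t ∘ₗ W.T.sp (p + q) := by
      rw [LinearMap.comp_assoc, GrMod.sp_comp]
    have hLHS : d ∘ₗ conv (deconcat W) (concat V) (E x ∘ₗ W.T.sp q) (E y) =
        conv (deconcat W) (concat V) ((d ∘ₗ E x) ∘ₗ W.T.sp q) (E y) +
        conv (deconcat W) (concat V) ((V.T.sp 1 ∘ₗ E x) ∘ₗ W.T.sp q) (d ∘ₗ E y) := by
      refine LinearMap.ext fun a => ?_
      simp only [LinearMap.comp_apply, LinearMap.add_apply, conv_apply]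
      generalize deconcat W a = z
      induction z using TensorProduct.induction_on with
      | zero => simp
      | add z z' h h' => simp only [map_add, h, h']; abel
      | tmul a b =>
        rw [TensorProduct.map_tmul, TensorProduct.map_tmul, TensorProduct.map_tmul, concat_tmul,
          concat_tmul, concat_tmul, d_mul]
        rfl
    rw [E_mul q y hy, hLHS, h1, ih, hσ, conv_dB, d_mul, hx1, map_add, smul_mul_assoc, map_smul,
      E_mul q y hy, E_mul _ _ hDy, ← hq1]
    have e9 : E x ∘ₗ W.T.sp q ∘ₗ W.T.sp 1 = (E x ∘ₗ W.T.sp q) ∘ₗ W.T.sp 1 := rfl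
    have e6 := conv_deconcat_sp (concat V) (E x ∘ₗ W.T.sp 1) t q
    have e7 := conv_deconcat_sp (concat V) (t ∘ₗ W.T.sp p) (E x) q
    have e8 := conv_deconcat_sp (concat V) (E x ∘ₗ W.T.sp q) (E y) 1
    simp only [LinearMap.add_comp, LinearMap.sub_comp, LinearMap.smul_comp, e6, e7, e8, e1, e4,
      e5, e9]
    simp only [conv_add_left, conv_add_right, conv_sub_left, conv_sub_right, conv_smul_left,
      conv_smul_right, hC.conv_assoc (concat_assoc _), smul_add, smul_sub, sg_add, smul_smul,
      ← mul_assoc, sg_mul_self, one_mul, one_smul]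
    rw [mul_comm (sg R q) (sg R p)]
    abel
  · intro m
    simp only [map_zero, LinearMap.comp_zero, LinearMap.zero_comp, conv_zero_left, conv_zero_right,
      smul_zero, add_zero, sub_zero]
  · intro m x y hx hy
    simp only [map_add, LinearMap.comp_add, LinearMap.add_comp, conv_add_left, conv_add_right,
      smul_add, hx, hy]
    abel
  · intro m c x hx
    simp only [map_smul, LinearMap.comp_smul, LinearMap.smul_comp, conv_smul_left, conv_smul_right,
      hx, smul_add, smul_sub]
    rw [smul_comm c (sg R m), smul_comm c (sg R m)]

variable {H : AugMod.{u, v} R} {mul : H.toGrMod ⊗[R] H.toGrMod →ₗ[R] H.toGrMod}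
  {comul : H.toGrMod →ₗ[R] H.toGrMod ⊗[R] H.toGrMod}

/-- The boundary of the operations `E_{1,k}`. -/
theorem d_braceOp (hb : IsDGBialgebra H mul comul) {r : ℤ} {x : TensorAlgebra R (H.susp (-1))}
    (hx : x ∈ (H.susp (-1)).T.deg r) :
    (cobar H comul).d ∘ₗ braceOp H mul comul x =
      braceOp H mul comul ((cobar H comul).d x) +
        sg R r • (braceOp H mul comul x ∘ₗ (bar (cobar H comul) (concat _)).d) -
        sg R r • conv (deconcat _) (concat _)
          (braceOp H mul comul x ∘ₗ (barLetters H comul).T.sp 1) (cobar H comul).tw +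
        conv (deconcat _) (concat _)
          ((cobar H comul).tw ∘ₗ (barLetters H comul).T.sp r) (braceOp H mul comul x) := by
  have hcb := isDGAlgebra_cobar hb.toIsDGCoalgebra
  have hbar := isDGCoalgebra_bar hcb
  have h_deg := hcb.toIsDGModule.isDeg_d
  have h_aug := hbar.counit_d
  have h_deg' := hbar.toIsDGModule.isDeg_d
  have h_conv : ∀ f g : (barLetters H comul).T →ₗ[R] (H.susp (-1)).T,
      conv (deconcat (barLetters H comul)) (concat (H.susp (-1))) f g ∘ₗ
          (bar (cobar H comul) (concat _)).d =
        conv (deconcat _) (concat _) (f ∘ₗ (bar (cobar H comul) (concat _)).d) g +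
          conv (deconcat _) (concat _) (f ∘ₗ (barLetters H comul).T.sp 1)
            (g ∘ₗ (bar (cobar H comul) (concat _)).d) := fun f g => bar_d_conv _ f g
  have h_d1 := cobar_d_one (C := H) (comul := comul)
  have h_dm := cobar_d_mul (C := H) (comul := comul)
  have h_letter : ∀ p, ∀ v ∈ (H.susp (-1)).deg p,
    (cobar H comul).d ∘ₗ braceOp H mul comul (letter _ v) =
      braceOp H mul comul ((cobar H comul).d (letter _ v)) +
        sg R p • (braceOp H mul comul (letter _ v) ∘ₗ (bar (cobar H comul) (concat _)).d) -
        sg R p • conv (deconcat _) (concat _)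
          (braceOp H mul comul (letter _ v) ∘ₗ (barLetters H comul).T.sp 1) (cobar H comul).tw +
        conv (deconcat _) (concat _)
          ((cobar H comul).tw ∘ₗ (barLetters H comul).T.sp p) (braceOp H mul comul (letter _ v)) := by
    intro p v hv
    have hbv : H.toGrMod.sp 1 (H.outS (-1) v) ∈ H.deg (p + 1) :=
      H.toGrMod.sp_mem 1 (GrMod.mem_of_eq (V := H.toGrMod) (H.isDeg_outS (-1) p v hv) (by ring))
    have hl : letter _ v = H.jay (H.toGrMod.sp 1 (H.outS (-1) v)) := by
      rw [H.letter_eq, AugMod.jay, LinearMap.comp_apply, GrMod.sp_self]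
    have h0 : H.counit (H.toGrMod.sp 1 (H.outS (-1) v)) = 0 :=
      (LinearMap.congr_fun (H.counit_sp 1) _).trans (H.counit_outS _ _)
    have h1 := d_braceOp_jay hb hbv h0
    rw [← hl] at h1
    exact h1
  generalize (bar (cobar H comul) (concat _)).d = dB at h_aug h_deg' h_conv h_letter ⊢
  generalize (cobar H comul).d = d at h_deg h_d1 h_dm h_letter ⊢
  exact boundary_of_letter (V := H.susp (-1)) (W := barLetters H comul)
    (E := braceOp H mul comul) (dB := dB) (t := (cobar H comul).tw) (d := d)
    (E_one := braceOp_one mul comul)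
    (E_mul := fun n z hz x => braceOp_mul hz x) (E_deg := fun n x hx => isDeg_braceOp hb hx)
    (d_one := h_d1) (d_mul := h_dm) (d_deg := h_deg) (aug_dB := h_aug) (dB_deg := h_deg')
    (conv_dB := h_conv) (letter_case := h_letter) hx

end BraceBoundaryWord

/-! ## The product on the bar construction defined by brace operations -/

/-- The linear map which is given by `f n` in degree `n`. -/
def GrMod.glue (V : GrMod.{u, v} R) {M : Type*} [AddCommGroup M] [Module R M]
    (f : ℤ → V →ₗ[R] M) : V →ₗ[R] M :=
  (DirectSum.toModule R ℤ M fun n => f n ∘ₗ (V.deg n).subtype) ∘ₗ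
    (DirectSum.decomposeLinearEquiv V.deg).toLinearMap

theorem GrMod.glue_apply (V : GrMod.{u, v} R) {M : Type*} [AddCommGroup M] [Module R M]
    (f : ℤ → V →ₗ[R] M) {n : ℤ} {a : V} (ha : a ∈ V.deg n) : V.glue f a = f n a := by
  lift a to V.deg n using ha
  simp only [GrMod.glue, LinearMap.comp_apply, LinearEquiv.coe_coe,
    DirectSum.decomposeLinearEquiv_apply, DirectSum.decompose_coe]
  rw [← DirectSum.lof_eq_of R, DirectSum.toModule_lof]
  rfl

/-- The operation `w ↦ ∑ ± E(x; w₁) · s⁻¹ pr(w₂)`. -/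
def braceTwRight {A : AugMod.{u, v} R} (mul : A.toGrMod ⊗[R] A.toGrMod →ₗ[R] A.toGrMod)
    (E : A.toGrMod →ₗ[R] (A.susp 1).T →ₗ[R] A.toGrMod) (x : A.toGrMod) :
    (A.susp 1).T →ₗ[R] A.toGrMod :=
  conv (deconcat (A.susp 1)) mul (E x ∘ₗ (A.susp 1).T.sp 1) A.tw

/-- The operation `w ↦ ∑ ± s⁻¹ pr(w₁) · E(x; w₂)`. -/
def braceTwLeft {A : AugMod.{u, v} R} (mul : A.toGrMod ⊗[R] A.toGrMod →ₗ[R] A.toGrMod)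
    (E : A.toGrMod →ₗ[R] (A.susp 1).T →ₗ[R] A.toGrMod) (r : ℤ) (x : A.toGrMod) :
    (A.susp 1).T →ₗ[R] A.toGrMod :=
  conv (deconcat (A.susp 1)) mul (A.tw ∘ₗ (A.susp 1).T.sp r) (E x)

/-- The formula for the boundary of the operations `E_{1,k}` of a homotopy G-algebra. -/
def BraceBoundary {A : AugMod.{u, v} R} (mul : A.toGrMod ⊗[R] A.toGrMod →ₗ[R] A.toGrMod)
    (E : A.toGrMod →ₗ[R] (A.susp 1).T →ₗ[R] A.toGrMod) : Prop :=
  ∀ r, ∀ x ∈ A.deg r, ∀ w, A.d (E x w) = E (A.d x) w + sg R r • E x ((bar A mul).d w) -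
    sg R r • braceTwRight mul E x w + braceTwLeft mul E r x w

/-- `E(x z; w) = ∑ ± E(x; w') E(z; w'')`. -/
def BraceMul {A : AugMod.{u, v} R} (mul : A.toGrMod ⊗[R] A.toGrMod →ₗ[R] A.toGrMod)
    (E : A.toGrMod →ₗ[R] (A.susp 1).T →ₗ[R] A.toGrMod) : Prop :=
  ∀ n, ∀ z ∈ A.deg n, ∀ x, E (mul (x ⊗ₜ z)) =
    conv (deconcat (A.susp 1)) mul (E x ∘ₗ (A.susp 1).T.sp n) (E z)

/-- `E(1; w) = ε(w)`. -/
def BraceOne {A : AugMod.{u, v} R} (E : A.toGrMod →ₗ[R] (A.susp 1).T →ₗ[R] A.toGrMod) : Prop :=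
  E A.one = cst (augT (A.susp 1)) A.one

/-- `E(x; )` has the degree of `x`. -/
def BraceDeg {A : AugMod.{u, v} R} (E : A.toGrMod →ₗ[R] (A.susp 1).T →ₗ[R] A.toGrMod) : Prop :=
  ∀ n, ∀ x ∈ A.deg n, GrMod.IsDeg (V := (A.susp 1).T) (W := A.toGrMod) (E x) n

/-- `E(x; 1) = x`. -/
def BraceApplyOne {A : AugMod.{u, v} R} (E : A.toGrMod →ₗ[R] (A.susp 1).T →ₗ[R] A.toGrMod) :
    Prop := ∀ x, E x (1 : TensorAlgebra R (A.susp 1)) = x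

/-- Operations `E(x; w)`, for `x` in `A` and `w` in `B A`, which are multiplicative in `x` and have
the boundary of the operations `E_{1,k}` of a homotopy G-algebra. -/
structure IsBrace (A : AugMod.{u, v} R) (mul : A.toGrMod ⊗[R] A.toGrMod →ₗ[R] A.toGrMod)
    (E : A.toGrMod →ₗ[R] (A.susp 1).T →ₗ[R] A.toGrMod) : Prop where
  one : BraceOne E
  mul_left : BraceMul mul E
  deg : BraceDeg E
  apply_one : BraceApplyOne E
  counit : ∀ x, A.counit x = 0 → ∀ w, A.counit (E x w) = 0
  boundary : BraceBoundary mul E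

section BraceProduct

variable {A : AugMod.{u, v} R} (E : A.toGrMod →ₗ[R] (A.susp 1).T →ₗ[R] A.toGrMod)

/-- The operation `w ↦ s E(x; w)`. -/
abbrev sBrace (x : A.toGrMod) : (A.susp 1).T →ₗ[R] A.susp 1 := A.inS 1 ∘ₗ E x

/-- The operation `w ↦ ∑ s E(x; w₁) · w₂`. -/
abbrev sBraceMul (x : A.toGrMod) : (A.susp 1).T →ₗ[R] (A.susp 1).T :=
  conv (deconcat (A.susp 1)) (concat (A.susp 1)) (letter (A.susp 1) ∘ₗ sBrace E x) LinearMap.id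

variable {E} in
theorem sBraceMul_add (x y : A.toGrMod) : sBraceMul E (x + y) = sBraceMul E x + sBraceMul E y := by
  simp only [sBraceMul, sBrace, map_add, LinearMap.comp_add, conv_add_left]

variable {E} in
theorem sBraceMul_smul (r : R) (x : A.toGrMod) : sBraceMul E (r • x) = r • sBraceMul E x := by
  simp only [sBraceMul, sBrace, map_smul, LinearMap.comp_smul, conv_smul_left]

/-- The product on `B A` defined by the operations `E`:
`(u · sx) * w = ∑ (-1)^{|sx||w₁|} (u * w₁) · s E(x; w₂) · w₃`. -/
def braceMul : (A.susp 1).T →ₗ[R] (A.susp 1).T →ₗ[R] (A.susp 1).T :=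
  foldRight (A.susp 1) (M := (A.susp 1).T →ₗ[R] (A.susp 1).T)
    ((A.susp 1).glue fun n => LinearMap.mk₂ R
      (fun v φ => conv (deconcat (A.susp 1)) (concat (A.susp 1)) (φ ∘ₗ (A.susp 1).T.sp n)
        (sBraceMul E (A.outS 1 v)))
      (fun v v' φ => by
        rw [map_add, sBraceMul_add, conv_add_right])
      (fun r v φ => by
        rw [map_smul, sBraceMul_smul, conv_smul_right])
      (fun v φ ψ => by simp only [LinearMap.add_comp, conv_add_left])
      (fun r v φ => by simp only [LinearMap.smul_comp, conv_smul_left]))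
    LinearMap.id

theorem braceMul_one : braceMul E (1 : TensorAlgebra R (A.susp 1)) = LinearMap.id :=
  foldRight_one _ _ _

theorem braceMul_snoc {n : ℤ} {v : A.susp 1} (hv : v ∈ (A.susp 1).deg n)
    (x : TensorAlgebra R (A.susp 1)) :
    braceMul E (x * letter (A.susp 1) v : TensorAlgebra R (A.susp 1)) =
      conv (deconcat (A.susp 1)) (concat (A.susp 1)) (braceMul E x ∘ₗ (A.susp 1).T.sp n)
        (sBraceMul E (A.outS 1 v)) := by
  have h : braceMul E (x * letter (A.susp 1) v : TensorAlgebra R (A.susp 1)) = _ :=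
    foldRight_snoc _ _ _ v x
  rw [h, GrMod.glue_apply _ _ hv]
  rfl

/-- The product `braceMul` as a map on the tensor product. -/
abbrev braceMul' : (A.susp 1).T ⊗[R] (A.susp 1).T →ₗ[R] (A.susp 1).T :=
  TensorProduct.lift (braceMul E)

variable {E}

theorem augT_sBraceMul (x : A.toGrMod) : augT (A.susp 1) ∘ₗ sBraceMul E x = 0 := by
  rw [augT_conv, augT_letter_comp, conv_zero_left]

theorem augT_braceMul (x y : TensorAlgebra R (A.susp 1)) :
    augT (A.susp 1) (braceMul E x y) = augT (A.susp 1) x * augT (A.susp 1) y := by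
  induction x using GrMod.homogeneous_induction (V := (A.susp 1).T) with
  | zero => simp
  | add x x' h h' => simp only [map_add, LinearMap.add_apply, h, h', add_mul]
  | hom n x hx =>
    refine word_induction_right (V := A.susp 1) (P := fun n x =>
      augT (A.susp 1) (braceMul E x y) = augT (A.susp 1) x * augT (A.susp 1) y) ?_ ?_ ?_ ?_ ?_ n x hx
    · rw [braceMul_one, augT_one, one_mul]; rfl
    · intro p q v x hv hx ih
      rw [braceMul_snoc E hv, ← LinearMap.comp_apply, augT_conv, augT_sBraceMul, conv_zero_right,
        augT_mul, augT_letter, mul_zero, zero_mul, LinearMap.zero_apply]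
    · intro m; simp
    · intro m x y hx hy
      rw [map_add, LinearMap.add_apply, map_add, map_add, hx, hy, add_mul]
    · intro m r x hx
      rw [map_smul, LinearMap.smul_apply, map_smul, map_smul, hx, smul_mul_assoc]

variable {mul : A.toGrMod ⊗[R] A.toGrMod →ₗ[R] A.toGrMod} (hE : IsBrace A mul E)

theorem isDeg_conv_deconcat {W : GrMod.{u, v} R} {f g : W.T →ₗ[R] W.T} {s t : ℤ}
    (hf : GrMod.IsDeg (V := W.T) (W := W.T) f s) (hg : GrMod.IsDeg (V := W.T) (W := W.T) g t) :
    GrMod.IsDeg (V := W.T) (W := W.T) (conv (deconcat W) (concat W) f g) (s + t) := by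
  intro m a ha
  refine GrMod.tensorDeg_mem (f := concat _ ∘ₗ TensorProduct.map f g) ?_
    (by simpa using isDeg_deconcat W m a ha)
  intro i j hij c hc e he
  exact GrMod.mem_of_eq (mul_memT (hf _ _ hc) (hg _ _ he)) (by lia)

include hE

theorem isDeg_braceMul {n : ℤ} {x : TensorAlgebra R (A.susp 1)} (hx : x ∈ (A.susp 1).T.deg n) :
    GrMod.IsDeg (V := (A.susp 1).T) (W := (A.susp 1).T) (braceMul E x) n := by
  refine word_induction_right (V := A.susp 1) (P := fun n x =>
    GrMod.IsDeg (V := (A.susp 1).T) (W := (A.susp 1).T) (braceMul E x) n) ?_ ?_ ?_ ?_ ?_ n x hx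
  · rw [braceMul_one]
    exact isDeg_id
  · intro p q v x hv hx ih
    rw [braceMul_snoc E hv]
    refine isDeg_conv_deconcat (fun m a ha => ih m _ (GrMod.sp_mem p ha)) ?_
    have h1 : GrMod.IsDeg (V := (A.susp 1).T) (W := (A.susp 1).T)
        (letter (A.susp 1) ∘ₗ sBrace E (A.outS 1 v)) p := by
      intro m a ha
      have h := letter_mem (A.isDeg_inS 1 _ _ (hE.deg _ _ (A.isDeg_outS 1 _ _ hv) m a ha))
      exact GrMod.mem_of_eq h (by ring)
    have h2 := isDeg_conv_deconcat h1 (isDeg_id (V := (A.susp 1).T))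
    rw [add_zero] at h2
    exact h2
  · intro m k a ha
    rw [map_zero]; exact zero_mem _
  · intro m x y hx hy k a ha
    rw [map_add]; exact add_mem (hx k a ha) (hy k a ha)
  · intro m r x hx k a ha
    rw [map_smul]; exact Submodule.smul_mem _ _ (hx k a ha)

theorem sp_braceMul (n : ℤ) (x y : TensorAlgebra R (A.susp 1)) :
    (A.susp 1).T.sp n (braceMul E x y) =
      braceMul E ((A.susp 1).T.sp n x) ((A.susp 1).T.sp n y) := by
  induction x using GrMod.homogeneous_induction (V := (A.susp 1).T) with
  | zero => simp
  | add x x' h h' => simp only [map_add, LinearMap.add_apply, h, h']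
  | hom p x hx =>
    induction y using GrMod.homogeneous_induction (V := (A.susp 1).T) with
    | zero => simp
    | add x x' h h' => simp only [map_add, h, h']
    | hom q y hy =>
      rw [GrMod.sp_apply n (isDeg_braceMul hE hx q y hy), GrMod.sp_apply n hx,
        GrMod.sp_apply n hy, map_smul, map_smul, LinearMap.smul_apply, smul_smul, ← sg_add]
      refine sg_smul_congr ?_ rfl
      push_cast; ring

theorem braceMul_right_one (x : TensorAlgebra R (A.susp 1)) :
    braceMul E x (1 : TensorAlgebra R (A.susp 1)) = x := by
  induction x using GrMod.homogeneous_induction (V := (A.susp 1).T) with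
  | zero => simp
  | add x x' h h' => simp only [map_add, LinearMap.add_apply, h, h']
  | hom n x hx =>
    refine word_induction_right (V := A.susp 1) (P := fun n x =>
      braceMul E x (1 : TensorAlgebra R (A.susp 1)) = x) ?_ ?_ ?_ ?_ ?_ n x hx
    · rw [braceMul_one]; rfl
    · intro p q v x hv hx ih
      rw [braceMul_snoc E hv, conv_deconcat_one, conv_deconcat_one, LinearMap.comp_apply, sp_oneT, ih,
        LinearMap.comp_apply, LinearMap.comp_apply, hE.apply_one, A.inS_outS, concat_tmul,
        concat_tmul, LinearMap.id_apply, mul_one]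
    · intro m; simp
    · intro m x y hx hy
      rw [map_add, LinearMap.add_apply, hx, hy]
    · intro m r x hx
      rw [map_smul, LinearMap.smul_apply, hx]

end BraceProduct

section DeconcatConv

variable {W : GrMod.{u, v} R}

variable (W) in
/-- `x ⊗ (a ⊗ b) ↦ x a ⊗ b`. -/
def mulFst' : W.T ⊗[R] (W.T ⊗[R] W.T) →ₗ[R] W.T ⊗[R] W.T :=
  LinearMap.rTensor W.T (concat W) ∘ₗ (TensorProduct.assoc R W.T W.T W.T).symm.toLinearMap

variable (W) in
/-- `(a ⊗ b) ⊗ x ↦ a ⊗ b x`. -/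
def mulSnd' : (W.T ⊗[R] W.T) ⊗[R] W.T →ₗ[R] W.T ⊗[R] W.T :=
  LinearMap.lTensor W.T (concat W) ∘ₗ (TensorProduct.assoc R W.T W.T W.T).toLinearMap

theorem mulFst'_tmul (x : W.T) (z : W.T ⊗[R] W.T) : mulFst' W (x ⊗ₜ z) = mulFst x z := by
  induction z with
  | zero => simp
  | add z z' h h' => simp only [TensorProduct.tmul_add, map_add, h, h']
  | tmul a b => rfl

theorem mulSnd'_tmul (x : W.T) (z : W.T ⊗[R] W.T) : mulSnd' W (z ⊗ₜ x) = mulSnd x z := by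
  induction z with
  | zero => simp
  | add z z' h h' => simp only [TensorProduct.add_tmul, map_add, h, h']
  | tmul a b => rfl

theorem conv_id_id {cm : W.T →ₗ[R] W.T ⊗[R] W.T} :
    conv cm (LinearMap.id : W.T ⊗[R] W.T →ₗ[R] _) LinearMap.id LinearMap.id = cm := by
  ext x
  rw [conv_apply, TensorProduct.map_id]; rfl

theorem conv_id_eq {K A B : Type*} [AddCommGroup K] [Module R K] [AddCommGroup A] [AddCommGroup B]
    [Module R A] [Module R B] (cm : K →ₗ[R] K ⊗[R] K) (f : K →ₗ[R] A) (g : K →ₗ[R] B) :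
    TensorProduct.map f g ∘ₗ cm = conv cm LinearMap.id f g := by
  ext x
  rw [conv_apply]; rfl

/-- The coproduct of a convolution `∑ f(w₁) · g(w₂) · w₃` with a letter `g(w₂)` in the middle. -/
theorem deconcat_conv_cons (f : W.T →ₗ[R] W.T) (g : W.T →ₗ[R] W) :
    deconcat W ∘ₗ conv (deconcat W) (concat W) f
        (conv (deconcat W) (concat W) (letter W ∘ₗ g) LinearMap.id) =
      conv (deconcat W) (mulSnd' W) (deconcat W ∘ₗ f)
        (conv (deconcat W) (concat W) (letter W ∘ₗ g) LinearMap.id) +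
      conv (deconcat W) LinearMap.id (conv (deconcat W) (concat W) f
        (conv (deconcat W) (concat W) (letter W ∘ₗ g) LinearMap.id)) LinearMap.id := by
  have hc := isCoalg_deconcat W
  have e1 : conv (deconcat W) LinearMap.id (conv (deconcat W) (concat W) f
        (conv (deconcat W) (concat W) (letter W ∘ₗ g) LinearMap.id)) LinearMap.id =
      conv (deconcat W) (mulFst' W) f (conv (deconcat W) (mulFst' W) (letter W ∘ₗ g)
        (deconcat W)) := by
    rw [hc.conv_assoc (mu₂ := mulFst' W) (mu₂' := LinearMap.id) (fun a b d => rfl),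
      hc.conv_assoc (mu₂ := mulFst' W) (mu₂' := LinearMap.id) (fun a b d => rfl), conv_id_id]
  rw [e1]
  ext c
  rw [LinearMap.comp_apply, LinearMap.add_apply, conv_apply, conv_apply, conv_apply]
  generalize deconcat W c = Z
  induction Z with
  | zero => simp
  | add z z' h h' => simp only [map_add, h, h']; abel
  | tmul p w =>
    rw [TensorProduct.map_tmul, TensorProduct.map_tmul, TensorProduct.map_tmul, conv_apply,
      conv_apply, LinearMap.comp_apply]
    generalize deconcat W w = Y at *
    have key : ∀ Y : W.T ⊗[R] W.T, deconcat W (concat W (f p ⊗ₜ concat W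
        (TensorProduct.map (letter W ∘ₗ g) LinearMap.id Y))) =
        mulSnd' W (deconcat W (f p) ⊗ₜ concat W
          (TensorProduct.map (letter W ∘ₗ g) LinearMap.id Y)) +
        mulFst' W (f p ⊗ₜ mulFst' W (TensorProduct.map (letter W ∘ₗ g) (deconcat W) Y)) := by
      intro Y
      induction Y with
      | zero => simp
      | add z z' h h' => simp only [map_add, TensorProduct.tmul_add, h, h']; abel
      | tmul q r =>
        rw [TensorProduct.map_tmul, TensorProduct.map_tmul, mulFst'_tmul, mulFst'_tmul,
          mulSnd'_tmul, concat_tmul, concat_tmul, LinearMap.comp_apply, LinearMap.id_apply,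
          deconcat_mul_cons, mulFst_mul]
    exact key Y

end DeconcatConv

section BraceProduct

variable {A : AugMod.{u, v} R} {E : A.toGrMod →ₗ[R] (A.susp 1).T →ₗ[R] A.toGrMod}

theorem augT_comp_braceMul (x : TensorAlgebra R (A.susp 1)) :
    augT (A.susp 1) ∘ₗ braceMul E x = augT (A.susp 1) x • augT (A.susp 1) :=
  LinearMap.ext fun y => augT_braceMul x y

theorem unletter_sBraceMul (x : A.toGrMod) :
    unletter (A.susp 1) ∘ₗ sBraceMul E x = sBrace E x := by
  have e1 : unletter (A.susp 1) ∘ₗ letter (A.susp 1) ∘ₗ sBrace E x = sBrace E x := by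
    ext w; rw [LinearMap.comp_apply, LinearMap.comp_apply, unletter_letter]
  rw [unletter_conv, augT_letter_comp, conv_zero_left, add_zero, e1]
  refine conv_counit_right (isCoalg_deconcat _) ?_ _
  intro y a
  rfl

/-- `x ↦ N(z)(w' ⊗ w'')`, the product of `B A ⊗ B A` on the left by `z`. -/
def braceMulTwo (E : A.toGrMod →ₗ[R] (A.susp 1).T →ₗ[R] A.toGrMod) :
    (A.susp 1).T ⊗[R] (A.susp 1).T →ₗ[R] (A.susp 1).T ⊗[R] (A.susp 1).T →ₗ[R]
      (A.susp 1).T ⊗[R] (A.susp 1).T :=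
  TensorProduct.curry (TensorProduct.map (braceMul' E) (braceMul' E) ∘ₗ middleSwap (A.susp 1).T)

theorem braceMulTwo_tmul {n : ℤ} (a : (A.susp 1).T) {b : (A.susp 1).T}
    (hb : b ∈ (A.susp 1).T.deg n) : braceMulTwo E (a ⊗ₜ b) =
      TensorProduct.map (braceMul E a ∘ₗ (A.susp 1).T.sp n) (braceMul E b) := by
  refine TensorProduct.ext' fun c d => ?_
  rw [braceMulTwo, TensorProduct.curry_apply, LinearMap.comp_apply,
    middleSwap_tmul' (A.susp 1).T a hb c d]
  rfl

theorem braceMulTwo_mulSnd {n : ℤ} {v : A.susp 1} (hv : v ∈ (A.susp 1).deg n)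
    (z : (A.susp 1).T ⊗[R] (A.susp 1).T) :
    braceMulTwo E (mulSnd (letter (A.susp 1) v) z) ∘ₗ deconcat (A.susp 1) =
      conv (deconcat (A.susp 1)) (mulSnd' (A.susp 1))
        (braceMulTwo E z ∘ₗ deconcat (A.susp 1) ∘ₗ (A.susp 1).T.sp n)
        (sBraceMul E (A.outS 1 v)) := by
  induction z using GrMod.tensor_induction (V := (A.susp 1).T) (W := (A.susp 1).T) with
  | zero => simp only [map_zero, LinearMap.zero_comp, conv_zero_left]
  | add z z' h h' => simp only [map_add, LinearMap.add_comp, conv_add_left, h, h']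
  | hom i j a ha b hb =>
    rw [mulSnd_tmul, braceMulTwo_tmul (E := E) a (mul_memT hb (letter_mem hv)),
      braceMulTwo_tmul (E := E) a hb, braceMul_snoc E hv, conv_id_eq, ← LinearMap.comp_assoc,
      conv_id_eq, conv_deconcat_sp]
    have h := (isCoalg_deconcat (A.susp 1)).conv_assoc (mu := mulSnd' (A.susp 1))
      (mu' := LinearMap.id) (mu₂ := LinearMap.id) (mu₂' := concat (A.susp 1))
      (fun a b d => mulSnd'_tmul d (a ⊗ₜ b)) ((braceMul E a ∘ₗ (A.susp 1).T.sp j) ∘ₗ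
        (A.susp 1).T.sp n) (braceMul E b ∘ₗ (A.susp 1).T.sp n) (sBraceMul E (A.outS 1 v))
    rw [h, LinearMap.comp_assoc, GrMod.sp_comp]

theorem deconcat_braceMul (x : TensorAlgebra R (A.susp 1)) :
    deconcat (A.susp 1) ∘ₗ braceMul E x =
      braceMulTwo E (deconcat (A.susp 1) x) ∘ₗ deconcat (A.susp 1) := by
  induction x using GrMod.homogeneous_induction (V := (A.susp 1).T) with
  | zero => simp only [map_zero, LinearMap.zero_comp, LinearMap.comp_zero]
  | add x x' h h' => simp only [map_add, LinearMap.comp_add, LinearMap.add_comp, h, h']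
  | hom n x hx =>
    refine word_induction_right (V := A.susp 1) (P := fun n x =>
      deconcat (A.susp 1) ∘ₗ braceMul E x =
        braceMulTwo E (deconcat (A.susp 1) x) ∘ₗ deconcat (A.susp 1)) ?_ ?_ ?_ ?_ ?_ n x hx
    · rw [deconcat_one, braceMulTwo_tmul (E := E) _ one_memT, braceMul_one, GrMod.sp_zero,
        LinearMap.comp_id, LinearMap.comp_id, TensorProduct.map_id]
      rfl
    · intro p q v x hv hx ih
      rw [deconcat_mul_letter, map_add, LinearMap.add_comp, braceMulTwo_mulSnd hv,
        braceMulTwo_tmul (E := E) _ one_memT, braceMul_snoc E hv, deconcat_conv_cons,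
        ← LinearMap.comp_assoc, ih, braceMul_one, GrMod.sp_zero, LinearMap.comp_id, conv_id_eq]
      rfl
    · intro m
      simp only [map_zero, LinearMap.zero_comp, LinearMap.comp_zero]
    · intro m x y hx hy
      simp only [map_add, LinearMap.comp_add, LinearMap.add_comp, hx, hy]
    · intro m r x hx
      simp only [map_smul, LinearMap.comp_smul, LinearMap.smul_comp, hx]

theorem deconcat_braceMul' : deconcat (A.susp 1) ∘ₗ braceMul' E =
    TensorProduct.map (braceMul' E) (braceMul' E) ∘ₗ middleSwap (A.susp 1).T ∘ₗ
      TensorProduct.map (deconcat (A.susp 1)) (deconcat (A.susp 1)) := by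
  refine TensorProduct.ext' fun x y => ?_
  have h := LinearMap.congr_fun (deconcat_braceMul (E := E) x) y
  exact h

/-- The compatibility `E(E(x; u); w) = E(x; u * w)` of the operations with the product of `B A`. -/
def BraceModule (E : A.toGrMod →ₗ[R] (A.susp 1).T →ₗ[R] A.toGrMod) (x : A.toGrMod) : Prop :=
  ∀ u w, E (E x u) w = E x (braceMul E u w)

variable {mul : A.toGrMod ⊗[R] A.toGrMod →ₗ[R] A.toGrMod} (hE : IsBrace A mul E)
include hE

theorem tw_braceMul (x : TensorAlgebra R (A.susp 1)) :
    A.tw ∘ₗ braceMul E x = E (A.tw x) + augT (A.susp 1) x • A.tw := by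
  induction x using GrMod.homogeneous_induction (V := (A.susp 1).T) with
  | zero => simp only [map_zero, LinearMap.comp_zero, zero_smul, add_zero]
  | add x x' h h' => simp only [map_add, LinearMap.comp_add, add_smul, h, h']; abel
  | hom n x hx =>
    refine word_induction_right (V := A.susp 1) (P := fun n x =>
      A.tw ∘ₗ braceMul E x = E (A.tw x) + augT (A.susp 1) x • A.tw) ?_ ?_ ?_ ?_ ?_ n x hx
    · rw [braceMul_one, augT_one, one_smul, A.tw_one, map_zero, zero_add, LinearMap.comp_id]
    · intro p q v x hv hx ih
      have e1 : A.tw (x * letter (A.susp 1) v : TensorAlgebra R (A.susp 1)) =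
          augT (A.susp 1) x • A.outS 1 v := by
        rw [AugMod.tw, LinearMap.comp_apply, unletter_mul, augT_letter, zero_smul, zero_add,
          unletter_letter, map_smul]
      have e2 : A.outS 1 ∘ₗ sBrace E (A.outS 1 v) = E (A.outS 1 v) := by
        ext w
        rw [LinearMap.comp_apply, sBrace, LinearMap.comp_apply, A.outS_inS,
          hE.counit _ (A.counit_outS 1 v), zero_smul, sub_zero]
      have e3 : unletter (A.susp 1) ∘ₗ braceMul E (x * letter (A.susp 1) v :
          TensorAlgebra R (A.susp 1)) = augT (A.susp 1) x • sBrace E (A.outS 1 v) := by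
        rw [braceMul_snoc E hv, unletter_conv, augT_sBraceMul, conv_zero_right, zero_add,
          unletter_sBraceMul, ← LinearMap.comp_assoc, augT_comp_braceMul, LinearMap.smul_comp,
          augT_sp, conv_smul_left]
        congr 1
        refine conv_counit_left (isCoalg_deconcat _) ?_ _
        intro y a
        rfl
      rw [augT_mul, augT_letter, mul_zero, zero_smul, add_zero, e1, map_smul, ← e2, AugMod.tw,
        LinearMap.comp_assoc, e3, LinearMap.comp_smul]
    · intro m
      simp only [map_zero, LinearMap.comp_zero, zero_smul, add_zero]
    · intro m x y hx hy
      simp only [map_add, LinearMap.comp_add, add_smul, hx, hy]; abel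
    · intro m r x hx
      simp only [map_smul, LinearMap.comp_smul, smul_add, hx, smul_assoc]

theorem tw_braceMul_apply (x y : (A.susp 1).T) :
    A.tw (braceMul E x y) = E (A.tw x) y + augT (A.susp 1) x • A.tw y :=
  LinearMap.congr_fun (tw_braceMul hE x) y

end BraceProduct

theorem midSwap_map {V V' : GrMod.{u, v} R} {W W' : GrMod.{u, w} R} {f : V →ₗ[R] V'}
    {g : W →ₗ[R] W'} (hf : GrMod.IsDeg f 0) (hg : GrMod.IsDeg g 0) :
    TensorProduct.map (TensorProduct.map f g) (TensorProduct.map f g) ∘ₗ midSwap V W =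
      midSwap V' W' ∘ₗ TensorProduct.map (TensorProduct.map f f) (TensorProduct.map g g) := by
  refine TensorProduct.ext_fourfold' fun a b c d => ?_
  induction c using GrMod.homogeneous_induction with
  | zero => simp
  | add c c' h h' => simp only [TensorProduct.add_tmul, TensorProduct.tmul_add, map_add, h, h']
  | hom n c hc =>
    have hgc : g c ∈ W'.deg n := GrMod.mem_of_eq (hg n c hc) (add_zero n)
    simp only [LinearMap.comp_apply, midSwap_tmul a b hc d, TensorProduct.map_tmul,
      midSwap_tmul (f a) (f b) hgc (g d)]
    rw [← LinearMap.comp_apply, ← LinearMap.comp_apply, hf.sp_comp_zero]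

theorem middleSwap_eq_midSwap (V : GrMod.{u, v} R) : middleSwap V = midSwap V V := by
  refine TensorProduct.ext_fourfold' fun a b c d => ?_
  induction c using GrMod.homogeneous_induction with
  | zero => simp
  | add c c' h h' => simp only [TensorProduct.add_tmul, TensorProduct.tmul_add, map_add, h, h']
  | hom n c hc => rw [midSwap_tmul a b hc d, middleSwap_tmul V a b hc d]

theorem tensorDeg_induction {V : GrMod.{u, v} R} {W : GrMod.{u, w} R} {n : ℤ}
    {P : V ⊗[R] W → Prop} (zero : P 0) (add : ∀ a b, P a → P b → P (a + b))
    (smul : ∀ (r : R) a, P a → P (r • a))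
    (hom : ∀ p q, p + q = n → ∀ a ∈ V.deg p, ∀ b ∈ W.deg q, P (a ⊗ₜ b)) {x : V ⊗[R] W}
    (hx : x ∈ tensorDeg V W n) : P x :=
  GrMod.tensorDeg_le
    (N := { carrier := P
            add_mem' := fun h1 h2 => add _ _ h1 h2
            zero_mem' := zero
            smul_mem' := smul }) hom hx

section BraceProduct

variable {A : AugMod.{u, v} R} {E : A.toGrMod →ₗ[R] (A.susp 1).T →ₗ[R] A.toGrMod}

/-- The coproduct of `B A ⊗ B A`. -/
abbrev deconcatTwo (W : GrMod.{u, v} R) :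
    W.T ⊗[R] W.T →ₗ[R] (W.T ⊗[R] W.T) ⊗[R] (W.T ⊗[R] W.T) :=
  midSwap W.T W.T ∘ₗ TensorProduct.map (deconcat W) (deconcat W)

/-- The coproduct of `B A ⊗ B A ⊗ B A`. -/
abbrev deconcatThree (W : GrMod.{u, v} R) : (W.T ⊗[R] W.T) ⊗[R] W.T →ₗ[R]
    ((W.T ⊗[R] W.T) ⊗[R] W.T) ⊗[R] ((W.T ⊗[R] W.T) ⊗[R] W.T) :=
  midSwap (W.T.tensor W.T) W.T ∘ₗ TensorProduct.map (deconcatTwo W) (deconcat W)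

theorem deconcat_braceMul_two : deconcat (A.susp 1) ∘ₗ braceMul' E =
    TensorProduct.map (braceMul' E) (braceMul' E) ∘ₗ deconcatTwo (A.susp 1) := by
  rw [deconcat_braceMul', middleSwap_eq_midSwap]

theorem assoc_deconcatThree (W : GrMod.{u, v} R) :
    midSwap W.T (W.T.tensor W.T) ∘ₗ TensorProduct.map (deconcat W) (deconcatTwo W) ∘ₗ
        (TensorProduct.assoc R W.T W.T W.T).toLinearMap =
      TensorProduct.map (TensorProduct.assoc R W.T W.T W.T).toLinearMap
        (TensorProduct.assoc R W.T W.T W.T).toLinearMap ∘ₗ deconcatThree W := by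
  refine TensorProduct.ext_threefold fun x y z => ?_
  have key : ∀ x y z : W.T ⊗[R] W.T, midSwap W.T (W.T.tensor W.T) (x ⊗ₜ midSwap W.T W.T (y ⊗ₜ z)) =
      TensorProduct.map (TensorProduct.assoc R W.T W.T W.T).toLinearMap
        (TensorProduct.assoc R W.T W.T W.T).toLinearMap
        (midSwap (W.T.tensor W.T) W.T (midSwap W.T W.T (x ⊗ₜ y) ⊗ₜ z)) := by
    intro x y z
    induction x with
    | zero => simp
    | add x x' h h' => simp only [TensorProduct.add_tmul, map_add, h, h']
    | tmul a a' =>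
      induction y using GrMod.tensor_induction (V := W.T) (W := W.T) with
      | zero => simp
      | add x x' h h' => simp only [TensorProduct.add_tmul, TensorProduct.tmul_add, map_add, h, h']
      | hom i i' b hb b' hb' =>
        induction z using GrMod.tensor_induction (V := W.T) (W := W.T) with
        | zero => simp
        | add x x' h h' => simp only [TensorProduct.tmul_add, map_add, h, h']
        | hom j j' c hc c' hc' =>
          have hbc : b ⊗ₜ[R] c ∈ (W.T.tensor W.T).deg (i + j) := GrMod.tmul_mem hb hc rfl
          rw [midSwap_tmul b b' hc c', midSwap_tmul a a' hb b', midSwap_tmul a a' hbc,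
            midSwap_tmul (V := W.T.tensor W.T) _ _ hc, GrMod.sp_tmul, GrMod.sp_sp, add_comm j i]
          rfl
  exact key _ _ _

theorem unletter_ext {K : Type*} [AddCommGroup K] [Module R K] {f g : K →ₗ[R] (A.susp 1).T}
    (h : A.tw ∘ₗ f = A.tw ∘ₗ g) : unletter (A.susp 1) ∘ₗ (f - g) = 0 := by
  ext1 k
  have := LinearMap.congr_fun h k
  rw [LinearMap.comp_apply, LinearMap.sub_apply, map_sub, LinearMap.zero_apply, sub_eq_zero]
  exact A.outS_injective 1 this

variable {mul : A.toGrMod ⊗[R] A.toGrMod →ₗ[R] A.toGrMod} (hE : IsBrace A mul E)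
include hE

theorem isDeg_braceMul' : GrMod.IsDeg (V := (A.susp 1).T.tensor (A.susp 1).T) (W := (A.susp 1).T)
    (braceMul' E) 0 := by
  intro n z hz
  refine GrMod.tensorDeg_mem (f := braceMul' E) ?_ hz
  intro p q hpq a ha b hb
  exact GrMod.mem_of_eq (isDeg_braceMul hE ha q b hb) (by lia)

theorem braceMul_assoc (hM : ∀ x, BraceModule E x)
    (x y z : TensorAlgebra R (A.susp 1)) :
    braceMul E (braceMul E x y) z = braceMul E x (braceMul E y z) := by
  set φ₁ : ((A.susp 1).T ⊗[R] (A.susp 1).T) ⊗[R] (A.susp 1).T →ₗ[R] (A.susp 1).T :=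
    braceMul' E ∘ₗ TensorProduct.map (braceMul' E) LinearMap.id with hφ₁
  set φ₂ : ((A.susp 1).T ⊗[R] (A.susp 1).T) ⊗[R] (A.susp 1).T →ₗ[R] (A.susp 1).T :=
    braceMul' E ∘ₗ TensorProduct.map LinearMap.id (braceMul' E) ∘ₗ
      (TensorProduct.assoc R (A.susp 1).T (A.susp 1).T (A.susp 1).T).toLinearMap with hφ₂
  have h1 : deconcat (A.susp 1) ∘ₗ φ₁ =
      TensorProduct.map φ₁ φ₁ ∘ₗ deconcatThree (A.susp 1) := by
    rw [hφ₁, TensorProduct.map_comp, ← LinearMap.comp_assoc, deconcat_braceMul_two,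
      LinearMap.comp_assoc, LinearMap.comp_assoc, ← TensorProduct.map_comp, LinearMap.comp_id,
      deconcat_braceMul_two, LinearMap.comp_assoc,
      ← LinearMap.comp_assoc (g := midSwap ((A.susp 1).T.tensor (A.susp 1).T) (A.susp 1).T),
      midSwap_map (V := (A.susp 1).T.tensor (A.susp 1).T) (V' := (A.susp 1).T)
        (isDeg_braceMul' hE) isDeg_id, LinearMap.comp_assoc, ← TensorProduct.map_comp,
      TensorProduct.map_id, LinearMap.id_comp]
  have h2 : deconcat (A.susp 1) ∘ₗ φ₂ =
      TensorProduct.map φ₂ φ₂ ∘ₗ deconcatThree (A.susp 1) := by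
    rw [hφ₂, TensorProduct.map_comp, TensorProduct.map_comp, LinearMap.comp_assoc,
      LinearMap.comp_assoc, ← assoc_deconcatThree,
      ← LinearMap.comp_assoc (g := midSwap (A.susp 1).T ((A.susp 1).T.tensor (A.susp 1).T)),
      midSwap_map (W := (A.susp 1).T.tensor (A.susp 1).T) (W' := (A.susp 1).T)
        isDeg_id (isDeg_braceMul' hE), LinearMap.comp_assoc,
      ← LinearMap.comp_assoc (h := TensorProduct.map (TensorProduct.map _ _) _),
      ← TensorProduct.map_comp, TensorProduct.map_id, LinearMap.id_comp,
      ← deconcat_braceMul_two, ← LinearMap.comp_assoc, deconcat_braceMul_two,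
      LinearMap.comp_assoc, LinearMap.comp_assoc,
      ← LinearMap.comp_assoc (g := TensorProduct.map LinearMap.id (braceMul' E)),
      ← TensorProduct.map_comp, LinearMap.comp_id, deconcat_braceMul_two]
  have h : φ₁ - φ₂ = 0 := by
    refine coderivation_ext (K := ((A.susp 1).T ⊗[R] (A.susp 1).T) ⊗[R] (A.susp 1).T)
      (cm := deconcatThree (A.susp 1)) (f := φ₁) (g := φ₂) ?_ ?_ ?_
    · rw [LinearMap.comp_sub, h1, h2, ← LinearMap.sub_comp]
      congr 1
      refine TensorProduct.ext' fun a b => ?_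
      simp only [LinearMap.sub_apply, LinearMap.add_apply, TensorProduct.map_tmul,
        TensorProduct.sub_tmul, TensorProduct.tmul_sub]
      abel
    · refine unletter_ext (K := ((A.susp 1).T ⊗[R] (A.susp 1).T) ⊗[R] (A.susp 1).T)
        (TensorProduct.ext_threefold fun x y z => ?_)
      have ht := fun x y => LinearMap.congr_fun (tw_braceMul hE x) y
      simp only [LinearMap.comp_apply, LinearMap.add_apply, LinearMap.smul_apply] at ht
      change A.tw (braceMul E (braceMul E x y) z) = A.tw (braceMul E x (braceMul E y z))
      rw [ht, ht, ht, ht, augT_braceMul, map_add, LinearMap.add_apply, hM _ _ _, map_smul,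
        LinearMap.smul_apply, smul_add, smul_smul, add_assoc]
    · refine TensorProduct.ext_threefold fun x y z => ?_
      change augT _ (braceMul E (braceMul E x y) z - braceMul E x (braceMul E y z)) = 0
      rw [map_sub, augT_braceMul, augT_braceMul, augT_braceMul, augT_braceMul, mul_assoc, sub_self]
  have := LinearMap.congr_fun h ((x ⊗ₜ y) ⊗ₜ z)
  exact sub_eq_zero.mp this

end BraceProduct

section BraceDerivation

variable {A : AugMod.{u, v} R} {E : A.toGrMod →ₗ[R] (A.susp 1).T →ₗ[R] A.toGrMod}

/-- `D ⊗ 1 + σ ⊗ D`. -/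
abbrev tensorDer {W : GrMod.{u, v} R} (D : W.T →ₗ[R] W.T) :
    W.T ⊗[R] W.T →ₗ[R] W.T ⊗[R] W.T :=
  LinearMap.rTensor W.T D + TensorProduct.map (W.T.sp 1) D

theorem deconcatTwo_tensorDer {W : GrMod.{u, v} R} {D : W.T →ₗ[R] W.T}
    (hdeg : GrMod.IsDeg (V := W.T) (W := W.T) D (-1))
    (hD : deconcat W ∘ₗ D = tensorDer D ∘ₗ deconcat W) :
    deconcatTwo W ∘ₗ tensorDer D = (TensorProduct.map (tensorDer D) LinearMap.id +
      TensorProduct.map (TensorProduct.map (W.T.sp 1) (W.T.sp 1)) (tensorDer D)) ∘ₗ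
        deconcatTwo W := by
  refine TensorProduct.ext' fun x y => ?_
  have e1 : ∀ x, deconcat W (D x) = tensorDer D (deconcat W x) := LinearMap.congr_fun hD
  have e2 : ∀ x, deconcat W (W.T.sp 1 x) =
      TensorProduct.map (W.T.sp 1) (W.T.sp 1) (deconcat W x) := fun x => by
    have h := GrMod.IsDeg.sp_comp_zero (V := W.T) (W := W.T.tensor W.T) (isDeg_deconcat W) 1
    rw [GrMod.sp_tensor] at h
    exact (LinearMap.congr_fun h x).symm
  simp only [LinearMap.comp_apply, LinearMap.add_apply, LinearMap.rTensor_tmul,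
    TensorProduct.map_tmul, map_add, e1, e2]
  generalize deconcat W x = X
  generalize deconcat W y = Y
  have key : ∀ X Y : W.T ⊗[R] W.T, midSwap W.T W.T (tensorDer D X ⊗ₜ Y) +
      midSwap W.T W.T (TensorProduct.map (W.T.sp 1) (W.T.sp 1) X ⊗ₜ tensorDer D Y) =
      TensorProduct.map (tensorDer D) LinearMap.id (midSwap W.T W.T (X ⊗ₜ Y)) +
      TensorProduct.map (TensorProduct.map (W.T.sp 1) (W.T.sp 1)) (tensorDer D)
        (midSwap W.T W.T (X ⊗ₜ Y)) := by
    intro X Y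
    induction X with
    | zero => simp
    | add x x' h h' =>
      simp only [map_add, TensorProduct.add_tmul] at h h' ⊢
      rw [add_add_add_comm, h, h']; abel
    | tmul a a' =>
      induction Y using GrMod.tensor_induction (V := W.T) (W := W.T) with
      | zero => simp
      | add x x' h h' =>
        simp only [map_add, TensorProduct.tmul_add] at h h' ⊢
        rw [add_add_add_comm, h, h']; abel
      | hom i j b hb b' hb' =>
        have hDb : D b ∈ W.T.deg (i - 1) := hdeg _ _ hb
        have hsb : W.T.sp 1 b ∈ W.T.deg i := GrMod.sp_mem 1 hb
        have e3 : W.T.sp i (D a') = sg R i • D (W.T.sp i a') := by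
          rw [hdeg.sp]; exact sg_smul_congr (by push_cast; ring_nf; generalize (i : ZMod 2) = x; revert x; decide) rfl
        have e4 : W.T.sp 1 b = sg R i • b := by rw [GrMod.sp_apply 1 hb, one_mul]
        have e5 : W.T.sp (i - 1) (W.T.sp 1 a') = W.T.sp i a' := by
          rw [GrMod.sp_sp, sub_add_cancel]
        have e6 : W.T.sp i (W.T.sp 1 a') = W.T.sp 1 (W.T.sp i a') := by
          rw [GrMod.sp_sp, GrMod.sp_sp, add_comm]
        rw [midSwap_tmul a a' hb b']
        simp only [tensorDer, LinearMap.add_apply, LinearMap.rTensor_tmul, TensorProduct.map_tmul,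
          TensorProduct.add_tmul, TensorProduct.tmul_add, map_add, LinearMap.id_apply]
        rw [midSwap_tmul _ _ hb b', midSwap_tmul _ _ hb b', midSwap_tmul _ _ hDb b',
          midSwap_tmul _ _ hsb (D b'), e3, e5, e6]
        have e7 : (W.T.sp 1 a ⊗ₜ[R] b) ⊗ₜ[R] ((sg R i • D (W.T.sp i a')) ⊗ₜ[R] b') =
          (W.T.sp 1 a ⊗ₜ[R] W.T.sp 1 b) ⊗ₜ[R] (D (W.T.sp i a') ⊗ₜ[R] b') := by
            rw [e4]; simp only [← TensorProduct.smul_tmul', TensorProduct.tmul_smul]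
        rw [e7]
        abel
  exact key X Y

variable {mul : A.toGrMod ⊗[R] A.toGrMod →ₗ[R] A.toGrMod} (hE : IsBrace A mul E)
include hE

/-- The value of the twisted square of `tw` on a product. -/
theorem conv_tw_braceMul {p : ℤ} {z : (A.susp 1).T ⊗[R] (A.susp 1).T}
    (hz : z ∈ tensorDeg (A.susp 1).T (A.susp 1).T p) :
    mul ∘ₗ TensorProduct.map (A.tw ∘ₗ (A.susp 1).T.sp 1) A.tw ∘ₗ braceMulTwo E z ∘ₗ
        deconcat (A.susp 1) =
      E (mul (TensorProduct.map (A.tw ∘ₗ (A.susp 1).T.sp 1) A.tw z)) +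
      conv (deconcat (A.susp 1)) mul (E (A.tw ((A.susp 1).T.sp 1
        (TensorProduct.rid R _ (LinearMap.lTensor _ (augT (A.susp 1)) z)))) ∘ₗ
          (A.susp 1).T.sp 1) A.tw +
      conv (deconcat (A.susp 1)) mul (A.tw ∘ₗ (A.susp 1).T.sp (1 + p)) (E (A.tw
        (TensorProduct.lid R _ (LinearMap.rTensor _ (augT (A.susp 1)) z)))) +
      TensorProduct.lid R R (TensorProduct.map (augT (A.susp 1)) (augT (A.susp 1)) z) •
        conv (deconcat (A.susp 1)) mul (A.tw ∘ₗ (A.susp 1).T.sp 1) A.tw := by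
  refine tensorDeg_induction (V := (A.susp 1).T) (W := (A.susp 1).T) (P := fun z =>
    mul ∘ₗ TensorProduct.map (A.tw ∘ₗ (A.susp 1).T.sp 1) A.tw ∘ₗ braceMulTwo E z ∘ₗ
        deconcat (A.susp 1) =
      E (mul (TensorProduct.map (A.tw ∘ₗ (A.susp 1).T.sp 1) A.tw z)) +
      conv (deconcat (A.susp 1)) mul (E (A.tw ((A.susp 1).T.sp 1
        (TensorProduct.rid R _ (LinearMap.lTensor _ (augT (A.susp 1)) z)))) ∘ₗ
          (A.susp 1).T.sp 1) A.tw +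
      conv (deconcat (A.susp 1)) mul (A.tw ∘ₗ (A.susp 1).T.sp (1 + p)) (E (A.tw
        (TensorProduct.lid R _ (LinearMap.rTensor _ (augT (A.susp 1)) z)))) +
      TensorProduct.lid R R (TensorProduct.map (augT (A.susp 1)) (augT (A.susp 1)) z) •
        conv (deconcat (A.susp 1)) mul (A.tw ∘ₗ (A.susp 1).T.sp 1) A.tw) ?_ ?_ ?_ ?_ hz
  · simp only [map_zero, LinearMap.zero_comp, LinearMap.comp_zero, conv_zero_left, conv_zero_right,
      zero_smul, add_zero]
  · intro z z' h h'
    simp only [map_add, LinearMap.add_comp, LinearMap.comp_add, conv_add_left, conv_add_right,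
      add_smul, h, h']
    abel
  · intro r z h
    simp only [map_smul, LinearMap.smul_comp, LinearMap.comp_smul, conv_smul_left,
      conv_smul_right, smul_assoc, smul_add, h]
  · intro i j hij a ha b hb
    have hsa := GrMod.sp_mem (V := (A.susp 1).T) 1 ha
    have e1 : A.tw ∘ₗ (A.susp 1).T.sp 1 ∘ₗ braceMul E a =
        (E (A.tw ((A.susp 1).T.sp 1 a)) + augT (A.susp 1) a • A.tw) ∘ₗ (A.susp 1).T.sp 1 := by
      have h : (A.susp 1).T.sp 1 ∘ₗ braceMul E a =
          braceMul E ((A.susp 1).T.sp 1 a) ∘ₗ (A.susp 1).T.sp 1 :=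
        LinearMap.ext fun y => sp_braceMul hE 1 a y
      rw [h, ← LinearMap.comp_assoc, tw_braceMul hE]
      have h2 : augT (A.susp 1) ((A.susp 1).T.sp 1 a) = augT (A.susp 1) a :=
        LinearMap.congr_fun (augT_sp (W := A.susp 1) 1) a
      rw [h2]
    have htb : A.tw b ∈ A.deg (j - 1) := A.isDeg_tw _ _ hb
    have e2 : augT (A.susp 1) b • (A.susp 1).T.sp (1 + j) =
        augT (A.susp 1) b • (A.susp 1).T.sp 1 := by
      by_cases hj : j = 0
      · subst hj; rw [add_zero]
      · rw [augT_eq_zero _ j hj b hb, zero_smul, zero_smul]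
    have e3 : augT (A.susp 1) a • (A.susp 1).T.sp (1 + j) =
        augT (A.susp 1) a • (A.susp 1).T.sp (1 + p) := by
      by_cases hi : i = 0
      · subst hi; rw [← hij, zero_add]
      · rw [augT_eq_zero _ i hi a ha, zero_smul, zero_smul]
    have e4 : (A.susp 1).T.sp (1 + j) = (A.susp 1).T.sp (j - 1) :=
      GrMod.sp_congr (by push_cast; generalize (j : ZMod 2) = x; revert x; decide)
    have lhs : mul ∘ₗ TensorProduct.map (A.tw ∘ₗ (A.susp 1).T.sp 1) A.tw ∘ₗ
        braceMulTwo E (a ⊗ₜ b) ∘ₗ deconcat (A.susp 1) =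
        conv (deconcat (A.susp 1)) mul
          ((E (A.tw ((A.susp 1).T.sp 1 a)) + augT (A.susp 1) a • A.tw) ∘ₗ (A.susp 1).T.sp (1 + j))
          (E (A.tw b) + augT (A.susp 1) b • A.tw) := by
      rw [braceMulTwo_tmul (E := E) a hb, ← GrMod.sp_comp, ← LinearMap.comp_assoc (f := GrMod.sp _ j),
        ← e1, ← tw_braceMul hE b, ← LinearMap.comp_assoc (h := TensorProduct.map _ _),
        ← TensorProduct.map_comp]
      rfl
    rw [lhs]
    simp only [TensorProduct.map_tmul, LinearMap.lTensor_tmul, LinearMap.rTensor_tmul,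
      TensorProduct.lid_tmul, TensorProduct.rid_tmul, map_smul, LinearMap.smul_comp,
      LinearMap.comp_apply]
    rw [hE.mul_left _ _ htb]
    simp only [LinearMap.add_comp, conv_add_left, conv_add_right, LinearMap.smul_comp,
      conv_smul_left, conv_smul_right, smul_add]
    have e5 : augT (A.susp 1) b • conv (deconcat (A.susp 1)) mul
        (E (A.tw ((A.susp 1).T.sp 1 a)) ∘ₗ (A.susp 1).T.sp (1 + j)) A.tw =
        augT (A.susp 1) b • conv (deconcat (A.susp 1)) mul
        (E (A.tw ((A.susp 1).T.sp 1 a)) ∘ₗ (A.susp 1).T.sp 1) A.tw := by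
      rw [← conv_smul_left, ← LinearMap.comp_smul, e2, LinearMap.comp_smul, conv_smul_left]
    have e6 : augT (A.susp 1) a • conv (deconcat (A.susp 1)) mul
        (A.tw ∘ₗ (A.susp 1).T.sp (1 + j)) (E (A.tw b)) =
        augT (A.susp 1) a • conv (deconcat (A.susp 1)) mul
        (A.tw ∘ₗ (A.susp 1).T.sp (1 + p)) (E (A.tw b)) := by
      rw [← conv_smul_left, ← LinearMap.comp_smul, e3, LinearMap.comp_smul, conv_smul_left]
    have e7 : augT (A.susp 1) b • augT (A.susp 1) a • conv (deconcat (A.susp 1)) mul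
        (A.tw ∘ₗ (A.susp 1).T.sp (1 + j)) A.tw =
        (augT (A.susp 1) a • augT (A.susp 1) b) • conv (deconcat (A.susp 1)) mul
        (A.tw ∘ₗ (A.susp 1).T.sp 1) A.tw := by
      rw [smul_comm, ← conv_smul_left, ← LinearMap.comp_smul, e2, LinearMap.comp_smul,
        conv_smul_left, smul_assoc]
    rw [e5, e6, e7, e4]
    abel

end BraceDerivation

section BraceBialgebra

variable {A : AugMod.{u, v} R} {E : A.toGrMod →ₗ[R] (A.susp 1).T →ₗ[R] A.toGrMod}
  {mul : A.toGrMod ⊗[R] A.toGrMod →ₗ[R] A.toGrMod}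

theorem tw_bar_d_braceMul (hA : IsDGAlgebra A mul) (hE : IsBrace A mul E) {p : ℤ}
    {x : (A.susp 1).T} (hx : x ∈ (A.susp 1).T.deg p) :
    A.tw ∘ₗ (bar A mul).d ∘ₗ braceMul E x =
      A.tw ∘ₗ (braceMul E ((bar A mul).d x) +
        braceMul E ((A.susp 1).T.sp 1 x) ∘ₗ (bar A mul).d) := by
  have hd := tw_bar_d hA
  have hbd : ∀ r, ∀ x ∈ A.deg r, A.d ∘ₗ E x = E (A.d x) + sg R r • (E x ∘ₗ (bar A mul).d) -
      sg R r • conv (deconcat (A.susp 1)) mul (E x ∘ₗ (A.susp 1).T.sp 1) A.tw +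
      conv (deconcat (A.susp 1)) mul (A.tw ∘ₗ (A.susp 1).T.sp r) (E x) :=
    fun r x hx => LinearMap.ext (hE.boundary r x hx)
  have haug : augT (A.susp 1) ∘ₗ (bar A mul).d = 0 := augT_insertOdd_letter _
  generalize (bar A mul).d = D at *
  have e1 : A.tw ∘ₗ D ∘ₗ braceMul E x = -(A.d ∘ₗ (E (A.tw x) + augT (A.susp 1) x • A.tw)) +
      mul ∘ₗ TensorProduct.map (A.tw ∘ₗ (A.susp 1).T.sp 1) A.tw ∘ₗ
        braceMulTwo E (deconcat (A.susp 1) x) ∘ₗ deconcat (A.susp 1) := by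
    rw [← LinearMap.comp_assoc, hd, LinearMap.add_comp, LinearMap.neg_comp, LinearMap.comp_assoc,
      tw_braceMul hE, ← deconcat_braceMul]
    rfl
  have hz : deconcat (A.susp 1) x ∈ tensorDeg (A.susp 1).T (A.susp 1).T p :=
    GrMod.mem_of_eq (V := (A.susp 1).T.tensor (A.susp 1).T) (isDeg_deconcat _ _ _ hx) (add_zero p)
  have c1 : TensorProduct.rid R (A.susp 1).T (LinearMap.lTensor _ (augT (A.susp 1))
      (deconcat (A.susp 1) x)) = x :=
    LinearMap.congr_fun (isCoalg_deconcat (A.susp 1)).counit_right x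
  have c2 : TensorProduct.lid R (A.susp 1).T (LinearMap.rTensor _ (augT (A.susp 1))
      (deconcat (A.susp 1) x)) = x := counit_deconcat x
  have c3 : TensorProduct.lid R R (TensorProduct.map (augT (A.susp 1)) (augT (A.susp 1))
      (deconcat (A.susp 1) x)) = augT (A.susp 1) x := by
    conv_rhs => rw [← c2]
    generalize deconcat (A.susp 1) x = z
    induction z with
    | zero => simp
    | add z z' h h' => simp only [map_add, h, h']
    | tmul a b =>
      rw [TensorProduct.map_tmul, LinearMap.rTensor_tmul, TensorProduct.lid_tmul,
        TensorProduct.lid_tmul, map_smul]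
  have c4 : mul (TensorProduct.map (A.tw ∘ₗ (A.susp 1).T.sp 1) A.tw (deconcat (A.susp 1) x)) =
      A.tw (D x) + A.d (A.tw x) := by
    have h := LinearMap.congr_fun hd x
    rw [LinearMap.comp_apply] at h
    rw [h, LinearMap.add_apply, LinearMap.neg_apply, LinearMap.comp_apply, neg_add_cancel_comm]
    rfl
  have htx : A.tw x ∈ A.deg (p - 1) := A.isDeg_tw _ _ hx
  have c5 : A.tw ((A.susp 1).T.sp 1 x) = -(sg R (p - 1) • A.tw x) := by
    rw [GrMod.sp_apply 1 hx, map_smul, ← neg_smul, one_mul, sg_eq_neg (n := p - 1) (by push_cast; ring)]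
  have c6 : (A.susp 1).T.sp (1 + p) = (A.susp 1).T.sp (p - 1) :=
    GrMod.sp_congr (by push_cast; generalize (p : ZMod 2) = x; revert x; decide)
  have c7 : augT (A.susp 1) (D x) = 0 := LinearMap.congr_fun haug x
  have c8 : augT (A.susp 1) ((A.susp 1).T.sp 1 x) = augT (A.susp 1) x :=
    LinearMap.congr_fun (augT_sp (W := A.susp 1) 1) x
  rw [e1, conv_tw_braceMul hE hz, c1, c2, c3, c4, c5, c6, LinearMap.comp_add, LinearMap.comp_add,
    ← LinearMap.comp_assoc, tw_braceMul hE, tw_braceMul hE, c5, c7, c8, hbd _ _ htx,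
    LinearMap.comp_smul]
  simp only [LinearMap.add_comp, LinearMap.smul_comp, hd, zero_smul, add_zero, map_add, map_neg,
    LinearMap.neg_comp, conv_neg_left, map_smul, conv_smul_left, smul_add, smul_neg]
  abel

theorem bar_d_braceMul' (hA : IsDGAlgebra A mul) (hE : IsBrace A mul E) :
    (bar A mul).d ∘ₗ braceMul' E = braceMul' E ∘ₗ (bar A mul).tensorD := by
  have htD : (bar A mul).tensorD = tensorDer (bar A mul).d := by
    rw [AugMod.tensorD, GrMod.sgn_eq]
  rw [htD]
  have ht := fun p (x : (A.susp 1).T) (hx : x ∈ (A.susp 1).T.deg p) => tw_bar_d_braceMul hA hE hx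
  have haug : augT (A.susp 1) ∘ₗ (bar A mul).d = 0 := augT_insertOdd_letter _
  have hdeg : GrMod.IsDeg (V := (A.susp 1).T) (W := (A.susp 1).T) (bar A mul).d (-1) :=
    isDeg_insertOdd_letter _ (isDeg_barCogen hA)
  have hD : deconcat (A.susp 1) ∘ₗ (bar A mul).d =
    tensorDer (bar A mul).d ∘ₗ deconcat (A.susp 1) := deconcat_insertOdd (barCogen A mul)
  generalize (bar A mul).d = D at *
  have hs : (A.susp 1).T.sp 1 ∘ₗ braceMul' E =
      braceMul' E ∘ₗ TensorProduct.map ((A.susp 1).T.sp 1) ((A.susp 1).T.sp 1) :=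
    TensorProduct.ext' fun x y => sp_braceMul hE 1 x y
  have h : D ∘ₗ braceMul' E - braceMul' E ∘ₗ tensorDer D = 0 := by
    refine coderivation_ext (K := (A.susp 1).T ⊗[R] (A.susp 1).T)
      (cm := deconcatTwo (A.susp 1)) (f := braceMul' E) (g := (A.susp 1).T.sp 1 ∘ₗ braceMul' E)
      ?_ ?_ ?_
    · have e1 : deconcat (A.susp 1) ∘ₗ D ∘ₗ braceMul' E =
          (TensorProduct.map (D ∘ₗ braceMul' E) (braceMul' E) +
            TensorProduct.map ((A.susp 1).T.sp 1 ∘ₗ braceMul' E) (D ∘ₗ braceMul' E)) ∘ₗ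
            deconcatTwo (A.susp 1) := by
        rw [← LinearMap.comp_assoc, hD, LinearMap.comp_assoc, deconcat_braceMul_two,
          ← LinearMap.comp_assoc]
        congr 1
        refine TensorProduct.ext' fun a b => ?_
        rfl
      have e2 : deconcat (A.susp 1) ∘ₗ braceMul' E ∘ₗ tensorDer D =
          (TensorProduct.map (braceMul' E ∘ₗ tensorDer D) (braceMul' E) +
            TensorProduct.map ((A.susp 1).T.sp 1 ∘ₗ braceMul' E) (braceMul' E ∘ₗ tensorDer D)) ∘ₗ
            deconcatTwo (A.susp 1) := by
        rw [← LinearMap.comp_assoc, deconcat_braceMul_two, LinearMap.comp_assoc,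
          deconcatTwo_tensorDer hdeg hD, ← LinearMap.comp_assoc, hs]
        congr 1
        refine TensorProduct.ext' fun a b => ?_
        rfl
      rw [LinearMap.comp_sub, e1, e2, ← LinearMap.sub_comp]
      congr 1
      refine TensorProduct.ext' fun a b => ?_
      simp only [LinearMap.sub_apply, LinearMap.add_apply, TensorProduct.map_tmul,
        TensorProduct.sub_tmul, TensorProduct.tmul_sub]
      abel
    · refine unletter_ext (K := (A.susp 1).T ⊗[R] (A.susp 1).T)
        (TensorProduct.ext' fun x y => ?_)
      have key : ∀ x y, A.tw (D (braceMul E x y)) =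
          A.tw (braceMul E (D x) y + braceMul E ((A.susp 1).T.sp 1 x) (D y)) := by
        intro x y
        induction x using GrMod.homogeneous_induction (V := (A.susp 1).T) with
        | zero => simp
        | add x x' h h' =>
          simp only [map_add, LinearMap.add_apply] at h h' ⊢
          rw [h, h']; abel
        | hom n x hx => exact LinearMap.congr_fun (ht n x hx) y
      exact key x y
    · have ha : ∀ x, augT (A.susp 1) (D x) = 0 := LinearMap.congr_fun haug
      refine TensorProduct.ext' fun x y => ?_
      change augT _ (D (braceMul E x y) -
        braceMul' E (D x ⊗ₜ y + (A.susp 1).T.sp 1 x ⊗ₜ D y)) = 0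
      rw [map_sub, map_add, map_add, ha, TensorProduct.lift.tmul, TensorProduct.lift.tmul,
        augT_braceMul, augT_braceMul, ha, ha, zero_mul, mul_zero, add_zero, sub_zero]
  exact sub_eq_zero.mp h

/-- The product defined by brace operations makes the bar construction into a DG-bialgebra. -/
theorem isDGBialgebra_braceMul' (hA : IsDGAlgebra A mul) (hE : IsBrace A mul E)
    (hM : ∀ x, BraceModule E x) :
    IsDGBialgebra (bar A mul) (braceMul' E) (deconcat (A.susp 1)) where
  toIsDGAlgebra :=
    { toIsDGModule := (isDGCoalgebra_bar hA).toIsDGModule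
      mul_mem := fun m n a ha b hb => GrMod.mem_of_eq (isDeg_braceMul hE ha n b hb) (add_comm n m)
      mul_assoc := braceMul_assoc hE hM
      one_mul := fun a => LinearMap.congr_fun (braceMul_one E) a
      mul_one := braceMul_right_one hE
      d_mul := bar_d_braceMul' hA hE
      counit_mul := augT_braceMul }
  comul_mem := (isDGCoalgebra_bar hA).comul_mem
  coassoc := (isDGCoalgebra_bar hA).coassoc
  counit_comul := (isDGCoalgebra_bar hA).counit_comul
  comul_counit := (isDGCoalgebra_bar hA).comul_counit
  comul_d := (isDGCoalgebra_bar hA).comul_d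
  comul_one := (isDGCoalgebra_bar hA).comul_one
  comul_mul := deconcat_braceMul'

theorem augT_lengthProj {V : GrMod.{u, v} R} (n : ℕ) (x : TensorAlgebra R V) :
    augT V (lengthProj V n x) = if n = 0 then augT V x else 0 := by
  have h := lengthProj_lengthProj 0 n x
  rw [lengthProj_zero] at h
  have h2 := congrArg (augT V) h
  rw [map_smul, augT_one, smul_eq_mul, mul_one] at h2
  rw [h2]
  split_ifs with hn
  · subst hn; rw [lengthProj_zero, map_smul, augT_one, smul_eq_mul, mul_one]
  · exact map_zero _

theorem unletter_lengthProj {V : GrMod.{u, v} R} (n : ℕ) (x : TensorAlgebra R V) :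
    unletter V (lengthProj V n x) = if n = 1 then unletter V x else 0 := by
  have h := lengthProj_lengthProj 1 n x
  rw [lengthProj_one_eq] at h
  have h2 := congrArg (unletter V) h
  rw [unletter_letter] at h2
  rw [h2]
  split_ifs with hn
  · subst hn; rw [lengthProj_one_eq, unletter_letter]
  · exact map_zero _

theorem barOp_braceMul' (hE : IsBrace A mul E) (i j : ℕ) (x y : (A.susp 1).T) :
    barOp A (braceMul' E) i j (x ⊗ₜ y) = E (A.tw (lengthProj (A.susp 1) i x))
      (lengthProj (A.susp 1) j y) +
      augT (A.susp 1) (lengthProj (A.susp 1) i x) • A.tw (lengthProj (A.susp 1) j y) :=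
  LinearMap.congr_fun (tw_braceMul hE (lengthProj (A.susp 1) i x)) (lengthProj (A.susp 1) j y)

theorem barOp_braceMul'_eq_zero (hE : IsBrace A mul E) (i j : ℕ) (hi : 2 ≤ i) :
    barOp A (braceMul' E) i j = 0 := by
  refine TensorProduct.ext' fun x y => ?_
  rw [barOp_braceMul' hE, augT_lengthProj, if_neg (by lia), zero_smul, add_zero, AugMod.tw,
    LinearMap.comp_apply, unletter_lengthProj, if_neg (by lia), map_zero, map_zero]
  rfl

theorem barOp_braceMul'_letter (hE : IsBrace A mul E) (k : ℕ) (x : A.susp 1) (w : (A.susp 1).T) :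
    barOp A (braceMul' E) 1 k (letter (A.susp 1) x ⊗ₜ w) =
      E (A.outS 1 x) (lengthProj (A.susp 1) k w) := by
  rw [barOp_braceMul' hE, lengthProj_letter, if_pos rfl, augT_letter, zero_smul, add_zero,
    A.tw_letter]

end BraceBialgebra

section BraceModule

variable {A : AugMod.{u, v} R} {E : A.toGrMod →ₗ[R] (A.susp 1).T →ₗ[R] A.toGrMod}
  {mul : A.toGrMod ⊗[R] A.toGrMod →ₗ[R] A.toGrMod}

theorem BraceModule.zero : BraceModule E 0 := fun u w => by simp

theorem BraceModule.add {x y : A.toGrMod} (hx : BraceModule E x) (hy : BraceModule E y) :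
    BraceModule E (x + y) := fun u w => by
  rw [map_add, LinearMap.add_apply, map_add, LinearMap.add_apply, hx, hy, LinearMap.add_apply]

theorem BraceModule.smul (r : R) {x : A.toGrMod} (hx : BraceModule E x) :
    BraceModule E (r • x) := fun u w => by
  rw [map_smul, LinearMap.smul_apply, map_smul, LinearMap.smul_apply, hx, LinearMap.smul_apply]

theorem IsBrace.module_one (hE : IsBrace A mul E) : BraceModule E A.one := fun u w => by
  rw [hE.one, cst_apply, map_smul, hE.one, LinearMap.smul_apply, cst_apply, cst_apply,
    augT_braceMul, smul_smul]

theorem IsBrace.module_mul (hE : IsBrace A mul E) {n : ℤ}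
    {x z : A.toGrMod} (hz : z ∈ A.deg n) (hx : BraceModule E x)
    (hzM : BraceModule E z) : BraceModule E (mul (x ⊗ₜ z)) := by
  intro u w
  replace hx : ∀ u, E (E x u) = E x ∘ₗ braceMul E u := fun u => LinearMap.ext (hx u)
  replace hzM : ∀ u, E (E z u) = E z ∘ₗ braceMul E u := fun u => LinearMap.ext (hzM u)
  rw [← LinearMap.comp_apply (f := E _)]
  refine LinearMap.congr_fun ?_ w
  rw [hE.mul_left _ _ hz, conv_comp, deconcat_braceMul, conv_apply]
  generalize deconcat (A.susp 1) u = Z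
  have h1 : ∀ Y : (A.susp 1).T ⊗[R] (A.susp 1).T,
      E (mul (TensorProduct.map (E x ∘ₗ (A.susp 1).T.sp n) (E z) Y)) =
      conv (braceMulTwo E Y ∘ₗ deconcat (A.susp 1)) mul (E x ∘ₗ (A.susp 1).T.sp n) (E z) := by
    intro Y
    induction Y using GrMod.tensor_induction (V := (A.susp 1).T) (W := (A.susp 1).T) with
    | zero => ext w; simp [conv_apply]
    | add x x' h h' =>
      rw [map_add, map_add, map_add, h, h', map_add]
      ext w; simp only [conv_apply, LinearMap.add_apply, LinearMap.comp_apply, map_add]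
    | hom i j a ha b hb =>
      have e1 : braceMul E ((A.susp 1).T.sp n a) ∘ₗ (A.susp 1).T.sp (j + n) =
          (A.susp 1).T.sp n ∘ₗ braceMul E a ∘ₗ (A.susp 1).T.sp j := by
        rw [add_comm, ← GrMod.sp_comp]
        ext w
        exact (sp_braceMul hE n a _).symm
      rw [TensorProduct.map_tmul, hE.mul_left _ _ (hE.deg _ _ hz _ _ hb), LinearMap.comp_apply, hx,
        hzM, LinearMap.comp_assoc, e1, braceMulTwo_tmul (E := E) a hb, ← conv_comp_comp]
      rfl
  exact h1 Z

theorem IsBrace.module_of_act (hE : IsBrace A mul E)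
    {v : A.toGrMod} (act : A.toGrMod →ₗ[R] A.toGrMod) (h2 : ∀ x w, E (act x) w = act (E x w))
    (h3 : ∀ w, E v w = augT (A.susp 1) w • v + act (A.tw w)) :
    BraceModule E v := by
  intro u w
  rw [h3, h3, tw_braceMul_apply hE, augT_braceMul, map_add, LinearMap.add_apply, map_smul,
    LinearMap.smul_apply, h3, h2, map_add, map_smul, smul_add, smul_smul, add_assoc, add_comm (_ • _)
    (act (E _ _))]

end BraceModule

section FreeAlgebra

variable {V : GrMod.{u, v} R} {d : V.T →ₗ[R] V.T}
  {E : V.T →ₗ[R] ((augTensor V d).susp 1).T →ₗ[R] V.T}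

theorem BraceBoundary.of_augTensor
    (boundary : ∀ r, ∀ x ∈ V.T.deg r, ∀ w, d (E x w) = E (d x) w +
      sg R r • E x ((bar (augTensor V d) (concat V)).d w) -
      sg R r • braceTwRight (A := augTensor V d) (concat V) E x w +
      braceTwLeft (A := augTensor V d) (concat V) E r x w) :
    BraceBoundary (A := augTensor V d) (concat V) E := boundary

theorem IsBrace.of_augTensor
    (one : E (1 : TensorAlgebra R V) = cst (augT ((augTensor V d).susp 1)) (1 : TensorAlgebra R V))
    (mul_left : ∀ n, ∀ z ∈ V.T.deg n, ∀ x : V.T, E (x * z : TensorAlgebra R V) =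
      conv (deconcat ((augTensor V d).susp 1)) (concat V)
        (E x ∘ₗ ((augTensor V d).susp 1).T.sp n) (E z))
    (deg : ∀ n, ∀ x ∈ V.T.deg n,
      GrMod.IsDeg (V := ((augTensor V d).susp 1).T) (W := V.T) (E x) n)
    (apply_one : ∀ x : V.T, E x (1 : TensorAlgebra R ((augTensor V d).susp 1)) = x)
    (counit : ∀ x : V.T, augT V ∘ₗ E x = augT V x • augT ((augTensor V d).susp 1))
    (boundary : BraceBoundary (A := augTensor V d) (concat V) E) :
    IsBrace (augTensor V d) (concat V) E where
  one := one
  mul_left := mul_left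
  deg := deg
  apply_one := apply_one
  counit x hx w := by
    have h := LinearMap.congr_fun (counit x) w
    have hx' : augT V x = 0 := hx
    rw [hx', zero_smul] at h
    exact h
  boundary := boundary

theorem word_induction_right' {P : TensorAlgebra R V → Prop} (one : P 1)
    (snoc : ∀ m n (v : V) x, v ∈ V.deg m → x ∈ V.T.deg n → P x → P (x * letter V v))
    (zero : P 0) (add : ∀ x y, P x → P y → P (x + y)) (smul : ∀ (r : R) x, P x → P (r • x))
    (x : TensorAlgebra R V) : P x := by
  induction x using GrMod.homogeneous_induction (V := V.T) with
  | zero => exact zero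
  | add x x' h h' => exact add _ _ h h'
  | hom n x hx =>
    exact word_induction_right (V := V) (P := fun _ x => P x) one snoc (fun _ => zero)
      (fun _ => add) (fun _ => smul) n x hx

theorem IsBrace.module_of_letter (hE : IsBrace (augTensor V d) (concat V) E)
    (hlet : ∀ v : V, ∃ act : V.T →ₗ[R] V.T, (∀ x w, E (act x) w = act (E x w)) ∧
      ∀ w, E (letter V v) w = augT ((augTensor V d).susp 1) w • letter V v +
        act ((augTensor V d).tw w)) (x : V.T) : BraceModule (A := augTensor V d) E x := by
  refine word_induction_right' (P := BraceModule (A := augTensor V d) E) ?_ ?_ ?_ ?_ ?_ x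
  · exact hE.module_one
  · intro m n v x hv hx ih
    obtain ⟨act, h2, h3⟩ := hlet v
    have h := hE.module_mul (letter_mem hv) ih (hE.module_of_act act h2 h3)
    rw [concat_tmul] at h
    exact h
  · exact BraceModule.zero
  · exact fun x y hx hy => hx.add hy
  · exact fun r x hx => hx.smul r

end FreeAlgebra

section Concrete

variable {H : AugMod.{u, v} R} {mul : H.toGrMod ⊗[R] H.toGrMod →ₗ[R] H.toGrMod}
  {comul : H.toGrMod →ₗ[R] H.toGrMod ⊗[R] H.toGrMod}

theorem AugMod.letter_eq_jay (v : H.susp (-1)) :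
    letter (H.susp (-1)) v = H.jay (H.toGrMod.sp 1 (H.outS (-1) v)) := by
  rw [H.letter_eq, ← AugMod.jay_sp]; rfl

theorem counit_sp_outS (v : H.susp (-1)) : H.counit (H.toGrMod.sp 1 (H.outS (-1) v)) = 0 :=
  (LinearMap.congr_fun (H.counit_sp 1) _).trans (H.counit_outS _ v)

theorem augT_dact (x : TensorAlgebra R (H.susp (-1))) :
    augT (H.susp (-1)) ∘ₗ dact mul comul x = augT (H.susp (-1)) x • H.counit := by
  induction x using GrMod.homogeneous_induction (V := (H.susp (-1)).T) with
  | zero => simp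
  | add x x' h h' => simp only [map_add, LinearMap.comp_add, h, h', add_smul]
  | hom n x hx =>
    refine word_induction (V := H.susp (-1)) (P := fun n x =>
      augT (H.susp (-1)) ∘ₗ dact mul comul x = augT (H.susp (-1)) x • H.counit)
      ?_ ?_ ?_ ?_ ?_ n x hx
    · rw [dact, diagonalAct_one, augT_one, one_smul]
      ext a
      rw [LinearMap.comp_apply, cst_apply, map_smul, augT_one, smul_eq_mul, mul_one]
    · intro p q v x hv hx ih
      have h : augT (H.susp (-1)) ∘ₗ letterAct (H := H) mul LinearMap.id v = 0 := by
        ext a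
        exact augT_letter _
      rw [dact, diagonalAct_cons _ _ _ hv, augT_conv, h, conv_zero_left, augT_mul, augT_letter,
        zero_mul, zero_smul]
    · intro m; simp
    · intro m x y hx hy
      simp only [map_add, LinearMap.comp_add, hx, hy, add_smul]
    · intro m r x hx
      simp only [map_smul, LinearMap.comp_smul, hx, smul_assoc]

theorem braceOp_letter_apply (v : H.susp (-1)) (w : (barLetters H comul).T) :
    braceOp H mul comul (letter (H.susp (-1)) v) w =
      augT (barLetters H comul) w • letter (H.susp (-1)) v +
      actOn mul comul (H.toGrMod.sp 1 (H.outS (-1) v)) ((cobar H comul).tw w) := by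
  rw [H.letter_eq_jay, braceOp_jay, counit_sp_outS, zero_smul, sub_zero, LinearMap.add_apply]
  rfl

theorem braceOp_apply_one (x : TensorAlgebra R (H.susp (-1))) :
    braceOp H mul comul x (1 : TensorAlgebra R (barLetters H comul)) = x := by
  induction x using GrMod.homogeneous_induction (V := (H.susp (-1)).T) with
  | zero => simp
  | add x x' h h' => simp only [map_add, LinearMap.add_apply, h, h']
  | hom n x hx =>
    refine word_induction_right (V := H.susp (-1)) (P := fun n x =>
      braceOp H mul comul x (1 : TensorAlgebra R (barLetters H comul)) = x)
      ?_ ?_ ?_ ?_ ?_ n x hx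
    · rw [braceOp_one, cst_apply, augT_one, one_smul]
    · intro p q v x hv hx ih
      rw [braceOp_mul (letter_mem hv), conv_deconcat_one, LinearMap.comp_apply, sp_oneT, ih,
        braceOp_letter_apply, augT_one, one_smul, AugMod.tw_one, map_zero, add_zero, concat_tmul]
    · intro m; simp
    · intro m x y hx hy
      rw [map_add, LinearMap.add_apply, hx, hy]
    · intro m r x hx
      rw [map_smul, LinearMap.smul_apply, hx]

theorem augT_actOn (a : H.toGrMod) (x : TensorAlgebra R (H.susp (-1))) :
    augT (H.susp (-1)) (actOn mul comul a x) = augT (H.susp (-1)) x * H.counit a :=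
  LinearMap.congr_fun (augT_dact x) a

theorem augT_braceOp (x : TensorAlgebra R (H.susp (-1))) :
    augT (H.susp (-1)) ∘ₗ braceOp H mul comul x =
      augT (H.susp (-1)) x • augT (barLetters H comul) := by
  induction x using GrMod.homogeneous_induction (V := (H.susp (-1)).T) with
  | zero => simp
  | add x x' h h' => simp only [map_add, LinearMap.comp_add, h, h', add_smul]
  | hom n x hx =>
    refine word_induction_right (V := H.susp (-1)) (P := fun n x =>
      augT (H.susp (-1)) ∘ₗ braceOp H mul comul x =
        augT (H.susp (-1)) x • augT (barLetters H comul)) ?_ ?_ ?_ ?_ ?_ n x hx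
    · rw [braceOp_one, comp_cst, augT_one, one_smul]
      ext w
      rw [cst_apply, smul_eq_mul, mul_one]
    · intro p q v x hv hx ih
      have h : augT (H.susp (-1)) ∘ₗ braceOp H mul comul (letter (H.susp (-1)) v) = 0 := by
        ext1 w
        have hw : augT (H.susp (-1)) ((cobar H comul).tw w) = 0 :=
          LinearMap.congr_fun (AugMod.counit_tw (cobar H comul)) w
        rw [LinearMap.comp_apply, braceOp_letter_apply, map_add, map_smul, augT_letter, smul_zero,
          zero_add, augT_actOn, hw, zero_mul, LinearMap.zero_apply]
      rw [braceOp_mul (letter_mem hv), augT_conv, h, conv_zero_right, augT_mul, augT_letter,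
        mul_zero, zero_smul]
    · intro m; simp
    · intro m x y hx hy
      simp only [map_add, LinearMap.comp_add, hx, hy, add_smul]
    · intro m r x hx
      simp only [map_smul, LinearMap.comp_smul, hx, smul_assoc]

/-- The operations `E_{1,k}` on the cobar construction of a DG-bialgebra are brace operations. -/
theorem isBrace_braceOp (hb : IsDGBialgebra H mul comul) :
    IsBrace (cobar H comul) (concat (H.susp (-1))) (braceOp H mul comul) :=
  IsBrace.of_augTensor (braceOp_one mul comul) (fun _ _ hz x => braceOp_mul hz x)
    (fun _ _ hx => isDeg_braceOp hb hx) braceOp_apply_one augT_braceOp (BraceBoundary.of_augTensor fun r x hx w => by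
      have h := LinearMap.congr_fun (d_braceOp hb hx) w
      have e1 : conv (deconcat (barLetters H comul)) (concat (H.susp (-1)))
          (braceOp H mul comul x ∘ₗ (barLetters H comul).T.sp 1) (cobar H comul).tw =
          braceTwRight (A := cobar H comul) (concat _) (braceOp H mul comul) x := rfl
      have e2 : conv (deconcat (barLetters H comul)) (concat (H.susp (-1)))
          ((cobar H comul).tw ∘ₗ (barLetters H comul).T.sp r) (braceOp H mul comul x) =
          braceTwLeft (A := cobar H comul) (concat _) (braceOp H mul comul) r x := rfl
      rw [e1, e2] at h
      exact h)

theorem braceOp_braceOp (hb : IsDGBialgebra H mul comul) (x : (H.susp (-1)).T) :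
    BraceModule (A := cobar H comul) (braceOp H mul comul) x :=
  (isBrace_braceOp hb).module_of_letter (fun v =>
    ⟨actOn mul comul (H.toGrMod.sp 1 (H.outS (-1) v)),
      fun x => LinearMap.congr_fun (braceOp_dact hb x (H.toGrMod.sp 1 (H.outS (-1) v))),
      braceOp_letter_apply v⟩) x

end Concrete

section BraceOps

variable {A : AugMod.{u, v} R}

/-- `E` gives the operations `E_{1,k}` of the product `mulB` on the bar construction. -/
def HasOps (E : A.toGrMod →ₗ[R] (A.susp 1).T →ₗ[R] A.toGrMod)
    (mulB : (A.susp 1).T ⊗[R] (A.susp 1).T →ₗ[R] (A.susp 1).T) : Prop :=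
  ∀ k : ℕ, TensorProduct.curry (barOp A mulB 1 k) ∘ₗ letter (A.susp 1) =
    E.compl₂ (lengthProj (A.susp 1) k) ∘ₗ A.outS 1

theorem hasOps_braceMul' {E : A.toGrMod →ₗ[R] (A.susp 1).T →ₗ[R] A.toGrMod}
    {mul : A.toGrMod ⊗[R] A.toGrMod →ₗ[R] A.toGrMod} (hE : IsBrace A mul E) :
    HasOps E (braceMul' E) := fun k => by
  refine LinearMap.ext fun x => LinearMap.ext fun w => ?_
  exact barOp_braceMul'_letter hE k x w

/-- `HasOps` for a free algebra. -/
def HasFreeOps {V : GrMod.{u, v} R} {d : V.T →ₗ[R] V.T}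
    (E : V.T →ₗ[R] ((augTensor V d).susp 1).T →ₗ[R] V.T)
    (mulB : ((augTensor V d).susp 1).T ⊗[R] ((augTensor V d).susp 1).T →ₗ[R]
      ((augTensor V d).susp 1).T) : Prop :=
  ∀ k : ℕ, TensorProduct.curry (barOp (augTensor V d) mulB 1 k) ∘ₗ
    letter ((augTensor V d).susp 1) =
      E.compl₂ (lengthProj ((augTensor V d).susp 1) k) ∘ₗ (augTensor V d).outS 1

theorem HasOps.free {V : GrMod.{u, v} R} {d : V.T →ₗ[R] V.T}
    {E : V.T →ₗ[R] ((augTensor V d).susp 1).T →ₗ[R] V.T}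
    {mulB : ((augTensor V d).susp 1).T ⊗[R] ((augTensor V d).susp 1).T →ₗ[R]
      ((augTensor V d).susp 1).T}
    (h : HasOps (A := augTensor V d) E mulB) : HasFreeOps E mulB := h

end BraceOps

theorem conv_sp {V : GrMod.{u, v} R} {cm : V →ₗ[R] V ⊗[R] V}
    (hdeg : GrMod.IsDeg (W := V.tensor V) cm 0) {A B C : Type*} [AddCommGroup A]
    [AddCommGroup B] [AddCommGroup C] [Module R A] [Module R B] [Module R C]
    (mu : A ⊗[R] B →ₗ[R] C) (f : V →ₗ[R] A) (g : V →ₗ[R] B) (n : ℤ) :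
    conv cm mu f g ∘ₗ V.sp n = conv cm mu (f ∘ₗ V.sp n) (g ∘ₗ V.sp n) := by
  rw [conv_comp, comul_sp hdeg, conv_comp_comp]

section Action

variable {H : AugMod.{u, v} R} {mul : H.toGrMod ⊗[R] H.toGrMod →ₗ[R] H.toGrMod}
  {comul : H.toGrMod →ₗ[R] H.toGrMod ⊗[R] H.toGrMod} {S : H.toGrMod →ₗ[R] H.toGrMod}

theorem HasFreeOps.hasBraceOps {mulB}
    (h : HasFreeOps (V := H.susp (-1)) (d := (cobar H comul).d) (braceOp H mul comul) mulB) :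
    HasBraceOps H mul comul mulB :=
  fun k x w => LinearMap.congr_fun (LinearMap.congr_fun (h k) x) w

theorem hasBraceOps_braceMul' (hb : IsDGBialgebra H mul comul) :
    HasBraceOps H mul comul (braceMul' (A := cobar H comul) (braceOp H mul comul)) :=
  HasFreeOps.hasBraceOps (HasOps.free (hasOps_braceMul' (isBrace_braceOp hb)))

theorem isDGBialgebra_braceOp (hb : IsDGBialgebra H mul comul) :
    IsDGBialgebra (bar (cobar H comul) (concat (H.susp (-1))))
      (braceMul' (A := cobar H comul) (braceOp H mul comul))
      (deconcat ((cobar H comul).susp 1)) :=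
  isDGBialgebra_braceMul' (isDGAlgebra_cobar hb.toIsDGCoalgebra) (isBrace_braceOp hb)
    (braceOp_braceOp hb)

variable (mul comul) in
/-- The diagonal action `a ⊗ x ↦ a ⋄ x`. -/
abbrev actPair : H.toGrMod ⊗[R] (H.susp (-1)).T →ₗ[R] (H.susp (-1)).T :=
  TensorProduct.lift (dact mul comul).flip

variable (mul comul S) in
/-- The map `a ↦ S(a) ⋄ x`. -/
abbrev sact (x : (H.susp (-1)).T) : H.toGrMod →ₗ[R] (H.susp (-1)).T := dact mul comul x ∘ₗ S

variable (hb : IsDGBialgebra H mul comul) (hS : IsAntipode H mul comul S)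

include hb

theorem conv_actPair_mul {cm : H.toGrMod →ₗ[R] H.toGrMod ⊗[R] H.toGrMod}
    {f g : H.toGrMod →ₗ[R] H.toGrMod} (hfg : conv cm mul f g = cst H.counit H.one)
    (x : (H.susp (-1)).T) :
    conv cm (actPair mul comul) f (dact mul comul x ∘ₗ g) = cst H.counit x := by
  have h1 := congrArg (fun f => dact mul comul x ∘ₗ f) hfg
  simp only [comp_conv, comp_cst, dact_unit hb] at h1
  rw [← h1]
  unfold conv
  congr 1
  rw [← LinearMap.comp_assoc, ← LinearMap.comp_assoc]
  congr 1
  refine TensorProduct.ext' fun a b => ?_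
  exact (dact_dact hb x (f a) (g b)).symm

theorem conv_actPair_jay {cm : H.toGrMod →ₗ[R] H.toGrMod ⊗[R] H.toGrMod}
    (hcm : IsCoalg cm H.counit)
    {f : H.toGrMod →ₗ[R] H.toGrMod} (hf : conv cm mul f LinearMap.id = cst H.counit H.one) :
    conv cm (actPair mul comul) f H.jay = -(H.jay ∘ₗ f) := by
  have h1 := congrArg (fun f => H.jay ∘ₗ f) hf
  simp only [comp_conv, comp_cst, H.jay_one, cst_zero] at h1
  have h2 := hcm.conv_cst (mu := (TensorProduct.rid R H.toGrMod).toLinearMap) (1 : R) f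
  have h3 : mulR (TensorProduct.rid R H.toGrMod).toLinearMap (1 : R) = LinearMap.id := by
    ext a; simp [mulR]
  rw [h3, LinearMap.id_comp] at h2
  rw [eq_neg_iff_add_eq_zero, ← h1]
  nth_rewrite 2 [← h2]
  rw [comp_conv]
  unfold conv
  rw [← LinearMap.comp_assoc, ← LinearMap.comp_assoc, ← LinearMap.comp_assoc, ← LinearMap.add_comp]
  congr 1
  refine TensorProduct.ext' fun a b => ?_
  simp only [LinearMap.add_apply, LinearMap.comp_apply, TensorProduct.map_tmul, cst_apply,
    LinearMap.id_apply, smul_eq_mul, mul_one, LinearEquiv.coe_coe, TensorProduct.rid_tmul,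
    map_smul]
  have := dact_jay hb (f a) b
  rw [eq_sub_iff_add_eq] at this
  exact this

include hS

/-- The antipode applied to a product: `∑ S(b') ⋄ (X(b'') Y)`. -/
theorem conv_sact_mulR {s : ℤ} {X : H.toGrMod →ₗ[R] (H.susp (-1)).T}
    (hX : GrMod.IsDeg (V := H.toGrMod) (W := (H.susp (-1)).T) X s) (Y : (H.susp (-1)).T) :
    conv comul (actPair mul comul) S (mulR (concat _) Y ∘ₗ X) =
      conv (cop comul) (concat _) (conv comul (actPair mul comul) S X)
        (sact mul comul S Y ∘ₗ H.toGrMod.sp s) := by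
  have hdeg := hb.toIsDGCoalgebra.isDeg
  let M : (H.toGrMod ⊗[R] H.toGrMod) ⊗[R] H.toGrMod →ₗ[R] (H.susp (-1)).T :=
    concat _ ∘ₗ TensorProduct.map (actPair mul comul ∘ₗ TensorProduct.map S X)
      (sact mul comul S Y ∘ₗ H.toGrMod.sp s)
  have h1 : actPair mul comul ∘ₗ TensorProduct.map S (mulR (concat _) Y ∘ₗ X) =
      M ∘ₗ koszul H.toGrMod (H.toGrMod.tensor H.toGrMod) ∘ₗ
        (TensorProduct.assoc R H.toGrMod H.toGrMod H.toGrMod).toLinearMap ∘ₗ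
        LinearMap.rTensor H.toGrMod comul := by
    refine GrMod.tensor_ext fun m n a ha b hb' => ?_
    have e1 : actPair mul comul (S a ⊗ₜ mulR (concat _) Y (X b)) =
        dact mul comul (X b * Y : TensorAlgebra R (H.susp (-1))) (S a) := rfl
    have e2 := LinearMap.congr_fun (dact_mul hb (hX n b hb') Y) (S a)
    have e3 := LinearMap.congr_fun (hS.anticomul hb) a
    simp only [LinearMap.comp_apply] at e3
    rw [LinearMap.comp_apply, TensorProduct.map_tmul, LinearMap.comp_apply, e1, e2, conv_apply, e3]
    simp only [LinearMap.comp_apply, LinearMap.rTensor_tmul, LinearEquiv.coe_coe]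
    generalize comul a = z
    induction z using GrMod.tensor_induction (V := H.toGrMod) (W := H.toGrMod) with
    | zero => simp only [map_zero, TensorProduct.zero_tmul]
    | add z z' h h' => simp only [map_add, TensorProduct.add_tmul, h, h']
    | hom p q c hc d hd =>
      have hdb : d ⊗ₜ[R] b ∈ (H.toGrMod.tensor H.toGrMod).deg (q + n) := GrMod.tmul_mem hd hb' rfl
      rw [TensorProduct.assoc_tmul, GrMod.koszul_tmul' hc hd,
        GrMod.koszul_tmul' (W := H.toGrMod.tensor H.toGrMod) hc hdb]
      simp only [map_smul, TensorProduct.map_tmul, M, LinearMap.comp_apply,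
        GrMod.sp_apply s hc, GrMod.sp_apply (n + s) (hS.mem p c hc), TensorProduct.tmul_smul,
        smul_smul, ← sg_add]
      refine sg_smul_congr ?_ rfl
      push_cast
      generalize (p : ZMod 2) = p, (q : ZMod 2) = q, (n : ZMod 2) = n, (s : ZMod 2) = s
      revert p q n s
      decide
  have h2 : koszul H.toGrMod (H.toGrMod.tensor H.toGrMod) ∘ₗ LinearMap.lTensor H.toGrMod comul =
    LinearMap.rTensor H.toGrMod comul ∘ₗ koszul H.toGrMod H.toGrMod := koszul_lTensor_cm hdeg
  calc _ = (actPair mul comul ∘ₗ TensorProduct.map S (mulR (concat _) Y ∘ₗ X)) ∘ₗ comul := rfl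
    _ = M ∘ₗ koszul H.toGrMod (H.toGrMod.tensor H.toGrMod) ∘ₗ
        ((TensorProduct.assoc R H.toGrMod H.toGrMod H.toGrMod).toLinearMap ∘ₗ
        LinearMap.rTensor H.toGrMod comul ∘ₗ comul) := by rw [h1]; rfl
    _ = M ∘ₗ (koszul H.toGrMod (H.toGrMod.tensor H.toGrMod) ∘ₗ
        LinearMap.lTensor H.toGrMod comul) ∘ₗ comul := by rw [hb.isCoalg.coassoc]; rfl
    _ = M ∘ₗ LinearMap.rTensor H.toGrMod comul ∘ₗ cop comul := by rw [h2]; rfl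
    _ = _ := by
      unfold conv
      rw [← LinearMap.comp_assoc]
      simp only [M]
      rw [LinearMap.comp_assoc (LinearMap.rTensor H.toGrMod comul), LinearMap.map_comp_rTensor]
      rfl

/-- The antipode applied to a product: `∑ S(b') ⋄ (Y X(b''))`, for the opposite coproduct. -/
theorem conv_sact_mulL {q : ℤ} {Y : (H.susp (-1)).T} (hY : Y ∈ (H.susp (-1)).T.deg q)
    (X : H.toGrMod →ₗ[R] (H.susp (-1)).T) :
    conv (cop comul) (actPair mul comul) S (mulL (concat _) Y ∘ₗ X) =
      conv (cop comul) (concat _) (sact mul comul S Y)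
        (conv (cop comul) (actPair mul comul) (S ∘ₗ H.toGrMod.sp q) X) := by
  have hcop := hb.isCoalg_cop
  let μ : ((H.susp (-1)).T ⊗[R] H.toGrMod) ⊗[R] (H.susp (-1)).T →ₗ[R] (H.susp (-1)).T :=
    concat _ ∘ₗ LinearMap.lTensor _ (actPair mul comul) ∘ₗ
      (TensorProduct.assoc R (H.susp (-1)).T H.toGrMod (H.susp (-1)).T).toLinearMap
  have h := IsCoalg.conv_assoc (hc := hcop) (mu := μ) (mu' := (LinearMap.id : (H.susp (-1)).T ⊗[R] H.toGrMod →ₗ[R] _))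
    (mu₂ := concat _)
    (mu₂' := actPair mul comul) (fun a b c => rfl) (sact mul comul S Y) (S ∘ₗ H.toGrMod.sp q) X
  refine Eq.trans ?_ h
  have key : actPair mul comul ∘ₗ TensorProduct.map S (mulL (concat _) Y ∘ₗ X) =
      μ ∘ₗ TensorProduct.map (conv (cop comul)
        (LinearMap.id : (H.susp (-1)).T ⊗[R] H.toGrMod →ₗ[R] _) (sact mul comul S Y)
        (S ∘ₗ H.toGrMod.sp q)) X := ?_
  · exact congrArg (fun f => f ∘ₗ cop comul) key
  refine TensorProduct.ext' fun a b => ?_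
  have e1 : actPair mul comul (S a ⊗ₜ mulL (concat _) Y (X b)) =
      dact mul comul (Y * X b : TensorAlgebra R (H.susp (-1))) (S a) := rfl
  have e2 := LinearMap.congr_fun (dact_mul hb hY (X b)) (S a)
  have e3 := LinearMap.congr_fun (hS.anticomul hb) a
  simp only [LinearMap.comp_apply] at e3
  rw [LinearMap.comp_apply, TensorProduct.map_tmul, LinearMap.comp_apply, e1, e2, conv_apply, e3,
    LinearMap.comp_apply μ, TensorProduct.map_tmul, conv_apply, LinearMap.comp_apply,
    LinearMap.id_apply]
  generalize koszul H.toGrMod H.toGrMod (comul a) = z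
  have hsp : ∀ c, H.toGrMod.sp q (S c) = S (H.toGrMod.sp q c) := LinearMap.congr_fun (hS.sp q)
  induction z using TensorProduct.induction_on with
  | zero => simp only [map_zero, TensorProduct.zero_tmul]
  | add z z' h h' => simp only [map_add, TensorProduct.add_tmul, h, h']
  | tmul c d =>
    simp only [TensorProduct.map_tmul, LinearMap.comp_apply, μ, hsp, LinearEquiv.coe_coe,
      TensorProduct.assoc_tmul, LinearMap.lTensor_tmul]
    rfl

/-- The boundary of `S(b) ⋄ Y`. -/
theorem d_sact {k : ℤ} {Y : (H.susp (-1)).T} (hY : Y ∈ (H.susp (-1)).T.deg k)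
    (hcop : conv (cop comul) mul S LinearMap.id = cst H.counit H.one) :
    (cobar H comul).d ∘ₗ sact mul comul S Y ∘ₗ H.toGrMod.sp 1 =
      -(sact mul comul S Y ∘ₗ H.toGrMod.sp 1 ∘ₗ H.d) + sact mul comul S ((cobar H comul).d Y) -
        conv comul (actPair mul comul) S (mulR (concat _) Y ∘ₗ H.jay) +
        sg R k • conv (cop comul) (actPair mul comul) S
          (mulL (concat _) Y ∘ₗ H.jay ∘ₗ H.toGrMod.sp k) := by
  have hcoalg := hb.isCoalg
  have hcop' := hb.isCoalg_cop
  have h1 : conv comul (actPair mul comul) S (mulR (concat _) Y ∘ₗ H.jay) =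
      -conv (cop comul) (concat _) (H.jay ∘ₗ S) (sact mul comul S Y ∘ₗ H.toGrMod.sp 1) := by
    rw [conv_sact_mulR hb hS H.isDeg_jay, conv_actPair_jay hb hcoalg hS.conv_left, conv_neg_left,
      GrMod.sp_congr (m := -1) (n := 1) (by decide)]
  have h2 : conv (cop comul) (actPair mul comul) S
        (mulL (concat _) Y ∘ₗ H.jay ∘ₗ H.toGrMod.sp k) =
      -conv (cop comul) (concat _) (sact mul comul S Y) (H.jay ∘ₗ S ∘ₗ H.toGrMod.sp k) := by
    have e : conv (cop comul) (actPair mul comul) (S ∘ₗ H.toGrMod.sp k) (H.jay ∘ₗ H.toGrMod.sp k) =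
        -(H.jay ∘ₗ S ∘ₗ H.toGrMod.sp k) := by
      rw [← conv_sp (isDeg_cop hb.toIsDGCoalgebra.isDeg), conv_actPair_jay hb hcop' hcop]
      rfl
    rw [conv_sact_mulL hb hS hY, e, conv_neg_right]
  have h3 : ∀ (f g : H.toGrMod →ₗ[R] (H.susp (-1)).T), conv comul (concat _) f g ∘ₗ S =
      conv (cop comul) (concat _) (f ∘ₗ S) (g ∘ₗ S) := fun f g => by
    unfold conv
    rw [LinearMap.comp_assoc, LinearMap.comp_assoc, hS.anticomul hb, TensorProduct.map_comp]
    rfl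
  have hS' : ∀ n c, S (H.toGrMod.sp n c) = H.toGrMod.sp n (S c) := fun n c =>
    (LinearMap.congr_fun (hS.sp n) c).symm
  have h4 : conv (cop comul) (concat _) (H.ell ∘ₗ S) (dact mul comul Y ∘ₗ S) ∘ₗ H.toGrMod.sp 1 =
      conv (cop comul) (concat _) (H.jay ∘ₗ S) (sact mul comul S Y ∘ₗ H.toGrMod.sp 1) := by
    rw [conv_sp (isDeg_cop hb.toIsDGCoalgebra.isDeg)]
    congr 1
    ext c
    simp only [LinearMap.comp_apply, hS', AugMod.jay]
  have h5 : conv (cop comul) (concat _) ((dact mul comul Y ∘ₗ H.toGrMod.sp 1) ∘ₗ S)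
        ((H.ell ∘ₗ H.toGrMod.sp k) ∘ₗ S) ∘ₗ H.toGrMod.sp 1 =
      conv (cop comul) (concat _) (sact mul comul S Y) (H.jay ∘ₗ S ∘ₗ H.toGrMod.sp k) := by
    rw [conv_sp (isDeg_cop hb.toIsDGCoalgebra.isDeg)]
    congr 1
    · ext c
      simp only [LinearMap.comp_apply, hS', GrMod.sp_self]
    · ext c
      simp only [LinearMap.comp_apply, hS', AugMod.jay, GrMod.sp_sp, add_comm]
  have h6 : (dact mul comul Y ∘ₗ H.d) ∘ₗ S ∘ₗ H.toGrMod.sp 1 =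
      -(sact mul comul S Y ∘ₗ H.toGrMod.sp 1 ∘ₗ H.d) := by
    ext c
    have e := LinearMap.congr_fun hS.comm_d (H.toGrMod.sp 1 c)
    simp only [LinearMap.comp_apply] at e
    simp only [LinearMap.comp_apply, LinearMap.neg_apply, ← e, hb.toIsDGModule.sp_d, sg_one,
      neg_smul, one_smul, map_neg, neg_neg]
  have h7 : (dact mul comul ((cobar H comul).d Y) ∘ₗ H.toGrMod.sp 1) ∘ₗ S ∘ₗ H.toGrMod.sp 1 =
      sact mul comul S ((cobar H comul).d Y) := by
    ext c
    simp only [LinearMap.comp_apply, hS', GrMod.sp_self]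
  have hd := congrArg (fun f => f ∘ₗ S ∘ₗ H.toGrMod.sp 1) (d_dact hb hY)
  refine hd.trans ?_
  beta_reduce
  rw [h1, h2, LinearMap.sub_comp, LinearMap.add_comp, LinearMap.add_comp, LinearMap.smul_comp, h6,
    h7, ← LinearMap.comp_assoc (H.toGrMod.sp 1) S (conv comul _ H.ell _), h3, h4,
    ← LinearMap.comp_assoc (H.toGrMod.sp 1) S (conv comul _ _ _), h3, h5, sub_neg_eq_add, smul_neg,
    ← sub_eq_add_neg]

end Action

section Cyc

variable {V : GrMod.{u, v} R}

variable (V) in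
/-- For `v` in `V` and `θ : T(V) → T(V)`, the map `p ↦ (-1)^{|v||p'|} θ(p v)`, where `p' = θ(p v)`. -/
def rotOp : V →ₗ[R] (V.T →ₗ[R] V.T) →ₗ[R] V.T →ₗ[R] V.T :=
  V.glue (M := (V.T →ₗ[R] V.T) →ₗ[R] V.T →ₗ[R] V.T) fun n => LinearMap.llcomp R _ _ _ (LinearMap.llcomp R V.T V.T V.T (V.T.sp n)) ∘ₗ
    (LinearMap.llcomp R V.T V.T V.T).flip ∘ₗ (LinearMap.mul R (TensorAlgebra R V)).flip ∘ₗ letter V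

theorem rotOp_apply {n : ℤ} {v : V} (hv : v ∈ V.deg n) (θ : V.T →ₗ[R] V.T) (p : V.T) :
    rotOp V v θ p = V.T.sp n (θ (p * letter V v : TensorAlgebra R V)) := by
  rw [rotOp, V.glue_apply _ hv]
  rfl

/-- For an operation `v ▷ x` of `V` on `T(V)` and a map `G`, the sum
`∑ ± v_i ▷ (G(v_{i+1} ⋯ v_n) p v_1 ⋯ v_{i-1})` over the letters of the word `v_1 ⋯ v_n`. -/
def cyc (tri : V →ₗ[R] V.T →ₗ[R] V.T) (G : V.T →ₗ[R] V.T) : V.T →ₗ[R] V.T →ₗ[R] V.T :=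
  LinearMap.snd R V.T (V.T →ₗ[R] V.T) ∘ₗ
    foldLeft V (M := V.T × (V.T →ₗ[R] V.T))
      (LinearMap.mk₂ R
        (fun v m => ((letter V v * m.1 : TensorAlgebra R V),
          tri v ∘ₗ LinearMap.mul R (TensorAlgebra R V) (G m.1) + rotOp V v m.2))
        (fun v w m => by
          ext : 1
          · exact (congrArg (· * m.1) (map_add (letter V) v w)).trans
              (add_mul (R := TensorAlgebra R V) _ _ _)
          · simp only [map_add, LinearMap.add_comp, LinearMap.add_apply, Prod.snd_add]
            abel)
        (fun r v m => by
          ext : 1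
          · exact (congrArg (· * m.1) (map_smul (letter V) r v)).trans
              (smul_mul_assoc (β := TensorAlgebra R V) _ _ _)
          · simp only [map_smul, LinearMap.smul_comp, LinearMap.smul_apply, Prod.smul_snd, smul_add])
        (fun v m m' => by
          ext : 1
          · exact mul_add (R := TensorAlgebra R V) _ _ _
          · simp only [map_add, LinearMap.comp_add, Prod.snd_add, Prod.fst_add]
            abel)
        (fun r v m => by
          ext : 1
          · exact mul_smul_comm (β := TensorAlgebra R V) _ _ _
          · simp only [map_smul, LinearMap.comp_smul, Prod.smul_snd, Prod.smul_fst, smul_add]))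
      ((1 : TensorAlgebra R V), 0)

variable (tri : V →ₗ[R] V.T →ₗ[R] V.T) (G : V.T →ₗ[R] V.T)

theorem cyc_aux : ∃ step : V →ₗ[R] (V.T × (V.T →ₗ[R] V.T)) →ₗ[R] (V.T × (V.T →ₗ[R] V.T)),
    (∀ v m, step v m = ((letter V v * m.1 : TensorAlgebra R V),
      tri v ∘ₗ LinearMap.mul R (TensorAlgebra R V) (G m.1) + rotOp V v m.2)) ∧
    ∀ x, foldLeft V step ((1 : TensorAlgebra R V), 0) x = (x, cyc tri G x) := by
  refine ⟨_, ?_, fun x => Prod.ext ?_ (rfl : _ = cyc tri G x)⟩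
  · intro a p; rfl
  induction x using word_induction' with
  | one => rw [foldLeft_one]
  | cons m n v x hv hx ih =>
    refine (congrArg Prod.fst (foldLeft_cons V _ _ v x)).trans ?_
    exact congrArg (fun z : TensorAlgebra R V => (TensorAlgebra.ι R v * z : TensorAlgebra R V)) ih
  | zero => rw [map_zero]; rfl
  | add x y hx hy => rw [map_add, Prod.fst_add, hx, hy]
  | smul r x hx => rw [map_smul, Prod.smul_fst, hx]

@[simp] theorem cyc_one : cyc tri G (1 : TensorAlgebra R V) = 0 := by
  rw [cyc, LinearMap.comp_apply, foldLeft_one]; rfl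

theorem cyc_letter_mul (v : V) (x : V.T) : cyc tri G (letter V v * x : TensorAlgebra R V) =
    tri v ∘ₗ LinearMap.mul R (TensorAlgebra R V) (G x) + rotOp V v (cyc tri G x) := by
  obtain ⟨step, h1, h2⟩ := cyc_aux tri G
  have h := h2 (letter V v * x : TensorAlgebra R V)
  have h3 := foldLeft_cons V step ((1 : TensorAlgebra R V), 0) v x
  rw [h2 x, h1] at h3
  exact congrArg Prod.snd (h.symm.trans h3)

theorem cyc_cons {n : ℤ} {v : V} (hv : v ∈ V.deg n) (x p : V.T) :
    cyc tri G (letter V v * x : TensorAlgebra R V) p =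
      tri v (G x * p : TensorAlgebra R V) +
        V.T.sp n (cyc tri G x (p * letter V v : TensorAlgebra R V)) := by
  rw [cyc_letter_mul, ← rotOp_apply hv (cyc tri G x) p]
  rfl

variable {tri G}

theorem cyc_mem (htri : ∀ n, ∀ v ∈ V.deg n, GrMod.IsDeg (V := V.T) (W := V.T) (tri v) (n + 1))
    {g : ℤ} (hG : GrMod.IsDeg (V := V.T) (W := V.T) G g) {r : ℤ} {x : V.T} (hx : x ∈ V.T.deg r) :
    ∀ s, ∀ p ∈ V.T.deg s, cyc tri G x p ∈ V.T.deg (r + s + g + 1) := by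
  refine word_induction (V := V) (P := fun r x => ∀ s, ∀ p ∈ V.T.deg s,
    cyc tri G x p ∈ V.T.deg (r + s + g + 1)) ?_ ?_ ?_ ?_ ?_ r x hx
  · intro s p hp; rw [cyc_one]; exact Submodule.zero_mem _
  · intro n r v x hv hx ih s p hp
    rw [cyc_cons tri G hv]
    refine Submodule.add_mem _ ?_ ?_
    · exact GrMod.mem_of_eq (htri n v hv _ _ (mul_memT (hG r x hx) hp)) (by lia)
    · exact GrMod.mem_of_eq (V.T.sp_mem n (ih _ _ (mul_memT hp (letter_mem hv)))) (by lia)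
  · intro r s p hp; rw [map_zero]; exact Submodule.zero_mem _
  · intro r x y hx hy s p hp; rw [map_add]; exact Submodule.add_mem _ (hx s p hp) (hy s p hp)
  · intro r c x hx s p hp; rw [map_smul]; exact Submodule.smul_mem _ _ (hx s p hp)

theorem cyc_id_mul (htri : ∀ n, ∀ v ∈ V.deg n, GrMod.IsDeg (V := V.T) (W := V.T) (tri v) (n + 1))
    {r : ℤ} {x : V.T} (hx : x ∈ V.T.deg r) :
    ∀ y p : V.T, cyc tri LinearMap.id (x * y : TensorAlgebra R V) p =
      cyc tri LinearMap.id x (y * p : TensorAlgebra R V) +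
        V.T.sp r (cyc tri LinearMap.id y (p * x : TensorAlgebra R V)) := by
  refine word_induction (V := V) (P := fun r x => ∀ y p : V.T,
    cyc tri LinearMap.id (x * y : TensorAlgebra R V) p =
      cyc tri LinearMap.id x (y * p : TensorAlgebra R V) +
        V.T.sp r (cyc tri LinearMap.id y (p * x : TensorAlgebra R V))) ?_ ?_ ?_ ?_ ?_ r x hx
  · intro y p
    rw [cyc_one, GrMod.sp_zero, one_mul, mul_one, LinearMap.zero_apply, zero_add]; rfl
  · intro n r v x hv hx ih y p
    rw [mul_assoc, cyc_cons tri _ hv, ih, cyc_cons tri _ hv, map_add, GrMod.sp_sp,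
      LinearMap.id_apply, LinearMap.id_apply]
    rw [mul_assoc, mul_assoc, mul_assoc, add_assoc]
  · intro r y p; simp only [zero_mul, mul_zero, map_zero, LinearMap.zero_apply, add_zero]
  · intro r x z hx hz y p
    rw [add_mul, map_add, LinearMap.add_apply, hx, hz, map_add (cyc tri _) x z, LinearMap.add_apply,
      mul_add, map_add, map_add]
    abel
  · intro r c x hx y p
    rw [smul_mul_assoc, map_smul, LinearMap.smul_apply, hx, map_smul (cyc tri _) c x,
      LinearMap.smul_apply, mul_smul_comm, map_smul, map_smul, smul_add]

theorem word_isDeg {φ : V.T →ₗ[R] V.T} {s : ℤ} (h1 : φ (1 : TensorAlgebra R V) = 0)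
    (hcons : ∀ m n, ∀ v ∈ V.deg m, ∀ x ∈ V.T.deg n,
      φ (letter V v * x : TensorAlgebra R V) ∈ V.T.deg (m + n + s)) :
    GrMod.IsDeg (V := V.T) (W := V.T) φ s := fun n x hx => by
  refine word_induction (V := V) (P := fun n x => φ x ∈ V.T.deg (n + s)) ?_ ?_ ?_ ?_ ?_ n x hx
  · rw [h1]; exact Submodule.zero_mem _
  · intro m n v x hv hx _; exact hcons m n v hv x hx
  · intro n; rw [map_zero]; exact Submodule.zero_mem _
  · intro n x y hx hy; rw [map_add]; exact Submodule.add_mem _ hx hy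
  · intro n r x hx; rw [map_smul]; exact Submodule.smul_mem _ _ hx

theorem rotate_cons {n : ℤ} {v : V} (hv : v ∈ V.deg n) (x : V.T) :
    rotate V (letter V v * x : TensorAlgebra R V) =
      (V.T.sp n x * letter V v : TensorAlgebra R V) := by
  rw [rotate, LinearMap.comp_apply, LinearMap.comp_apply, LinearMap.comp_apply, uncons_cons,
    GrMod.koszul_left hv, LinearMap.lTensor_tmul, concat_tmul]

theorem isDeg_rotate : GrMod.IsDeg (V := V.T) (W := V.T) (rotate V) 0 := by
  refine word_isDeg ?_ ?_
  · rw [rotate, LinearMap.comp_apply, LinearMap.comp_apply, LinearMap.comp_apply, uncons_one,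
      map_zero, map_zero, map_zero]
  · intro m n v hv x hx
    rw [rotate_cons hv]
    exact GrMod.mem_of_eq (mul_memT (V.T.sp_mem m hx) (letter_mem hv)) (by lia)

theorem sp_rotate_pow (n : ℤ) (i : ℕ) (x : V.T) :
    V.T.sp n ((rotate V ^ i : Module.End R V.T) x) =
      (rotate V ^ i : Module.End R V.T) (V.T.sp n x) := by
  induction i with
  | zero => rfl
  | succ i ih =>
    have h := LinearMap.congr_fun ((isDeg_rotate (V := V)).sp_comp_zero n)
    simp only [LinearMap.comp_apply] at h
    rw [pow_succ', Module.End.mul_apply, Module.End.mul_apply, h, ih]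

theorem cyc_id_lengthProj
    (htri : ∀ n, ∀ v ∈ V.deg n, GrMod.IsDeg (V := V.T) (W := V.T) (tri v) (n + 1)) (x : V.T) :
    ∀ (k : ℕ) (p : V.T), cyc tri LinearMap.id (lengthProj V k x) p =
      ∑ i ∈ Finset.range k, TensorProduct.lift tri (uncons V
        ((rotate V ^ i : Module.End R V.T) (lengthProj V k x * p : TensorAlgebra R V))) := by
  have hπ : GrMod.IsDeg (V := V.T) (W := V.T) (TensorProduct.lift tri ∘ₗ uncons V) 1 := by
    refine word_isDeg ?_ ?_
    · rw [LinearMap.comp_apply, uncons_one, map_zero]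
    · intro m n v hv x hx
      rw [LinearMap.comp_apply, uncons_cons]
      exact GrMod.mem_of_eq (htri m v hv n x hx) (by lia)
  induction x using word_induction' with
  | one =>
    intro k p
    rw [lengthProj_one]
    split_ifs with h
    · subst h; rw [cyc_one]; rfl
    · simp only [map_zero, LinearMap.zero_apply, zero_mul, Finset.sum_const_zero]
  | cons n r v x hv hx ih =>
    intro k p
    cases k with
    | zero => rw [lengthProj_zero_cons, map_zero]; rfl
    | succ k =>
      rw [lengthProj_cons, cyc_cons tri _ hv, ih k, Finset.sum_range_succ', pow_zero,
        Module.End.one_apply, mul_assoc, uncons_cons, TensorProduct.lift.tmul, add_comm,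
        LinearMap.id_apply, map_sum]
      congr 1
      refine Finset.sum_congr rfl fun i _ => ?_
      rw [pow_succ, Module.End.mul_apply, rotate_cons hv]
      refine (hπ.sp n _).trans ?_
      rw [sp_rotate_pow, ← mul_assoc, sp_mul, sp_letter, V.sp_apply n hv, map_smul,
        mul_smul_comm, map_smul, map_smul, smul_smul, ← sg_add,
        sg_congr (m := n * 1 + n * n) (n := 0) (by
          push_cast; generalize (n : ZMod 2) = n; revert n; decide), sg_zero, one_smul]
      rfl
  | zero => intro k p; simp only [map_zero, LinearMap.zero_apply, zero_mul, Finset.sum_const_zero]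
  | add x z hx hz =>
    intro k p
    simp only [map_add, LinearMap.add_apply, hx k p, hz k p, add_mul, Finset.sum_add_distrib]
  | smul c x hx =>
    intro k p
    simp only [map_smul, LinearMap.smul_apply, hx k p, smul_mul_assoc, Finset.smul_sum]

theorem byLength_of_lengthProj (f : ℕ → V.T →ₗ[R] V.T) (φ : V.T →ₗ[R] V.T)
    (h : ∀ k x, φ (lengthProj V k x) = f k (lengthProj V k x)) : byLength V f = φ := by
  ext x
  induction x using length_induction with
  | add x y hx hy => rw [map_add, hx, hy, map_add]
  | hom k x hx =>
    have h1 := h k x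
    have h2 : lengthProj V k x = x := (lengthProj_of_mem hx).trans (if_pos rfl)
    rw [h2] at h1
    rw [h1, byLength, LinearMap.comp_apply, LinearEquiv.coe_coe,
      DirectSum.decomposeLinearEquiv_apply]
    lift x to (LinearMap.range (TensorAlgebra.ι R : V →ₗ[R] TensorAlgebra R V) ^ k :
      Submodule R (TensorAlgebra R V)) using hx
    rw [DirectSum.decompose_coe, ← DirectSum.lof_eq_of R, DirectSum.toModule_lof]
    rfl

end Cyc

section Connes

variable {H : AugMod.{u, v} R} {mul : H.toGrMod ⊗[R] H.toGrMod →ₗ[R] H.toGrMod}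
  {comul : H.toGrMod →ₗ[R] H.toGrMod ⊗[R] H.toGrMod} {S : H.toGrMod →ₗ[R] H.toGrMod}

variable (mul comul S) in
/-- The operation `s⁻¹a ▷ x = S(a) ⋄ x`. -/
def antiAct : H.susp (-1) →ₗ[R] (H.susp (-1)).T →ₗ[R] (H.susp (-1)).T :=
  (dact mul comul).flip ∘ₗ S ∘ₗ H.outS (-1)

theorem antiAct_apply (v : H.susp (-1)) (x : (H.susp (-1)).T) :
    antiAct mul comul S v x = sact mul comul S x (H.outS (-1) v) := rfl

variable (mul comul S) in
/-- The sums `∑ ± S(a_i) ⋄ (G(s⁻¹a_{i+1} ⋯ s⁻¹a_n) p s⁻¹a_1 ⋯ s⁻¹a_{i-1})`. -/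
abbrev antiCyc (G : (H.susp (-1)).T →ₗ[R] (H.susp (-1)).T) :
    (H.susp (-1)).T →ₗ[R] (H.susp (-1)).T →ₗ[R] (H.susp (-1)).T :=
  cyc (antiAct mul comul S) G

section

variable (hb : IsDGBialgebra H mul comul) (hS : IsAntipode H mul comul S)

include hb hS

theorem isDeg_antiAct (n : ℤ) (v : H.susp (-1)) (hv : v ∈ (H.susp (-1)).deg n) :
    GrMod.IsDeg (V := (H.susp (-1)).T) (W := (H.susp (-1)).T) (antiAct mul comul S v) (n + 1) := by
  intro m x hx
  rw [antiAct_apply]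
  exact GrMod.mem_of_eq (dact_isDeg hb hx _ _ (hS.mem _ _ (H.isDeg_outS (-1) n v hv))) (by lia)

theorem connesMoscovici_eq :
    connesMoscovici H mul comul S =
      (antiCyc mul comul S LinearMap.id).flip (1 : TensorAlgebra R (H.susp (-1))) := by
  have htri := isDeg_antiAct hb hS
  have hπ : connesPi H mul comul S =
      TensorProduct.lift (antiAct mul comul S) ∘ₗ uncons (H.susp (-1)) := by
    rw [connesPi]
    congr 2
    refine LinearMap.ext fun v => LinearMap.ext fun x => ?_
    exact LinearMap.congr_fun (diagonalAct_cop_antipode hb hS x) (H.outS (-1) v)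
  refine byLength_of_lengthProj _ _ fun k x => ?_
  have h := cyc_id_lengthProj htri x k (1 : TensorAlgebra R (H.susp (-1)))
  rw [mul_one] at h
  refine h.trans ?_
  rw [hπ]
  by_cases hk : 2 ≤ k
  · rw [if_pos hk, LinearMap.sum_apply]
    rfl
  rw [if_neg hk, LinearMap.zero_apply]
  interval_cases k
  · rfl
  · rw [Finset.sum_range_one, pow_zero, Module.End.one_apply, lengthProj_one_eq]
    have h1 : letter (H.susp (-1)) (unletter (H.susp (-1)) x) =
        (letter (H.susp (-1)) (unletter (H.susp (-1)) x) * 1 : TensorAlgebra R (H.susp (-1))) :=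
      (mul_one _).symm
    have h2 := LinearMap.congr_fun (hS.counit hb) (H.outS (-1) (unletter (H.susp (-1)) x))
    rw [LinearMap.comp_apply, H.counit_outS] at h2
    rw [h1, uncons_cons, TensorProduct.lift.tmul, antiAct_apply, sact, dact, diagonalAct_one,
      LinearMap.comp_apply, cst_apply, h2, zero_smul]

theorem antiAct_inS (a : H.toGrMod) (x : (H.susp (-1)).T) :
    antiAct mul comul S (H.inS (-1) a) x = sact mul comul S x a - H.counit a • x := by
  rw [antiAct_apply, H.outS_inS, map_sub, map_smul, LinearMap.comp_apply, LinearMap.comp_apply,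
    hS.one hb, dact_unit hb]

theorem antiCyc_jay_mul (G : (H.susp (-1)).T →ₗ[R] (H.susp (-1)).T) {m : ℤ} {c : H.toGrMod}
    (hc : c ∈ H.deg m) (x p : (H.susp (-1)).T) :
    antiCyc mul comul S G (H.jay c * x : TensorAlgebra R (H.susp (-1))) p =
      sact mul comul S (G x * p : TensorAlgebra R (H.susp (-1))) (H.toGrMod.sp 1 c) -
        H.counit c • (G x * p : TensorAlgebra R (H.susp (-1))) +
        (H.susp (-1)).T.sp (m - 1)
          (antiCyc mul comul S G x (p * H.jay c : TensorAlgebra R (H.susp (-1)))) := by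
  have h1 : H.jay c = letter (H.susp (-1)) (H.inS (-1) (H.toGrMod.sp 1 c)) := rfl
  have h2 : H.counit (H.toGrMod.sp 1 c) = H.counit c := LinearMap.congr_fun (H.counit_sp 1) c
  have h3 := H.isDeg_inS (-1) m _ (H.toGrMod.sp_mem 1 hc)
  rw [h1, cyc_cons _ _ h3, antiAct_inS hb hS, h2, ← sub_eq_add_neg m 1]

end

end Connes

section Connes

variable {H : AugMod.{u, v} R} {mul : H.toGrMod ⊗[R] H.toGrMod →ₗ[R] H.toGrMod}
  {comul : H.toGrMod →ₗ[R] H.toGrMod ⊗[R] H.toGrMod} {S : H.toGrMod →ₗ[R] H.toGrMod}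

local notation "ΩH" => TensorAlgebra R (H.susp (-1))

section

variable (hb : IsDGBialgebra H mul comul) (hS : IsAntipode H mul comul S)

include hb hS

theorem sp_antiCyc_jay_mul (G : (H.susp (-1)).T →ₗ[R] (H.susp (-1)).T) {k p' q' : ℤ}
    {c e : H.toGrMod} (hc : c ∈ H.deg p') (he : e ∈ H.deg q') {x p : (H.susp (-1)).T}
    (hY : (G x * p : ΩH) ∈ (H.susp (-1)).T.deg k) :
    (H.susp (-1)).T.sp (p' - 1) (antiCyc mul comul S G (H.jay e * x : ΩH)
        (p * H.ell c : ΩH)) =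
      -(sg R k • actPair mul comul (TensorProduct.map S
        (mulL (concat _) (G x * p : ΩH) ∘ₗ H.jay ∘ₗ H.toGrMod.sp k)
          (koszul H.toGrMod H.toGrMod (c ⊗ₜ e)))) -
        sg R ((p' + q' - 1) * (k + 1)) • H.counit e •
          (G x * p * H.ell c : ΩH) +
        (H.susp (-1)).T.sp (p' + q' - 2) (antiCyc mul comul S G x
          (p * (H.ell c * H.jay e) : ΩH)) := by
  have h := antiCyc_jay_mul hb hS G he x (p * H.ell c : ΩH)
  rw [← mul_assoc, mul_assoc p] at h
  have hell := H.isDeg_ell p' c hc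
  have hYc := mul_memT hY hell
  rw [h, map_add, map_sub, map_smul, GrMod.sp_sp, show p' - 1 + (q' - 1) = p' + q' - 2 by ring]
  congr 1
  congr 1
  · have h1 : sact mul comul S (G x * p * H.ell c : ΩH)
        (H.toGrMod.sp 1 e) ∈ (H.susp (-1)).T.deg (q' + (k + (p' + -1))) :=
      dact_isDeg hb hYc _ _ (hS.mem _ _ (H.toGrMod.sp_mem 1 he))
    rw [GrMod.sp_apply _ h1, GrMod.koszul_tmul' hc he, map_smul, map_smul, TensorProduct.map_tmul,
      smul_smul]
    have h2 : actPair mul comul (S e ⊗ₜ ((mulL (concat _) (G x * p : ΩH)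
        ∘ₗ H.jay ∘ₗ H.toGrMod.sp k) c)) = sg R (k * p' + p') • sact mul comul S
          (G x * p * H.ell c : ΩH) e := by
      have e0 : H.jay (H.toGrMod.sp k c) = sg R (k * p' + p') • H.ell c := by
        rw [H.toGrMod.sp_apply k hc, map_smul, AugMod.jay, LinearMap.comp_apply,
          H.toGrMod.sp_apply 1 hc, map_smul, smul_smul, ← sg_add, one_mul]
      have e1 : (mulL (concat _) (G x * p : ΩH)
          ∘ₗ H.jay ∘ₗ H.toGrMod.sp k) c =
          (G x * p * H.jay (H.toGrMod.sp k c) : ΩH) := rfl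
      rw [e1, e0, mul_smul_comm, TensorProduct.tmul_smul, map_smul]
      rfl
    rw [h2, smul_smul, ← sg_add, ← sg_add, H.toGrMod.sp_apply 1 he, map_smul, smul_smul, ← sg_add,
      ← neg_smul]
    congr 1
    refine sg_eq_neg ?_
    push_cast
    generalize (k : ZMod 2) = k, (p' : ZMod 2) = p, (q' : ZMod 2) = q
    revert p k q
    decide
  · by_cases hq : q' = 0
    · subst hq
      rw [GrMod.sp_apply _ hYc, smul_comm]
      refine sg_smul_congr ?_ rfl
      push_cast
      generalize (k : ZMod 2) = k, (p' : ZMod 2) = p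
      revert p k
      decide
    · rw [H.counit_eq_zero q' hq e he, zero_smul, zero_smul, smul_zero]

/-- The cyclic sums of a word starting with a piece of `d(s⁻¹b)`. -/
theorem antiCyc_two (G : (H.susp (-1)).T →ₗ[R] (H.susp (-1)).T) {k m : ℤ} {x p : (H.susp (-1)).T}
    (hY : (G x * p : ΩH) ∈ (H.susp (-1)).T.deg k)
    {φ : H.toGrMod →ₗ[R] (H.susp (-1)).T}
    (hφ : ∀ e, (G (H.jay e * x : ΩH) * p : TensorAlgebra R _) = φ e)
    {z : H.toGrMod ⊗[R] H.toGrMod} (hz : z ∈ tensorDeg H.toGrMod H.toGrMod m) :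
    antiCyc mul comul S G
        (concat _ (TensorProduct.map H.ell H.jay z) * x : ΩH) p =
      actPair mul comul (TensorProduct.map S φ z) -
        TensorProduct.lid R _ (TensorProduct.map H.counit φ z) -
        sg R k • actPair mul comul (TensorProduct.map S
          (mulL (concat _) (G x * p : ΩH) ∘ₗ H.jay ∘ₗ H.toGrMod.sp k)
          (koszul H.toGrMod H.toGrMod z)) -
        sg R ((m - 1) * (k + 1)) • TensorProduct.rid R _ (TensorProduct.map
          (mulL (concat _) (G x * p : ΩH) ∘ₗ H.ell) H.counit z) +
        (H.susp (-1)).T.sp (m - 2) (antiCyc mul comul S G x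
          (p * concat _ (TensorProduct.map H.ell H.jay z) : ΩH)) := by
  refine tensorDeg_induction (P := fun z =>
    antiCyc mul comul S G
        (concat _ (TensorProduct.map H.ell H.jay z) * x : ΩH) p =
      actPair mul comul (TensorProduct.map S φ z) -
        TensorProduct.lid R _ (TensorProduct.map H.counit φ z) -
        sg R k • actPair mul comul (TensorProduct.map S
          (mulL (concat _) (G x * p : ΩH) ∘ₗ H.jay ∘ₗ H.toGrMod.sp k)
          (koszul H.toGrMod H.toGrMod z)) -
        sg R ((m - 1) * (k + 1)) • TensorProduct.rid R _ (TensorProduct.map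
          (mulL (concat _) (G x * p : ΩH) ∘ₗ H.ell) H.counit z) +
        (H.susp (-1)).T.sp (m - 2) (antiCyc mul comul S G x
          (p * concat _ (TensorProduct.map H.ell H.jay z) : ΩH))) ?_ ?_ ?_ ?_ hz
  · simp only [map_zero, zero_mul, mul_zero, smul_zero, sub_zero, LinearMap.zero_apply, add_zero]
  · intro z z' h h'
    simp only [map_add, add_mul, mul_add, smul_add, LinearMap.add_apply, h, h']
    abel
  · intro c z h
    simp only [map_smul, smul_mul_assoc, mul_smul_comm, LinearMap.smul_apply, h, smul_add, smul_sub,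
      smul_comm c]
  · intro p' q' hpq c hc e he
    have h1 : H.ell c = H.jay (H.toGrMod.sp 1 c) := (LinearMap.congr_fun H.jay_sp c).symm
    have h2 := antiCyc_jay_mul hb hS G (H.toGrMod.sp_mem 1 hc)
      (H.jay e * x : ΩH) p
    have h3 : H.counit (H.toGrMod.sp 1 c) = H.counit c := LinearMap.congr_fun (H.counit_sp 1) c
    rw [← h1, GrMod.sp_self, h3, hφ,
      sp_antiCyc_jay_mul hb hS G hc he hY, hpq] at h2
    rw [TensorProduct.map_tmul, concat_tmul, mul_assoc]
    refine h2.trans ?_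
    have e1 : (mulL (concat _) (G x * p : ΩH) ∘ₗ H.ell) c =
          (G x * p * H.ell c : ΩH) := rfl
    have e2 : actPair mul comul (S c ⊗ₜ φ e) = sact mul comul S (φ e) c := rfl
    rw [TensorProduct.map_tmul, TensorProduct.map_tmul, TensorProduct.map_tmul, e1, e2,
      TensorProduct.lid_tmul, TensorProduct.rid_tmul]
    abel

theorem cobar_d_letter (v : H.susp (-1)) {b : H.toGrMod} (hv : letter (H.susp (-1)) v = H.jay b) :
    (cobar H comul).d (letter (H.susp (-1)) v) =
      H.jay (H.d b) + concat _ (TensorProduct.map H.ell H.jay (comul b)) := by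
  rw [hv]
  exact LinearMap.congr_fun (cobar_d_jay hb.toIsDGCoalgebra) b

/-- The recursion for the boundary of the cyclic sums. -/
theorem d_antiCyc_cons (hcop : conv (cop comul) mul S LinearMap.id = cst H.counit H.one)
    {G : (H.susp (-1)).T →ₗ[R] (H.susp (-1)).T} {g k : ℤ}
    (hG : GrMod.IsDeg (V := (H.susp (-1)).T) (W := (H.susp (-1)).T) G g)
    {K : H.toGrMod →ₗ[R] (H.susp (-1)).T}
    (hK : ∀ b (x : (H.susp (-1)).T), G (H.jay b * x : ΩH) =
      (H.jay b * G x : ΩH) +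
        (K b * (H.susp (-1)).T.sp k x : ΩH))
    {n r s : ℤ} {v : H.susp (-1)} (hv : v ∈ (H.susp (-1)).deg n) {x : (H.susp (-1)).T}
    (hx : x ∈ (H.susp (-1)).T.deg r) {p : (H.susp (-1)).T} (hp : p ∈ (H.susp (-1)).T.deg s) :
    (cobar H comul).d (antiCyc mul comul S G
        (letter (H.susp (-1)) v * x : ΩH) p) +
      antiCyc mul comul S G ((cobar H comul).d
        (letter (H.susp (-1)) v * x : ΩH)) p =
    sg R n • (H.susp (-1)).T.sp n
        ((cobar H comul).d (antiCyc mul comul S G x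
          (p * letter (H.susp (-1)) v : ΩH)) +
        antiCyc mul comul S G ((cobar H comul).d x)
          (p * letter (H.susp (-1)) v : ΩH)) +
      (H.susp (-1)).T.sp (n - 1) (antiCyc mul comul S G x
        (p * (cobar H comul).d (letter (H.susp (-1)) v) : ΩH)) +
      sg R n • antiAct mul comul S v
        ((G ((cobar H comul).d x) * p : ΩH) -
          (cobar H comul).d (G x * p : ΩH)) -
      (G (letter (H.susp (-1)) v * x : ΩH) * p : ΩH) +
      sg R (n * (r + g + s)) • (G x * p * letter (H.susp (-1)) v : ΩH) +
      conv comul (actPair mul comul) S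
        (mulR (concat _) ((H.susp (-1)).T.sp k x * p : ΩH) ∘ₗ K)
        (H.toGrMod.sp 1 (H.outS (-1) v)) := by
  have hC := hb.isCoalg
  have hY := mul_memT (hG r x hx) hp
  have hcb := (isDGAlgebra_cobar hb.toIsDGCoalgebra).toIsDGModule
  have ho := H.isDeg_outS (-1) n v hv
  have hj := AugMod.letter_eq_jay v
  have hε := counit_sp_outS v
  have hob : H.toGrMod.sp 1 (H.toGrMod.sp 1 (H.outS (-1) v)) = H.outS (-1) v :=
    GrMod.sp_self (V := H.toGrMod) 1 _
  have hell : H.ell (H.toGrMod.sp 1 (H.outS (-1) v)) = sg R (n + 1) • letter (H.susp (-1)) v := by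
    rw [GrMod.sp_apply _ ho, map_smul, ← AugMod.letter_eq, one_mul, neg_neg]
  have ht : antiAct mul comul S v = (dact mul comul).flip (S (H.outS (-1) v)) := rfl
  have hB := H.toGrMod.sp_mem 1 ho
  rw [← hob] at ht
  generalize H.toGrMod.sp 1 (H.outS (-1) v) = b at *
  have hDv := cobar_d_letter hb hS v hj
  have hdb := hb.toIsDGModule.isDeg_d _ b hB
  have hdε : H.counit (H.d b) = 0 := LinearMap.congr_fun hb.toIsDGModule.counit_d b
  have hz := hb.toIsDGCoalgebra.isDeg _ b hB
  set D := (cobar H comul).d with hD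
  have ht' : ∀ Y, antiAct mul comul S v Y = sact mul comul S Y (H.toGrMod.sp 1 b) := fun Y => by
    rw [ht]; rfl
  let φ : H.toGrMod →ₗ[R] (H.susp (-1)).T :=
    mulR (concat _) p ∘ₗ G ∘ₗ mulR (concat _) x ∘ₗ H.jay
  have hφ : ∀ e, (G (H.jay e * x : ΩH) * p : ΩH) = φ e := fun e => rfl
  have hdb' : H.d b ∈ H.deg n := GrMod.mem_of_eq hdb (by lia)
  have hz' : comul b ∈ tensorDeg H.toGrMod H.toGrMod (n + 1) := by
    have h : n + - -1 + 0 = n + 1 := by lia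
    rw [← h]; exact hz
  have hJ := antiCyc_jay_mul hb hS G hdb' x p
  rw [hdε, zero_smul, sub_zero] at hJ
  have hT := antiCyc_two hb hS G hY hφ hz'
  have hφ' : φ = mulR (concat _) (G x * p : ΩH) ∘ₗ H.jay +
      mulR (concat _) ((H.susp (-1)).T.sp k x * p : ΩH) ∘ₗ K := by
    ext e
    refine (hφ e).symm.trans ?_
    rw [hK, add_mul, mul_assoc, mul_assoc]
    rfl
  have h1 : actPair mul comul (TensorProduct.map S φ (comul b)) =
      conv comul (actPair mul comul) S
        (mulR (concat _) (G x * p : ΩH) ∘ₗ H.jay) b +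
      conv comul (actPair mul comul) S
        (mulR (concat _) ((H.susp (-1)).T.sp k x * p : ΩH) ∘ₗ K) b := by
    rw [hφ', ← LinearMap.add_apply, ← conv_add_right]; rfl
  have h2 : TensorProduct.lid R _ (TensorProduct.map H.counit φ (comul b)) = φ b :=
    LinearMap.congr_fun (conv_counit_left hC (mu := (TensorProduct.lid R _).toLinearMap)
      (f := H.counit) (fun x b => TensorProduct.lid_tmul _ _) φ) b
  have h3 : TensorProduct.rid R _ (TensorProduct.map
      (mulL (concat _) (G x * p : ΩH) ∘ₗ H.ell) H.counit (comul b)) =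
      (G x * p * H.ell b : ΩH) :=
    LinearMap.congr_fun (conv_counit_right hC (mu := (TensorProduct.rid R _).toLinearMap)
      (g := H.counit) (fun x b => TensorProduct.rid_tmul _ _)
      (mulL (concat _) (G x * p : ΩH) ∘ₗ H.ell)) b
  have hds : D (sact mul comul S (G x * p : ΩH) (H.toGrMod.sp 1 b)) =
      -sact mul comul S (G x * p : ΩH) (H.toGrMod.sp 1 (H.d b)) +
      sact mul comul S (D (G x * p : ΩH)) b -
      conv comul (actPair mul comul) S
        (mulR (concat _) (G x * p : ΩH) ∘ₗ H.jay) b +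
      sg R (r + g + s) • actPair mul comul (TensorProduct.map S
        (mulL (concat _) (G x * p : ΩH) ∘ₗ H.jay ∘ₗ
          H.toGrMod.sp (r + g + s)) (koszul H.toGrMod H.toGrMod (comul b))) :=
    LinearMap.congr_fun (d_sact hb hS hY hcop) b
  have hdsp : ∀ y : (H.susp (-1)).T, D ((H.susp (-1)).T.sp n y) =
      sg R n • (H.susp (-1)).T.sp n (D y) := fun y => by
    have e := hcb.sp_d n y
    rw [← sg_self (R := R) n (D ((H.susp (-1)).T.sp n y))]
    exact congrArg (sg R n • ·) e.symm
  have h4 : sg R ((n + 1 - 1) * (r + g + s + 1)) • (G x * p * H.ell b : ΩH) =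
      -(sg R (n * (r + g + s)) •
        (G x * p * letter (H.susp (-1)) v : ΩH)) := by
    rw [hell, mul_smul_comm, smul_smul, ← sg_add, ← neg_smul]
    congr 1
    refine sg_eq_neg ?_
    push_cast
    generalize (n : ZMod 2) = n, (r : ZMod 2) = r, (g : ZMod 2) = g, (s : ZMod 2) = s
    revert n r g s
    decide
  have h5 : ∀ y : (H.susp (-1)).T, sg R n • sact mul comul S y (H.toGrMod.sp 1 b) =
      -sact mul comul S y b := fun y => by
    rw [GrMod.sp_apply 1 hB, map_smul, smul_smul, ← sg_add, sg_congr (n := 1) (by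
      push_cast
      generalize (n : ZMod 2) = n
      revert n
      decide), sg_one, neg_one_smul]
  have h6 : φ b = (G (letter (H.susp (-1)) v * x : ΩH) * p : ΩH) := by rw [hj]; exact (hφ b).symm
  have hmul : D (letter (H.susp (-1)) v * x : ΩH) =
      ((D (letter (H.susp (-1)) v) * x : ΩH) +
        (sg R n • letter (H.susp (-1)) v * D x : ΩH)) := by
    refine (cobar_d_mul _ _).trans ?_
    rw [sp_letter, GrMod.sp_apply 1 hv, map_smul, one_mul]
  rw [h1, h2, h3, h4, h6] at hT
  rw [hmul, hDv, smul_mul_assoc, add_mul, map_add, map_add, map_smul, LinearMap.add_apply,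
    LinearMap.add_apply, LinearMap.smul_apply, hJ, hT, cyc_cons _ _ hv, cyc_cons _ _ hv, map_add,
    hdsp, ht', hds, ht', map_sub, ht', ht', mul_add p, map_add, map_add, map_add]
  simp only [smul_add, smul_sub, h5]
  rw [show n + 1 - 2 = n - 1 by ring]
  abel

end

end Connes

theorem cobar_d_mul' {C : AugMod.{u, v} R} {comul : C.toGrMod →ₗ[R] C.toGrMod ⊗[R] C.toGrMod}
    {r : ℤ} {x : (C.susp (-1)).T} (hx : x ∈ (C.susp (-1)).T.deg r) (y : (C.susp (-1)).T) :
    (cobar C comul).d (x * y : TensorAlgebra R (C.susp (-1))) =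
      ((cobar C comul).d x * y : TensorAlgebra R (C.susp (-1))) +
        sg R r • (x * (cobar C comul).d y : TensorAlgebra R (C.susp (-1))) := by
  rw [cobar_d_mul, GrMod.sp_apply 1 hx, one_mul, smul_mul_assoc]

section Connes

variable {H : AugMod.{u, v} R} {mul : H.toGrMod ⊗[R] H.toGrMod →ₗ[R] H.toGrMod}
  {comul : H.toGrMod →ₗ[R] H.toGrMod ⊗[R] H.toGrMod} {S : H.toGrMod →ₗ[R] H.toGrMod}
  (hb : IsDGBialgebra H mul comul) (hS : IsAntipode H mul comul S)
  (hcop : conv (cop comul) mul S LinearMap.id = cst H.counit H.one)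

local notation "ΩH" => TensorAlgebra R (H.susp (-1))

include hb hS hcop

theorem d_antiCyc_id {r : ℤ} {x : (H.susp (-1)).T} (hx : x ∈ (H.susp (-1)).T.deg r) :
    ∀ s, ∀ p ∈ (H.susp (-1)).T.deg s,
    (cobar H comul).d (antiCyc mul comul S LinearMap.id x p) +
        antiCyc mul comul S LinearMap.id ((cobar H comul).d x) p +
        sg R r • antiCyc mul comul S LinearMap.id x ((cobar H comul).d p) =
      -(x * p : ΩH) +
        sg R (r * s) • (p * x : ΩH) := by
  have hcyc := fun r x hx s p hp => cyc_mem (isDeg_antiAct hb hS) (g := 0) isDeg_id (r := r) (x := x) hx s p hp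
  have hcb := (isDGAlgebra_cobar hb.toIsDGCoalgebra).toIsDGModule.isDeg_d
  refine word_induction (V := H.susp (-1)) (P := fun r x => ∀ s, ∀ p ∈ (H.susp (-1)).T.deg s,
    (cobar H comul).d (antiCyc mul comul S LinearMap.id x p) +
        antiCyc mul comul S LinearMap.id ((cobar H comul).d x) p +
        sg R r • antiCyc mul comul S LinearMap.id x ((cobar H comul).d p) =
      -(x * p : ΩH) +
        sg R (r * s) • (p * x : ΩH)) ?_ ?_ ?_ ?_ ?_ r x hx
  · intro s p hp
    rw [cobar_d_one, cyc_one, map_zero, LinearMap.zero_apply, LinearMap.zero_apply, map_zero,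
      smul_zero, zero_mul, sg_zero, one_smul, one_mul, mul_one]
    abel
  · intro n r v x hv hx ih s p hp
    have hl := letter_mem hv
    have hDv := hcb n _ hl
    have hDp := hcb s _ hp
    have h := d_antiCyc_cons hb hS hcop (g := 0) (k := 0) (G := LinearMap.id) (K := 0) isDeg_id
      (fun b x => by rw [LinearMap.zero_apply, zero_mul, add_zero]; rfl) hv hx hp
    have ih' := ih _ _ (mul_memT hp hl)
    rw [← eq_sub_iff_add_eq, cobar_d_mul' hp, map_add, map_smul] at ih'
    rw [ih', LinearMap.comp_zero, conv_zero_right, LinearMap.zero_apply, add_zero] at h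
    simp only [LinearMap.id_apply] at h
    rw [cobar_d_mul' hx] at h
    rw [h, cyc_cons _ _ hv, LinearMap.id_apply]
    have e1 := hcyc r x hx _ _ (mul_memT hp hDv)
    have e2 := mul_memT hx (mul_memT hp hl)
    have e3 := mul_memT (mul_memT hp hl) hx
    simp only [map_add, map_sub, map_neg, map_smul]
    rw [GrMod.sp_apply _ e1, GrMod.sp_apply _ e1, GrMod.sp_apply _ e2, GrMod.sp_apply _ e3]
    rw [mul_assoc p, mul_assoc x, mul_assoc (letter (H.susp (-1)) v)]
    simp only [smul_add, smul_sub, smul_neg, smul_smul]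
    match_scalars
    all_goals simp only [mul_one, ← sg_add, neg_add_eq_zero, sub_self]
    all_goals
      refine sg_congr ?_
      push_cast
      generalize (n : ZMod 2) = n, (r : ZMod 2) = r, (s : ZMod 2) = s
      revert n r s
      decide
  · intro r s p hp; simp only [map_zero, LinearMap.zero_apply, zero_mul, mul_zero, smul_zero, add_zero, neg_zero]
  · intro r x z hx hz s p hp
    have := congrArg₂ (· + ·) (hx s p hp) (hz s p hp)
    simp only [map_add, LinearMap.add_apply, smul_add, add_mul, mul_add, neg_add] at this ⊢
    rw [← sub_eq_zero] at this ⊢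
    rw [← this]
    abel
  · intro r c x hx s p hp
    have := congrArg (c • ·) (hx s p hp)
    simp only [map_smul, LinearMap.smul_apply, smul_add, smul_neg, smul_mul_assoc, mul_smul_comm] at this ⊢
    simp only [smul_comm c] at this ⊢
    exact this

theorem antiCyc_d_anticomm :
    (cobar H comul).d ∘ₗ (antiCyc mul comul S LinearMap.id).flip
        (1 : ΩH) =
      -((antiCyc mul comul S LinearMap.id).flip (1 : ΩH) ∘ₗ
        (cobar H comul).d) := by
  refine GrMod.hom_ext (V := (H.susp (-1)).T) fun r x hx => ?_
  have h := d_antiCyc_id hb hS hcop hx 0 _ one_memT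
  rw [cobar_d_one, map_zero, smul_zero, add_zero, mul_zero, sg_zero, one_smul, one_mul, mul_one,
    neg_add_cancel] at h
  exact eq_neg_of_add_eq_zero_left h

end Connes

theorem conv_deconcat_letter {W : GrMod.{u, v} R} {A B C : Type*} [AddCommGroup A]
    [AddCommGroup B] [AddCommGroup C] [Module R A] [Module R B] [Module R C]
    (mu : A ⊗[R] B →ₗ[R] C) (f : W.T →ₗ[R] A) (g : W.T →ₗ[R] B) (a : W) :
    conv (deconcat W) mu f g (letter W a) =
      mu (f (1 : TensorAlgebra R W) ⊗ₜ g (letter W a)) +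
        mu (f (letter W a) ⊗ₜ g (1 : TensorAlgebra R W)) := by
  rw [conv_apply, deconcat_letter, map_add, map_add, TensorProduct.map_tmul, TensorProduct.map_tmul]

theorem bar_d_letter {A : AugMod.{u, v} R} {mul : A.toGrMod ⊗[R] A.toGrMod →ₗ[R] A.toGrMod}
    (a : A.susp 1) : (bar A mul).d (letter (A.susp 1) a) =
      -letter (A.susp 1) (A.inS 1 (A.d (A.outS 1 a))) := by
  have h1 : barCogen A mul (1 : TensorAlgebra R (A.susp 1)) = 0 := by
    simp only [barCogen, LinearMap.add_apply, LinearMap.neg_apply, LinearMap.comp_apply]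
    rw [unletter_one, deconcat_one, TensorProduct.map_tmul, LinearMap.comp_apply (A.outS 1),
      LinearMap.comp_apply (A.outS 1), unletter_one]
    simp only [map_zero, neg_zero, TensorProduct.tmul_zero, add_zero]
  have h2 : barCogen A mul (letter (A.susp 1) a) = -A.inS 1 (A.d (A.outS 1 a)) := by
    simp only [barCogen, LinearMap.add_apply, LinearMap.neg_apply, LinearMap.comp_apply]
    rw [unletter_letter, deconcat_letter, map_add, TensorProduct.map_tmul, TensorProduct.map_tmul]
    simp only [LinearMap.comp_apply]
    rw [unletter_one, unletter_letter]
    simp only [map_zero, TensorProduct.zero_tmul, TensorProduct.tmul_zero, add_zero]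
  refine (LinearMap.congr_fun (insertOdd_eq (letter (A.susp 1) ∘ₗ barCogen A mul)) _).trans ?_
  rw [conv_deconcat_letter, conv_deconcat_letter, conv_deconcat_one, LinearMap.comp_apply,
    LinearMap.comp_apply, h1, h2, map_zero, TensorProduct.zero_tmul, TensorProduct.zero_tmul,
    map_zero, TensorProduct.tmul_zero, map_zero, zero_add, add_zero, concat_tmul, concat_tmul,
    sp_oneT, one_mul, LinearMap.id_apply, mul_one, map_neg]

section Connes

variable {H : AugMod.{u, v} R} {mul : H.toGrMod ⊗[R] H.toGrMod →ₗ[R] H.toGrMod}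
  {comul : H.toGrMod →ₗ[R] H.toGrMod ⊗[R] H.toGrMod}

local notation "ΩH" => TensorAlgebra R (H.susp (-1))

variable (H comul) in
/-- The letter `s y` of the bar construction of `Ω H`. -/
def barLetter (y : (H.susp (-1)).T) : (barLetters H comul).T :=
  letter (barLetters H comul) ((cobar H comul).inS 1 y)

theorem barLetter_mem {q : ℤ} {y : (H.susp (-1)).T} (hy : y ∈ (H.susp (-1)).T.deg q) :
    barLetter H comul y ∈ (barLetters H comul).T.deg (q + 1) :=
  letter_mem ((cobar H comul).isDeg_inS 1 q y hy)

theorem tw_barLetter (y : (H.susp (-1)).T) : (cobar H comul).tw (barLetter H comul y) =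
    y - augT (H.susp (-1)) y • (1 : ΩH) :=
  ((cobar H comul).tw_letter _).trans ((cobar H comul).outS_inS 1 y)

variable (mul comul) in
/-- The operation `x ↦ E_{1,1}(x; y)`. -/
def braceOn (y : (H.susp (-1)).T) : (H.susp (-1)).T →ₗ[R] (H.susp (-1)).T :=
  (braceOp H mul comul).flip (barLetter H comul y)

theorem braceOn_apply (y x : (H.susp (-1)).T) :
    braceOn mul comul y x = braceOp H mul comul x (barLetter H comul y) := rfl

theorem braceOn_one (y : (H.susp (-1)).T) :
    braceOn mul comul y (1 : ΩH) = 0 := by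
  rw [braceOn_apply, braceOp_one, cst_apply, barLetter, augT_letter, zero_smul]

theorem braceOn_mul {q : ℤ} {y : (H.susp (-1)).T} (hy : y ∈ (H.susp (-1)).T.deg q)
    (x z : (H.susp (-1)).T) : braceOn mul comul y (x * z : ΩH) =
      (x * braceOn mul comul y z : ΩH) +
        (braceOn mul comul y x * (H.susp (-1)).T.sp (q + 1) z : ΩH) := by
  induction z using GrMod.homogeneous_induction (V := (H.susp (-1)).T) with
  | zero => simp only [mul_zero, map_zero, add_zero]
  | add z z' h h' =>
    simp only [mul_add, map_add, h, h']
    abel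
  | hom n z hz =>
    have hw := barLetter_mem (comul := comul) hy
    rw [braceOn_apply, braceOp_mul hz, barLetter, conv_deconcat_letter, concat_tmul, concat_tmul,
      LinearMap.comp_apply, LinearMap.comp_apply, sp_oneT, braceOp_apply_one, braceOp_apply_one]
    rw [barLetter] at hw
    rw [GrMod.sp_apply _ hw, GrMod.sp_apply _ hz, map_smul, smul_mul_assoc, mul_smul_comm,
      mul_comm n]
    rfl

theorem braceOn_jay (hb : IsDGBialgebra H mul comul) (y : (H.susp (-1)).T) (b : H.toGrMod) :
    braceOn mul comul y (H.jay b) = (dact mul comul y - cst H.counit y) b := by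
  rw [braceOn_apply, braceOp_jay, LinearMap.add_apply, cst_apply, barLetter, augT_letter, zero_smul,
    zero_add, LinearMap.comp_apply, ← barLetter, tw_barLetter]
  have h : dact mul comul (y - augT (H.susp (-1)) y • (1 : ΩH)) =
      dact mul comul y - augT (H.susp (-1)) y • cst H.counit (1 : ΩH) := by
    rw [map_sub, map_smul, dact, diagonalAct_one]
  change dact mul comul (y - augT (H.susp (-1)) y • (1 : ΩH))
    (b - H.counit b • H.one) = _
  rw [h, map_sub, map_smul, LinearMap.sub_apply, LinearMap.sub_apply, LinearMap.sub_apply,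
    LinearMap.smul_apply, LinearMap.smul_apply, dact_unit hb, cst_apply, cst_apply, cst_apply,
    H.counit_one, one_smul, smul_sub, smul_comm (H.counit b)]
  abel

theorem isDeg_braceOn (hb : IsDGBialgebra H mul comul) {q : ℤ} {y : (H.susp (-1)).T}
    (hy : y ∈ (H.susp (-1)).T.deg q) :
    GrMod.IsDeg (V := (H.susp (-1)).T) (W := (H.susp (-1)).T) (braceOn mul comul y) (q + 1) :=
  fun r x hx => GrMod.mem_of_eq (isDeg_braceOp hb hx _ _ (barLetter_mem hy)) (by lia)

theorem bar_d_barLetter (hb : IsDGBialgebra H mul comul) (y : (H.susp (-1)).T) :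
    (bar (cobar H comul) (concat (H.susp (-1)))).d (barLetter H comul y) =
      -barLetter H comul ((cobar H comul).d y) := by
  have hd := (isDGAlgebra_cobar hb.toIsDGCoalgebra).toIsDGModule.d_one
  refine (bar_d_letter _).trans ?_
  rw [(cobar H comul).outS_inS, map_sub, map_smul, hd, smul_zero, sub_zero]
  rfl

theorem conv_barLetter_right (x y : (H.susp (-1)).T) :
    conv (deconcat (barLetters H comul)) (concat (H.susp (-1)))
      (braceOp H mul comul x ∘ₗ (barLetters H comul).T.sp 1) (cobar H comul).tw
        (barLetter H comul y) =
      (x * y : ΩH) - augT (H.susp (-1)) y • x := by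
  have h : (x * (y - augT (H.susp (-1)) y • 1 : ΩH) : ΩH) =
      (x * y : ΩH) - augT (H.susp (-1)) y • x := by
    rw [mul_sub, mul_smul_comm, mul_one]
  rw [← h, ← tw_barLetter (comul := comul), barLetter, conv_deconcat_letter, concat_tmul,
    concat_tmul, LinearMap.comp_apply, sp_oneT, braceOp_apply_one, AugMod.tw_one, mul_zero, add_zero]

theorem conv_barLetter_left {q : ℤ} {y : (H.susp (-1)).T} (hy : y ∈ (H.susp (-1)).T.deg q)
    (r : ℤ) (x : (H.susp (-1)).T) :
    conv (deconcat (barLetters H comul)) (concat (H.susp (-1)))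
      ((cobar H comul).tw ∘ₗ (barLetters H comul).T.sp r) (braceOp H mul comul x)
        (barLetter H comul y) =
      sg R (r * (q + 1)) • (y * x : ΩH) -
        sg R r • augT (H.susp (-1)) y • x := by
  have hw := barLetter_mem (comul := comul) hy
  have h4 : sg R r • augT (H.susp (-1)) y • x = sg R (r * (q + 1)) • augT (H.susp (-1)) y • x := by
    by_cases h0 : q = 0
    · rw [h0, zero_add, mul_one]
    · rw [(cobar H comul).counit_eq_zero q h0 y hy, zero_smul, smul_zero, smul_zero]
  have h : sg R (r * (q + 1)) • ((y - augT (H.susp (-1)) y • 1 : ΩH) *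
      x : ΩH) =
      sg R (r * (q + 1)) • (y * x : ΩH) -
        sg R r • augT (H.susp (-1)) y • x := by
    rw [h4, sub_mul, smul_mul_assoc, one_mul, smul_sub]
  rw [← h, ← tw_barLetter (comul := comul), barLetter, conv_deconcat_letter, concat_tmul,
    concat_tmul, LinearMap.comp_apply, LinearMap.comp_apply, sp_oneT, braceOp_apply_one,
    AugMod.tw_one, zero_mul, zero_add]
  rw [barLetter] at hw
  rw [GrMod.sp_apply _ hw, map_smul, smul_mul_assoc]

theorem d_braceOn (hb : IsDGBialgebra H mul comul) {q r : ℤ} {y x : (H.susp (-1)).T}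
    (hy : y ∈ (H.susp (-1)).T.deg q) (hx : x ∈ (H.susp (-1)).T.deg r) :
    (cobar H comul).d (braceOn mul comul y x) = braceOn mul comul y ((cobar H comul).d x) -
      sg R r • braceOn mul comul ((cobar H comul).d y) x -
      sg R r • (x * y : ΩH) +
      sg R (r * (q + 1)) • (y * x : ΩH) := by
  refine (LinearMap.congr_fun (d_braceOp hb hx) (barLetter H comul y)).trans ?_
  rw [LinearMap.add_apply, LinearMap.sub_apply, LinearMap.add_apply, LinearMap.smul_apply,
    LinearMap.smul_apply, conv_barLetter_right, conv_barLetter_left hy, LinearMap.comp_apply,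
    bar_d_barLetter hb, map_neg, ← braceOn_apply, ← braceOn_apply]
  generalize braceOn mul comul y ((cobar H comul).d x) = a,
    braceOn mul comul ((cobar H comul).d y) x = b, (x * y : ΩH) = c,
    (y * x : ΩH) = e, augT (H.susp (-1)) y • x = f
  module

end Connes

section Connes

variable {H : AugMod.{u, v} R} {mul : H.toGrMod ⊗[R] H.toGrMod →ₗ[R] H.toGrMod}
  {comul : H.toGrMod →ₗ[R] H.toGrMod ⊗[R] H.toGrMod} {S : H.toGrMod →ₗ[R] H.toGrMod}
  (hb : IsDGBialgebra H mul comul) (hS : IsAntipode H mul comul S)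

local notation "ΩH" => TensorAlgebra R (H.susp (-1))

include hb hS

theorem conv_sact_mulR_dact {q : ℤ} {y : (H.susp (-1)).T} (hy : y ∈ (H.susp (-1)).T.deg q)
    (z : (H.susp (-1)).T) (b : H.toGrMod) :
    conv comul (actPair mul comul) S (mulR (concat _) z ∘ₗ dact mul comul y) b =
      (y * sact mul comul S z (H.toGrMod.sp q b) : ΩH) := by
  rw [conv_sact_mulR hb hS (dact_isDeg hb hy)]
  have h : conv comul (actPair mul comul) S (dact mul comul y) = cst H.counit y :=
    conv_actPair_mul hb hS.conv_left y
  rw [h, hb.isCoalg_cop.cst_conv]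
  rfl

theorem conv_sact_braceOn {q : ℤ} {y : (H.susp (-1)).T} (hy : y ∈ (H.susp (-1)).T.deg q)
    (z : (H.susp (-1)).T) (b : H.toGrMod) :
    conv comul (actPair mul comul) S
        (mulR (concat _) z ∘ₗ (dact mul comul y - cst H.counit y)) b =
      (y * sact mul comul S z (H.toGrMod.sp q b) : ΩH) -
        sact mul comul S (y * z : ΩH) b := by
  have h : mulR (concat _) z ∘ₗ cst H.counit y =
      cst H.counit (y * z : ΩH) := comp_cst _ _ _
  rw [LinearMap.comp_sub, conv_sub_right, LinearMap.sub_apply, conv_sact_mulR_dact hb hS hy, h,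
    hb.isCoalg.conv_cst]
  rfl

variable (hcop : conv (cop comul) mul S LinearMap.id = cst H.counit H.one)

include hcop

theorem d_antiCyc_braceOn {q r : ℤ} {y x : (H.susp (-1)).T} (hy : y ∈ (H.susp (-1)).T.deg q)
    (hx : x ∈ (H.susp (-1)).T.deg r) :
    ∀ s, ∀ p ∈ (H.susp (-1)).T.deg s,
    (cobar H comul).d (antiCyc mul comul S (braceOn mul comul y) x p) +
        antiCyc mul comul S (braceOn mul comul y) ((cobar H comul).d x) p -
        sg R r • antiCyc mul comul S (braceOn mul comul ((cobar H comul).d y)) x p +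
        sg R (r + q + 1) • antiCyc mul comul S (braceOn mul comul y) x ((cobar H comul).d p) =
      sg R r • antiCyc mul comul S LinearMap.id x (y * p : ΩH) +
        sg R ((r + 1) * (q + 1)) •
          (y * antiCyc mul comul S LinearMap.id x p : ΩH) -
        (braceOn mul comul y x * p : ΩH) := by
  have hG := isDeg_braceOn hb hy
  have hcyc := fun r x hx s p hp => cyc_mem (isDeg_antiAct hb hS) hG (r := r) (x := x) hx s p hp
  have hcb := (isDGAlgebra_cobar hb.toIsDGCoalgebra).toIsDGModule.isDeg_d
  refine word_induction (V := H.susp (-1)) (P := fun r x => ∀ s, ∀ p ∈ (H.susp (-1)).T.deg s,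
    (cobar H comul).d (antiCyc mul comul S (braceOn mul comul y) x p) +
        antiCyc mul comul S (braceOn mul comul y) ((cobar H comul).d x) p -
        sg R r • antiCyc mul comul S (braceOn mul comul ((cobar H comul).d y)) x p +
        sg R (r + q + 1) • antiCyc mul comul S (braceOn mul comul y) x ((cobar H comul).d p) =
      sg R r • antiCyc mul comul S LinearMap.id x (y * p : ΩH) +
        sg R ((r + 1) * (q + 1)) •
          (y * antiCyc mul comul S LinearMap.id x p : ΩH) -
        (braceOn mul comul y x * p : ΩH)) ?_ ?_ ?_ ?_ ?_ r x hx
  · intro s p hp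
    rw [cobar_d_one, cyc_one, cyc_one, cyc_one, braceOn_one, map_zero]
    simp only [LinearMap.zero_apply, map_zero, mul_zero, zero_mul, smul_zero, add_zero, sub_zero]
  · intro n r v x hv hx ih s p hp
    have hl := letter_mem hv
    have hDv := hcb n _ hl
    have h := d_antiCyc_cons hb hS hcop hG (K := dact mul comul y - cst H.counit y) (k := q + 1)
      (fun b x => by rw [braceOn_mul hy, braceOn_jay hb]) hv hx hp
    have ih' := ih _ _ (mul_memT hp hl)
    have key : (cobar H comul).d (antiCyc mul comul S (braceOn mul comul y) x
          (p * letter (H.susp (-1)) v : ΩH)) +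
        antiCyc mul comul S (braceOn mul comul y) ((cobar H comul).d x)
          (p * letter (H.susp (-1)) v : ΩH) = _ :=
      (sub_eq_iff_eq_add.1 (eq_sub_of_add_eq ih'))
    rw [cobar_d_mul' hp, map_add, map_smul] at key
    have ho := GrMod.mem_of_eq (H.isDeg_outS (-1) n v hv) (show _ = n + 1 by lia)
    have hz : H.toGrMod.sp 1 (H.outS (-1) v) = sg R (n + 1) • H.outS (-1) v := by
      rw [GrMod.sp_apply _ ho, one_mul]
    have hz2 : H.toGrMod.sp q (H.outS (-1) v) = sg R (q * (n + 1)) • H.outS (-1) v :=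
      GrMod.sp_apply _ ho
    rw [key, conv_sact_braceOn hb hS hy, hz, map_smul (H.toGrMod.sp q), hz2, map_smul, map_smul,
      map_smul, ← antiAct_apply, ← antiAct_apply, cobar_d_mul' (hG _ _ hx), d_braceOn hb hy hx,
      GrMod.sp_apply _ hx] at h
    rw [eq_sub_of_add_eq h]
    rw [cyc_cons _ _ hv, cyc_cons _ _ hv, cyc_cons _ _ hv, cyc_cons _ _ hv]
    have e1 := hcyc r x hx _ _ (mul_memT hp hDv)
    have e2 := mul_memT (hG _ _ hx) (mul_memT hp hl)
    simp only [LinearMap.id_apply, map_add, map_sub, map_neg, map_smul]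
    rw [GrMod.sp_apply _ e1, GrMod.sp_apply _ e1, GrMod.sp_apply _ e2, sp_mul,
      GrMod.sp_apply n hy]
    simp only [add_mul, sub_mul, neg_mul, mul_add, smul_mul_assoc, mul_smul_comm, mul_assoc, map_add,
      map_sub, map_neg, map_smul]
    simp only [smul_add, smul_sub, smul_neg, smul_smul]
    match_scalars
    all_goals simp only [mul_one, ← sg_add, neg_add_eq_zero, neg_neg, sub_self]
    all_goals
      first | refine sg_congr ?_ | refine sg_eq_neg ?_
      push_cast
      generalize (n : ZMod 2) = n, (r : ZMod 2) = r, (s : ZMod 2) = s, (q : ZMod 2) = q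
      revert n r s q
      decide
  · intro r s p hp
    simp only [map_zero, LinearMap.zero_apply, zero_mul, mul_zero, smul_zero, add_zero, sub_zero]
  · intro r x z hx hz s p hp
    have := congrArg₂ (· + ·) (hx s p hp) (hz s p hp)
    simp only [map_add, LinearMap.add_apply, smul_add, add_mul, mul_add] at this ⊢
    rw [← sub_eq_zero] at this ⊢
    rw [← this]
    abel
  · intro r c x hx s p hp
    have := congrArg (c • ·) (hx s p hp)
    simp only [map_smul, LinearMap.smul_apply, smul_add, smul_sub, smul_mul_assoc, mul_smul_comm]
      at this ⊢
    simp only [smul_comm c] at this ⊢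
    exact this

end Connes

section Connes

variable {H : AugMod.{u, v} R} {mul : H.toGrMod ⊗[R] H.toGrMod →ₗ[R] H.toGrMod}
  {comul : H.toGrMod →ₗ[R] H.toGrMod ⊗[R] H.toGrMod} {S : H.toGrMod →ₗ[R] H.toGrMod}

variable (mul) in
/-- The action of `H` on a single letter. -/
def actS (v : H.susp (-1)) : H.toGrMod →ₗ[R] H.susp (-1) :=
  H.inS (-1) ∘ₗ mul ∘ₗ (TensorProduct.mk R H.toGrMod H.toGrMod).flip (H.outS (-1) v) ∘ₗ
    H.toGrMod.sp 1

variable (mul comul S) in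
/-- `v ⊗ x ↦ (p ↦ v ▷ (x p))`. -/
def antiStep : H.susp (-1) ⊗[R] (H.susp (-1)).T →ₗ[R] (H.susp (-1)).T →ₗ[R] (H.susp (-1)).T :=
  TensorProduct.lift ((LinearMap.llcomp R (H.susp (-1)).T (H.susp (-1)).T (H.susp (-1)).T ∘ₗ
    antiAct mul comul S).compl₂ (LinearMap.mul R (TensorAlgebra R (H.susp (-1)))))

variable (mul comul S) in
/-- `v ⊗ x ↦ (p ↦ ± Δ(x, p v))`. -/
def rotStep : H.susp (-1) ⊗[R] (H.susp (-1)).T →ₗ[R] (H.susp (-1)).T →ₗ[R] (H.susp (-1)).T :=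
  TensorProduct.lift ((rotOp (H.susp (-1))).compl₂ (antiCyc mul comul S LinearMap.id))

variable (H) in
/-- Evaluation of endomorphisms. -/
abbrev evalT : ((H.susp (-1)).T →ₗ[R] (H.susp (-1)).T) ⊗[R] (H.susp (-1)).T →ₗ[R]
    (H.susp (-1)).T := TensorProduct.lift LinearMap.id

variable (hb : IsDGBialgebra H mul comul) (hS : IsAntipode H mul comul S)

include hb

theorem outS_actS (v : H.susp (-1)) (a : H.toGrMod) :
    H.outS (-1) (actS mul v a) = mul (H.toGrMod.sp 1 a ⊗ₜ H.outS (-1) v) := by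
  refine (H.outS_inS _ _).trans ?_
  have : H.counit (mul (H.toGrMod.sp 1 a ⊗ₜ H.outS (-1) v)) = 0 := by
    rw [hb.counit_mul, H.counit_outS, mul_zero]
  refine Eq.trans (congrArg₂ (· - ·) rfl (congrArg (· • H.one) this)) ?_
  rw [zero_smul, sub_zero]
  rfl

theorem dact_letter (v : H.susp (-1)) :
    dact mul comul (letter (H.susp (-1)) v) = letter (H.susp (-1)) ∘ₗ actS mul v := by
  refine LinearMap.ext fun a => ?_
  rw [H.letter_eq, dact_ell hb, H.counit_outS, zero_smul, sub_zero]
  rfl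

theorem actS_mem {n : ℤ} {v : H.susp (-1)} (hv : v ∈ (H.susp (-1)).deg n) {k : ℤ} {a : H.toGrMod}
    (ha : a ∈ H.deg k) : actS mul v a ∈ (H.susp (-1)).deg (k + n) :=
  GrMod.mem_of_eq (V := H.susp (-1)) (H.isDeg_inS (-1) _ _ (hb.mul_mem _ _ _
    (H.toGrMod.sp_mem 1 ha) _ (H.isDeg_outS (-1) n v hv))) (by lia)

theorem antiCyc_comp_dact {n : ℤ} {v : H.susp (-1)} (hv : v ∈ (H.susp (-1)).deg n)
    (x : (H.susp (-1)).T) :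
    antiCyc mul comul S LinearMap.id ∘ₗ
        dact mul comul (letter (H.susp (-1)) v * x : TensorAlgebra R (H.susp (-1))) =
      conv comul (antiStep mul comul S) (actS mul v) (dact mul comul x ∘ₗ H.toGrMod.sp n) +
      conv comul (rotStep mul comul S) (actS mul v) (dact mul comul x ∘ₗ H.toGrMod.sp n) := by
  rw [dact_mul hb (letter_mem hv), dact_letter hb]
  refine LinearMap.ext fun a => ?_
  rw [LinearMap.comp_apply, LinearMap.add_apply, conv_apply, conv_apply, conv_apply]
  generalize comul a = z
  induction z using TensorProduct.induction_on with
  | zero => simp only [map_zero, add_zero]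
  | add z z' h h' =>
    rw [map_add, map_add, map_add, map_add, map_add, map_add, h, h']
    abel
  | tmul a b => exact cyc_letter_mul _ _ _ _

include hS

theorem conv_antiStep {n r : ℤ} {v : H.susp (-1)} (hv : v ∈ (H.susp (-1)).deg n)
    {x : (H.susp (-1)).T} (hx : x ∈ (H.susp (-1)).T.deg r) (c : H.toGrMod) (q : (H.susp (-1)).T) :
    conv comul (antiStep mul comul S) (actS mul v) (dact mul comul x ∘ₗ H.toGrMod.sp n) c q =
      dact mul comul (x * dact mul comul q (S (H.toGrMod.sp (n + r) c)) :
        TensorAlgebra R (H.susp (-1))) (S (H.outS (-1) v)) := by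
  have ho := GrMod.mem_of_eq (H.isDeg_outS (-1) n v hv) (show _ = n + 1 by lia)
  have h := conv_sact_mulR_dact hb hS hx q (H.toGrMod.sp n c)
  have h2 := LinearMap.congr_fun (conv_sp hb.toIsDGCoalgebra.isDeg (actPair mul comul) S
    (mulR (concat _) q ∘ₗ dact mul comul x) n) c
  have h3 : H.toGrMod.sp r (H.toGrMod.sp n c) = H.toGrMod.sp (n + r) c := by
    rw [← LinearMap.comp_apply, GrMod.sp_comp, add_comm]
  rw [LinearMap.comp_apply] at h2
  rw [h2, h3] at h
  refine Eq.trans ?_ (congrArg (fun z => dact mul comul z (S (H.outS (-1) v))) h)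
  rw [conv_apply, conv_apply]
  generalize comul c = z
  induction z using GrMod.tensor_induction (V := H.toGrMod) (W := H.toGrMod) with
  | zero => simp only [map_zero, LinearMap.zero_apply]
  | add z z' h h' => simp only [map_add, LinearMap.add_apply, h, h']
  | hom k l a ha b hb' =>
    have e := LinearMap.congr_fun (hS.antimul hb) (H.toGrMod.sp 1 a ⊗ₜ H.outS (-1) v)
    have e1 : antiStep mul comul S (TensorProduct.map (actS mul v)
        (dact mul comul x ∘ₗ H.toGrMod.sp n) (a ⊗ₜ b)) q =
      dact mul comul (dact mul comul x (H.toGrMod.sp n b) * q : TensorAlgebra R (H.susp (-1)))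
        (S (H.outS (-1) (actS mul v a))) := rfl
    have e2 : actPair mul comul (TensorProduct.map (S ∘ₗ H.toGrMod.sp n)
        ((mulR (concat _) q ∘ₗ dact mul comul x) ∘ₗ H.toGrMod.sp n) (a ⊗ₜ b)) =
      dact mul comul (dact mul comul x (H.toGrMod.sp n b) * q : TensorAlgebra R (H.susp (-1)))
        (S (H.toGrMod.sp n a)) := rfl
    rw [e1, e2, ← dact_dact hb, outS_actS hb]
    refine congrArg _ (e.trans ?_)
    simp only [LinearMap.comp_apply, TensorProduct.map_tmul]
    rw [GrMod.sp_apply 1 ha, GrMod.sp_apply n ha, map_smul, map_smul, ← TensorProduct.smul_tmul',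
      map_smul, GrMod.koszul_tmul' (hS.mem _ _ ha) (hS.mem _ _ ho), TensorProduct.tmul_smul,
      map_smul, map_smul, map_smul, smul_smul, ← sg_add]
    refine sg_smul_congr ?_ rfl
    push_cast
    generalize (n : ZMod 2) = n, (k : ZMod 2) = k
    revert n k
    decide

end Connes

section Connes

variable {H : AugMod.{u, v} R} {mul : H.toGrMod ⊗[R] H.toGrMod →ₗ[R] H.toGrMod}
  {comul : H.toGrMod →ₗ[R] H.toGrMod ⊗[R] H.toGrMod} {S : H.toGrMod →ₗ[R] H.toGrMod}
  (hb : IsDGBialgebra H mul comul) (hS : IsAntipode H mul comul S)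

include hb hS

theorem conv_rotStep {n r s : ℤ} {v : H.susp (-1)} (hv : v ∈ (H.susp (-1)).deg n)
    {x p : (H.susp (-1)).T} (hx : x ∈ (H.susp (-1)).T.deg r) (hp : p ∈ (H.susp (-1)).T.deg s) :
    conv (cop comul) (evalT H)
        (conv comul (rotStep mul comul S) (actS mul v) (dact mul comul x ∘ₗ H.toGrMod.sp n))
        (dact mul comul p ∘ₗ H.toGrMod.sp (n + r)) =
      (H.susp (-1)).T.sp n ∘ₗ conv (cop comul)
        (TensorProduct.lift (antiCyc mul comul S LinearMap.id)) (dact mul comul x)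
        (dact mul comul (p * letter (H.susp (-1)) v : TensorAlgebra R (H.susp (-1))) ∘ₗ
          H.toGrMod.sp r) ∘ₗ H.toGrMod.sp n := by
  have hdeg := hb.toIsDGCoalgebra.isDeg
  have hcyc := fun r x hx s p hp => cyc_mem (isDeg_antiAct hb hS) (g := 0) isDeg_id (r := r) (x := x) hx s p hp
  let F : (H.toGrMod ⊗[R] H.toGrMod) ⊗[R] H.toGrMod →ₗ[R] (H.susp (-1)).T :=
    evalT H ∘ₗ TensorProduct.map (rotStep mul comul S ∘ₗ TensorProduct.map (actS mul v)
      (dact mul comul x ∘ₗ H.toGrMod.sp n)) (dact mul comul p ∘ₗ H.toGrMod.sp (n + r))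
  let G : H.toGrMod ⊗[R] (H.toGrMod ⊗[R] H.toGrMod) →ₗ[R] (H.susp (-1)).T :=
    (H.susp (-1)).T.sp n ∘ₗ TensorProduct.lift (antiCyc mul comul S LinearMap.id) ∘ₗ
      TensorProduct.map (dact mul comul x) (concat _ ∘ₗ TensorProduct.map (dact mul comul p)
        (letter (H.susp (-1)) ∘ₗ actS mul v ∘ₗ H.toGrMod.sp s) ∘ₗ
          (H.toGrMod.tensor H.toGrMod).sp r)
  have h1 : F ∘ₗ koszul H.toGrMod (H.toGrMod.tensor H.toGrMod) ∘ₗ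
      (TensorProduct.assoc R H.toGrMod H.toGrMod H.toGrMod).toLinearMap =
      G ∘ₗ koszul (H.toGrMod.tensor H.toGrMod) H.toGrMod ∘ₗ
        TensorProduct.map ((H.toGrMod.tensor H.toGrMod).sp n) (H.toGrMod.sp n) := by
    refine TensorProduct.ext_threefold fun a b c => ?_
    induction a using GrMod.homogeneous_induction with
    | zero => simp only [TensorProduct.zero_tmul, map_zero]
    | add a a' h h' => simp only [TensorProduct.add_tmul, map_add, h, h']
    | hom i a ha =>
    induction b using GrMod.homogeneous_induction with
    | zero => simp only [TensorProduct.zero_tmul, TensorProduct.tmul_zero, map_zero]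
    | add a a' h h' => simp only [TensorProduct.add_tmul, TensorProduct.tmul_add, map_add, h, h']
    | hom j b hb' =>
    induction c using GrMod.homogeneous_induction with
    | zero => simp only [TensorProduct.tmul_zero, map_zero]
    | add a a' h h' => simp only [TensorProduct.tmul_add, map_add, h, h']
    | hom k c hc =>
    have hab : a ⊗ₜ[R] b ∈ (H.toGrMod.tensor H.toGrMod).deg (i + j) := GrMod.tmul_mem ha hb' rfl
    have hbc : b ⊗ₜ[R] c ∈ (H.toGrMod.tensor H.toGrMod).deg (j + k) := GrMod.tmul_mem hb' hc rfl
    have hl := actS_mem hb hv hb'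
    have hX := dact_isDeg hb hx k c hc
    have hP := dact_isDeg hb hp i a ha
    have hθ := hcyc _ _ hX _ _ (mul_memT hP (letter_mem hl))
    have e1 : F ((b ⊗ₜ c) ⊗ₜ a) = sg R (n * k) • sg R ((n + r) * i) • sg R ((j + n) * (k + r + (i + s + (j + n)) + 0 + 1)) •
        antiCyc mul comul S LinearMap.id (dact mul comul x c)
          (dact mul comul p a * letter (H.susp (-1)) (actS mul v b) :
            TensorAlgebra R (H.susp (-1))) := by
      have : F ((b ⊗ₜ c) ⊗ₜ a) = rotOp (H.susp (-1)) (actS mul v b)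
        (antiCyc mul comul S LinearMap.id (dact mul comul x (H.toGrMod.sp n c)))
          (dact mul comul p (H.toGrMod.sp (n + r) a)) := rfl
      rw [this, GrMod.sp_apply n hc, GrMod.sp_apply (n + r) ha]
      simp only [map_smul, LinearMap.smul_apply]
      rw [rotOp_apply hl, GrMod.sp_apply _ hθ]
      simp only [smul_smul]
      exact congrArg (· • _) (by ring)
    have e2 : G (c ⊗ₜ (a ⊗ₜ b)) = sg R (r * (i + j)) • sg R (s * j) • sg R (n * (k + r + (i + s + (j + n)) + 0 + 1)) •
        antiCyc mul comul S LinearMap.id (dact mul comul x c)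
          (dact mul comul p a * letter (H.susp (-1)) (actS mul v b) :
            TensorAlgebra R (H.susp (-1))) := by
      have e3 : TensorProduct.lift (antiCyc mul comul S LinearMap.id) (dact mul comul x c ⊗ₜ
        concat _ (dact mul comul p a ⊗ₜ letter (H.susp (-1)) (actS mul v b))) =
        antiCyc mul comul S LinearMap.id (dact mul comul x c)
          (dact mul comul p a * letter (H.susp (-1)) (actS mul v b) :
            TensorAlgebra R (H.susp (-1))) := rfl
      simp only [G, LinearMap.comp_apply, TensorProduct.map_tmul]
      rw [GrMod.sp_apply r hab, map_smul, TensorProduct.map_tmul]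
      simp only [LinearMap.comp_apply]
      rw [GrMod.sp_apply s hb']
      simp only [map_smul, TensorProduct.tmul_smul]
      rw [e3, GrMod.sp_apply _ hθ]
    simp only [LinearMap.comp_apply, LinearEquiv.coe_coe, TensorProduct.assoc_tmul,
      TensorProduct.map_tmul]
    rw [GrMod.koszul_tmul' (W := H.toGrMod.tensor H.toGrMod) ha hbc, GrMod.sp_apply n hab,
      GrMod.sp_apply n hc, ← TensorProduct.smul_tmul', TensorProduct.tmul_smul]
    simp only [map_smul]
    rw [GrMod.koszul_tmul' (V := H.toGrMod.tensor H.toGrMod) hab hc, map_smul, e1, e2]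
    simp only [smul_smul, ← sg_add]
    refine sg_smul_congr ?_ rfl
    push_cast
    generalize (n : ZMod 2) = n, (r : ZMod 2) = r, (s : ZMod 2) = s, (i : ZMod 2) = i,
      (j : ZMod 2) = j, (k : ZMod 2) = k
    revert n r s i j k
    decide
  have h2 : koszul H.toGrMod (H.toGrMod.tensor H.toGrMod) ∘ₗ LinearMap.lTensor H.toGrMod comul =
    LinearMap.rTensor H.toGrMod comul ∘ₗ koszul H.toGrMod H.toGrMod := koszul_lTensor_cm hdeg
  have h3 : koszul (H.toGrMod.tensor H.toGrMod) H.toGrMod ∘ₗ LinearMap.rTensor H.toGrMod comul =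
    LinearMap.lTensor H.toGrMod comul ∘ₗ koszul H.toGrMod H.toGrMod := koszul_rTensor_cm hdeg
  have h4 : TensorProduct.map ((H.toGrMod.tensor H.toGrMod).sp n) (H.toGrMod.sp n) ∘ₗ
      LinearMap.rTensor H.toGrMod comul =
      LinearMap.rTensor H.toGrMod comul ∘ₗ TensorProduct.map (H.toGrMod.sp n) (H.toGrMod.sp n) := by
    rw [LinearMap.map_comp_rTensor, LinearMap.rTensor_comp_map, ← hdeg.sp_comp_zero]
  have h8 := hb.isCoalg.coassoc
  calc _ = F ∘ₗ LinearMap.rTensor H.toGrMod comul ∘ₗ cop comul := by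
        have h7 : F ∘ₗ LinearMap.rTensor H.toGrMod comul = evalT H ∘ₗ TensorProduct.map
            (conv comul (rotStep mul comul S) (actS mul v) (dact mul comul x ∘ₗ H.toGrMod.sp n))
            (dact mul comul p ∘ₗ H.toGrMod.sp (n + r)) := by
          simp only [F]
          rw [LinearMap.comp_assoc, LinearMap.map_comp_rTensor]
          rfl
        exact (congrArg (fun f => f ∘ₗ cop comul) h7).symm
    _ = F ∘ₗ (koszul H.toGrMod (H.toGrMod.tensor H.toGrMod) ∘ₗ
        LinearMap.lTensor H.toGrMod comul) ∘ₗ comul := by rw [h2]; rfl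
    _ = (F ∘ₗ koszul H.toGrMod (H.toGrMod.tensor H.toGrMod) ∘ₗ
        (TensorProduct.assoc R H.toGrMod H.toGrMod H.toGrMod).toLinearMap) ∘ₗ
        LinearMap.rTensor H.toGrMod comul ∘ₗ comul := by
          exact (congrArg (fun f => F ∘ₗ koszul H.toGrMod (H.toGrMod.tensor H.toGrMod) ∘ₗ f) h8).symm
    _ = G ∘ₗ koszul (H.toGrMod.tensor H.toGrMod) H.toGrMod ∘ₗ
        (TensorProduct.map ((H.toGrMod.tensor H.toGrMod).sp n) (H.toGrMod.sp n) ∘ₗ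
        LinearMap.rTensor H.toGrMod comul) ∘ₗ comul := by rw [h1]; rfl
    _ = G ∘ₗ (koszul (H.toGrMod.tensor H.toGrMod) H.toGrMod ∘ₗ LinearMap.rTensor H.toGrMod comul) ∘ₗ
         TensorProduct.map (H.toGrMod.sp n) (H.toGrMod.sp n) ∘ₗ comul := by rw [h4]; rfl
    _ = G ∘ₗ LinearMap.lTensor H.toGrMod comul ∘ₗ cop comul ∘ₗ H.toGrMod.sp n := by
      rw [h3, ← comul_sp hdeg]; rfl
    _ = _ := by
      rw [dact_mul hb hp, dact_letter hb]
      have h5 : (H.toGrMod.tensor H.toGrMod).sp r ∘ₗ comul = comul ∘ₗ H.toGrMod.sp r :=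
        hdeg.sp_comp_zero r
      have h6 : (concat (H.susp (-1)) ∘ₗ TensorProduct.map (dact mul comul p)
          (letter (H.susp (-1)) ∘ₗ actS mul v ∘ₗ H.toGrMod.sp s) ∘ₗ
          (H.toGrMod.tensor H.toGrMod).sp r) ∘ₗ comul =
          conv comul (concat _) (dact mul comul p)
            ((letter (H.susp (-1)) ∘ₗ actS mul v) ∘ₗ H.toGrMod.sp s) ∘ₗ H.toGrMod.sp r := by
        rw [LinearMap.comp_assoc, LinearMap.comp_assoc, h5]; rfl
      rw [← h6]
      generalize cop comul = cc
      unfold conv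
      rw [← LinearMap.map_comp_lTensor]
      rfl

end Connes

section Connes

variable {H : AugMod.{u, v} R} {mul : H.toGrMod ⊗[R] H.toGrMod →ₗ[R] H.toGrMod}
  {comul : H.toGrMod →ₗ[R] H.toGrMod ⊗[R] H.toGrMod} {S : H.toGrMod →ₗ[R] H.toGrMod}
  (hb : IsDGBialgebra H mul comul) (hS : IsAntipode H mul comul S)

local notation "ΩH" => TensorAlgebra R (H.susp (-1))

include hb hS

variable (hcop : conv (cop comul) mul S LinearMap.id = cst H.counit H.one)

include hcop

theorem conv_antiCyc {r : ℤ} {x : (H.susp (-1)).T} (hx : x ∈ (H.susp (-1)).T.deg r) :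
    ∀ s, ∀ p ∈ (H.susp (-1)).T.deg s, conv (cop comul)
        (TensorProduct.lift (antiCyc mul comul S LinearMap.id)) (dact mul comul x)
        (dact mul comul p ∘ₗ H.toGrMod.sp r) =
      cst H.counit (antiCyc mul comul S LinearMap.id x p) := by
  have hdeg := hb.toIsDGCoalgebra.isDeg
  have hcs : ∀ n c, H.counit (H.toGrMod.sp n c) = H.counit c := fun n c =>
    LinearMap.congr_fun (H.counit_sp n) c
  refine word_induction (V := H.susp (-1)) (P := fun r x => ∀ s, ∀ p ∈ (H.susp (-1)).T.deg s,
      conv (cop comul) (TensorProduct.lift (antiCyc mul comul S LinearMap.id)) (dact mul comul x)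
        (dact mul comul p ∘ₗ H.toGrMod.sp r) =
      cst H.counit (antiCyc mul comul S LinearMap.id x p)) ?_ ?_ ?_ ?_ ?_ r x hx
  · intro s p hp
    have h : dact mul comul (1 : ΩH) =
      cst H.counit (1 : ΩH) := diagonalAct_one _ _ _
    rw [h, hb.isCoalg_cop.cst_conv]
    refine LinearMap.ext fun a => ?_
    have e := LinearMap.congr_fun (cyc_one (antiAct mul comul S) LinearMap.id)
    rw [cst_apply, e, LinearMap.zero_apply, smul_zero]
    exact e _
  · intro n r v x hv hx ih s p hp
    have h1 : conv (cop comul) (TensorProduct.lift (antiCyc mul comul S LinearMap.id))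
        (dact mul comul (letter (H.susp (-1)) v * x : ΩH))
        (dact mul comul p ∘ₗ H.toGrMod.sp (n + r)) = conv (cop comul) (evalT H)
          (antiCyc mul comul S LinearMap.id ∘ₗ
            dact mul comul (letter (H.susp (-1)) v * x : ΩH))
          (dact mul comul p ∘ₗ H.toGrMod.sp (n + r)) :=
      congrArg (· ∘ₗ cop comul) (TensorProduct.ext' (M := H.toGrMod) (N := H.toGrMod)
        (g := TensorProduct.lift (antiCyc mul comul S LinearMap.id) ∘ₗ TensorProduct.map
          (dact mul comul (letter (H.susp (-1)) v * x : ΩH))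
          (dact mul comul p ∘ₗ H.toGrMod.sp (n + r)))
        (h := evalT H ∘ₗ TensorProduct.map (antiCyc mul comul S LinearMap.id ∘ₗ
            dact mul comul (letter (H.susp (-1)) v * x : ΩH))
          (dact mul comul p ∘ₗ H.toGrMod.sp (n + r))) fun a b => rfl)
    rw [h1, antiCyc_comp_dact hb hv, conv_add_left, conv_rotStep hb hS hv hx hp,
      ih _ _ (mul_memT hp (letter_mem hv))]
    refine LinearMap.ext fun c => ?_
    have h2 : conv (cop comul) (evalT H)
        (conv comul (antiStep mul comul S) (actS mul v) (dact mul comul x ∘ₗ H.toGrMod.sp n))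
        (dact mul comul p ∘ₗ H.toGrMod.sp (n + r)) c =
      dact mul comul (x * conv (cop comul) (actPair mul comul) (S ∘ₗ H.toGrMod.sp (n + r))
        (dact mul comul p ∘ₗ H.toGrMod.sp (n + r)) c : ΩH)
        (S (H.outS (-1) v)) := by
      rw [conv_apply, conv_apply]
      generalize cop comul c = z
      induction z using TensorProduct.induction_on with
      | zero => simp only [map_zero, mul_zero, LinearMap.zero_apply]
      | add z z' h h' => simp only [map_add, mul_add, LinearMap.add_apply, h, h']
      | tmul a b => exact conv_antiStep hb hS hv hx a _
    have h3 : conv (cop comul) (actPair mul comul) S (dact mul comul p) = cst H.counit p :=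
      conv_actPair_mul hb hcop p
    rw [← conv_sp (isDeg_cop hdeg), h3] at h2
    rw [LinearMap.add_apply, h2, cst_apply, cyc_cons _ _ hv]
    simp only [LinearMap.comp_apply, cst_apply, hcs, map_smul, smul_add, mul_smul_comm,
      LinearMap.smul_apply]
    rfl
  · intro r s p hp
    refine LinearMap.ext fun c => ?_
    simp only [map_zero, conv_zero_left, LinearMap.zero_apply, cst_apply, smul_zero]
  · intro r x z hx hz s p hp
    refine LinearMap.ext fun c => ?_
    rw [map_add, map_add, conv_add_left, hx s p hp, hz s p hp, LinearMap.add_apply, cst_apply,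
      cst_apply, cst_apply, LinearMap.add_apply, smul_add]
  · intro r c x hx s p hp
    refine LinearMap.ext fun a => ?_
    rw [map_smul, map_smul, conv_smul_left, hx s p hp, LinearMap.smul_apply, cst_apply,
      cst_apply, LinearMap.smul_apply, smul_comm]

theorem antiCyc_dact_one (x : (H.susp (-1)).T) (c : H.toGrMod) :
    antiCyc mul comul S LinearMap.id (dact mul comul x c) (1 : ΩH) =
      H.counit c • antiCyc mul comul S LinearMap.id x (1 : ΩH) := by
  induction x using GrMod.homogeneous_induction (V := (H.susp (-1)).T) with
  | zero => simp only [map_zero, LinearMap.zero_apply, smul_zero]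
  | add x y h h' => simp only [map_add, LinearMap.add_apply, smul_add, h, h']
  | hom r x hx =>
    have h := LinearMap.congr_fun (conv_antiCyc hb hS hcop hx 0 _ one_memT) c
    have h1 : dact mul comul (1 : ΩH) ∘ₗ H.toGrMod.sp r =
        cst H.counit (1 : ΩH) := by
      have : dact mul comul (1 : ΩH) =
        cst H.counit (1 : ΩH) := diagonalAct_one _ _ _
      rw [this, cst_comp, H.counit_sp]
    rw [h1, hb.isCoalg_cop.conv_cst] at h
    exact h

theorem antiCyc_sq : (antiCyc mul comul S LinearMap.id).flip (1 : ΩH) ∘ₗ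
    (antiCyc mul comul S LinearMap.id).flip (1 : ΩH) = 0 := by
  have hΔ : GrMod.IsDeg (V := (H.susp (-1)).T) (W := (H.susp (-1)).T)
      ((antiCyc mul comul S LinearMap.id).flip (1 : ΩH)) 1 :=
    fun r x hx => GrMod.mem_of_eq (cyc_mem (isDeg_antiAct hb hS) (g := 0) isDeg_id hx 0 _ one_memT)
      (by lia)
  refine LinearMap.ext fun x => ?_
  have key : ∀ p : (H.susp (-1)).T, (antiCyc mul comul S LinearMap.id).flip
      (1 : ΩH) (antiCyc mul comul S LinearMap.id x p) = 0 := by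
    induction x using word_induction' with
    | one =>
      intro p
      rw [cyc_one, LinearMap.zero_apply, map_zero]
    | cons m n v x hv hx ih =>
      intro p
      have h1 := hΔ.sp m (antiCyc mul comul S LinearMap.id x
        (p * letter (H.susp (-1)) v : ΩH))
      rw [ih, map_zero] at h1
      have h2 : (antiCyc mul comul S LinearMap.id).flip (1 : ΩH)
          ((H.susp (-1)).T.sp m (antiCyc mul comul S LinearMap.id x
            (p * letter (H.susp (-1)) v : ΩH))) = 0 := by
        have := congrArg (sg R (m * 1) • ·) h1
        simp only [smul_zero, smul_smul, ← sg_add] at this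
        rw [sg_congr (n := 0), sg_zero, one_smul] at this
        · exact this.symm
        · push_cast; generalize (m : ZMod 2) = m; revert m; decide
      rw [cyc_cons _ _ hv, map_add, h2, add_zero, antiAct_apply]
      refine (antiCyc_dact_one hb hS hcop _ _).trans ?_
      have h3 := LinearMap.congr_fun (hS.counit hb) (H.outS (-1) v)
      rw [LinearMap.comp_apply, H.counit_outS] at h3
      rw [h3, zero_smul]
    | zero => intro p; rw [map_zero, LinearMap.zero_apply, map_zero]
    | add x y hx hy => intro p; rw [map_add, LinearMap.add_apply, map_add, hx, hy, add_zero]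
    | smul r x hx => intro p; rw [map_smul, LinearMap.smul_apply, map_smul, hx, smul_zero]
  exact key _

end Connes

section Cyc

variable {V : GrMod.{u, v} R} (tri : V →ₗ[R] V.T →ₗ[R] V.T)

theorem cyc_add (G G' : V.T →ₗ[R] V.T) : cyc tri (G + G') = cyc tri G + cyc tri G' := by
  refine LinearMap.ext fun x => ?_
  induction x using word_induction' with
  | one => rw [LinearMap.add_apply, cyc_one, cyc_one, cyc_one, add_zero]
  | cons m n v x hv hx ih =>
    refine LinearMap.ext fun p => ?_
    rw [LinearMap.add_apply, LinearMap.add_apply, cyc_cons _ _ hv, cyc_cons _ _ hv,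
      cyc_cons _ _ hv, ih, LinearMap.add_apply, LinearMap.add_apply, LinearMap.add_apply, map_add,
      add_mul, map_add]
    abel
  | zero => rw [map_zero, map_zero]
  | add x y hx hy => rw [map_add, map_add, hx, hy]
  | smul r x hx => rw [map_smul, map_smul, hx]

theorem cyc_smul (c : R) (G : V.T →ₗ[R] V.T) : cyc tri (c • G) = c • cyc tri G := by
  refine LinearMap.ext fun x => ?_
  induction x using word_induction' with
  | one => rw [LinearMap.smul_apply, cyc_one, cyc_one, smul_zero]
  | cons m n v x hv hx ih =>
    refine LinearMap.ext fun p => ?_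
    rw [LinearMap.smul_apply, LinearMap.smul_apply, cyc_cons _ _ hv, cyc_cons _ _ hv, ih,
      LinearMap.smul_apply, LinearMap.smul_apply, LinearMap.smul_apply, map_smul, smul_mul_assoc,
      map_smul, smul_add]
  | zero => rw [map_zero, map_zero]
  | add x y hx hy => rw [map_add, map_add, hx, hy]
  | smul r x hx => rw [map_smul, map_smul, hx]

end Cyc

section Connes

variable {H : AugMod.{u, v} R} {mul : H.toGrMod ⊗[R] H.toGrMod →ₗ[R] H.toGrMod}
  {comul : H.toGrMod →ₗ[R] H.toGrMod ⊗[R] H.toGrMod} {S : H.toGrMod →ₗ[R] H.toGrMod}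

local notation "ΩH" => TensorAlgebra R (H.susp (-1))

theorem braceOn_add (y y' : (H.susp (-1)).T) :
    braceOn mul comul (y + y') = braceOn mul comul y + braceOn mul comul y' := by
  unfold braceOn barLetter
  rw [map_add, map_add, map_add]

theorem braceOn_smul (c : R) (y : (H.susp (-1)).T) :
    braceOn mul comul (c • y) = c • braceOn mul comul y := by
  unfold braceOn barLetter
  rw [map_smul, map_smul, map_smul]

variable (mul comul S) in
/-- The pairing `(x, y) ↦ ∑ ± S(a_i) ⋄ ((s⁻¹a_{i+1} ⋯ s⁻¹a_n){y} s⁻¹a_1 ⋯ s⁻¹a_{i-1})`. -/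
def braceCyc : (H.susp (-1)).T →ₗ[R] (H.susp (-1)).T →ₗ[R] (H.susp (-1)).T :=
  LinearMap.mk₂ R (fun x y => antiCyc mul comul S (braceOn mul comul y) x
      (1 : ΩH))
    (fun x x' y => by simp only [map_add, LinearMap.add_apply])
    (fun c x y => by simp only [map_smul, LinearMap.smul_apply])
    (fun x y y' => by
      rw [braceOn_add y y', antiCyc, cyc_add, LinearMap.add_apply, LinearMap.add_apply])
    (fun c x y => by
      rw [braceOn_smul c y, antiCyc, cyc_smul, LinearMap.smul_apply, LinearMap.smul_apply])

variable (mul comul S) in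
/-- The homotopy between the bracket and the deviation of `Δ` from being a derivation. -/
def bvHomotopy : (H.susp (-1)).T →ₗ[R] (H.susp (-1)).T →ₗ[R] (H.susp (-1)).T :=
  -braceCyc mul comul S -
    TensorProduct.curry (TensorProduct.lift (braceCyc mul comul S) ∘ₗ
      koszul (H.susp (-1)).T (H.susp (-1)).T ∘ₗ
      TensorProduct.map ((H.susp (-1)).T.sp 1) ((H.susp (-1)).T.sp 1)) +
    LinearMap.mk₂ R (fun x y => braceOn mul comul y (antiCyc mul comul S LinearMap.id x
      (1 : ΩH)))
      (fun x x' y => by simp only [map_add, LinearMap.add_apply])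
      (fun c x y => by simp only [map_smul, LinearMap.smul_apply])
      (fun x y y' => by rw [braceOn_add y y', LinearMap.add_apply])
      (fun c x y => by rw [braceOn_smul c y, LinearMap.smul_apply])

theorem bvHomotopy_apply {r q : ℤ} {x y : (H.susp (-1)).T} (hx : x ∈ (H.susp (-1)).T.deg r)
    (hy : y ∈ (H.susp (-1)).T.deg q) : bvHomotopy mul comul S x y =
      -braceCyc mul comul S x y + sg R ((r + 1) * (q + 1)) • braceCyc mul comul S y x +
        braceOn mul comul y
          (antiCyc mul comul S LinearMap.id x (1 : ΩH)) := by
  have h : bvHomotopy mul comul S x y = -braceCyc mul comul S x y -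
      TensorProduct.lift (braceCyc mul comul S) (koszul (H.susp (-1)).T (H.susp (-1)).T
        ((H.susp (-1)).T.sp 1 x ⊗ₜ (H.susp (-1)).T.sp 1 y)) +
      braceOn mul comul y
        (antiCyc mul comul S LinearMap.id x (1 : ΩH)) := rfl
  rw [h, GrMod.koszul_tmul' ((H.susp (-1)).T.sp_mem 1 hx) ((H.susp (-1)).T.sp_mem 1 hy),
    GrMod.sp_apply _ hx, GrMod.sp_apply _ hy, ← TensorProduct.smul_tmul', TensorProduct.tmul_smul,
    map_smul, map_smul, map_smul, TensorProduct.lift.tmul, smul_smul, smul_smul, ← sg_add, ← sg_add,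
    sg_eq_neg (m := r * q + 1 * q + 1 * r) (n := (r + 1) * (q + 1)), neg_smul, sub_neg_eq_add]
  push_cast
  generalize (r : ZMod 2) = r, (q : ZMod 2) = q
  revert r q
  decide

variable (hb : IsDGBialgebra H mul comul) (hS : IsAntipode H mul comul S)

include hb hS

theorem isDeg_connes : GrMod.IsDeg (V := (H.susp (-1)).T) (W := (H.susp (-1)).T)
    ((antiCyc mul comul S LinearMap.id).flip (1 : ΩH)) 1 :=
  fun _ _ hx => GrMod.mem_of_eq
    (cyc_mem (isDeg_antiAct hb hS) (g := 0) isDeg_id hx 0 _ one_memT) (by lia)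

theorem braceCyc_mem {r q : ℤ} {x y : (H.susp (-1)).T} (hx : x ∈ (H.susp (-1)).T.deg r)
    (hy : y ∈ (H.susp (-1)).T.deg q) : braceCyc mul comul S x y ∈ (H.susp (-1)).T.deg (r + q + 2) :=
  GrMod.mem_of_eq
    (cyc_mem (isDeg_antiAct hb hS) (isDeg_braceOn hb hy) hx 0 _ one_memT) (by lia)

theorem bvHomotopy_mem {r q : ℤ} {x y : (H.susp (-1)).T} (hx : x ∈ (H.susp (-1)).T.deg r)
    (hy : y ∈ (H.susp (-1)).T.deg q) :
    bvHomotopy mul comul S x y ∈ (H.susp (-1)).T.deg (r + q + 2) := by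
  rw [bvHomotopy_apply hx hy]
  refine add_mem (add_mem (neg_mem (braceCyc_mem hb hS hx hy)) (Submodule.smul_mem _ _
    (GrMod.mem_of_eq (braceCyc_mem hb hS hy hx) (by lia)))) ?_
  exact GrMod.mem_of_eq (isDeg_braceOn hb hy _ _ (isDeg_connes hb hS _ _ hx)) (by lia)

variable (hcop : conv (cop comul) mul S LinearMap.id = cst H.counit H.one)

include hcop

theorem d_braceCyc {r q : ℤ} {x y : (H.susp (-1)).T} (hx : x ∈ (H.susp (-1)).T.deg r)
    (hy : y ∈ (H.susp (-1)).T.deg q) :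
    (cobar H comul).d (braceCyc mul comul S x y) +
        braceCyc mul comul S ((cobar H comul).d x) y -
        sg R r • braceCyc mul comul S x ((cobar H comul).d y) =
      sg R r • antiCyc mul comul S LinearMap.id x y + sg R ((r + 1) * (q + 1)) •
          (y * antiCyc mul comul S LinearMap.id x (1 : ΩH) : ΩH) -
        braceOn mul comul y x := by
  have h := d_antiCyc_braceOn hb hS hcop hy hx 0 _ one_memT
  rw [cobar_d_one, map_zero, smul_zero, add_zero, mul_one, mul_one] at h
  exact h

theorem bracket_eq {r q : ℤ} {x y : (H.susp (-1)).T} (hx : x ∈ (H.susp (-1)).T.deg r)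
    (hy : y ∈ (H.susp (-1)).T.deg q) :
    braceOn mul comul y x - sg R ((r + 1) * (q + 1)) • braceOn mul comul x y =
      sg R r • (antiCyc mul comul S LinearMap.id (x * y : ΩH)
          (1 : ΩH) -
        (antiCyc mul comul S LinearMap.id x (1 : ΩH) * y : ΩH) -
        sg R r • (x * antiCyc mul comul S LinearMap.id y (1 : ΩH) : ΩH)) +
      ((cobar H comul).d (bvHomotopy mul comul S x y) +
        bvHomotopy mul comul S ((cobar H comul).d x) y -
        sg R r • bvHomotopy mul comul S x ((cobar H comul).d y)) := by
  have hcb := (isDGAlgebra_cobar hb.toIsDGCoalgebra).toIsDGModule.isDeg_d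
  have h1 := eq_sub_of_add_eq (sub_eq_iff_eq_add.1 (d_braceCyc hb hS hcop hx hy))
  have h2 := eq_sub_of_add_eq (sub_eq_iff_eq_add.1 (d_braceCyc hb hS hcop hy hx))
  have hΔ : antiCyc mul comul S LinearMap.id x (1 : ΩH) ∈
    (H.susp (-1)).T.deg (r + 1) := isDeg_connes hb hS _ _ hx
  have h3 := d_braceOn hb hy hΔ
  have h4 : (cobar H comul).d
      (antiCyc mul comul S LinearMap.id x (1 : ΩH)) =
      -antiCyc mul comul S LinearMap.id ((cobar H comul).d x)
        (1 : ΩH) :=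
    LinearMap.congr_fun (antiCyc_d_anticomm hb hS hcop) x
  have hs : sg R (r + 1) = -sg R r := sg_eq_neg (by push_cast; ring)
  have h5 := cyc_id_mul (isDeg_antiAct hb hS) hx y (1 : ΩH)
  have e := cyc_mem (isDeg_antiAct hb hS) (g := 0) isDeg_id hy _ _ hx
  rw [mul_one, one_mul, GrMod.sp_apply _ e] at h5
  rw [h4, map_neg, hs] at h3
  rw [bvHomotopy_apply hx hy, bvHomotopy_apply (hcb _ _ hx) hy, bvHomotopy_apply hx (hcb _ _ hy),
    map_add, map_add, map_neg, map_smul, h1, h2, h3, h5]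
  simp only [smul_add, smul_sub, smul_neg, neg_smul, smul_smul]
  match_scalars
  all_goals try simp only [mul_one, ← sg_add, neg_neg, sub_neg_eq_add]
  all_goals first
    | exact (neg_add_cancel _).symm
    | exact (add_neg_cancel _).symm
    | exact (sub_self _).symm
    | refine (neg_add_eq_zero.2 (sg_congr (R := R) ?_)).symm
    | refine (eq_neg_iff_add_eq_zero.1 (sg_eq_neg (R := R) ?_)).symm
    | refine (sub_eq_zero.2 (sg_eq_neg (R := R) ?_).symm).symm
  all_goals
    push_cast
    generalize (r : ZMod 2) = r, (q : ZMod 2) = q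
    revert r q
    decide

end Connes

theorem degT_one {V : GrMod.{u, v} R} (hV : ∀ n ≤ 1, V.deg n = ⊥) : V.T.deg 1 = ⊥ := by
  rw [eq_bot_iff]
  intro x hx
  refine word_induction (V := V) (P := fun n x => n = 1 → x = 0) ?_ ?_ ?_ ?_ ?_ 1 x hx rfl
  · intro h
    exact absurd h (by decide)
  · intro m n v x hv hx ih hmn
    by_cases hm : m ≤ 1
    · rw [hV m hm, Submodule.mem_bot] at hv
      rw [hv, map_zero, zero_mul]
    · rw [degT_neg (fun k hk => hV k (by lia)) n (by lia), Submodule.mem_bot] at hx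
      rw [hx, mul_zero]
  · exact fun _ _ => rfl
  · intro n x y hx hy h
    rw [hx h, hy h, add_zero]
  · intro n r x hx h
    rw [hx h, smul_zero]

theorem AugMod.IsReduced.one_of_two {A : AugMod.{u, v} R} (h : A.IsReduced 2) : A.IsReduced 1 where
  toIsConnected := h.toIsConnected
  deg_eq_bot k h1 h2 := h.deg_eq_bot k h1 (by push_cast at h2 ⊢; lia)

theorem AugMod.IsReduced.susp_neg_one {A : AugMod.{u, v} R} (h : A.IsReduced 2) (n : ℤ)
    (hn : n ≤ 1) : (A.susp (-1)).deg n = ⊥ := by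
  rcases hn.lt_or_eq with hn | rfl
  · exact AugMod.IsConnected.susp_neg_one h.one_of_two n (by lia)
  · rw [eq_bot_iff]
    intro a ha
    have ha' : A.outS (-1) a ∈ A.deg (1 - -1) := ha
    rw [h.deg_eq_bot _ (by lia) (by norm_num)] at ha'
    exact A.outS_injective (-1) (((Submodule.mem_bot R).1 ha').trans (map_zero _).symm)

theorem isConnected_augTensor {V : GrMod.{u, v} R} (d : V.T →ₗ[R] V.T)
    (hV : ∀ n ≤ 0, V.deg n = ⊥) : (augTensor V d).IsConnected where
  deg_neg := degT_neg hV
  deg_zero := degT_zero hV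

theorem isReduced_cobar {C : AugMod.{u, v} R} (comul : C.toGrMod →ₗ[R] C.toGrMod ⊗[R] C.toGrMod)
    (h : C.IsReduced 2) : (cobar C comul).IsReduced 1 where
  toIsConnected := isConnected_augTensor _ fun n hn => h.susp_neg_one n (by lia)
  deg_eq_bot k h1 h2 := by
    obtain rfl : k = 1 := by push_cast at h2; lia
    exact degT_one h.susp_neg_one

theorem E11_braceMul' {A : AugMod.{u, v} R} {mul : A.toGrMod ⊗[R] A.toGrMod →ₗ[R] A.toGrMod}
    {E : A.toGrMod →ₗ[R] (A.susp 1).T →ₗ[R] A.toGrMod} (hE : IsBrace A mul E) (a b : A.toGrMod) :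
    E11 A (braceMul' E) a b = E a (letter (A.susp 1) (A.inS 1 b)) := by
  rw [E11, barOp_braceMul'_letter hE, lengthProj_letter, if_pos rfl, A.outS_inS, map_sub, map_smul,
    LinearMap.sub_apply, LinearMap.smul_apply, hE.one, cst_apply, augT_letter, zero_smul, smul_zero,
    sub_zero]

theorem isHomotopyBVAlgebra_braceMul' {V : GrMod.{u, v} R} {d : V.T →ₗ[R] V.T}
    {E : V.T →ₗ[R] ((augTensor V d).susp 1).T →ₗ[R] V.T} (hV : ∀ n ≤ 0, V.deg n = ⊥)
    (hA : IsDGAlgebra (augTensor V d) (concat V)) (hE : IsBrace (augTensor V d) (concat V) E)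
    (hB : IsDGBialgebra (bar (augTensor V d) (concat V)) (braceMul' (A := augTensor V d) E)
      (deconcat ((augTensor V d).susp 1)))
    {Δ : V.T →ₗ[R] V.T} (hΔ : GrMod.IsDeg (V := V.T) (W := V.T) Δ 1) (hd : d ∘ₗ Δ = -(Δ ∘ₗ d))
    (hsq : Δ ∘ₗ Δ = 0) (h : V.T →ₗ[R] V.T →ₗ[R] V.T)
    (hmem : ∀ p q : ℤ, ∀ a ∈ V.T.deg p, ∀ b ∈ V.T.deg q, h a b ∈ V.T.deg (p + q + 2))
    (heq : ∀ p q : ℤ, ∀ a ∈ V.T.deg p, ∀ b ∈ V.T.deg q,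
      E a (letter ((augTensor V d).susp 1) ((augTensor V d).inS 1 b)) -
        sg R ((p + 1) * (q + 1)) • E b (letter ((augTensor V d).susp 1) ((augTensor V d).inS 1 a)) =
      sg R p • (Δ (a * b : TensorAlgebra R V) - (Δ a * b : TensorAlgebra R V) -
        sg R p • (a * Δ b : TensorAlgebra R V)) + (d (h a b) + h (d a) b - sg R p • h a (d b))) :
    IsHomotopyBVAlgebra (augTensor V d) (concat V) (braceMul' (A := augTensor V d) E) Δ where
  isHomotopyGAlgebra :=
    { isConnected := isConnected_augTensor d hV
      isDGAlgebra := hA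
      isDGBialgebra := hB
      barOp_eq_zero := barOp_braceMul'_eq_zero hE }
  mem := hΔ
  d_comm := hd
  sq_zero := hsq
  exists_homotopy := by
    refine ⟨h, hmem, fun p q a ha b hb => ?_⟩
    have e := heq p q a ha b hb
    rw [E11_braceMul' hE, E11_braceMul' hE, negOnePow_smul (R := R), negOnePow_smul (R := R),
      negOnePow_smul (R := R), negOnePow_smul (R := R)]
    exact e

section Connes

variable {H : AugMod.{u, v} R} {mul : H.toGrMod ⊗[R] H.toGrMod →ₗ[R] H.toGrMod}
  {comul : H.toGrMod →ₗ[R] H.toGrMod ⊗[R] H.toGrMod} {S : H.toGrMod →ₗ[R] H.toGrMod}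

/-- The cobar construction of a simply connected involutive DG-Hopf algebra is a homotopy
BV-algebra. -/
theorem isHomotopyBVAlgebra_cobar (hH : H.IsReduced 1) (h : IsInvolutiveDGHopf H mul comul S) :
    IsHomotopyBVAlgebra (cobar H comul) (concat (H.susp (-1)))
      (braceMul' (A := cobar H comul) (braceOp H mul comul)) (connesMoscovici H mul comul S) := by
  have hb := h.bialgebra
  have hS := h.antipode
  have hcop := h.conv_cop_left
  rw [connesMoscovici_eq hb hS]
  exact isHomotopyBVAlgebra_braceMul' (V := H.susp (-1)) (d := (cobar H comul).d)
    (AugMod.IsConnected.susp_neg_one hH) (isDGAlgebra_cobar hb.toIsDGCoalgebra)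
    (isBrace_braceOp hb) (isDGBialgebra_braceOp hb) (isDeg_connes hb hS)
    (antiCyc_d_anticomm hb hS hcop) (antiCyc_sq hb hS hcop) (bvHomotopy mul comul S)
    (fun p q a ha b hb' => bvHomotopy_mem hb hS ha hb')
    (fun p q a ha b hb' => bracket_eq hb hS hcop ha hb')

end Connes
end
end DoubleCobar

theorem mainTheorem3 {R : Type u} [CommRing R] (X : DoubleCobar.HomotopyGCoalgebra.{u, v} R) :
    -- `Ω C` has a unique antipode `S`, and the `O_n`, `n ≥ 2`, are the components of `S² - Id`
    ((∃! S, DoubleCobar.IsAntipode (DoubleCobar.cobar X.C X.comul)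
        (DoubleCobar.concat (X.C.susp (-1))) X.nabla S) ∧
      ∀ S, DoubleCobar.IsAntipode (DoubleCobar.cobar X.C X.comul)
          (DoubleCobar.concat (X.C.susp (-1))) X.nabla S →
        ∀ n : ℕ, 2 ≤ n →
          DoubleCobar.lengthProj (X.C.susp (-1)) n ∘ₗ (S ∘ₗ S - LinearMap.id) ∘ₗ
            DoubleCobar.letter (X.C.susp (-1)) = DoubleCobar.obstruction X.nabla n) ∧
    -- `Ω C` is an involutive DG-Hopf algebra if and only if all the obstructions vanish
    ((∃ S, DoubleCobar.IsInvolutiveDGHopf (DoubleCobar.cobar X.C X.comul)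
        (DoubleCobar.concat (X.C.susp (-1))) X.nabla S) ↔
      ∀ n : ℕ, 2 ≤ n → DoubleCobar.obstruction X.nabla n = 0) ∧
    -- the homotopy BV-algebra structure on `Ω² C`
    (X.C.IsReduced 2 → (∀ n : ℕ, 2 ≤ n → DoubleCobar.obstruction X.nabla n = 0) →
      ∃ S, DoubleCobar.IsInvolutiveDGHopf (DoubleCobar.cobar X.C X.comul)
          (DoubleCobar.concat (X.C.susp (-1))) X.nabla S ∧
        ∃ mulB, DoubleCobar.HasBraceOps (DoubleCobar.cobar X.C X.comul)
            (DoubleCobar.concat (X.C.susp (-1))) X.nabla mulB ∧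
          DoubleCobar.IsHomotopyBVAlgebra
            (DoubleCobar.cobar (DoubleCobar.cobar X.C X.comul) X.nabla)
            (DoubleCobar.concat ((DoubleCobar.cobar X.C X.comul).susp (-1))) mulB
            (DoubleCobar.connesMoscovici (DoubleCobar.cobar X.C X.comul)
              (DoubleCobar.concat (X.C.susp (-1))) X.nabla S)) := by
  have hb := X.isDGBialgebra
  have hV := DoubleCobar.AugMod.IsConnected.susp_neg_one X.isReduced
  have hS₀ := DoubleCobar.isAntipode_antipode hb hV
  have hO : ∀ S, DoubleCobar.IsAntipode (DoubleCobar.cobar X.C X.comul)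
      (DoubleCobar.concat (X.C.susp (-1))) X.nabla S → ∀ n : ℕ, 2 ≤ n →
        DoubleCobar.lengthProj (X.C.susp (-1)) n ∘ₗ (S ∘ₗ S - LinearMap.id) ∘ₗ
          DoubleCobar.letter (X.C.susp (-1)) = DoubleCobar.obstruction X.nabla n := by
    intro S hS n hn
    refine LinearMap.ext fun v => ?_
    have h := DoubleCobar.lengthProj_antipode_sq hb X.coOp_eq_zero hS n (by lia) v
    have h' : DoubleCobar.lengthProj (X.C.susp (-1)) n
        (DoubleCobar.letter (X.C.susp (-1)) v) = 0 := by
      rw [DoubleCobar.lengthProj_letter, if_neg (by lia)]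
    refine Eq.trans (map_sub (DoubleCobar.lengthProj (X.C.susp (-1)) n) _ _) ?_
    exact (congrArg₂ (· - ·) h h').trans (sub_zero _)
  have hinv : (∀ n : ℕ, 2 ≤ n → DoubleCobar.obstruction X.nabla n = 0) →
      DoubleCobar.IsInvolutiveDGHopf (DoubleCobar.cobar X.C X.comul)
        (DoubleCobar.concat (X.C.susp (-1))) X.nabla
        (DoubleCobar.antipode (X.C.susp (-1)) X.nabla) := fun h =>
    ⟨hb, hS₀, DoubleCobar.antipode_sq_eq_id hb X.coOp_eq_zero hS₀ h⟩
  refine ⟨⟨⟨_, hS₀, fun S hS => hS.unique hb hS₀⟩, hO⟩, ⟨?_, fun h => ⟨_, hinv h⟩⟩, ?_⟩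
  · rintro ⟨S, hS⟩ n hn
    rw [← hO S hS.antipode n hn, hS.involutive, sub_self, LinearMap.zero_comp, LinearMap.comp_zero]
  · intro hred h
    exact ⟨_, hinv h, _, DoubleCobar.hasBraceOps_braceMul' hb,
      DoubleCobar.isHomotopyBVAlgebra_cobar (DoubleCobar.isReduced_cobar X.comul hred) (hinv h)⟩
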